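/- **Theorem 4.1 (Reduction from $k$-PDS to ISGM).** *Source problem.* Let $k\mid N$ and let $E$ be a partition $[N]=E_1\cup\dots\cup E_k$ with $|E_a|=N/k$. The problem $k\text{-PDS}(N,k,p,q)$ has hypotheses $H_0: G\sim\mathcal G(N,q)$ and $H_1: G\sim\mathcal G_E(N,k,p,q)$, where the latter is obtained from a sample of $\mathcal G(N,q)$ by choosing one vertex uniformly from each $E_a$ and replacing the induced subgraph on these $k$ vertices by an independent sample of $\mathcal G(k,p)$. *Target problem.* For $\mu\in\mathbb R$ and $\epsilon\in(0,1)$ let $\mu'$ satisfy $\epsilon\mu'+(1-\epsilon)\mu=0$. The problem $\text{ISGM}(n,k,d,\mu,\epsilon)$ has hypotheses $H_0: (X_1,\dots,X_n)\sim\mathcal N(0,I_d)^{\otimes n}$ and $H_1$: choose a $k$-subset $S\subseteq[d]$ uniformly and then draw $X_1,\dots,X_n$ i.i.d. from the mixture of $\mathcal N(\mu\mathbf 1_S,I_d)$ (weight $1-\epsilon$) and $\mathcal N(\mu'\mathbf 1_S,I_d)$ (weight $\epsilon$). *Parameters.* Fix constants $0<q<p\le1$ and put $Q=1-\sqrt{(1-p)(1-q)}+\mathbf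 1_{\{p=1\}}(\sqrt q-1)$ and $\delta=\min\{\log\frac pQ,\log\frac{1-Q}{1-p}\}$ (the second term is $+\infty$ if $p=1$). Let $r$ be a prime, $\epsilon=1/r$, $t\in\mathbb N$, $N,n\ge1$, $w\ge1$, let $m$ be the smallest multiple of $k$ larger than $(\frac pQ+1)N$, and suppose $$wn\le\frac{k(r^t-1)}{r-1},\qquad m\le d,\qquad m\le kr^t,\qquad 0\le\mu\le\frac{\delta}{2\sqrt{3\log(kmr^t)+2\log (p-Q)^{-1}}}\cdot\frac1{\sqrt{r^t(r-1)}} .$$ *The map $\mathcal A=k\text{-PDS-TO-ISGM}$.* On a graph $G$ on $[N]$: 1. *(To-$k$-Partite-Submatrix.)* For each pair $\{i,j\}$ independently draw $x^{ij}\in\{0,1\}^2$, where $x^{ij}=v$ has probability $\frac1{p-q}\big[(1-q)p^{|v|}(1-p)^{2-|v|}-(1-p)Q^{|v|}(1-Q)^{2-|v|}\big]$ if $\{i,j\}$ is an edge of $G$, and $\frac1{p-q}\big[p\,Q^{|v|}(1-Q)^{2-|v|}-q\,p^{|v|}(1-p)^{2-|v|}\big]$ if not. This gives graphs $G_1,G_2$.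 Let $F'_1,\dots,F'_k$ partition $[m]$ into consecutive parts of size $m/k$. For each $a\in[k]$ independently draw $s_1^a\sim\mathrm{Bin}(N/k,p)$, $s_2^a\sim\mathrm{Bin}(m/k,Q)$, a uniform $(N/k)$-subset $S_a\subseteq F'_a$, uniform subsets $T_1^a\subseteq S_a$ of size $s_1^a$ and $T_2^a\subseteq F'_a\setminus S_a$ of size $\min\{\max\{s_2^a-s_1^a,0\},(m-N)/k\}$, and a uniform bijection $\pi_a:S_a\to E_a$. Let $S=\bigcup_a S_a$ and let $\pi:S\to[N]$ be the union of the $\pi_a$. Form the $m\times m$ 0/1 matrix whose $(i,j)$ entry, for $i\ne j$ in $S$, indicates that $\{\pi(i),\pi(j)\}$ is an edge of $G_1$ (if $i<j$) or of $G_2$ (if $i>j$); whose diagonal entry at $i\in F_a'$ indicates $i\in T_1^a\cup T_2^a$; and whose other entries are independent $\mathrm{Bern}(Q)$. 2. *(Pad.)* Add to each part of the columns $r^t-m/k$ new columns of independent $\mathrm{Bern}(Q)$ entries; permute the $m$ rows uniformly at random, and the $r^t$ columns within each part uniformly at random. 3. *(Gaussianize.)* Independently replace each entry $B$ by the output of the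 rejection kernel with mean $\tau=\sqrt{r^t(r-1)}\,\mu$: for at most $\lceil3\delta^{-1}\log(m\cdot kr^t)\rceil$ iterations draw $z\sim\mathcal N(0,1)$; if $B=0$ and $p\varphi_0(z)\ge Q\varphi_\tau(z)$, output $z$ with probability $1-\frac{Q\varphi_\tau(z)}{p\varphi_0(z)}$; if $B=1$ and $(1-Q)\varphi_\tau(z+\tau)\ge(1-p)\varphi_0(z+\tau)$, output $z+\tau$ with probability $1-\frac{(1-p)\varphi_0(z+\tau)}{(1-Q)\varphi_\tau(z+\tau)}$; stop at the first output, and output $0$ if there is none. Here $\varphi_\nu$ is the density of $\mathcal N(\nu,1)$. 4. *(Rotation matrix.)* Let $\ell=\frac{r^t-1}{r-1}$, and let $H_{r,t}$ be the $\ell\times r^t$ matrix with rows indexed by the hyperplanes $V$ (linear subspaces of codimension 1) and columns by the points $P$ of $\mathbb F_r^t$, with entry $\frac{1}{\sqrt{r^t(r-1)}}$ if $P\notin V$ and $\frac{1-r}{\sqrt{r^t(r-1)}}$ if $P\in V$. 5. *(Rotate.)* Multiply the $m\times r^t$ block of columns of each part on the right by $H_{r,t}^\top$, which gives an $m\times k\ell$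 matrix. 6. *(Output.)* Choose $n$ distinct columns, in uniformly random order, place the resulting $m$ rows at the positions given by a uniformly random injection $[m]\to[d]$, fill the other $d-m$ rows with independent $\mathcal N(0,1)$ entries, and output the columns $(X_1,\dots,X_n)$. *Conclusion.* (a) There are constants $C,c>0$, depending only on $p$ and $q$, such that for all such parameters and every such partition $E$ $$d_{TV}\big(\mathcal A(k\text{-PDS}(N,k,p,q)),\ \text{ISGM}(n,k,d,\mu,1/r)\big)\le C\Big(w^{-1}+\frac{k^2}{wN}+\frac k{\sqrt N}+e^{-cN^2/(kn)}+N^{-1}\Big)$$ both under $H_0$ and under $H_1$. In particular the distance is $O\big(w^{-1}+\frac{k^2}{wN}+\frac k{\sqrt N}+e^{-\Omega(N^2/kn)}+N^{-1}\big)$ as $N\to\infty$ for parameters depending on $N$ with $w=\omega(1)$. (b) $\mathcal A$ runs in randomized polynomial time: there is one program, for a random access machine with exact real arithmetic (including $\exp,\log,\sqrt{\ }$ and comparisons) that can draw $\mathrm{Bern}(x)$ bits and $\mathcal N(0,1)$ variables at unit cost, such that for all parameters as above with $kr^t,d\le\mathrm{poly}(N)$, given the parameters, $E$ and $G$, it halts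 within $\mathrm{poly}(N)$ steps and its output has exactly the law of $\mathcal A(G)$; the polynomial depends only on $p$, $q$ and the polynomial that bounds $kr^t$ and $d$. -/

import Mathlib

open MeasureTheory ProbabilityTheory
open scoped ENNReal

noncomputable section

namespace KPdsIsgm

/-! ### Generic probability -/

/-- Total variation distance of two probability measures. -/
def tvDist {α : Type*} [MeasurableSpace α] (μ ν : Measure α) : ℝ :=
  ⨆ s : {s : Set α // MeasurableSet s}, |μ.real s - ν.real s|

/-- Law of the outcome of: draw `a` uniformly from the finite type `α`, then continue with `f a`. -/
def unif (α : Type*) [Fintype α] {β : Type*} [MeasurableSpace β] (f : α → Measure β) : Measure β :=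
  ∑ a, (Fintype.card α : ℝ≥0∞)⁻¹ • f a

/-- A real number as a probability (clipped to the unit interval). -/
def prob (x : ℝ) : unitInterval := Set.projIcc 0 1 zero_le_one x

/-- `Bern(x)` on `Bool`. -/
def coin (x : ℝ) : Measure Bool := bernoulliMeasure true false (prob x)

/-- `mix_ε(D₁, D₂)`: `D₁` with probability `1 - ε` and `D₂` with probability `ε`. -/
def mix {α : Type*} [MeasurableSpace α] (ε : ℝ) (D₁ D₂ : Measure α) : Measure α :=
  ENNReal.ofReal (1 - ε) • D₁ + ENNReal.ofReal ε • D₂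

/-! ### The target problem: imbalanced sparse Gaussian mixtures.
A sample is a function `Fin n → Fin d → ℝ`, the value at `j` being the vector `X_j`. -/

/-- `N(v, I_d)`. -/
def stdGaussianAt {d : ℕ} (v : Fin d → ℝ) : Measure (Fin d → ℝ) :=
  Measure.pi fun i => gaussianReal (v i) 1

/-- `N(0, I_d)^{⊗ n}`, the hypothesis `H₀`. -/
def isgmNull (n d : ℕ) : Measure (Fin n → Fin d → ℝ) :=
  Measure.pi fun _ => stdGaussianAt 0

/-- The number `μ'` with `ε * μ' + (1 - ε) * μ = 0`. -/
def isgmOther (μ ε : ℝ) : ℝ := -((1 - ε) * μ) / ε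

open scoped Classical in
/-- The hypothesis `H₁` of the problem with parameters `n, k, d, μ, ε`. -/
def isgmPlanted (n k d : ℕ) (μ ε : ℝ) : Measure (Fin n → Fin d → ℝ) :=
  unif {S : Finset (Fin d) // S.card = k} fun S =>
    Measure.pi fun _ : Fin n =>
      mix ε (stdGaussianAt fun i => if i ∈ S.1 then μ else 0)
        (stdGaussianAt fun i => if i ∈ S.1 then isgmOther μ ε else 0)

/-! ### The source problem: `k`-partite planted dense subgraph.
The partition of the vertex set is `E : Fin N → Fin k`, the map that sends a vertex to its part. -/

/-- `G(N, q)`, the hypothesis `H₀`. -/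
def kPdsNull (N : ℕ) (q : ℝ) : Measure (SimpleGraph (Fin N)) :=
  SimpleGraph.binomialRandom (Fin N) (prob q)

open scoped Classical in
/-- Replace the subgraph of `G` induced on the vertices `R 0, R 1, …` (with `R a` in part `a`)
by `H`, where `R a` plays the role of the vertex `a` of `H`. -/
def plant {N k : ℕ} (E : Fin N → Fin k) (R : ∀ a, {v // E v = a}) (G : SimpleGraph (Fin N))
    (H : SimpleGraph (Fin k)) : SimpleGraph (Fin N) where
  Adj u v :=
    if (R (E u) : Fin N) = u ∧ (R (E v) : Fin N) = v then H.Adj (E u) (E v) else G.Adj u v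
  symm := ⟨fun u v h => by
    simp only [and_comm (a := (R (E v) : Fin N) = v)] at *
    split_ifs at * with h1
    · exact h.symm
    · exact h.symm⟩
  loopless := ⟨fun u h => by
    split_ifs at h with h1
    · exact H.irrefl h
    · exact G.irrefl h⟩

/-- `G_E(N, k, p, q)`, the hypothesis `H₁`: one vertex is drawn uniformly from each part, and a
copy of `G(k, p)` is planted on these vertices in a graph drawn from `G(N, q)`. -/
def kPdsPlanted {N k : ℕ} (E : Fin N → Fin k) (p q : ℝ) : Measure (SimpleGraph (Fin N)) :=
  unif (∀ a, {v // E v = a}) fun R =>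
    ((SimpleGraph.binomialRandom (Fin N) (prob q)).prod
      (SimpleGraph.binomialRandom (Fin k) (prob p))).map fun GH => plant E R GH.1 GH.2

/-! ### Parameters -/

/-- The parameters of the reduction. -/
structure Params where
  /-- number of vertices -/
  N : ℕ
  /-- size of the dense subgraph -/
  k : ℕ
  /-- edge probability inside the dense subgraph -/
  p : ℝ
  /-- ambient edge probability -/
  q : ℝ
  /-- number of output samples -/
  n : ℕ
  /-- dimension of the output samples -/
  d : ℕ
  /-- mean parameter of the output -/
  μ : ℝ
  /-- order of the prime field -/
  r : ℕ
  /-- dimension of the vector space over the prime field -/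
  t : ℕ
  [prime : Fact r.Prime]

namespace Params

instance (P : Params) : Fact P.r.Prime := P.prime

/-- `Q = 1 - √((1 - p)(1 - q)) + 1_{p = 1} (√q - 1)`. -/
def Q (P : Params) : ℝ :=
  1 - √((1 - P.p) * (1 - P.q)) + if P.p = 1 then √P.q - 1 else 0

/-- `δ = min {log (p / Q), log ((1 - Q) / (1 - p))}`, where the second term is `+∞` if `p = 1`. -/
def δ (P : Params) : ℝ :=
  if P.p = 1 then Real.log (P.p / P.Q)
  else min (Real.log (P.p / P.Q)) (Real.log ((1 - P.Q) / (1 - P.p)))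

/-- The quotient `m / k`. -/
def blockLen (P : Params) : ℕ := ⌊(P.p / P.Q + 1) * P.N / P.k⌋₊ + 1

/-- The smallest multiple of `k` larger than `(p / Q + 1) N`. -/
def m (P : Params) : ℕ := P.k * P.blockLen

theorem isLeast_m (P : Params) (hk : 0 < P.k) (h : 0 ≤ (P.p / P.Q + 1) * P.N) :
    IsLeast {x : ℕ | P.k ∣ x ∧ (P.p / P.Q + 1) * P.N < x} P.m := by
  have hk' : (0 : ℝ) < P.k := by exact_mod_cast hk
  refine ⟨⟨Dvd.intro _ rfl, ?_⟩, ?_⟩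
  · have := Nat.lt_floor_add_one ((P.p / P.Q + 1) * P.N / P.k)
    rw [div_lt_iff₀ hk'] at this
    simp only [m, blockLen]
    push_cast
    linarith
  · rintro x ⟨⟨y, rfl⟩, hy⟩
    refine Nat.mul_le_mul_left _ ?_
    push_cast at hy
    rw [blockLen, Nat.succ_le_iff, Nat.floor_lt (by positivity), div_lt_iff₀ hk']
    linarith

/-- `τ = √(r^t (r - 1)) μ`, the mean of the planted entries after Gaussianization. -/
def τ (P : Params) : ℝ := √((P.r : ℝ) ^ P.t * (P.r - 1)) * P.μ

/-- The conditions on the initial and the target parameters. -/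
structure Admissible (P : Params) (w : ℝ) (E : Fin P.N → Fin P.k) : Prop where
  N_pos : 0 < P.N
  n_pos : 0 < P.n
  k_dvd : P.k ∣ P.N
  parts : ∀ a, Nat.card {v // E v = a} = P.N / P.k
  one_le_w : 1 ≤ w
  wn_le : w * P.n ≤ P.k * (((P.r : ℝ) ^ P.t - 1) / (P.r - 1))
  m_le_d : P.m ≤ P.d
  m_le_cols : P.m ≤ P.k * P.r ^ P.t
  μ_nonneg : 0 ≤ P.μ
  μ_le : P.μ ≤ P.δ / (2 * √(3 * Real.log (P.k * P.m * (P.r : ℝ) ^ P.t)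
      + 2 * Real.log (P.p - P.Q)⁻¹)) * (1 / √((P.r : ℝ) ^ P.t * (P.r - 1)))

/-- Row (and column) indices of the `m × m` matrix; the `a`-th part consists of the `(a, x)`. -/
abbrev Row (P : Params) : Type := Fin P.k × Fin P.blockLen

/-- The points of `𝔽_r^t`. -/
abbrev Point (P : Params) : Type := Fin P.t → ZMod P.r

/-- The hyperplanes of `𝔽_r^t` (linear subspaces of codimension one). -/
abbrev Hyperplane (P : Params) : Type :=
  {V : Submodule (ZMod P.r) P.Point // Module.finrank (ZMod P.r) V + 1 = P.t}

instance (P : Params) : Fintype P.Hyperplane := Fintype.ofFinite _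

end Params

/-! ### The reduction -/

/-- The probability that the cloning step outputs `v` on a pair that is an edge (`b = true`) or a
non-edge (`b = false`). -/
def cloneWeight (p q P Q : ℝ) {s : ℕ} (b : Bool) (v : Fin s → Bool) : ℝ :=
  let c := (Finset.univ.filter fun a => v a = true).card
  if b then
    1 / (p - q) * ((1 - q) * (P ^ c * (1 - P) ^ (s - c)) - (1 - p) * (Q ^ c * (1 - Q) ^ (s - c)))
  else
    1 / (p - q) * (p * (Q ^ c * (1 - Q) ^ (s - c)) - q * (P ^ c * (1 - P) ^ (s - c)))

open scoped Classical in
/-- Graph-Clone with `s` clones. The edge indicator of `e` in the `a`-th clone is `x e a`; the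
entries at the loops `e` carry no meaning and are never read. -/
def graphClone {N : ℕ} (p q P Q : ℝ) (s : ℕ) (G : SimpleGraph (Fin N)) :
    Measure (Sym2 (Fin N) → Fin s → Bool) :=
  Measure.pi fun e =>
    ∑ v : Fin s → Bool, ENNReal.ofReal (cloneWeight p q P Q (decide (e ∈ G.edgeSet)) v) •
      Measure.dirac v

open scoped Classical in
/-- The matrix of To-k-Partite-Submatrix, given all random choices: the off-diagonal entries
indexed by the chosen rows and columns `⋃ S_a` are read off from the first clone above the diagonal
and from the second clone below it, the other off-diagonal entries are the bits `Z`. -/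
def partiteMatrix (P : Params) (E : Fin P.N → Fin P.k) (S : Fin P.k → Finset (Fin P.blockLen))
    (π : ∀ a, S a ≃ {v // E v = a}) (T₁ T₂ : Fin P.k → Finset (Fin P.blockLen))
    (x : Sym2 (Fin P.N) → Fin 2 → Bool) (Z : P.Row → P.Row → Bool) : P.Row → P.Row → Bool :=
  fun i j =>
    if i = j then
      if i.2 ∈ S i.1 then decide (i.2 ∈ T₁ i.1) else decide (i.2 ∈ T₂ i.1)
    else if h : i.2 ∈ S i.1 ∧ j.2 ∈ S j.1 then
      x s((π i.1 ⟨i.2, h.1⟩ : Fin P.N), (π j.1 ⟨j.2, h.2⟩ : Fin P.N))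
        (if toLex i < toLex j then 0 else 1)
    else Z i j

open scoped Classical in
/-- Step 1: To-k-Partite-Submatrix. The size of `T₂ a` is cut off at the size of the complement of
`S a`, so that the step is defined for all outcomes of the two binomial variables. -/
def toKPartiteSubmatrix (P : Params) (E : Fin P.N → Fin P.k) (G : SimpleGraph (Fin P.N)) :
    Measure (P.Row → P.Row → Bool) :=
  (graphClone P.p P.q P.p P.Q 2 G).bind fun x =>
  (Measure.pi fun _ : Fin P.k => binomial (P.N / P.k) (prob P.p)).bind fun s₁ =>
  (Measure.pi fun _ : Fin P.k => binomial P.blockLen (prob P.Q)).bind fun s₂ =>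
  unif {S : Fin P.k → Finset (Fin P.blockLen) // ∀ a, (S a).card = P.N / P.k} fun S =>
  unif {T : Fin P.k → Finset (Fin P.blockLen) // ∀ a, T a ⊆ S.1 a ∧ (T a).card = s₁ a} fun T₁ =>
  unif {T : Fin P.k → Finset (Fin P.blockLen) // ∀ a, T a ⊆ (S.1 a)ᶜ ∧
      (T a).card = min (s₂ a - s₁ a) (P.blockLen - P.N / P.k)} fun T₂ =>
  unif (∀ a, S.1 a ≃ {v // E v = a}) fun π =>
  (Measure.pi fun _ : P.Row => Measure.pi fun _ : P.Row => coin P.Q).map fun Z =>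
    partiteMatrix P E S.1 π T₁.1 T₂.1 x Z

open scoped Classical in
/-- Step 2: add `r^t - m/k` columns of `Bern(Q)` bits to each part, permute the rows, and permute
the columns within each part. The columns of a part are labelled by the points of `𝔽_r^t`: the
random bijection `ρ a` combines the random permutation of the part with an enumeration of the
points. -/
def padPermute (P : Params) (M : P.Row → P.Row → Bool) :
    Measure (P.Row → Fin P.k → P.Point → Bool) :=
  unif (Equiv.Perm P.Row) fun σ =>
  unif (Fin P.k → (P.Point ≃ Fin (P.r ^ P.t))) fun ρ =>
  (Measure.pi fun _ : P.Row => Measure.pi fun _ : Fin P.k =>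
      Measure.pi fun _ : Fin (P.r ^ P.t) => coin P.Q).map fun Z =>
    fun i a y =>
      if h : (ρ a y : ℕ) < P.blockLen then M (σ i) (a, ⟨ρ a y, h⟩) else Z (σ i) a (ρ a y)

/-- The density of `N(ν, 1)`. -/
def φ (ν x : ℝ) : ℝ := gaussianPDFReal ν 1 x

/-- The value proposed by the rejection kernel from the draw `z` of `N(0, 1)`. -/
def rkProposal (ν : ℝ) (B : Bool) (z : ℝ) : ℝ := if B then z + ν else z

/-- The probability with which the rejection kernel accepts its proposal. -/
def rkAccept (p q ν : ℝ) (B : Bool) (z : ℝ) : ℝ :=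
  if B then
    if (1 - p) * φ 0 (z + ν) ≤ (1 - q) * φ ν (z + ν) then
      1 - (1 - p) * φ 0 (z + ν) / ((1 - q) * φ ν (z + ν))
    else 0
  else
    if q * φ ν z ≤ p * φ 0 z then 1 - q * φ ν z / (p * φ 0 z) else 0

/-- The Gaussian rejection kernel `rk_G(ν, B)` with the given number of iterations. -/
def rkG (p q ν : ℝ) (B : Bool) : ℕ → Measure ℝ
  | 0 => Measure.dirac 0
  | j + 1 => (gaussianReal 0 1).bind fun z =>
      (coin (rkAccept p q ν B z)).bind fun a =>
        if a then Measure.dirac (rkProposal ν B z) else rkG p q ν B j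

/-- Step 3: Gaussianize. -/
def gaussianize (P : Params) (M : P.Row → Fin P.k → P.Point → Bool) :
    Measure (P.Row → Fin P.k → P.Point → ℝ) :=
  Measure.pi fun i => Measure.pi fun a => Measure.pi fun y =>
    rkG P.p P.Q P.τ (M i a y) ⌈3 * P.δ⁻¹ * Real.log (P.m * (P.k * (P.r : ℝ) ^ P.t))⌉₊

open scoped Classical in
/-- Step 4: the matrix `H_{r,t}`. -/
def rotation (P : Params) : Matrix P.Hyperplane P.Point ℝ :=
  Matrix.of fun V y => 1 / √((P.r : ℝ) ^ P.t * (P.r - 1)) * if y ∈ V.1 then 1 - (P.r : ℝ) else 1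

/-- Step 5: multiply the columns of each part by the transpose of `H_{r,t}`. -/
def rotate (P : Params) (M : P.Row → Fin P.k → P.Point → ℝ) :
    Matrix P.Row (Fin P.k × P.Hyperplane) ℝ :=
  Matrix.of fun i aV =>
    ((Matrix.of fun i y => M i aV.1 y : Matrix P.Row P.Point ℝ) * (rotation P).transpose) i aV.2

open scoped Classical in
/-- Step 6: choose `n` distinct columns in random order, embed them as `m` random rows of a matrix
with `d` rows, and fill the other rows with standard Gaussians. -/
def permuteOutput (P : Params) (M : Matrix P.Row (Fin P.k × P.Hyperplane) ℝ) :
    Measure (Fin P.n → Fin P.d → ℝ) :=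
  unif (Fin P.n ↪ Fin P.k × P.Hyperplane) fun c =>
  unif (P.Row ↪ Fin P.d) fun ι =>
  (isgmNull P.n P.d).map fun Z => fun j => Function.extend ι (fun i => M i (c j)) (Z j)

/-- The law of the output of k-pds-to-isgm on the graph `G`. -/
def kPdsToIsgm (P : Params) (E : Fin P.N → Fin P.k) (G : SimpleGraph (Fin P.N)) :
    Measure (Fin P.n → Fin P.d → ℝ) :=
  (toKPartiteSubmatrix P E G).bind fun M₁ =>
  (padPermute P M₁).bind fun M₂ =>
  (gaussianize P M₂).bind fun M₃ =>
  permuteOutput P (rotate P M₃)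

/-! ### Randomized computation
A random access machine with arrays of natural numbers and arrays of real numbers. Arithmetic on
natural numbers is charged by the bit length of the operands. As usual for real random access
machines, arithmetic on reals, `exp`, `log`, `√` and comparisons are exact and cost one step; so do
a draw of a biased bit and a draw of `N(0, 1)`. The only way from reals to naturals are
comparisons, random bits and a ceiling instruction that is charged its (unary) value. The only
repetition is the bounded loop. -/

/-- The memory: the entry `i` of the array `a` is `s.1 a i` (naturals) or `s.2 a i` (reals). -/
abbrev Store : Type := (ℕ → ℕ → ℕ) × (ℕ → ℕ → ℝ)

/-- Expressions for natural numbers. -/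
inductive NExp : Type
  | lit (c : ℕ)
  | get (a : ℕ) (i : NExp)
  | add (e f : NExp)
  | sub (e f : NExp)
  | mul (e f : NExp)
  | div (e f : NExp)
  | mod (e f : NExp)

namespace NExp

/-- The value of an expression. -/
def eval (s : Store) : NExp → ℕ
  | lit c => c
  | get a i => s.1 a (i.eval s)
  | add e f => e.eval s + f.eval s
  | sub e f => e.eval s - f.eval s
  | mul e f => e.eval s * f.eval s
  | div e f => e.eval s / f.eval s
  | mod e f => e.eval s % f.eval s

/-- The number of steps that the evaluation takes. -/
def cost (s : Store) : NExp → ℕ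
  | lit c => 1 + c.size
  | get a i => i.cost s + 1 + (s.1 a (i.eval s)).size
  | add e f => e.cost s + f.cost s + 1 + (e.eval s + f.eval s).size
  | sub e f => e.cost s + f.cost s + 1 + (e.eval s - f.eval s).size
  | mul e f => e.cost s + f.cost s + 1 + (e.eval s * f.eval s).size
  | div e f => e.cost s + f.cost s + 1 + (e.eval s / f.eval s).size
  | mod e f => e.cost s + f.cost s + 1 + (e.eval s % f.eval s).size

end NExp

/-- Expressions for real numbers. -/
inductive RExp : Type
  | ofNat (e : NExp)
  | get (a : ℕ) (i : NExp)
  | add (e f : RExp)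
  | sub (e f : RExp)
  | mul (e f : RExp)
  | div (e f : RExp)
  | exp (e : RExp)
  | log (e : RExp)
  | sqrt (e : RExp)

namespace RExp

/-- The value of an expression. -/
def eval (s : Store) : RExp → ℝ
  | ofNat e => (e.eval s : ℝ)
  | get a i => s.2 a (i.eval s)
  | add e f => e.eval s + f.eval s
  | sub e f => e.eval s - f.eval s
  | mul e f => e.eval s * f.eval s
  | div e f => e.eval s / f.eval s
  | exp e => Real.exp (e.eval s)
  | log e => Real.log (e.eval s)
  | sqrt e => √(e.eval s)

/-- The number of steps that the evaluation takes. -/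
def cost (s : Store) : RExp → ℕ
  | ofNat e => e.cost s + 1
  | get _ i => i.cost s + 1
  | add e f => e.cost s + f.cost s + 1
  | sub e f => e.cost s + f.cost s + 1
  | mul e f => e.cost s + f.cost s + 1
  | div e f => e.cost s + f.cost s + 1
  | exp e => e.cost s + 1
  | log e => e.cost s + 1
  | sqrt e => e.cost s + 1

end RExp

/-- Tests. -/
inductive BExp : Type
  | natEq (e f : NExp)
  | natLt (e f : NExp)
  | realLe (e f : RExp)
  | not (b : BExp)
  | and (b c : BExp)

namespace BExp

/-- The truth of a test. -/
def Holds (s : Store) : BExp → Prop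
  | natEq e f => e.eval s = f.eval s
  | natLt e f => e.eval s < f.eval s
  | realLe e f => e.eval s ≤ f.eval s
  | not b => ¬ b.Holds s
  | and b c => b.Holds s ∧ c.Holds s

/-- The number of steps that the test takes. -/
def cost (s : Store) : BExp → ℕ
  | natEq e f => e.cost s + f.cost s + 1
  | natLt e f => e.cost s + f.cost s + 1
  | realLe e f => e.cost s + f.cost s + 1
  | not b => b.cost s + 1
  | and b c => b.cost s + c.cost s + 1

end BExp

/-- Programs. `setNat`, `setReal` assign the value of an expression to the entry `i` of the array
`a`; `ceil` assigns a rounded-up real; `flip` assigns `1` with probability `e` and else `0`;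
`gauss` assigns a draw of `N(0, 1)`; `loop e c` runs `c` as many times as the value of `e` at the
start says. -/
inductive Cmd : Type
  | skip
  | setNat (a : ℕ) (i e : NExp)
  | setReal (a : ℕ) (i : NExp) (e : RExp)
  | ceil (a : ℕ) (i : NExp) (e : RExp)
  | flip (a : ℕ) (i : NExp) (e : RExp)
  | gauss (a : ℕ) (i : NExp)
  | seq (c₁ c₂ : Cmd)
  | ite (b : BExp) (c₁ c₂ : Cmd)
  | loop (e : NExp) (c : Cmd)

/-- The array `f` with the entry `(a, i)` replaced by `v`. -/
def upd {α : Type} (f : ℕ → ℕ → α) (a i : ℕ) (v : α) : ℕ → ℕ → α :=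
  fun a' i' => if a' = a ∧ i' = i then v else f a' i'

/-- A store together with the number of steps made so far. -/
abbrev Config : Type := Store × ℕ

/-- `j` runs of the loop body `f`, each with one step of overhead. -/
def iter (f : Config → Measure Config) : ℕ → Config → Measure Config
  | 0, x => Measure.dirac x
  | j + 1, x => (f (x.1, x.2 + 1)).bind (iter f j)

open scoped Classical in
/-- The law of the configuration in which a program halts. -/
def run : Cmd → Config → Measure Config
  | .skip, x => Measure.dirac (x.1, x.2 + 1)
  | .setNat a i e, (s, T) =>
      Measure.dirac ((upd s.1 a (i.eval s) (e.eval s), s.2), T + (i.cost s + e.cost s + 1))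
  | .setReal a i e, (s, T) =>
      Measure.dirac ((s.1, upd s.2 a (i.eval s) (e.eval s)), T + (i.cost s + e.cost s + 1))
  | .ceil a i e, (s, T) =>
      Measure.dirac ((upd s.1 a (i.eval s) ⌈e.eval s⌉₊, s.2),
        T + (i.cost s + e.cost s + 1 + ⌈e.eval s⌉₊))
  | .flip a i e, (s, T) => (coin (e.eval s)).map fun b =>
      ((upd s.1 a (i.eval s) (if b then 1 else 0), s.2), T + (i.cost s + e.cost s + 1))
  | .gauss a i, (s, T) => (gaussianReal 0 1).map fun z =>
      ((s.1, upd s.2 a (i.eval s) z), T + (i.cost s + 1))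
  | .seq c₁ c₂, x => (run c₁ x).bind (run c₂)
  | .ite b c₁ c₂, (s, T) =>
      if b.Holds s then run c₁ (s, T + (b.cost s + 1)) else run c₂ (s, T + (b.cost s + 1))
  | .loop e c, (s, T) => iter (run c) (e.eval s) (s, T + (e.cost s + 1))

open scoped Classical in
/-- The memory that presents the input: the integer parameters in the natural array `0`, the
adjacency matrix of the graph in the natural array `1`, the partition in the natural array `2`, the
real parameters in the real array `0`; all else is zero. -/
def inputStore (P : Params) (E : Fin P.N → Fin P.k) (G : SimpleGraph (Fin P.N)) : Store :=
  (fun a i =>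
    match a with
    | 0 => [P.N, P.k, P.n, P.d, P.r, P.t].getD i 0
    | 1 => if ∃ u v : Fin P.N, i = u * P.N + v ∧ G.Adj u v then 1 else 0
    | 2 => if h : i < P.N then (E ⟨i, h⟩ : ℕ) else 0
    | _ => 0,
  fun a i =>
    match a with
    | 0 => [P.p, P.q, P.μ].getD i 0
    | _ => 0)

/-- The output is read from the real array `1`; sample `j` occupies the entries from `j * d` on. -/
def output (n d : ℕ) (x : Config) : Fin n → Fin d → ℝ := fun j i => x.1.2 1 (j * d + i)

end KPdsIsgm

end

noncomputable section

namespace KPdsIsgm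

open MeasureTheory renaming IsProbabilityMeasure → IsProb
open MeasureTheory.Measure renaming pi → piM
open MeasureTheory.Measure Function
open Finset hiding pi prod map card
open Fintype (card)
open Equiv (Perm)
open ENNReal (ofReal ofReal_mul ofReal_add ofReal_one ofReal_zero ofReal_ne_top ofReal_le_ofReal toReal_ofReal ofReal_sub ofReal_inv_of_pos ofReal_toReal ofReal_eq_zero)
open Real (exp log exp_pos exp_le_exp exp_log log_le_log add_one_le_exp exp_add exp_sub exp_zero)

open scoped Classical

/-! ### Calculus of random draws: composing, mapping and exchanging them. -/

section General

variable {α β γ : Type*} [MeasurableSpace α] [MeasurableSpace β] [MeasurableSpace γ]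

/-! ### Measures -/

/-! Each step of the reduction carries one random array with independent entries to another, exactly
or up to an error in total variation. By data processing (`Close.bind`) an error does not grow in
later steps, so the errors add up. `Close` is the one-sided form of a total variation bound.

Submatrix. The cloning weights are affine in the edge probability (`cloneWeight_mix`): an edge of
probability `p` becomes two independent `Bern(p)` bits, one of probability `q` two `Bern(Q)` bits.
So the entries off the diagonal have the ideal law exactly (`bind_cloneMatrix`). The diagonal has no
source in the graph. Once the choices of step 1 are written as uniform permutations of the parts
(`toKPartiteSubmatrix_eq`), the law of the matrix depends on the diagonal only through the number of
ones in each part and the bit at the planted index (`shuffledMatrix_congr`). In the reduction this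
number is `Bin(m/k, Q)` and independent of a `Bern(p)` bit, unless a cut-off interferes; in the
ideal matrix both come from independent bits. The chi-square divergence of the two laws is of order
`k/m` per part, and over `k` parts this amounts to an error `O(k/√N)` (`close_planted_bits`).

Gaussianization. Without truncation the rejection kernel would map `Bern(p)` to `N(τ, 1)` and
`Bern(Q)` to `N(0, 1)`. The bound on `μ` makes truncation and failure to accept so rare that all
entries together cost `O(1/N)` (`close_coin_bind_rkG`, `Params.Admissible.exists_close_rkG`).

Rotation. The matrix has orthonormal rows (`rotation_mul_transpose`), so the noise stays standard.
In each part the mean of a planted row is `τ` times a single column of the matrix, whose entries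
become `μ` and `μ' = (1 - r) μ` (`rotation_mul_τ`). Given its labels, the output is therefore
exactly a sample of the target, and a sample is labelled if its hyperplane contains the random point
of its part. Under the null hypothesis no row is planted and only the earlier errors occur.

Labels. The labels of `n` columns drawn without replacement have to be compared with independent
`Bern(1/r)` bits. Unless one of the points is zero, the fraction of labelled columns is nearly
`1/r`; the chain rule for relative entropy (`urnEntropy_le`) and a Hellinger bound
(`sum_urnProb_sub_le`) then give `O(k/√N + 1/w)`.

Polynomial time. No command reads the clock (`run_delay`), so the law of the memory (`sem`) and the
time are treated apart. Uniform permutations come from a Fisher-Yates shuffle with reservoir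
sampling, clones from two flips, the kernel from a loop with a stop flag, and hyperplanes from
normal vectors with leading digit one. Apart from the computation of the constants, the program
never stores a natural number above a fixed capacity, and this alone gives a polynomial time bound
by structural induction (`run_bound`). -/

/-- An enumeration of each part of the partition `E`. -/
abbrev Params.Listing (P : Params) (E : Fin P.N → Fin P.k) := ∀ a, Fin (P.N / P.k) ≃ {v // E v = a}

/-- A permutation of each block. -/
abbrev Params.Perms (P : Params) := Fin P.k → Perm (Fin P.blockLen)

/-- A choice of `n` columns of the rotated matrix. -/
abbrev Params.Cols (P : Params) := Fin P.n ↪ Fin P.k × P.Hyperplane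

lemma disc [DiscreteMeasurableSpace α] {f : α → β} : Measurable f := .of_discrete

lemma map_bind {μ : Measure α} {f : α → β} {g : β → Measure γ} (hf : Measurable f)
    (hg : Measurable g) : (μ.map f).bind g = μ.bind fun a => g (f a) := by
  rw [Measure.bind, Measure.map_map hg hf]; rfl

lemma bind_bind {μ : Measure α} {f : α → Measure β} {g : β → Measure γ} (hf : Measurable f)
    (hg : Measurable g) : (μ.bind f).bind g = μ.bind fun a => (f a).bind g :=
  Measure.bind_bind hf.aemeasurable hg.aemeasurable

lemma bind_map {μ : Measure α} {f : α → Measure β} {g : β → γ} (hf : Measurable f)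
    (hg : Measurable g) : (μ.bind f).map g = μ.bind fun a => (f a).map g := by
  simpa only [comp_def, bind_dirac_eq_map _ hg] using (bind_bind hf (measurable_dirac.comp hg))

lemma isProb_bind {μ : Measure α} [IsProb μ] {f : α → Measure β}
    (hf : Measurable f) (h : ∀ a, IsProb (f a)) :
    IsProb (μ.bind f) := by
  constructor; rw [Measure.bind_apply .univ hf.aemeasurable]; simp

lemma isProb_map {μ : Measure α} [IsProb μ] {f : α → β}
    (hf : Measurable f) : IsProb (μ.map f) :=
  isProbabilityMeasure_map hf.aemeasurable

lemma measurable_lintegral_param {f : α → Measure β} (hf : Measurable f)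
    (h : ∀ a, IsProb (f a)) {g : α × β → ℝ≥0∞} (hg : Measurable g) :
    Measurable fun a => ∫⁻ b, g (a, b) ∂ f a :=
  let κ : Kernel α β := ⟨f, hf⟩; have : IsMarkovKernel κ := ⟨h⟩
  Measurable.lintegral_kernel_prod_right' (κ := κ) hg

lemma measurable_bind_param {f : α → Measure β} {g : α → β → Measure γ} (hf : Measurable f)
    (h : ∀ a, IsProb (f a))
    (hg : Measurable fun x : α × β => g x.1 x.2) : Measurable fun a => (f a).bind (g a) := by
  refine measurable_of_measurable_coe _ fun s hs => ?_
  have : ∀ a, ((f a).bind (g a)) s = ∫⁻ b, (fun x : α × β => g x.1 x.2 s) _ ∂ f a :=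
    fun a => Measure.bind_apply hs (hg.comp measurable_prodMk_left).aemeasurable
  simp_rw [this]; exact measurable_lintegral_param hf h ((measurable_coe hs).comp hg)

lemma measurable_map_param {f : α → Measure β} {g : α → β → γ} (hf : Measurable f)
    (h : ∀ a, IsProb (f a))
    (hg : Measurable fun x : α × β => g x.1 x.2) : Measurable fun a => (f a).map (g a) := by
  have : (fun a => (f a).map (g a)) = fun a => (f a).bind fun b => dirac (g a b) := by
    ext1 a; exact (bind_dirac_eq_map _ (hg.comp measurable_prodMk_left)).symm
  rw [this]; exact measurable_bind_param hf h (measurable_dirac.comp hg)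

lemma measurable_bind_const (ν : Measure β) [SFinite ν] {f : α → β → Measure γ}
    (hf : Measurable fun x : α × β => f x.1 x.2) : Measurable fun a => ν.bind fun b => f a b := by
  refine measurable_of_measurable_coe _ fun s hs => ?_
  have : ∀ a, (ν.bind (f a)) s = ∫⁻ b, (fun x : α × β => f x.1 x.2 s) _ ∂ ν :=
    fun a => Measure.bind_apply hs (hf.comp measurable_prodMk_left).aemeasurable
  simp_rw [this]; exact Measurable.lintegral_prod_right' ((measurable_coe hs).comp hf)

lemma bind_comm {μ : Measure α} {ν : Measure β} [SFinite μ] [SFinite ν] {f : α → β → Measure γ}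
    (hf : Measurable fun x : α × β => f x.1 x.2) :
    (μ.bind fun a => ν.bind fun b => f a b) = ν.bind fun b => μ.bind fun a => f a b := by
  have hf' := hf.comp measurable_swap; ext s hs
  rw [Measure.bind_apply hs (measurable_bind_const ν hf).aemeasurable, Measure.bind_apply hs (measurable_bind_const μ hf').aemeasurable]
  simp_rw [(fun a => Measure.bind_apply hs (hf.comp measurable_prodMk_left).aemeasurable : ∀ a, (ν.bind fun b => f a b) s = ∫⁻ b, f a b s ∂ν), (fun b => Measure.bind_apply hs (hf'.comp measurable_prodMk_left).aemeasurable : ∀ b, (μ.bind fun a => f a b) s = ∫⁻ a, f a b s ∂μ)]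
  exact lintegral_lintegral_swap ((measurable_coe hs).comp hf).aemeasurable

end General

/-! ### Finite product measures. -/

section Pi

variable {ι : Type*} [Fintype ι] {X Y : ι → Type*} [∀ i, MeasurableSpace (X i)]
  [∀ i, MeasurableSpace (Y i)] {γ : Type*} [MeasurableSpace γ]

lemma measurable_pi_measure {κ : ∀ i, γ → Measure (X i)} (h : ∀ i, Measurable (κ i))
    (hp : ∀ i c, IsProb (κ i c)) :
    Measurable fun c => piM fun i => κ i c := by
  refine Measurable.measure_of_isPiSystem_of_isProbabilityMeasure generateFrom_pi.symm isPiSystem_pi ?_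
  rintro _ ⟨s, hs, rfl⟩; simp_rw [pi_pi]
  exact measurable_fun_prod _ fun i _ =>
    (measurable_coe (hs i (Set.mem_univ i))).comp (h i)

lemma lintegral_pi_prod (μ : ∀ i, Measure (X i)) [∀ i, IsProb (μ i)]
    {f : ∀ i, X i → ℝ≥0∞} (hf : ∀ i, Measurable (f i)) :
    ∫⁻ x, ∏ i, f i (x i) ∂piM μ = ∏ i, ∫⁻ x, f i x ∂μ i := by
  refine (lintegral_prod_eq_prod_lintegral_of_indepFun univ _ (iIndepFun_pi fun i => (hf i).aemeasurable) fun i => (hf i).comp (measurable_pi_apply i)).trans ?_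
  refine prod_congr rfl fun i _ => ?_
  rw [← (measurePreserving_eval μ i).lintegral_comp (hf i)]

lemma pi_bind_pi (μ : ∀ i, Measure (X i)) [∀ i, IsProb (μ i)]
    {κ : ∀ i, X i → Measure (Y i)} (h : ∀ i, Measurable (κ i))
    (hp : ∀ i c, IsProb (κ i c)) :
    ((piM μ).bind fun x => piM fun i => κ i (x i)) =
      piM fun i => (μ i).bind (κ i) := by
  have : ∀ i, IsProb ((μ i).bind _) := fun i => isProb_bind (h i) (hp i)
  refine (pi_eq fun s hs => ?_).symm; rw [Measure.bind_apply (.univ_pi hs)]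
  · simp_rw [pi_pi]
    rw [lintegral_pi_prod μ (f := fun i x => κ i x _)
      fun i => (measurable_coe (hs i)).comp (h i)]
    exact prod_congr rfl fun i _ => (Measure.bind_apply (hs i) (h i).aemeasurable).symm
  · exact (measurable_pi_measure (fun i => (h i).comp (measurable_pi_apply i))
      fun i c => hp i _).aemeasurable

end Pi

/-! ### Reading coordinates of a product sample. -/

section PiRead

variable {I U K β : Type*} [Fintype I] [Fintype U] [Fintype K] [MeasurableSpace β]

/-- The workhorse for independence. Wherever a random array has independent entries below, the
reason is that distinct entries read distinct coordinates of one product space, and finding this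
injective addressing is the only work. The preimage of a box is a box that leaves the unread
coordinates free. -/
lemma pi_map_injective (μ : I → Measure β) [∀ i, IsProb (μ i)] {g : U → I}
    (hg : Injective g) :
    ((piM μ).map fun ω u => ω (g u)) = piM fun u => μ (g u) := by
  classical
  refine (pi_eq fun s hs => ?_).symm
  rw [map_apply (by fun_prop) (.univ_pi hs)]
  have : (fun ω u => ω (g u)) ⁻¹' Set.univ.pi s =
      Set.univ.pi fun i => if h : ∃ u, g u = i then s h.choose else Set.univ := by
    ext ω; simp
    constructor
    · intro h i; split_ifs with hi
      · grind
      simp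
    · intro h u; have hu : ∃ v, g v = g u := ⟨u, rfl⟩; grind
  rw [this, pi_pi]
  have h2 : ∀ u, μ (g u) (s u) = μ (g u) (if h : ∃ v, g v = g u then s h.choose else Set.univ) := by
    intro u; have hu : ∃ v, g v = g u := ⟨u, rfl⟩; grind
  simp_rw [h2]
  rw [← prod_image (g := g)
    (f := fun i => μ i (if h : ∃ v, g v = i then s h.choose else Set.univ)) (by intro a _ b _ h; grind)]
  refine (prod_subset (subset_univ _) fun i _ hi => ?_).symm; simp_all

lemma pi_curry (μ : I → K → Measure β) [∀ i k, IsProb (μ i k)] :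
    (piM fun x : I × K => μ x.1 x.2).map Function.curry =
      piM fun i => piM (μ i) := by
  have := infinitePi_map_curry μ; simp only [infinitePi_eq_pi] at this; exact this

lemma pi_pi_eq_map (μ : I → K → Measure β) [∀ i k, IsProb (μ i k)] :
    (piM fun i => piM (μ i)) =
      (piM fun x : I × K => μ x.1 x.2).map fun f i k => f (i, k) :=
  (pi_curry μ).symm

lemma pi_sum (μ : I → Measure β) (ν : K → Measure β) [∀ i, IsProb (μ i)]
    [∀ i, IsProb (ν i)] :
    (piM μ).prod (piM ν) =
      (piM (Sum.elim μ ν)).map fun f => (fun i => f (.inl i), fun k => f (.inr k)) := by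
  have : ∀ i, SigmaFinite (Sum.elim μ ν i) := by rintro (i | i) <;> dsimp <;> infer_instance
  exact ((measurePreserving_sumPiEquivProdPi (Sum.elim μ ν)).map_eq).symm

lemma prod_map_eq_bind {α γ : Type*} [MeasurableSpace α] [MeasurableSpace γ] {μ : Measure α}
    {ν : Measure β} [SFinite ν] {f : α × β → γ} (hf : Measurable f) :
    (μ.prod ν).map f = μ.bind fun a => ν.map fun b => f (a, b) := by
  rw [Measure.prod, bind_map Measurable.map_prodMk_left hf]; congr 1; ext1 a
  rw [Measure.map_map hf (by fun_prop)]; rfl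

/-- Splits off the last coordinate, for the induction in `close_pi_fin`. -/
lemma pi_snoc {n : ℕ} (μ : Fin (n + 1) → Measure β) [∀ i, IsProb (μ i)] :
    piM μ = (piM fun i : Fin n => μ i.castSucc).bind fun f =>
      (μ (Fin.last n)).map fun b => (Fin.snoc f b : Fin (n + 1) → β) := by
  have hm : Measurable fun x : (Fin n → β) × β => (Fin.snoc x.1 x.2 : Fin _ → β) := by
    refine measurable_pi_lambda _ fun i => ?_
    induction i using Fin.lastCases with
    | last => simpa using measurable_snd
    | cast i => simp; fun_prop
  rw [← prod_map_eq_bind hm]; refine pi_eq fun s hs => ?_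
  rw [map_apply hm (.univ_pi hs)]
  have : (fun x => (Fin.snoc x.1 x.2)) ⁻¹' Set.univ.pi s =
      (Set.univ.pi fun i => s i.castSucc) ×ˢ s (Fin.last n) := by
    ext x; simp [Fin.forall_fin_succ']
  rw [this, prod_prod, pi_pi, Fin.prod_univ_castSucc]

end PiRead

/-! ### Uniform choices from finite types. -/

section Unif

variable {A B C : Type*} [Fintype A] [Fintype B] {β γ : Type*} [MeasurableSpace β] [MeasurableSpace γ]

lemma unif_apply (f : A → Measure β) (s : Set β) :
    unif A f s = ∑ a, (card A : ℝ≥0∞)⁻¹ * f a s := by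
  simp [unif]

lemma isProb_unif [Nonempty A] {f : A → Measure β} (h : ∀ a, IsProb (f a)) :
    IsProb (unif A f) := by
  constructor; rw [unif_apply]; simp; exact ENNReal.mul_inv_cancel (by simp) (by simp)

lemma unif_congr {f g : A → Measure β} (h : ∀ a, f a = g a) : unif A f = unif A g := by congr 1; grind

lemma unif_const [Nonempty A] (μ : Measure β) : unif A (fun _ => μ) = μ := by
  ext s _; rw [unif_apply]; simp
  rw [← mul_assoc, ENNReal.mul_inv_cancel (by simp) (by simp), one_mul]

lemma measurable_unif {f : A → γ → Measure β} (h : ∀ a, Measurable (f a)) :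
    Measurable fun c => unif A fun a => f a c := by
  refine measurable_of_measurable_coe _ fun s hs => ?_; simp_rw [unif_apply]
  exact measurable_fun_sum _ fun a _ => ((measurable_coe hs).comp (h a)).const_mul _

lemma unif_bind (f : A → Measure β) {g : β → Measure γ} (hg : Measurable g) :
    (unif A f).bind g = unif A fun a => (f a).bind g := by
  ext s hs
  rw [Measure.bind_apply hs hg.aemeasurable, unif_apply, unif, lintegral_finsetSum_measure]
  simp_rw [lintegral_smul_measure, Measure.bind_apply hs hg.aemeasurable, smul_eq_mul]

lemma unif_map (f : A → Measure β) {g : β → γ} (hg : Measurable g) :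
    (unif A f).map g = unif A fun a => (f a).map g := by
  simpa only [comp_def, bind_dirac_eq_map _ hg] using (unif_bind f (measurable_dirac.comp hg))

lemma bind_unif {μ : Measure γ} {f : γ → A → Measure β} (h : ∀ a, Measurable fun c => f c a) :
    (μ.bind fun c => unif A (f c)) = unif A fun a => μ.bind fun c => f c a := by
  ext s hs; rw [Measure.bind_apply hs (measurable_unif h).aemeasurable, unif_apply]
  simp_rw [unif_apply, Measure.bind_apply hs (h _).aemeasurable]
  have h' : ∀ a, Measurable fun c => f c a s := fun a => (measurable_coe hs).comp (h a)
  rw [lintegral_finsetSum _ fun a _ => (h' a).const_mul _]; simp_all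

lemma unif_comm (f : A → B → Measure β) :
    (unif A fun a => unif B fun b => f a b) = unif B fun b => unif A fun a => f a b := by
  ext s _; simp_rw [unif_apply, mul_sum]; rw [Finset.sum_comm]; ring

lemma unif_prod (f : A → B → Measure β) :
    (unif (A × B) fun x => f x.1 x.2) = unif A fun a => unif B fun b => f a b := by
  ext s _
  simp_rw [unif_apply, mul_sum, Fintype.card_prod, Fintype.sum_prod_type, Nat.cast_mul]
  refine sum_congr rfl fun b _ => sum_congr rfl fun a _ => ?_
  rw [ENNReal.mul_inv (by simp) (by simp), mul_assoc]

lemma unif_comp_of_card_fiber [Nonempty A] [DecidableEq B] (h : A → B) (c : ℕ)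
    (hc : ∀ b, (univ.filter fun a => h a = b).card = c) (f : B → Measure β) :
    (unif A fun a => f (h a)) = unif B f := by
  have hcard : card A = c * card B := by
    rw [← Finset.card_univ, card_eq_sum_card_fiberwise (f := h) (t := univ) (by simp)]
    simp [hc, mul_comm]
  ext s _; rw [unif_apply, unif_apply, ← sum_fiberwise (g := h)]
  refine sum_congr rfl fun b _ => ?_
  rw [sum_congr rfl (fun a ha => by rw [(mem_filter.1 ha).2])]
  rw [Finset.sum_const, hc, nsmul_eq_mul, ← mul_assoc, hcard, Nat.cast_mul,
    ENNReal.mul_inv (by simp) (by simp), ← mul_assoc,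
    ENNReal.mul_inv_cancel (by exact_mod_cast (by rintro rfl; simp_all)) (by simp), one_mul]

lemma unif_equiv (e : A ≃ B) (f : B → Measure β) : (unif A fun a => f (e a)) = unif B f := by
  ext s _; rw [unif_apply, unif_apply, Fintype.card_congr e]; exact e.sum_comp fun b => _⁻¹ * f b s

/-- The image of the uniform distribution on a finite group under a surjection whose fibres are
compatible with right multiplication is uniform. -/
lemma unif_comp_of_group {G : Type*} [Group G] [Fintype G] (h : G → B)
    (hs : Surjective h) (hh : ∀ x y g, h x = h y → h (x * g) = h (y * g))
    (f : B → Measure β) : (unif G fun a => f (h a)) = unif B f := by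
  classical
  refine unif_comp_of_card_fiber h (univ.filter fun a => h a = h 1).card (fun b => ?_) f
  obtain ⟨g, rfl⟩ := hs b
  -- Right multiplication by `g⁻¹` carries the fibre over `h g` to the fibre over `h 1`, so all
  -- fibres have the same size.
  refine card_bij (fun a _ => a * g⁻¹) (fun a ha => ?_) (fun a _ b _ hab => by simp_all)
    fun a ha => ⟨a * g, ?_, by simp⟩
  · simp at ha ⊢; simpa using hh a g g⁻¹ ha
  grind

end Unif

/-! ### Permutations between colourings. -/

section Combinatorics

/-- Colour classes of equal size are matched class by class. This supplies the permutation wherever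
a law is shown to depend on a configuration only through its counts. -/
lemma exists_perm_comp_eq {α κ : Type*} [Fintype α] [DecidableEq κ] {f g : α → κ}
    (h : ∀ c, (univ.filter fun x => f x = c).card = (univ.filter fun x => g x = c).card) :
    ∃ τ : Perm α, ∀ x, f (τ x) = g x := by
  have e : ∀ c, {x // g x = c} ≃ {x // f x = c} := fun c =>
    Fintype.equivOfCardEq (by rw [Fintype.card_subtype, Fintype.card_subtype, h c])
  exact ⟨Equiv.ofFiberEquiv e, Equiv.ofFiberEquiv_map e⟩

def cnt {n : ℕ} (b : Fin n → Bool) : ℕ := (univ.filter fun z => b z = true).card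

lemma cnt_le {n : ℕ} (b : Fin n → Bool) : cnt b ≤ n :=
  (card_le_univ _).trans_eq (Fintype.card_fin n)

lemma card_filter_bool_eq {α : Type*} [Fintype α] {f g : α → Bool}
    (h : (univ.filter fun x => f x = true).card =
      (univ.filter fun x => g x = true).card) (c : Bool) :
    (univ.filter fun x => f x = c).card = (univ.filter fun x => g x = c).card := by
  cases c
  · have hf := card_filter_add_card_filter_not (s := univ) fun x => f x = true
    have hg := card_filter_add_card_filter_not (s := univ) fun x => g x = true
    simp at hf hg; omega
  · exact h

end Combinatorics

/-! ### Nested uniform choices as one uniform choice. -/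

section UnifSigma

variable {A : Type*} [Fintype A] {B : A → Type*} [∀ a, Fintype (B a)] {β : Type*} [MeasurableSpace β]

lemma unif_sigma (c : ℕ) (hc : ∀ a, card (B a) = c) (f : (a : A) → B a → Measure β) :
    (unif (Σ a, B a) fun x => f x.1 x.2) = unif A fun a => unif (B a) (f a) := by
  ext s _; simp_rw [unif_apply, mul_sum, Fintype.card_sigma, Fintype.sum_sigma, hc]
  refine sum_congr rfl fun b _ => sum_congr rfl fun a _ => ?_; simp
  rw [ENNReal.mul_inv (by simp) (by simp), mul_assoc]

end UnifSigma

/-! ### Coins, binomial counts and random subsets. -/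

section Coins

lemma prob_coe {x : ℝ} (h0 : 0 ≤ x) (h1 : x ≤ 1) : (prob x : ℝ) = x := by
  rw [prob, Set.projIcc_of_mem _ ⟨h0, h1⟩]

instance (x : ℝ) : IsProb (coin x) := by unfold coin; infer_instance

lemma coin_eq (x : ℝ) : coin x = ofReal (prob x) • dirac true +
    ofReal (1 - prob x) • dirac false := by
  have h : ∀ y (μ : Measure Bool), (unitInterval.toNNReal y) • μ = ofReal y • μ := by
    intro y μ; rw [ENNReal.ofReal_eq_coe_nnreal y.2.1]; rfl
  rw [coin, bernoulliMeasure_def, h, h]; rfl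

lemma coin_singleton (x : ℝ) (b : Bool) :
    coin x {b} = ofReal (if b then (prob x : ℝ) else 1 - prob x) := by
  rw [coin_eq]; cases b <;> simp

theorem pi_bool_map_cnt (n : ℕ) (x : ℝ) :
    (piM fun _ : Fin n => coin x).map cnt = binomial n (prob x) := by
  refine ext_of_singleton fun j => ?_
  rw [binomial_singleton, map_apply .of_discrete .of_discrete]
  have h1 : cnt ⁻¹' {j} = ((univ.filter fun b : Fin n → Bool => cnt b = j : Finset _) : Set (Fin n → Bool)) := by
    ext; simp
  rw [h1, ← sum_measure_singleton]
  have h2 : ∀ b ∈ univ.filter fun b : Fin n → Bool => cnt b = j,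
      (piM fun _ => coin x) {b} = ofReal ((prob x) ^ j * (1 - prob x) ^ (n - j)) := by
    intro b hb; simp at hb; rw [pi_singleton]; simp_rw [coin_singleton]
    rw [← ENNReal.ofReal_prod_of_nonneg, prod_ite]
    · simp only [prod_const]; congr 3
      have hf := card_filter_add_card_filter_not (s := univ) fun x => b x = true
      simp only [Finset.card_univ, Fintype.card_fin] at hf; rw [cnt] at hb; omega
    · intro i _; have := (prob x).2.1; have := (prob x).2.2; split_ifs <;> linarith
  rw [sum_congr rfl h2, Finset.sum_const, nsmul_eq_mul, mul_assoc,
    ofReal_mul (Nat.cast_nonneg _), ENNReal.ofReal_natCast]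
  congr 2
  let e : (Fin n → Bool) ≃ Finset _ :=
    { toFun := fun b => univ.filter fun z => b z = true
      invFun := fun s z => decide (z ∈ s)
      left_inv := fun b => by ext; simp
      right_inv := fun s => by ext; simp }
  rw [← card_fin n, ← card_powersetCard, card_fin]
  refine card_bij _ (fun b hb => ?_) (fun a _ b _ h => e.injective h) ?_
  · rw [mem_filter] at hb; simpa using (show (e b).card = j from hb.2)
  · intro s hs; refine ⟨e.symm s, ?_, e.apply_symm_apply s⟩; rw [mem_filter]
    simpa [cnt, e] using hs

lemma pi_pi_coin_map_cnt (k n : ℕ) (x : ℝ) : (piM fun _ : Fin k => binomial n (prob x)) =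
      (piM fun _ : Fin k => piM fun _ : Fin n => coin x).map fun B a => cnt (B a) := by
  rw [pi_map_pi fun _ => disc.aemeasurable]; simp_rw [pi_bool_map_cnt]

variable {β : Type*} [MeasurableSpace β]

lemma pi_pi_coin_perm {k n : ℕ} (x : ℝ) (τ : Fin k → Perm (Fin n)) :
    (piM fun _ : Fin k => piM fun _ : Fin n => coin x).map
      (fun B a z => B a (τ a z)) = piM fun _ : Fin k => piM fun _ : Fin n => coin x := by
  rw [pi_map_pi (f := fun a (b : Fin n → Bool) z => b (τ a z))
    fun _ => disc.aemeasurable]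
  simp_rw [(fun a => pi_map_injective _ (τ a).injective : ∀ a, (piM fun _ => coin x).map _ = piM fun _ => coin x)]

lemma cnt_perm {n : ℕ} (b : Fin n → Bool) (τ : Perm (Fin n)) :
    cnt (fun z => b (τ z)) = cnt b := by
  refine card_bij (fun z _ => τ z) (by simp) (by simp) fun z hz => ⟨τ.symm z, ?_, by simp⟩
  simpa using hz

/-- A uniform subset of binomial size is a Bernoulli subset. -/
lemma bind_binomial_unif_subset {k n L : ℕ} (x : ℝ) (S : Fin k → Finset (Fin L))
    (σ : ∀ a, Fin n ≃ S a) (h : (Fin k → ℕ) → (Fin k → Finset (Fin L)) → Measure β) :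
    ((piM fun _ : Fin k => binomial n (prob x)).bind fun s =>
      unif {T : Fin k → Finset (Fin L) // ∀ a, T a ⊆ S a ∧ (T a).card = s a} fun T => h s T.1) =
    (piM fun _ : Fin k => piM fun _ : Fin n => coin x).bind fun B =>
      h (fun a => cnt (B a)) fun a => (univ.filter fun z => B a z = true).image
        fun z => (σ a z : Fin L) := by
  rw [pi_pi_coin_map_cnt, map_bind disc disc]
  set μ := piM fun _ : Fin k => piM fun _ : Fin n => coin x
  have hinj : ∀ a, Injective fun z => _ := fun a z z' h => (σ a).injective (Subtype.ext h)
  -- Permuting the coins of a part by a fixed `τ` changes neither their law nor the number of ones,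
  -- so an average over all `τ` may be inserted. For fixed coins this average spreads the chosen
  -- subset uniformly over the subsets of its size.
  have key : ∀ τ : Fin k → Perm _, (μ.bind fun B =>
      h (fun a => cnt (B a)) fun a => (univ.filter fun z => B a z = true).image
        fun z => (σ a z)) = μ.bind fun B =>
      h (fun a => cnt (B a)) fun a => (univ.filter fun z => B a (τ a z) = true).image
        fun z => (σ a z) := by
    intro τ
    conv_lhs => rw [show μ = μ.map _ from (pi_pi_coin_perm x τ).symm]
    rw [map_bind disc disc]; simp_rw [cnt_perm]
  rw [← unif_const (A := Fin k → Perm (Fin n)) (μ.bind fun B =>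
      h _ fun a => (univ.filter fun z => B a z = true).image
        fun z => _), unif_congr key, ← bind_unif fun _ => disc]
  congr 1; ext1 B
  have hcard : ∀ (τ : Fin k → Perm _) a, ((univ.filter fun z => B a (τ a z) = true).image
        fun z => (σ a z : Fin L)) ⊆ S a ∧ ((univ.filter fun z => B a (τ a z) = true).image
        fun z => (σ a z : Fin L)).card = cnt (B a) := by
    refine fun τ a => ⟨?_, ?_⟩
    · intro y hy; obtain ⟨z, -, rfl⟩ := mem_image.1 hy; exact (σ a z).2
    · rw [card_image_of_injective _ (hinj a), ← cnt_perm _ _]; rfl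
  symm
  refine unif_comp_of_group (B := {T : Fin k → Finset _ // ∀ a, T a ⊆ S a ∧ (T a).card = cnt (B a)})
    (fun τ => ⟨_, hcard τ⟩) ?_ ?_ (fun T => h _ T.1)
  · rintro ⟨T, hT⟩
    have : ∀ a, ∃ τ : Perm _, ∀ z, B a (τ z) = decide ((σ a z : Fin L) ∈ T a) := by
      intro a; refine exists_perm_comp_eq (card_filter_bool_eq ?_); change cnt _ = _
      rw [← (hT a).2]; symm; refine card_bij _ (by simp) (fun z _ z' _ h => hinj a h) ?_
      exact fun y hy => ⟨(σ a).symm ⟨y, (hT a).1 hy⟩, by simpa using hy, by simp⟩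
    choose τ hτ using this; refine ⟨τ, Subtype.ext (funext fun a => ?_)⟩; ext y; simp [hτ]
    constructor
    · rintro ⟨z, hz, rfl⟩; exact hz
    · intro hy; exact ⟨(σ a).symm ⟨y, (hT a).1 hy⟩, by simpa using hy, by simp⟩
  · intro τ τ' g hh
    have h1 : ∀ a z, (B a (τ a z) = true) = (B a (τ' a z) = true) := by
      intro a z; simpa using (congrArg (fun T => (σ a z : Fin L) ∈ T.1 a) hh)
    ext y; simp only [mem_image, mem_filter]; simp [h1]

end Coins

/-! ### Step 1 through uniform permutations of the parts: the choice of sets and bijections. -/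

section Canonical

lemma unif_card_subtype_pi {k : ℕ} {X : Fin k → Type*} [∀ a, Fintype (X a)] (p : ∀ a, X a → Prop)
    [Fintype {T : ∀ a, X a // ∀ a, p a (T a)}] [∀ a, Fintype {t : X a // p a t}] :
    card {T : ∀ a, X a // ∀ a, p a (T a)} = ∏ a, card {t : X a // p a t} := by
  rw [Fintype.card_congr (Equiv.subtypePiEquivPi), Fintype.card_pi]

variable (P : Params) {E : Fin P.N → Fin P.k}

/-- The bit on the diagonal at the position `z` of the part `a`: the first `N / k` positions carry
Bernoulli bits, and the ones that follow top up their number. -/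
def diagBit (B₁ : Fin P.k → Fin (P.N / P.k) → Bool)
    (B₂ : Fin P.k → Fin P.blockLen → Bool) (a : Fin P.k) (z : Fin P.blockLen) : Bool :=
  if h : (z : ℕ) < P.N / P.k then B₁ a ⟨z, h⟩
  else decide ((z : ℕ) < P.N / P.k + (cnt (B₂ a) - cnt (B₁ a)))

/-- The matrix of To-k-Partite-Submatrix in terms of permutations `θ` of the parts. -/
def cloneMatrix (e : P.Listing E)
    (B₁ : Fin P.k → Fin (P.N / P.k) → Bool) (B₂ : Fin P.k → Fin P.blockLen → Bool)
    (θ : P.Perms) (x : Sym2 (Fin P.N) → Fin 2 → Bool)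
    (Z : P.Row → P.Row → Bool) : P.Row → P.Row → Bool :=
  fun i j => if i = j then diagBit P B₁ B₂ i.1 (θ i.1 i.2)
    else if h : (θ i.1 i.2 : ℕ) < P.N / P.k ∧ (θ j.1 j.2 : ℕ) < P.N / P.k then
      x s((e i.1 ⟨θ i.1 i.2, h.1⟩ : Fin P.N), (e j.1 ⟨θ j.1 j.2, h.2⟩ : Fin P.N))
        (if toLex i < toLex j then 0 else 1)
    else Z i j

lemma card_filter_fin {L a b : ℕ} (hb : b ≤ L) :
    (univ.filter fun z : Fin L => a ≤ (z : ℕ) ∧ (z : ℕ) < b).card = b - a := by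
  rw [← Nat.card_Ico]; refine card_bij _ (by simp) (fun z _ z' _ h => Fin.ext h) ?_
  intro y hy; simp at hy; exact ⟨⟨y, by omega⟩, by simpa using hy, rfl⟩

/-- The set of the elements of a part that are sent to the first `N / k` positions. -/
def selSet (θ : P.Perms) (a : Fin P.k) : Finset (Fin P.blockLen) :=
  univ.filter fun x => (θ a x : ℕ) < P.N / P.k

lemma mem_selSet (θ : P.Perms) (a : Fin P.k)
    (x : Fin P.blockLen) : x ∈ selSet P θ a ↔ (θ a x : ℕ) < P.N / P.k := by simp [selSet]

/-- The set of the elements of a part that are sent to the next `s` positions. -/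
def topSet (s : ℕ) (θ : P.Perms) (a : Fin P.k) :
    Finset (Fin P.blockLen) :=
  univ.filter fun x => P.N / P.k ≤ (θ a x : ℕ) ∧ (θ a x : ℕ) < P.N / P.k + s

/-- The bijection to the vertices of a part that a permutation induces. -/
def selEquiv (hL : P.N / P.k ≤ P.blockLen) (e : P.Listing E)
    (θ : P.Perms) (a : Fin P.k) :
    selSet P θ a ≃ {v // E v = a} :=
  (Equiv.subtypeEquiv (q := fun z : Fin P.blockLen => (z : ℕ) < P.N / P.k) (θ a)
    (fun x => by simp [selSet])).trans ((Fin.castLEquiv hL).symm.trans (e a))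

lemma selEquiv_apply (hL : P.N / P.k ≤ P.blockLen) (e : P.Listing E)
    (θ : P.Perms) (a : Fin P.k) (x : selSet P θ a) :
    selEquiv P hL e θ a x = e a ⟨θ a x, (mem_selSet P θ a x).1 x.2⟩ := rfl

/-- One uniform permutation `θ a` of each part encodes all three choices: `S a` is what it sends to
the first `N / k` positions, the bijection to the vertices is read off from the order of these
positions, and `T a` is what it sends to the next `s a` positions. Every triple arises from the same
number of permutations. -/
lemma unif_select (hL : P.N / P.k ≤ P.blockLen) (e : P.Listing E)
    (s : Fin P.k → ℕ) (hs : ∀ a, s a ≤ P.blockLen - P.N / P.k) {β : Type*} [MeasurableSpace β]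
    (h : (S : Fin P.k → Finset (Fin P.blockLen)) → (∀ a, S a ≃ {v // E v = a}) →
      (Fin P.k → Finset (Fin P.blockLen)) → Measure β) :
    (unif {S : Fin P.k → Finset (Fin P.blockLen) // ∀ a, (S a).card = P.N / P.k} fun S =>
      unif (∀ a, S.1 a ≃ {v // E v = a}) fun π =>
      unif {T : Fin P.k → Finset (Fin P.blockLen) // ∀ a, T a ⊆ (S.1 a)ᶜ ∧ (T a).card = s a}
        fun T => h S.1 π T.1) =
    unif P.Perms fun θ =>
      h (selSet P θ) (selEquiv P hL e θ) fun a => topSet P (s a) θ a := by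
  let Sel := {S : Fin P.k → Finset (Fin P.blockLen) // ∀ a, (S a).card = (P.N / P.k)}
  let X : Sel → Type := fun S => (∀ a, S.1 a ≃ {v // E v = a}) ×
      {T : Fin P.k → Finset _ // ∀ a, T a ⊆ (S.1 a)ᶜ ∧ (T a).card = s a}
  have hcard : ∀ a, card {v // E v = a} = _ := fun a => by
    rw [← Fintype.card_congr (e a), Fintype.card_fin]
  -- The number of pairs `(π, T)` is the same for every `S`, so the nested choices are one uniform
  -- choice from a disjoint union.
  have hX : ∀ S : Sel, card (X S) =
      (∏ _a : Fin P.k, (P.N / P.k).factorial) * ∏ a, (P.blockLen - (P.N / P.k)).choose (s a) := by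
    intro S; rw [Fintype.card_prod, Fintype.card_pi]; congr 1
    · refine prod_congr rfl fun a _ => ?_
      rw [Fintype.card_equiv (Fintype.equivOfCardEq (by rw [hcard, Fintype.card_coe, S.2 a])),
        Fintype.card_coe, S.2 a]
    · rw [unif_card_subtype_pi fun a t => t ⊆ (S.1 a)ᶜ ∧ t.card = s a]
      refine prod_congr rfl fun a _ => ?_
      have hc : (S.1 a)ᶜ.card = P.blockLen - P.N / P.k := by
        rw [card_compl, Fintype.card_fin, S.2 a]
      rw [Fintype.card_subtype, ← hc, ← card_powersetCard]
      congr 1; ext t; simp [mem_powersetCard]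
  have hl : (unif Sel fun S => unif _ fun π =>
      unif {T : Fin P.k → Finset _ // ∀ a, T a ⊆ (S.1 a)ᶜ ∧ (T a).card = s a}
        fun T => h S.1 π T.1) = unif (Σ S, X S) fun x => h x.1.1 x.2.1 x.2.2.1 := by
    rw [unif_sigma _ hX fun S x => h S.1 x.1 x.2.1]; exact unif_congr fun S => (unif_prod _).symm
  rw [hl]
  let F : _ → Σ S, X S := fun θ => ⟨⟨selSet P θ, fun a => by
        rw [← Fintype.card_coe, Fintype.card_congr (selEquiv P hL e θ a), hcard]⟩,
      selEquiv P hL e θ, ⟨fun a => topSet P (s a) θ a, fun a => by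
        refine ⟨fun x hx => ?_, ?_⟩
        · simp only [topSet, mem_filter_univ] at hx
          simp only [selSet, mem_compl, mem_filter_univ]; omega
        · have := card_filter_fin (L := P.blockLen) (a := (P.N / P.k)) (b := (P.N / P.k) + s a) (by have := hs a; omega)
          rw [Nat.add_sub_cancel_left] at this; rw [← this]
          refine card_bij (fun x _ => θ a x) (by simp [topSet]) (by simp) fun z hz =>
            ⟨(θ a).symm z, by simpa [topSet] using hz, by simp⟩⟩⟩
  -- A triple is recorded as a colouring of each part: a member of `S a` gets the index of its
  -- vertex, any other element the truth value of its membership in `T a`. The positions carry the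
  -- fixed colouring `pc`, and the colour of `y` under `F θ` is that of position `θ a y`. Since
  -- `Col` is injective, surjectivity of `F` reduces to equal colour counts, and compatibility with
  -- multiplication is immediate.
  let Col : (Σ S, X S) → Fin P.k → Fin P.blockLen → Fin _ ⊕ Bool := fun x a y =>
    if hy : y ∈ x.1.1 a then .inl ((e a).symm (x.2.1 a ⟨y, hy⟩)) else .inr (decide (y ∈ x.2.2.1 a))
  let pc : Fin P.k → Fin P.blockLen → Fin (P.N / P.k) ⊕ Bool := fun a z =>
    if hz : _ < _ then .inl ⟨z, hz⟩ else .inr (decide (z < (P.N / P.k) + s a))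
  have hColF : ∀ θ a y, Col (F θ) a y = pc a (θ a y) := by
    intro θ a y; simp only [Col, pc, F, mem_selSet, topSet, selEquiv_apply]; split_ifs with h1
    · simp
    · simp only [mem_filter_univ]; congr 2; simp; omega
  have hCol : Injective Col := by
    rintro ⟨⟨S, hS⟩, π, ⟨T, hT⟩⟩ ⟨⟨S', hS'⟩, π', ⟨T', hT'⟩⟩ heq
    have hSS : S = S' := by
      funext a; ext y; have := congrFun (congrFun heq a) y; simp only [Col] at this
      split_ifs at this with h1 h2 h2 <;> simp [h1, h2]
    subst hSS
    have hTT : T = T' := by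
      funext a; ext y; have h3 := congrFun (congrFun heq a) y; simp only [Col] at h3
      split_ifs at h3 with h1
      · have h4 := fun hy => mem_compl.1 ((hT a).1 hy) h1
        exact ⟨fun hy => (h4 hy).elim, fun hy => ((fun hy => mem_compl.1 ((hT' a).1 hy) h1) hy).elim⟩
      · simpa using h3
    subst hTT
    have hππ : π = π' := by
      funext a; ext y; have h3 := congrFun (congrFun heq a) y; simp only [Col, y.2, dif_pos] at h3
      have := (e a).symm.injective (Sum.inl.inj h3)
      exact congrArg (fun v : {v // E v = a} => (v : ℕ)) this
    subst hππ; rfl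
  symm
  refine unif_comp_of_group F (fun x => ?_) (fun θ θ' g hh => hCol ?_)
    (fun x : Σ S, X S => h x.1.1 x.2.1 x.2.2.1)
  · have : ∀ a, ∃ τ : Perm _, ∀ y, pc a (τ y) = Col x a y := by
      intro a; obtain ⟨⟨S, hS⟩, π, ⟨T, hT⟩⟩ := x
      have hdis : ∀ y ∈ T a, y ∉ S a := fun y hy => mem_compl.1 (((hT a).1) hy)
      have hsa := hs a; refine exists_perm_comp_eq fun c => ?_; rcases c with i | b
      · have h1 : (univ.filter fun z => pc a z = .inl i) = {Fin.castLE hL i} := by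
          ext z; simp only [pc, mem_filter_univ, mem_singleton]
          split_ifs with hz
          · simp [Fin.ext_iff]
          · have := i.2; simp only [Fin.ext_iff, false_iff, Fin.val_castLE]; omega
        have h2 : (univ.filter fun y => Col ⟨⟨S, hS⟩, π, ⟨T, hT⟩⟩ a y = .inl i) =
            {((π a).symm (e a i) : Fin P.blockLen)} := by
          ext z; simp only [Col, mem_filter_univ, mem_singleton]
          split_ifs with hz
          · rw [Sum.inl.injEq, Equiv.symm_apply_eq, ← Equiv.eq_symm_apply]
            exact ⟨fun h => congrArg Subtype.val h, fun h => Subtype.ext h⟩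
          · simp; rintro rfl; exact hz ((π a).symm _).2
        rw [h1, h2, card_singleton, card_singleton]
      · have h1 : (univ.filter fun z => pc a z = .inr b) = if b then
            univ.filter fun z : Fin P.blockLen => (P.N / P.k) ≤ z ∧ z < (P.N / P.k) + s a else
            univ.filter fun z => (P.N / P.k) + s a ≤ z ∧ z < P.blockLen := by
          ext z
          cases b <;> simp only [pc, Bool.false_eq_true, if_false, if_true, mem_filter,
            mem_univ, true_and] <;>
            split_ifs <;> simp <;> omega
        have h2 : (univ.filter fun y => Col ⟨⟨S, hS⟩, π, ⟨T, hT⟩⟩ a y = .inr b) = if b then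
            T a else (S a ∪ T a)ᶜ := by
          ext z
          cases b <;> simp only [Col, mem_filter_univ] <;>
            split_ifs with hz <;> simp <;> tauto
        rw [h1, h2]
        cases b
        · simp only [Bool.false_eq_true, if_false]
          rw [card_filter_fin le_rfl, card_compl, Fintype.card_fin,
            card_union_of_disjoint (disjoint_left.2 fun y h1 h2 => hdis y h2 h1),
            hS a, (hT a).2]
        · simp; rw [card_filter_fin (by omega), (hT a).2]; omega
    choose τ hτ using this; exact ⟨τ, hCol (funext fun a => funext fun y => by rw [hColF, hτ])⟩
  · funext a y; have := congrFun (congrFun (congrArg Col hh) a) (g a y); rw [hColF, hColF] at this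
    rwa [hColF, hColF]

end Canonical

/-! ### Step 1 through uniform permutations of the parts: the matrix. -/

section Canonical

variable (P : Params) {E : Fin P.N → Fin P.k}

abbrev coins (ι κ : Type*) [Fintype ι] [Fintype κ] (x : ℝ) : Measure (ι → κ → Bool) :=
  piM fun _ : ι => piM fun _ : κ => coin x

lemma partiteMatrix_eq_cloneMatrix (hL : P.N / P.k ≤ P.blockLen)
    (e : P.Listing E) (B₁ : Fin P.k → Fin (P.N / P.k) → Bool)
    (B₂ : Fin P.k → Fin P.blockLen → Bool) (θ : P.Perms)
    (x : Sym2 (Fin P.N) → Fin 2 → Bool) (Z : P.Row → P.Row → Bool) :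
    partiteMatrix P E (selSet P θ) (selEquiv P hL e θ)
      (fun a => (univ.filter fun z => B₁ a z = true).image fun z =>
        (((e a).trans (selEquiv P hL e θ a).symm) z : Fin P.blockLen))
      (fun a => topSet P (min (cnt (B₂ a) - cnt (B₁ a)) (P.blockLen - P.N / P.k)) θ a) x Z =
    cloneMatrix P e B₁ B₂ θ x Z := by
  funext i j; simp only [partiteMatrix, mem_selSet]; congr 1; simp only [diagBit]; split_ifs with h1
  · rw [← Bool.decide_coe (B₁ i.1 ⟨_, h1⟩)]; simp only [mem_image, mem_filter]
    have key : ∀ z, (((e i.1).trans (selEquiv P hL e θ i.1).symm) z) = i.2 ↔ z = ⟨θ i.1 i.2, h1⟩ := by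
      intro z
      rw [← (e i.1).apply_eq_iff_eq, ← selEquiv_apply P hL e θ i.1 ⟨i.2, (mem_selSet P θ _ _).2 h1⟩,
        ← Equiv.symm_apply_eq]
      grind
    grind
  -- The cut-off at `blockLen - N / k` is invisible here, because positions are below `blockLen`
  -- anyway.
  · have := (θ i.1 i.2).2
    simp only [topSet, mem_filter_univ, decide_eq_decide]; omega

/-- Only independent coins and uniform permutations are left: the binomial sizes become numbers of
ones, a uniform subset of binomial size becomes a family of coins, and the sets and bijections are
absorbed into `θ`. -/
lemma toKPartiteSubmatrix_eq (hL : P.N / P.k ≤ P.blockLen)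
    (e : P.Listing E) (G : SimpleGraph (Fin P.N)) :
    toKPartiteSubmatrix P E G = (graphClone P.p P.q P.p P.Q 2 G).bind fun x =>
      (coins (Fin P.k) (Fin (P.N / P.k)) P.p).bind fun B₁ =>
      (coins (Fin P.k) (Fin P.blockLen) P.Q).bind fun B₂ =>
      unif P.Perms fun θ =>
      (coins P.Row P.Row P.Q).map fun Z => cloneMatrix P e B₁ B₂ θ x Z := by
  unfold toKPartiteSubmatrix; congr 1; ext1 x
  let g : (S : Fin P.k → Finset _) → _ →
      _ → _ →
      Measure _ := fun S π T₁ T₂ =>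
    (coins P.Row P.Row P.Q).map fun Z => partiteMatrix P E S π T₁ T₂ x Z
  rw [bind_comm disc, pi_pi_coin_map_cnt P.k P.blockLen, map_bind disc disc,
    bind_comm (μ := coins _ _ P.p) disc]
  congr 1; ext1 B₂
  have h1 : ∀ s₁ : Fin P.k → ℕ, (unif {S : Fin P.k → Finset _ // ∀ a, (S a).card = P.N / P.k} fun S =>
      unif {T : Fin P.k → Finset _ // ∀ a, T a ⊆ S.1 a ∧ (T a).card = s₁ a} fun T₁ =>
      unif {T : Fin P.k → Finset _ // ∀ a, T a ⊆ (S.1 a)ᶜ ∧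
        (T a).card = min (cnt (B₂ a) - s₁ a) (P.blockLen - P.N / P.k)} fun T₂ =>
      unif _ fun π => g S.1 π T₁.1 T₂.1) =
      unif {S : Fin P.k → Finset _ // ∀ a, (S a).card = P.N / P.k} fun S =>
      unif _ fun π =>
      unif {T : Fin P.k → Finset _ // ∀ a, T a ⊆ S.1 a ∧ (T a).card = s₁ a} fun T₁ =>
      unif {T : Fin P.k → Finset _ // ∀ a, T a ⊆ (S.1 a)ᶜ ∧
        (T a).card = min (cnt (B₂ a) - s₁ a) (P.blockLen - P.N / P.k)} fun T₂ =>
        g S.1 π T₁.1 T₂.1 := by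
    intro s₁; refine unif_congr fun S => ?_
    exact (unif_congr fun T₁ => unif_comm _).trans (unif_comm _)
  trans (piM fun _ => binomial (P.N / P.k) (prob P.p)).bind fun s₁ =>
      unif {S : Fin P.k → Finset _ // ∀ a, (S a).card = P.N / P.k} fun S =>
      unif _ fun π =>
      unif {T : Fin P.k → Finset _ // ∀ a, T a ⊆ S.1 a ∧ (T a).card = s₁ a} fun T₁ =>
      unif {T : Fin P.k → Finset _ // ∀ a, T a ⊆ (S.1 a)ᶜ ∧
        (T a).card = min (cnt (B₂ a) - s₁ a) (P.blockLen - P.N / P.k)} fun T₂ =>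
        g S.1 π T₁.1 T₂.1
  · congr 1; ext1 s₁; rw [← h1]
  rw [bind_unif fun _ => disc]
  have h2 : ∀ S : {S : Fin P.k → Finset _ // ∀ a, (S a).card = P.N / P.k},
      ((piM fun _ => binomial (P.N / P.k) (prob P.p)).bind fun s₁ => unif _ fun π =>
        unif {T : Fin P.k → Finset _ // ∀ a, T a ⊆ S.1 a ∧ (T a).card = s₁ a} fun T₁ =>
        unif {T : Fin P.k → Finset _ // ∀ a, T a ⊆ (S.1 a)ᶜ ∧
          (T a).card = min (cnt (B₂ a) - s₁ a) (P.blockLen - P.N / P.k)} fun T₂ =>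
          g S.1 π T₁.1 T₂.1) =
      (coins _ _ P.p).bind fun B₁ => unif _ fun π =>
        unif {T : Fin P.k → Finset _ // ∀ a, T a ⊆ (S.1 a)ᶜ ∧
          (T a).card = min (cnt (B₂ a) - cnt (B₁ a)) (P.blockLen - P.N / P.k)} fun T₂ =>
          g S.1 π (fun a => (univ.filter fun z => B₁ a z = true).image fun z =>
            (((e a).trans (π a).symm) z)) T₂.1 := by
    intro S; rw [bind_unif fun _ => disc, bind_unif fun _ => disc]
    refine unif_congr fun π => ?_
    exact bind_binomial_unif_subset P.p S.1 _ fun s₁ T₁ =>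
      unif {T : Fin P.k → Finset _ // ∀ a, T a ⊆ (S.1 a)ᶜ ∧
        (T a).card = min (cnt (B₂ a) - s₁ a) _} fun T₂ =>
        g S.1 π T₁ T₂.1
  rw [unif_congr h2, ← bind_unif fun _ => disc]; congr 1; ext1 B₁
  refine (unif_select P hL e _ (fun a => min_le_right _ _) fun S π T₂ => g S π (fun a =>
      (univ.filter fun z => B₁ a z = true).image fun z =>
        (((e a).trans (π a).symm) z)) T₂).trans (unif_congr fun θ => ?_)
  simp only [g]; congr 1; ext1 Z; exact partiteMatrix_eq_cloneMatrix P hL e B₁ B₂ θ x Z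

end Canonical

/-! ### Reading arrays with two and three indices. -/

section Read

variable {I U V W β : Type*} [Fintype I] [Fintype U] [Fintype V] [Fintype W] [MeasurableSpace β]

lemma pi_map_injective₂ (μ : I → Measure β) [∀ i, IsProb (μ i)] {g : U → V → I}
    (hg : Injective fun x : U × V => g x.1 x.2) :
    ((piM μ).map fun ω u v => ω (g u v)) =
      piM fun u => piM fun v => μ (g u v) := by
  rw [pi_pi_eq_map, ← pi_map_injective μ hg, Measure.map_map (by fun_prop) (by fun_prop)]; rfl

lemma pi_map_injective₃ (μ : I → Measure β) [∀ i, IsProb (μ i)]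
    {g : U → V → W → I} (hg : Injective fun x : U × V × W => g x.1 x.2.1 x.2.2) :
    ((piM μ).map fun ω u v w => ω (g u v w)) =
      piM fun u => piM fun v => piM fun w => μ (g u v w) := by
  simp_rw [(fun u => pi_pi_eq_map _ : ∀ u, (piM fun v => piM fun w => μ (g u v w)) = (piM fun x => μ _).map fun f v w => f (v, w))]
  rw [← pi_map_pi fun u => Measurable.aemeasurable (by fun_prop), ← pi_map_injective₂ μ hg,
    Measure.map_map (by fun_prop) (by fun_prop)]
  rfl

lemma pi_pi_map {X Y : Type*} [MeasurableSpace X] [MeasurableSpace Y] (μ : U → V → Measure X)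
    [∀ u v, IsProb (μ u v)] {f : U → V → X → Y} (hf : ∀ u v, Measurable (f u v)) :
    ((piM fun u => piM (μ u)).map fun M u v => f u v (M u v)) =
      piM fun u => piM fun v => (μ u v).map (f u v) := by
  rw [pi_map_pi (f := fun u (M : V → X) v => f u v _) fun u =>
    Measurable.aemeasurable (measurable_pi_lambda _ fun v => (hf u v).comp (measurable_pi_apply v))]
  simp_rw [(fun u => pi_map_pi fun v => (hf u v).aemeasurable)]

lemma prod_pi_pi_eq_map {I' J J' : Type*} [Fintype I'] [Fintype J] [Fintype J']
    (μ : I → I' → Measure β) (ν : J → J' → Measure β) [∀ i k, IsProb (μ i k)]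
    [∀ i k, IsProb (ν i k)] :
    (piM fun i => piM (μ i)).prod (piM fun i => piM (ν i)) =
      (piM (Sum.elim (fun x : I × I' => μ x.1 x.2) fun x : J × J' => ν x.1 x.2)).map
        fun ω => (fun i k => ω (.inl (i, k)), fun i k => ω (.inr (i, k))) := by
  rw [pi_pi_eq_map μ, pi_pi_eq_map ν, Measure.map_prod_map _ _ (by fun_prop) (by fun_prop), pi_sum,
    Measure.map_map (by fun_prop) (by fun_prop)]
  rfl

end Read

/-! ### Padding and permuting a matrix with independent entries. -/

section Pad

variable (P : Params)

/-- The law of an entry of the padded and permuted matrix. -/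
def padLaw (m₁ : P.Row → P.Row → Measure Bool) (σ : Perm P.Row)
    (ρ : Fin P.k → (P.Point ≃ Fin (P.r ^ P.t))) (i : P.Row) (a : Fin P.k) (y : P.Point) :
    Measure Bool :=
  if h : (ρ a y : ℕ) < P.blockLen then m₁ (σ i) (a, ⟨ρ a y, h⟩) else coin P.Q

lemma pi_bind_padPermute (m₁ : P.Row → P.Row → Measure Bool) [∀ i j, IsProb (m₁ i j)] :
    ((piM fun i => piM (m₁ i)).bind (padPermute P)) =
      unif (Perm P.Row) fun σ => unif (Fin P.k → (P.Point ≃ Fin (P.r ^ P.t))) fun ρ =>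
        piM fun i => piM fun a => piM fun y => padLaw P m₁ σ ρ i a y := by
  unfold padPermute; rw [bind_unif fun _ => disc]; refine unif_congr fun σ => ?_
  rw [bind_unif fun _ => disc]; refine unif_congr fun ρ => ?_
  have h1 : (piM fun _ : P.Row => piM fun _ : Fin P.k =>
      piM fun _ : Fin (P.r ^ P.t) => coin P.Q) =
      (piM fun _ => piM fun _ => coin P.Q).map fun f i a y => f i (a, y) := by
    have h2 := pi_pi_eq_map (fun (_ : Fin P.k) (_ : Fin (P.r ^ P.t)) => coin P.Q)
    rw [h2, ← pi_map_pi fun u => Measurable.aemeasurable (by fun_prop)]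
  rw [h1]
  simp_rw [Measure.map_map (Measurable.of_discrete) (Measurable.of_discrete), comp_def]
  rw [← prod_map_eq_bind (f := fun x : (P.Row → P.Row → Bool) ×
      (P.Row → Fin P.k × Fin _ → Bool) => fun i a y =>
      if h : _ < P.blockLen then x.1 (σ i) (a, ⟨ρ a y, h⟩) else x.2 (σ i) (a, ρ a y))
      disc, prod_pi_pi_eq_map, Measure.map_map disc disc]
  -- The address of an output entry is a cell of the given matrix or a padding bit. As `σ` and every
  -- `ρ a` are injective, no address is used twice.
  let g : P.Row → Fin P.k → P.Point → P.Row × P.Row ⊕ P.Row × _ :=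
    fun i a y => if h : _ < P.blockLen then .inl (σ i, (a, ⟨ρ a y, h⟩)) else .inr (σ i, (a, ρ a y))
  have hg : Injective fun x : P.Row × Fin P.k × P.Point => g x.1 x.2.1 x.2.2 := by
    rintro ⟨i, a, y⟩ ⟨i', a', y'⟩ h; simp only [g] at h; split_ifs at h with h1 h2 h2
    · simp at h; obtain ⟨h3, rfl, h5⟩ := h; rw [h3, (ρ a).injective (Fin.ext h5)]
    · simp at h; obtain ⟨h3, rfl, h5⟩ := h; simp_all
  have := fun i => (show IsProb (Sum.elim (fun x : P.Row × P.Row => m₁ x.1 x.2)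
    (fun x : P.Row × (Fin P.k × Fin (P.r ^ P.t)) => coin P.Q) i) by
      rcases i with i | i <;> dsimp <;> infer_instance)
  convert (pi_map_injective₃ (Sum.elim (fun x => m₁ x.1 x.2) fun x => coin P.Q) hg) using 2
  · grind
  · funext a; congr 1; funext b; congr 1; funext y; simp only [padLaw]; grind

end Pad

/-! ### Inequalities for `Q`. -/

section Parameters

/-- The properties of `Q` that the reduction relies on. -/
structure GoodQ (p q Q : ℝ) : Prop where
  q_pos : 0 < q
  q_lt : q < Q
  lt_p : Q < p
  p_le : p ≤ 1
  mul_le : p * q ≤ Q ^ 2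
  sq_eq : p < 1 → (1 - Q) ^ 2 = (1 - p) * (1 - q)

/-- For `p < 1`, `1 - Q` is the geometric mean of `1 - p` and `1 - q`; this puts `Q` between `q` and
`p`, and the comparison with the arithmetic mean turns into `p * q ≤ Q ^ 2`. For `p = 1`, `Q = √q`.
-/
lemma Params.goodQ (P : Params) (h0 : 0 < P.q) (h1 : P.q < P.p) (h2 : P.p ≤ 1) :
    GoodQ P.p P.q P.Q := by
  rcases h2.eq_or_lt with h | h
  · have hQ : P.Q = √P.q := by simp [Params.Q, h]
    have hs := Real.sq_sqrt h0.le
    have hs0 := Real.sqrt_pos.2 h0; have hs1 : √P.q < 1 := by rw [Real.sqrt_lt' one_pos]; linarith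
    refine ⟨h0, ?_, ?_, h2, ?_, fun h' => absurd h h'.ne⟩ <;> rw [hQ]
    · nlinarith
    · linarith
    simp_all
  · have hQ : P.Q = 1 - √((1 - P.p) * (1 - P.q)) := by simp [Params.Q, h.ne]
    have hpos : 0 < (1 - P.p) * (1 - P.q) := mul_pos (by linarith) (by linarith)
    have hs := Real.sq_sqrt hpos.le; set g := √_
    have hg1 : 1 - P.p < g := by
      apply lt_of_pow_lt_pow_left₀ 2 (Real.sqrt_pos.2 hpos).le; rw [hs]; nlinarith
    have hg2 : g < 1 - P.q := by
      apply lt_of_pow_lt_pow_left₀ 2 (by linarith); rw [hs]; nlinarith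
    refine ⟨h0, by linarith, by linarith, h2, ?_, fun _ => ?_⟩ <;> rw [hQ]
    · have : g ≤ ((1 - P.p) + (1 - P.q)) / 2 := by
        apply le_of_sq_le_sq _ (by linarith); rw [hs]; nlinarith [sq_nonneg (P.p - P.q)]
      grind
    grind

variable {p q Q : ℝ}

lemma GoodQ.Q_pos (h : GoodQ p q Q) : 0 < Q := h.q_pos.trans h.q_lt

lemma GoodQ.Q_lt_one (h : GoodQ p q Q) : Q < 1 := h.lt_p.trans_le h.p_le

end Parameters

/-! ### The law of the two clones of an edge. -/

section Clone

/-- The law of the pair of clones of an edge or a non-edge. -/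
def cloneLaw (p q Q : ℝ) (b : Bool) : Measure (Fin 2 → Bool) :=
  ∑ v : Fin 2 → Bool, ofReal (cloneWeight p q p Q b v) • dirac v

lemma cloneLaw_singleton (p q Q : ℝ) (b : Bool) (v : Fin 2 → Bool) :
    cloneLaw p q Q b {v} = ofReal (cloneWeight p q p Q b v) := by
  simp [cloneLaw]; rw [sum_eq_single v] <;> simp_all

lemma card_filter_fin_two (v : Fin 2 → Bool) : (univ.filter fun a => v a = true).card =
      (if v 0 then 1 else 0) + (if v 1 then 1 else 0) := by
  rw [card_filter, Fin.sum_univ_two]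

variable {p q Q : ℝ}

/-- The critical vectors are two zeros on an edge and two ones on a non-edge. They require `(1 - p)
* (1 - Q) ^ 2 ≤ (1 - q) * (1 - p) ^ 2` and `q * p ^ 2 ≤ p * Q ^ 2`, which is what the choice of `Q`
guarantees. -/
lemma cloneWeight_nonneg (h : GoodQ p q Q) (b : Bool) (v : Fin 2 → Bool) : 0 ≤ cloneWeight p q p Q b v := by
  have h1 := h.q_pos; have h2 := h.q_lt; have h3 := h.lt_p; have h4 := h.p_le; have h5 := h.mul_le
  have h6 : (1 - p) * (1 - Q) ^ 2 = (1 - p) * ((1 - p) * (1 - q)) := by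
    rcases h4.eq_or_lt with h | h'
    · simp [h]
    · rw [h.sq_eq h']
  simp only [cloneWeight, card_filter_fin_two]
  cases b <;> cases v 0 <;> cases v 1 <;>
    simp only [Bool.false_eq_true, if_true, if_false] <;> refine mul_nonneg (one_div_nonneg.2 (by linarith)) ?_ <;> norm_num
  · nlinarith [mul_nonneg (sub_nonneg.2 h4) (sub_nonneg.2 h4),
      mul_nonneg (by linarith : 0 ≤ p - Q) (by linarith), mul_pos h1 (by linarith : 0 < p)]
  · have : q * (p * (1 - p)) ≤ p * (q * (1 - Q)) := by nlinarith [mul_pos h1 (by linarith : 0 < p)]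
    nlinarith [mul_pos (by linarith : 0 < p) (by linarith : 0 < 1 - Q)]
  · have : q * (p * (1 - p)) ≤ p * (q * (1 - Q)) := by nlinarith [mul_pos h1 (by linarith : 0 < p)]
    nlinarith [mul_pos (by linarith : 0 < p) (by linarith : 0 < 1 - Q)]
  · nlinarith
  · nlinarith
  · have : Q * (1 - Q) ≤ p * (1 - q) := by nlinarith
    nlinarith [mul_le_mul_of_nonneg_left this (by linarith)]
  · have : Q * (1 - Q) ≤ p * (1 - q) := by nlinarith
    nlinarith [mul_le_mul_of_nonneg_left this (by linarith)]
  · nlinarith [mul_le_mul (by linarith : 1 - p ≤ 1 - q) (by nlinarith) (by grind) (by linarith)]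

/-- The design of the weights: averaged over an edge indicator of bias `x` they are affine in `x`,
with a pair of independent `p`-coins at `x = p` and a pair of independent `Q`-coins at `x = q`. -/
lemma cloneWeight_mix {x : ℝ} (hpq : p ≠ q) (v : Fin 2 → Bool) :
    x * cloneWeight p q p Q true v + (1 - x) * cloneWeight p q p Q false v =
      (x - q) / (p - q) * ∏ i, (if v i then p else 1 - p) +
      (p - x) / (p - q) * ∏ i, (if v i then Q else 1 - Q) := by
  simp [cloneWeight, card_filter_fin_two]
  cases v 0 <;> cases v 1 <;> simp <;> grind <;> ring

lemma coin_bind_cloneLaw (h : GoodQ p q Q) {x : ℝ} (h0 : 0 ≤ x) (h1 : x ≤ 1) (v : Fin 2 → Bool) :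
    ((coin x).bind (cloneLaw p q Q)) {v} =
      ofReal ((x - q) / (p - q) * ∏ i, (if v i then p else 1 - p) +
      (p - x) / (p - q) * ∏ i, (if v i then Q else 1 - Q)) := by
  rw [Measure.bind_apply (by simp) disc.aemeasurable, coin_eq,
    lintegral_add_measure, lintegral_smul_measure, lintegral_smul_measure, lintegral_dirac,
    lintegral_dirac, cloneLaw_singleton, cloneLaw_singleton, prob_coe h0 h1, smul_eq_mul, smul_eq_mul,
    ← ofReal_mul h0, ← ofReal_mul (by linarith), ← ofReal_add
      (mul_nonneg h0 (cloneWeight_nonneg h _ _))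
      (mul_nonneg (by linarith) (cloneWeight_nonneg h _ _)),
    cloneWeight_mix (by have := h.q_lt; have := h.lt_p; linarith)]

lemma pi_coin_singleton {ι : Type*} [Fintype ι] {x : ℝ} (h0 : 0 ≤ x) (h1 : x ≤ 1) (v : ι → Bool) :
    (piM fun _ : ι => coin x) {v} = ofReal (∏ i, if v i then x else 1 - x) := by
  rw [pi_singleton, ENNReal.ofReal_prod_of_nonneg fun i _ => by grind]
  exact prod_congr rfl fun i _ => by rw [coin_singleton, prob_coe h0 h1]

lemma coin_bind_cloneLaw_p (h : GoodQ p q Q) : (coin p).bind (cloneLaw p q Q) = piM fun _ => coin p := by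
  have h1 := h.q_pos; have h2 := h.q_lt; have h3 := h.lt_p; have h4 := h.p_le
  refine ext_of_singleton fun v => ?_
  rw [coin_bind_cloneLaw h (by linarith) h4, pi_coin_singleton (by linarith) h4,
    div_self (by linarith), sub_self, zero_div, zero_mul, add_zero, one_mul]

lemma coin_bind_cloneLaw_q (h : GoodQ p q Q) : (coin q).bind (cloneLaw p q Q) = piM fun _ => coin Q := by
  have h1 := h.q_pos; have h2 := h.q_lt; have h3 := h.lt_p; have h4 := h.p_le
  refine ext_of_singleton fun v => ?_
  rw [coin_bind_cloneLaw h (by linarith) (by linarith), pi_coin_singleton (by linarith) (by linarith),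
    div_self (by linarith), sub_self, zero_div, zero_mul, zero_add, one_mul]

lemma isProb_cloneLaw (h : GoodQ p q Q) (b : Bool) : IsProb (cloneLaw p q Q b) := by
  have h1 := h.q_pos; have h2 := h.q_lt; have h3 := h.lt_p; have h4 := h.p_le
  -- A deterministic bit is a coin of bias 0 or 1, so the total mass follows from the mixture
  -- formula, whose two coefficients add up to one.
  have key : ∀ x : ℝ, (0 ≤ x) → x ≤ 1 → coin x = dirac b →
      IsProb (cloneLaw p q Q b) := by
    intro x hx0 hx1 hx
    constructor
    have e1 : ∀ v : Fin 2 → Bool, cloneLaw p q Q b {v} = ofReal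
      ((x - q) / (p - q) * ∏ i, (if v i then p else 1 - p) +
      (p - x) / (p - q) * ∏ i, (if v i then Q else 1 - Q)) := by
      intro v; rw [← coin_bind_cloneLaw h hx0 hx1, hx, dirac_bind disc]
    have e2 : ∀ v : Fin 2 → Bool, 0 ≤ (x - q) / (p - q) * ∏ i : Fin 2, (if v i then p else 1 - p) +
      (p - x) / (p - q) * ∏ i, (if v i then Q else 1 - Q) := by
      intro v; rw [← cloneWeight_mix (by linarith)]
      exact add_nonneg (mul_nonneg hx0 (cloneWeight_nonneg h _ _))
        (mul_nonneg (by linarith) (cloneWeight_nonneg h _ _))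
    have e3 : ∀ z : ℝ, ∑ v : Fin 2 → Bool, ∏ i, (if v i then z else 1 - z) = 1 := by
      intro z
      have := prod_univ_sum (fun _ : Fin 2 => (univ : Finset Bool))
        (fun _ b => if b then z else 1 - z)
      rw [Fintype.piFinset_univ] at this; rw [← this]; simp
    rw [← coe_univ, ← sum_measure_singleton, sum_congr rfl fun v _ => e1 v,
      ← ENNReal.ofReal_sum_of_nonneg fun v _ => e2 v, Finset.sum_add_distrib, ← mul_sum,
      ← mul_sum, e3, e3, mul_one, mul_one, ← add_div, sub_add_sub_cancel',
      div_self (by linarith), ofReal_one]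
  cases b
  · refine key 0 le_rfl zero_le_one ?_; rw [coin_eq, prob_coe le_rfl zero_le_one]; simp
  · refine key 1 zero_le_one le_rfl ?_; rw [coin_eq, prob_coe zero_le_one le_rfl]; simp

end Clone

/-! ### Edge indicators of random graphs and of their clones. -/

section RandomGraphs

instance discreteMeasurableSpace_simpleGraph {V : Type*} [Finite V] :
    DiscreteMeasurableSpace (SimpleGraph V) := by
  have h : ∀ s : Set (Sym2 V), MeasurableSet ({s}) := by simp
  have : MeasurableSingletonClass (SimpleGraph V) := ⟨fun G => by
    have : ({G}) = SimpleGraph.edgeSet ⁻¹' {G.edgeSet} := by ext H; simp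
    rw [this]
    exact SimpleGraph.measurableEmbedding_edgeSet.measurable (h _)⟩
  infer_instance

/-- The unordered pairs of distinct elements. -/
abbrev NonLoop (V : Type*) : Type _ := {e : Sym2 V // ¬ e.IsDiag}

def edgeBits {V : Type*} (G : SimpleGraph V) (e : NonLoop V) : Bool := decide (e.1 ∈ G.edgeSet)

lemma binomialRandom_map_edgeBits (V : Type*) [Fintype V] [DecidableEq V] (x : ℝ) :
    (SimpleGraph.binomialRandom V (prob x)).map edgeBits = piM fun _ : NonLoop V => coin x := by
  classical
  have hm : Measurable (edgeBits : SimpleGraph V → NonLoop V → Bool) := disc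
  have hd : Measurable fun P => decide P := disc
  rw [SimpleGraph.binomialRandom_eq_map, setBernoulli_eq_map, infinitePi_eq_pi,
    Measure.map_map hm (by fun_prop), Measure.map_map (hm.comp (by fun_prop)) (by fun_prop),
    Function.comp_assoc]
  set ν : Sym2 V → Measure Prop := fun e => unitInterval.toNNReal _ • dirac _ +
    unitInterval.toNNReal _ • dirac False with hν
  have h1 : (edgeBits ∘ SimpleGraph.fromEdgeSet ∘ fun p : Sym2 V → Prop => {i | p i}) =
      (fun b e => decide (b e)) ∘ fun p e => p e.1 := by
    funext p e; simp [edgeBits, e.2]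
  have h2 : ∀ e : NonLoop V, (ν e).map (fun P => decide P) = coin x := by
    intro e; rw [hν]; dsimp only
    rw [(by simpa using e.2 : (e.1 ∈ Sym2.diagSetᶜ) = True), ← bernoulliMeasure_def, map_bernoulliMeasure' _ _ hd]
    simp [coin]
  rw [h1, ← Measure.map_map (by fun_prop) (by fun_prop), pi_map_injective ν Subtype.val_injective,
    pi_map_pi fun _ => hd.aemeasurable]
  simp_rw [h2]

variable {N k : ℕ}

/-- The two end points of a planted pair are planted vertices. -/
def Planted (E : Fin N → Fin k) (R : ∀ a, {v // E v = a}) (e : Sym2 (Fin N)) : Prop :=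
  ∀ v ∈ e, (R (E v) : Fin N) = v

lemma edgeBits_plant (E : Fin N → Fin k) (R : ∀ a, {v // E v = a}) (G : SimpleGraph (Fin N))
    (H : SimpleGraph (Fin k)) (e : NonLoop (Fin N)) :
    edgeBits (plant E R G H) e = if Planted E R e.1 then decide (e.1.map E ∈ H.edgeSet)
      else edgeBits G e := by
  obtain ⟨e, he⟩ := e
  induction e using Sym2.ind with
  | _ u v =>
    have : Planted E R s(u, v) ↔ (R (E u)) = u ∧ (R (E v)) = v := by simp [Planted]
    simp only [edgeBits, this]; split_ifs with h <;> simp [plant, h]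

lemma isDiag_map_of_planted {E : Fin N → Fin k} {R : ∀ a, {v // E v = a}} {e : Sym2 (Fin N)}
    (h : Planted E R e) (he : ¬ e.IsDiag) : ¬ (e.map E).IsDiag := by
  induction e using Sym2.ind with
  | _ u v =>
    simp at he ⊢; exact fun huv => he (by rw [← (h u (by simp)), huv, (h v (by simp))])

/-- Each bit has its own source: a planted pair reads `H` at its image under `E`, any other pair
reads `G` at itself. On planted pairs `E` is injective, since `R` recovers the pair from its image.
-/
lemma planted_map_edgeBits (E : Fin N → Fin k) (R : ∀ a, {v // E v = a}) (p q : ℝ) :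
    (((SimpleGraph.binomialRandom (Fin N) (prob q)).prod
      (SimpleGraph.binomialRandom (Fin k) (prob p))).map fun GH => plant E R GH.1 GH.2).map edgeBits =
      piM fun e : NonLoop (Fin N) => coin (if Planted E R e.1 then p else q) := by
  have hg : ∀ e : NonLoop _, ∃ z : NonLoop _ ⊕ NonLoop _,
      (Planted E R e.1 → ∃ h, z = .inr ⟨e.1.map E, h⟩) ∧ (¬ Planted E R e.1 → z = .inl e) := by
    intro e; by_cases h : Planted E R e.1
    · exact ⟨.inr ⟨_, isDiag_map_of_planted h e.2⟩, fun _ => ⟨_, rfl⟩, fun h' => absurd h h'⟩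
    · exact ⟨.inl e, fun h' => absurd h' h, fun _ => rfl⟩
  choose g hg1 hg2 using hg
  have hinj : Injective g := by
    intro e e' hee; by_cases h : Planted E R e.1 <;> by_cases h' : Planted E R e'.1
    · obtain ⟨_, h1⟩ := hg1 e h
      have key : ∀ e : Sym2 _, Planted E R e → (e.map E).map (fun a => (R a)) = e := by
        intro e he
        induction e using Sym2.ind with
        | _ u v => simp [he u (by simp), he v (by simp)]
      grind
    · grind
    · grind
    grind
  have h1 : (edgeBits ∘ fun GH => plant E R GH.1 GH.2) = (fun ω e => ω (g e)) ∘
      (fun b => Sum.elim b.1 b.2) ∘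
      Prod.map edgeBits edgeBits := by
    funext GH e; simp only [comp_apply, edgeBits_plant]; split_ifs with h
    · obtain ⟨_, h1⟩ := hg1 e h; rw [h1]; rfl
    simp_all
  have h2 : (piM fun _ : NonLoop (Fin N) => coin q).prod
      (piM fun _ : NonLoop (Fin k) => coin p) =
      (piM fun z => coin (Sum.elim (fun _ => q) (fun _ => p) z)).map
        fun f => (fun i => f (.inl i), fun k => f (.inr k)) := by
    rw [pi_sum]; congr 2; grind
  rw [Measure.map_map disc disc, h1, ← Function.comp_assoc,
    ← Measure.map_map disc (Measurable.prodMap disc disc),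
    ← Measure.map_prod_map _ _ disc disc, binomialRandom_map_edgeBits,
    binomialRandom_map_edgeBits, h2, Measure.map_map disc disc]
  have h3 : (((fun ω e => ω (g e)) ∘ fun b => Sum.elim b.1 b.2) ∘
      fun f : NonLoop _ ⊕ NonLoop _ → Bool =>
        (fun i => f (.inl i), fun k => f (.inr k))) = fun ω e => ω (g e) := by
    funext ω e; simp
    cases g e <;> rfl
  rw [h3, pi_map_injective _ hinj]; grind

variable {p q Q : ℝ}

lemma graphClone_map_nonLoop (h : GoodQ p q Q) (G : SimpleGraph (Fin N)) :
    (graphClone p q p Q 2 G).map (fun x (e : NonLoop (Fin N)) => x e.1) =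
      piM fun e : NonLoop (Fin N) => cloneLaw p q Q (edgeBits G e) := by
  have := isProb_cloneLaw h
  exact pi_map_injective (fun e => cloneLaw p q Q _) Subtype.val_injective

lemma isProb_graphClone (h : GoodQ p q Q) (G : SimpleGraph (Fin N)) :
    IsProb (graphClone p q p Q 2 G) := by
  have := isProb_cloneLaw h; exact piM.instIsProbabilityMeasure (fun e => cloneLaw p q Q _)

/-- Cloning preserves bias `p` and replaces bias `q` by `Q`, separately for every pair. Loops are
left out because their indicators are not random. -/
lemma bind_cloneLaw_edgeBits (h : GoodQ p q Q) (pl : NonLoop (Fin N) → Prop) [DecidablePred pl]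
    (γ : Measure (SimpleGraph (Fin N)))
    (hγ : γ.map edgeBits = piM fun e => coin (if pl e then p else q)) :
    (γ.bind (graphClone p q p Q 2)).map (fun x (e : NonLoop (Fin N)) => x e.1) =
      piM fun e : NonLoop (Fin N) => piM fun _ : Fin 2 =>
        coin (if pl e then p else Q) := by
  rw [bind_map disc disc]; simp_rw [graphClone_map_nonLoop h]
  rw [← map_bind (f := edgeBits)
    (g := fun b => piM fun e => cloneLaw p q Q (b e)) disc disc,
    hγ, pi_bind_pi _ (fun _ => disc) (fun _ => isProb_cloneLaw h)]
  congr 1; funext e; split_ifs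
  · exact coin_bind_cloneLaw_p h
  · exact coin_bind_cloneLaw_q h

end RandomGraphs

/-! ### Independence of the entries off the diagonal. -/

section Submatrix

variable (P : Params) {E : Fin P.N → Fin P.k}

/-- The laws of the entries of the submatrix when the set of the planted rows is `pl` and the
diagonal is `D`. -/
def entryLaw (pl : P.Row → Prop) (D : P.Row → Bool) (i j : P.Row) : Measure Bool :=
  if i = j then dirac (D i) else coin (if pl i ∧ pl j then P.p else P.Q)

instance (pl : P.Row → Prop) (D : P.Row → Bool) (i j : P.Row) :
    IsProb (entryLaw P pl D i j) := by
  unfold entryLaw; split_ifs <;> infer_instance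

/-- The rows that are assigned to a vertex in `pv`. -/
def plantedRow (e : P.Listing E)
    (θ : P.Perms) (pv : Fin P.N → Prop) (i : P.Row) : Prop :=
  ∃ h : (θ i.1 i.2 : ℕ) < P.N / P.k, pv (e i.1 ⟨θ i.1 i.2, h⟩)

lemma selected_vertex_injective (e : P.Listing E)
    (θ : P.Perms) {i j : P.Row}
    (hi : (θ i.1 i.2 : ℕ) < P.N / P.k) (hj : (θ j.1 j.2 : ℕ) < P.N / P.k)
    (h : (e i.1 ⟨θ i.1 i.2, hi⟩ : Fin P.N) = e j.1 ⟨θ j.1 j.2, hj⟩) : i = j := by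
  obtain ⟨a, x⟩ := i; obtain ⟨b, y⟩ := j; have hab : a = b := by grind
  subst hab
  have := (e a).injective (Subtype.ext h); simp at this; rw [(θ a).injective (Fin.ext this)]

variable {P} in
-- Distinct entries off the diagonal have distinct addresses: an entry between two selected rows
-- reads one clone of one edge, any other entry reads a bit of `Z`. The entries `(i, j)` and `(j,
-- i)` share the edge but not the clone; this is why two clones are made.
lemma bind_cloneMatrix (hQ : GoodQ P.p P.q P.Q) (e : P.Listing E)
    (B₁ : Fin P.k → Fin (P.N / P.k) → Bool) (B₂ : Fin P.k → Fin P.blockLen → Bool)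
    (θ : P.Perms) (pv : Fin P.N → Prop)
    [DecidablePred fun e : NonLoop (Fin P.N) => ∀ v ∈ e.1, pv v]
    (γ : Measure (SimpleGraph (Fin P.N)))
    (hγ : γ.map edgeBits = piM fun e => coin (if ∀ v ∈ e.1, pv v then P.p else P.q)) :
    ((γ.bind (graphClone P.p P.q P.p P.Q 2)).bind fun x =>
      (coins P.Row P.Row P.Q).map fun Z => cloneMatrix P e B₁ B₂ θ x Z) =
    piM fun i => piM fun j =>
      entryLaw P (plantedRow P e θ pv) (fun i => diagBit P B₁ B₂ i.1 (θ i.1 i.2)) i j := by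
  classical
  have hg : ∀ i j : P.Row, ∃ z : (NonLoop (Fin P.N) × Fin 2) ⊕ _, (∀ hi hj, i ≠ j →
        ∃ hd, z = .inl (⟨s((e i.1 ⟨θ i.1 i.2, hi⟩), (e j.1 ⟨θ j.1 j.2, hj⟩)), hd⟩,
          if toLex i < toLex j then 0 else 1)) ∧
      (¬ (((θ i.1 i.2) < P.N / P.k ∧ (θ j.1 j.2) < P.N / P.k) ∧ i ≠ j) → z = .inr (i, j)) := by
    intro i j; by_cases h : ((θ i.1 i.2) < P.N / P.k ∧ (θ j.1 j.2) < P.N / P.k) ∧ i ≠ j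
    · refine ⟨.inl (⟨s((e i.1 ⟨θ i.1 i.2, h.1.1⟩), (e j.1 ⟨θ j.1 j.2, h.1.2⟩)), ?_⟩,
          if toLex i < toLex j then 0 else 1), fun _ _ _ => ⟨_, rfl⟩, fun h' => absurd h h'⟩
      exact fun h' => h.2 (selected_vertex_injective P e θ _ _ h')
    · exact ⟨.inr _, fun hi hj hij => absurd ⟨⟨hi, hj⟩, hij⟩ h, fun _ => rfl⟩
  choose g hg1 hg2 using hg
  have hinj : Injective fun x : P.Row × P.Row => g x.1 x.2 := by
    rintro ⟨i, j⟩ ⟨i', j'⟩ hee; dsimp only at hee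
    by_cases h : ((θ i.1 i.2) < P.N / P.k ∧ (θ j.1 j.2) < P.N / P.k) ∧ i ≠ j <;>
    by_cases h' : ((θ i'.1 i'.2) < P.N / P.k ∧ (θ j'.1 j'.2) < P.N / P.k) ∧ i' ≠ j'
    · obtain ⟨_, h1⟩ := hg1 i j h.1.1 h.1.2 h.2; obtain ⟨_, h2⟩ := hg1 i' j' h'.1.1 h'.1.2 h'.2
      rw [h1, h2] at hee; simp at hee; obtain ⟨h3 | h3, h4⟩ := hee
      · rw [selected_vertex_injective P e θ _ _ h3.1, selected_vertex_injective P e θ _ _ h3.2]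
      · exfalso; have h5 := selected_vertex_injective P e θ _ _ h3.1
        have h6 := selected_vertex_injective P e θ _ _ h3.2; subst h5 h6
        rcases lt_or_gt_of_ne (fun h8 => h.2 (toLex.injective h8)) with h8 | h8
        · rw [if_pos h8, if_neg h8.not_gt] at h4; exact absurd h4 (by decide)
        · rw [if_neg h8.not_gt, if_pos h8] at h4; exact absurd h4 (by decide)
    · obtain ⟨_, h1⟩ := hg1 i j h.1.1 h.1.2 h.2; rw [h1, hg2 i' j' h'] at hee; cases hee
    · obtain ⟨_, h1⟩ := hg1 i' j' h'.1.1 h'.1.2 h'.2; rw [h1, hg2 i j h] at hee; cases hee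
    · rw [hg2 i j h, hg2 i' j' h'] at hee; exact Sum.inr.inj hee
  set f : (NonLoop _ → Fin 2 → Bool) × (P.Row → P.Row → Bool) → P.Row → P.Row → Bool :=
    fun y i j => if i = j then diagBit P B₁ B₂ i.1 (θ i.1 i.2) else
      Sum.elim (fun z => y.1 z.1 z.2) (fun z => y.2 z.1 z.2) (g i j) with hf
  have h1 : ∀ x Z, cloneMatrix P e B₁ B₂ θ x Z = f (fun e => x e.1, Z) := by
    intro x Z; funext i j; simp only [cloneMatrix, hf]; by_cases hij : i = j
    · simp [hij]
    by_cases h2 : (θ i.1 i.2) < P.N / P.k ∧ (θ j.1 j.2) < P.N / P.k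
    · obtain ⟨_, h1⟩ := hg1 i j h2.1 h2.2 hij; rw [h1, dif_pos h2]; rfl
    · rw [hg2 i j fun h => h2 h.1, dif_neg h2]; rfl
  simp_rw [h1]
  rw [← map_bind
    (g := fun x => (coins P.Row P.Row P.Q).map fun Z => f _) disc disc, (bind_cloneLaw_edgeBits hQ _ γ hγ),
    ← prod_map_eq_bind disc, prod_pi_pi_eq_map, Measure.map_map disc disc]
  set c : _ ⊕ _ → Measure Bool := Sum.elim _ fun _ => coin P.Q with hc
  have hcp : ∀ z, IsProb (c z) := by rintro (z | z) <;> simp [hc] <;> infer_instance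
  have h2 : (f ∘ fun ω : _ ⊕ _ → Bool => ((fun i k => ω (.inl (i, k)), fun i k => ω (.inr (i, k))) :
        _ × _)) =
      (fun M i j => if i = j then diagBit P B₁ B₂ i.1 (θ i.1 i.2) else M i j) ∘
        fun ω i j => ω (g i j) := by
    funext ω i j; simp only [hf, comp_apply]
    cases g i j <;> rfl
  rw [h2, ← Measure.map_map disc disc, pi_map_injective₂ c hinj,
    pi_pi_map (fun i j => c (g i j))
      (f := fun i j b => if i = j then diagBit P B₁ B₂ i.1 _ else b) fun _ _ => disc]
  congr 1; funext i; congr 1; funext j; by_cases hij : i = j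
  · subst hij; simp only [entryLaw, if_true]; rw [Measure.map_const, measure_univ, one_smul]
  simp [entryLaw, hij]; by_cases h : (θ i.1 i.2) < P.N / P.k ∧ (θ j.1 j.2) < P.N / P.k
  · obtain ⟨_, h1⟩ := hg1 i j h.1 h.2 hij; rw [h1, hc, Sum.elim_inl]; simp [plantedRow, h]
  · rw [hg2 i j fun h' => h h'.1, hc, Sum.elim_inr, if_neg]; rintro ⟨⟨hi, _⟩, hj, _⟩
    exact h ⟨hi, hj⟩

variable {P} in
lemma bind_toKPartiteSubmatrix (hQ : GoodQ P.p P.q P.Q) (hL : P.N / P.k ≤ P.blockLen)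
    (e : P.Listing E) (pv : Fin P.N → Prop)
    [DecidablePred fun e : NonLoop (Fin P.N) => ∀ v ∈ e.1, pv v]
    (γ : Measure (SimpleGraph (Fin P.N)))
    [IsProb γ]
    (hγ : γ.map edgeBits = piM fun e => coin (if ∀ v ∈ e.1, pv v then P.p else P.q)) :
    γ.bind (toKPartiteSubmatrix P E) = (coins (Fin P.k) (Fin (P.N / P.k)) P.p).bind fun B₁ =>
      (coins (Fin P.k) (Fin P.blockLen) P.Q).bind fun B₂ =>
      unif P.Perms fun θ =>
      piM fun i => piM fun j =>
        entryLaw P (plantedRow P e θ pv) (fun i => diagBit P B₁ B₂ i.1 (θ i.1 i.2)) i j := by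
  rw [(funext fun G => toKPartiteSubmatrix_eq P hL e G), ← bind_bind disc disc,
    bind_comm disc]
  congr 1; funext B₁; rw [bind_comm disc]; congr 1; funext B₂
  rw [bind_unif fun _ => disc]
  exact unif_congr fun θ => bind_cloneMatrix hQ e B₁ B₂ θ pv γ hγ

end Submatrix

/-! ### One-sided total variation bounds. -/

section Closeness

variable {α β γ : Type*} [MeasurableSpace α] [MeasurableSpace β] [MeasurableSpace γ]

/-- The measure `μ` exceeds the measure `ν` by at most `ε` on every measurable set. -/
def Close (μ ν : Measure α) (ε : ℝ≥0∞) : Prop := ∀ s, MeasurableSet s → μ s ≤ ν s + ε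

lemma Close.refl (μ : Measure α) (ε : ℝ≥0∞) : Close μ μ ε := fun _ _ => le_self_add

lemma Close.mono {μ ν : Measure α} {ε ε' : ℝ≥0∞} (h : Close μ ν ε) (h' : ε ≤ ε') :
    Close μ ν ε' := fun s hs => (h s hs).trans (by gcongr)

lemma Close.trans {μ ν ρ : Measure α} {ε ε' : ℝ≥0∞} (h : Close μ ν ε) (h' : Close ν ρ ε') :
    Close μ ρ (ε + ε') := fun s hs =>
  (h s hs).trans (by rw [add_comm ε, ← add_assoc]; gcongr; exact h' s hs)

/-- Pass to complements. For probability measures the one-sided bound is therefore two-sided. -/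
lemma Close.symm {μ ν : Measure α} [IsProb μ] [IsProb ν] {ε : ℝ≥0∞}
    (h : Close μ ν ε) : Close ν μ ε := by
  intro s hs; have h1 := h sᶜ hs.compl
  rw [prob_compl_eq_one_sub hs, prob_compl_eq_one_sub hs] at h1
  have h2 : 1 ≤ μ s + (1 - ν s + ε) := by
    calc _ = μ s + _ := (add_tsub_cancel_of_le prob_le_one).symm
      _ ≤ _ := by gcongr
  calc ν s ≤ 1 - (1 - ν s) := by rw [ENNReal.sub_sub_cancel ENNReal.one_ne_top prob_le_one]
    _ ≤ μ s + ε := by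
      rw [tsub_le_iff_right]
      calc _ ≤ _ := h2
        _ = _ := by ring

lemma tvDist_le_of_close {μ ν : Measure α} [IsProb μ] [IsProb ν]
    {ε : ℝ} (hε : 0 ≤ ε) (h : Close μ ν (ofReal ε)) : tvDist μ ν ≤ ε := by
  have key : ∀ {μ ν : Measure α} [IsProb μ] [IsProb ν],
      Close μ ν (ofReal ε) → ∀ s, MeasurableSet s → μ.real s - ν.real s ≤ ε := by
    intro μ ν _ _ h s hs; have := ENNReal.toReal_mono (by simp) (h s hs)
    rw [ENNReal.toReal_add (by simp) (by simp), toReal_ofReal hε] at this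
    simp only [Measure.real]; linarith
  refine ciSup_le fun s => abs_le.2 ⟨?_, key h s.1 s.2⟩; have := key h.symm s.1 s.2; linarith

/-- Layer cake: the integral of `f` is the integral over `t` in `(0, 1]` of the masses of `{f > t}`,
and each of these changes by at most `ε`. -/
lemma Close.lintegral_le {μ ν : Measure α} {ε : ℝ≥0∞} (h : Close μ ν ε)
    {f : α → ℝ≥0∞} (hf : Measurable f) (hf1 : ∀ a, f a ≤ 1) :
    ∫⁻ a, f a ∂μ ≤ ∫⁻ a, f a ∂ν + ε := by
  have h1 : ∀ μ : Measure α, ∫⁻ a, f a ∂μ = ∫⁻ t in Set.Ioc 0 1, μ {a : α | t < (f a).toReal} := by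
    intro μ
    rw [← lintegral_congr (fun a => ofReal_toReal (ne_top_of_le_ne_top ENNReal.one_ne_top (hf1 a)))]
    rw [lintegral_eq_lintegral_meas_lt μ (Filter.Eventually.of_forall fun a => ENNReal.toReal_nonneg)
      hf.ennreal_toReal.aemeasurable, ← Set.Ioc_union_Ioi_eq_Ioi (zero_le_one' ℝ),
      lintegral_union measurableSet_Ioi (Set.Ioc_disjoint_Ioi le_rfl)]
    rw [setLIntegral_congr_fun measurableSet_Ioi, lintegral_zero, add_zero]; intro t ht
    have : {a : α | t < (f a).toReal} = ∅ := by
      ext a; simp; exact (ENNReal.toReal_mono ENNReal.one_ne_top (hf1 a)).trans (le_of_lt ht)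
    simp_all
  rw [h1 μ, h1 ν]
  calc _ ≤ ∫⁻ t in Set.Ioc (0 : ℝ) 1, _ :=
        lintegral_mono fun t => h _ (measurableSet_lt measurable_const hf.ennreal_toReal)
    _ = _ := by simp

/-- Data processing: an error made early in the reduction is not amplified by what follows. -/
lemma Close.bind {μ ν : Measure α} {ε : ℝ≥0∞} (h : Close μ ν ε) {κ : α → Measure β}
    (hκ : Measurable κ) (hp : ∀ a, IsProb (κ a)) :
    Close (μ.bind κ) (ν.bind κ) ε := by
  intro s hs; rw [Measure.bind_apply hs hκ.aemeasurable, Measure.bind_apply hs hκ.aemeasurable]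
  exact h.lintegral_le ((measurable_coe hs).comp hκ) fun a => prob_le_one

lemma Close.map {μ ν : Measure α} {ε : ℝ≥0∞} (h : Close μ ν ε) {f : α → β}
    (hf : Measurable f) : Close (μ.map f) (ν.map f) ε := by
  intro s hs; rw [map_apply hf hs, map_apply hf hs]; exact h _ (hf hs)

lemma Close.bind_right {μ : Measure α} [IsProb μ] {κ κ' : α → Measure β} {ε : ℝ≥0∞}
    (hκ : Measurable κ) (hκ' : Measurable κ') (h : ∀ a, Close (κ a) (κ' a) ε) :
    Close (μ.bind κ) (μ.bind κ') ε := by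
  intro s hs; rw [Measure.bind_apply hs hκ.aemeasurable, Measure.bind_apply hs hκ'.aemeasurable]
  calc _ ≤ ∫⁻ a, _ ∂μ := lintegral_mono fun a => h a s hs
    _ = _ := by simp

lemma Close.unif {A : Type*} [Fintype A] [Nonempty A] {f g : A → Measure β} {ε : ℝ≥0∞}
    (h : ∀ a, Close (f a) (g a) ε) : Close (unif A f) (unif A g) ε := by
  intro s hs; rw [unif_apply, unif_apply]
  calc _ ≤ ∑ a, (_⁻¹ * g a s + _⁻¹ * ε) :=
        sum_le_sum fun a _ => by rw [← mul_add]; gcongr; exact h a s hs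
    _ = _ := by
      rw [Finset.sum_add_distrib]; simp
      rw [← mul_assoc, ENNReal.mul_inv_cancel (by simp) (by simp), one_mul]

lemma Close.of_map {μ : Measure α} {f g : α → β} {ε : ℝ≥0∞} (hf : Measurable f)
    (hg : Measurable g) (h : μ {a | f a ≠ g a} ≤ ε) : Close (μ.map f) (μ.map g) ε := by
  intro s hs; rw [map_apply hf hs, map_apply hg hs]
  calc _ ≤ μ (g ⁻¹' s ∪ {a | f a ≠ g a}) := measure_mono fun a ha => by grind
    _ ≤ μ _ + μ {a | f a ≠ g a} := measure_union_le _ _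
    _ ≤ _ := by gcongr

/-- Hybrid argument: the coordinates are exchanged one at a time. -/
lemma close_pi_fin {n : ℕ} (μ ν : Fin n → Measure β) [∀ i, IsProb (μ i)]
    [∀ i, IsProb (ν i)] {ε : Fin n → ℝ≥0∞} (h : ∀ i, Close (μ i) (ν i) (ε i)) :
    Close (piM μ) (piM ν) (∑ i, ε i) := by
  induction n with
  | zero => rw [pi_of_empty, pi_of_empty]; exact .refl _ _
  | succ n ih =>
    rw [pi_snoc μ, pi_snoc ν, Fin.sum_univ_castSucc]
    have hm : Measurable fun x : (Fin n → β) × β => (Fin.snoc x.1 x.2 : Fin _ → β) := by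
      refine measurable_pi_lambda _ fun i => ?_
      induction i using Fin.lastCases with
      | last => simpa using measurable_snd
      | cast i => simpa using (by fun_prop)
    have hm1 : ∀ ρ : Measure β, [IsProb ρ] →
        Measurable fun f => ρ.map fun b => _ := fun ρ _ =>
      measurable_map_param measurable_const (fun _ => inferInstance) hm
    have hm2 : ∀ f : Fin n → β, Measurable fun b => (Fin.snoc f b : Fin _ → β) := fun f =>
      hm.comp measurable_prodMk_left
    exact ((ih _ _ fun i => h i.castSucc).bind (hm1 _) fun f => isProb_map (hm2 f)).trans
      (.bind_right (hm1 _) (hm1 _) fun f => (h _).map (hm2 f))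

lemma close_pi {ι : Type*} [Fintype ι] (μ ν : ι → Measure β) [∀ i, IsProb (μ i)]
    [∀ i, IsProb (ν i)] {ε : ι → ℝ≥0∞} (h : ∀ i, Close (μ i) (ν i) (ε i)) :
    Close (piM μ) (piM ν) (∑ i, ε i) := by
  have e := Fintype.equivFin ι
  have h1 : ∀ μ : ι → Measure β, [∀ i, IsProb (μ i)] → piM μ =
      (piM fun j => μ (e.symm j)).map fun ω i => ω (e i) := by
    intro μ _; rw [pi_map_injective _ e.injective]; simp
  rw [h1 μ, h1 ν, ← e.symm.sum_comp]; exact (close_pi_fin _ _ fun i => h _).map (by fun_prop)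

lemma close_pi_const {ι : Type*} [Fintype ι] (μ ν : ι → Measure β)
    [∀ i, IsProb (μ i)] [∀ i, IsProb (ν i)] {ε : ℝ≥0∞}
    (h : ∀ i, Close (μ i) (ν i) ε) :
    Close (piM μ) (piM ν) (card ι * ε) := by
  simpa using close_pi μ ν h

end Closeness

/-! ### Closeness from second moments of densities. -/

section ChiSquare

variable {α : Type*} [MeasurableSpace α]

/-- The excess on any set is at most `∫ |f - 1|`, and since a variance is nonnegative the square of
this is at most `∫ (f - 1) ^ 2 = ∫ f ^ 2 - 1`. -/
lemma close_of_density {ν : Measure α} [IsProb ν] {f : α → ℝ≥0∞}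
    (hf : Measurable f) [IsProb (ν.withDensity f)] {χ : ℝ} (hχ : 0 ≤ χ)
    (h : ∫⁻ a, f a ^ 2 ∂ν ≤ ofReal (1 + χ)) :
    Close (ν.withDensity f) ν (ofReal √χ) := by
  have h1 : ∫⁻ a, f a ∂ν = 1 := by
    have := measure_univ (μ := ν.withDensity f)
    rwa [withDensity_apply _ .univ, restrict_univ] at this
  have hfin := ae_lt_top hf (by rw [h1]; simp); set g : α → ℝ := fun a => (f a).toReal
  have hgm := hf.ennreal_toReal; have hfg := hfin.mono fun a ha => ofReal_toReal ha.ne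
  have hg2 : ∫⁻ a, ofReal (g a ^ 2) ∂ν ≤ ofReal (1 + χ) := by
    rw [lintegral_congr_ae]
    · exact h
    · filter_upwards [hfg] with a ha; rw [ENNReal.ofReal_pow ENNReal.toReal_nonneg, ha]
  have hmem : MemLp g 2 ν := by
    rw [memLp_two_iff_integrable_sq hgm.aestronglyMeasurable]
    refine ⟨(hgm.pow_const 2).aestronglyMeasurable, ?_⟩
    rw [hasFiniteIntegral_iff_ofReal (Filter.Eventually.of_forall fun a => sq_nonneg _)]
    exact hg2.trans_lt ENNReal.ofReal_lt_top
  have hgi : ∫ a, g a ∂ν = 1 := by rw [integral_toReal hf.aemeasurable hfin, h1]; rfl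
  have hgi2 : ∫ a, g a ^ 2 ∂ν ≤ 1 + χ := by
    rw [integral_eq_lintegral_of_nonneg_ae (Filter.Eventually.of_forall fun a => sq_nonneg _)
      (hgm.pow_const 2).aestronglyMeasurable]
    exact ENNReal.toReal_le_of_le_ofReal (by linarith) hg2
  have hmem' : MemLp (fun a => |g a - 1|) 2 ν := (hmem.sub (memLp_const 1)).abs
  have hV := variance_nonneg (fun a => |g a - 1|) ν; rw [variance_eq_sub hmem'] at hV
  have hsq : ∫ a, |g a - 1| ^ 2 ∂ν ≤ χ := by
    simp_rw [(fun a => by rw [sq_abs]; ring : ∀ a, |g a - 1| ^ 2 = g a ^ 2 - 2 * g a + 1)]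
    have i1 := hmem.integrable_sq; have i2 := (hmem.integrable (by norm_num)).const_mul 2
    have i3 : Integrable (fun a => g a ^ 2 - 2 * g a) ν := i1.sub i2
    rw [integral_add i3 (integrable_const 1), integral_sub i1 i2, integral_const_mul, hgi]; simp
    linarith
  have hle : ∫ a, |g a - 1| ∂ν ≤ √χ := by
    apply Real.le_sqrt_of_sq_le
    have : ∫ a, ((fun a => |g a - 1|) ^ 2) a ∂ν = ∫ a, |g a - 1| ^ 2 ∂ν := rfl; linarith
  intro s hs; rw [withDensity_apply _ hs]
  calc ∫⁻ a in s, f a ∂ν ≤ ∫⁻ a in s, (1 + ofReal |g a - 1|) ∂ν := by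
        refine lintegral_mono_ae ?_; filter_upwards [ae_restrict_of_ae hfg] with a ha
        rw [← ha, ← ofReal_one, ← ofReal_add zero_le_one (abs_nonneg _)]
        apply ofReal_le_ofReal; grind
    _ = ν s + ∫⁻ a in s, ofReal |g a - 1| ∂ν := by simp
    _ ≤ ν s + ∫⁻ a, ofReal |g a - 1| ∂ν := by gcongr; exact restrict_le_self
    _ ≤ _ := by
        rw [← ofReal_integral_eq_lintegral_ofReal (hmem'.integrable (by norm_num)) (Filter.Eventually.of_forall fun a => abs_nonneg _)]
        gcongr

lemma pi_withDensity {ι : Type*} [Fintype ι] {X : ι → Type*} [∀ i, MeasurableSpace (X i)]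
    (ν : ∀ i, Measure (X i)) [∀ i, IsProb (ν i)] {f : ∀ i, X i → ℝ≥0∞}
    (hf : ∀ i, Measurable (f i)) [∀ i, IsProb ((ν i).withDensity (f i))] :
    (piM fun i => (ν i).withDensity (f i)) =
      (piM ν).withDensity fun x => ∏ i, f i (x i) := by
  refine pi_eq fun s hs => ?_
  rw [withDensity_apply _ (.univ_pi hs), ← lintegral_indicator (.univ_pi hs)]
  have : ∀ x : ∀ i, X i, (Set.univ.pi s).indicator (fun x => ∏ i, f i (x i)) x =
      ∏ i, (s i).indicator (f i) (x i) := by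
    intro x; by_cases h : x ∈ Set.univ.pi s
    · simp_all
    · rw [Set.indicator_of_notMem h]; simp at h; obtain ⟨i, hi⟩ := h
      exact (prod_eq_zero (mem_univ i) (Set.indicator_of_notMem hi _)).symm
  simp_rw [this]; rw [lintegral_pi_prod ν fun i => (hf i).indicator (hs i)]; simp_all

/-- Second moments of densities multiply, so `n` factors have the second moment `(1 + χ) ^ n ≤ exp
(n χ)`. For small `n χ` the error is of order `√(n χ)`, where replacing the coordinates one at a
time would cost `n √χ`. -/
lemma close_pi_of_density {ι : Type*} [Fintype ι] (ν : ι → Measure α)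
    [∀ i, IsProb (ν i)] {f : ι → α → ℝ≥0∞}
    (hf : ∀ i, Measurable (f i)) [∀ i, IsProb ((ν i).withDensity (f i))] {χ : ℝ}
    (hχ : 0 ≤ χ) (h : ∀ i, ∫⁻ a, f i a ^ 2 ∂ν i ≤ ofReal (1 + χ)) :
    Close (piM fun i => (ν i).withDensity (f i)) (piM ν)
      (ofReal √(exp (card ι * χ) - 1)) := by
  have hw := pi_withDensity ν hf
  have : IsProb ((piM ν).withDensity fun x => ∏ i, f i (x i)) := by
    rw [← hw]; infer_instance
  rw [hw]
  refine close_of_density (measurable_fun_prod _ fun i _ => (hf i).comp (measurable_pi_apply i) : Measurable fun x => ∏ i, f i _)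
    (by have := add_one_le_exp (card ι * χ); nlinarith) ?_
  simp_rw [← prod_pow]; rw [lintegral_pi_prod ν fun i => (hf i).pow_const 2]
  calc _ ≤ ∏ _i : ι, ofReal (exp χ) := prod_le_prod' fun i _ =>
        (h i).trans (ofReal_le_ofReal (by linarith [add_one_le_exp χ]))
    _ = _ := by
      rw [prod_const, Finset.card_univ, ← ENNReal.ofReal_pow (exp_pos _).le,
        ← Real.exp_nat_mul]
      simp

end ChiSquare

/-! ### The number of ones among independent coins, and its dependence on one biased coin. -/

section Counting

lemma cnt_eq_sum {n : ℕ} (b : Fin n → Bool) : cnt b = ∑ i, if b i = true then 1 else 0 := by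
  rw [cnt, card_filter]

lemma integral_coin {x : ℝ} (h0 : 0 ≤ x) (h1 : x ≤ 1) (f : Bool → ℝ) :
    ∫ b, f b ∂coin x = x * f true + (1 - x) * f false := by
  rw [integral_fintype (.of_finite), Fintype.sum_bool]
  simp [Measure.real, coin_singleton, prob_coe h0 h1]; simp_all

theorem integral_cnt (n : ℕ) {x : ℝ} (h0 : 0 ≤ x) (h1 : x ≤ 1) :
    ∫ b, (cnt b : ℝ) ∂(piM fun _ : Fin n => coin x) = n * x := by
  simp_rw [cnt_eq_sum]; push_cast; rw [integral_finsetSum _ fun i _ => .of_finite]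
  have : ∀ i : Fin n, ∫ b : Fin n → Bool, (if b i = true then 1 else 0)
      ∂(piM fun _ => coin x) = x := by
    intro i
    rw [integral_comp_eval (μ := fun _ => coin x) (f := fun b => if b = true then _ else 0)
      (Measurable.of_discrete.aestronglyMeasurable), integral_coin h0 h1]
    simp
  simp_all

theorem variance_cnt (n : ℕ) {x : ℝ} (h0 : 0 ≤ x) (h1 : x ≤ 1) :
    variance (fun b => (cnt b : ℝ)) (piM fun _ : Fin n => coin x) = n * (x * (1 - x)) := by
  have h : (fun b => (cnt b : ℝ)) =
      ∑ i : Fin n, fun b => (fun c => if c = true then 1 else 0) (b i) := by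
    funext b; rw [cnt_eq_sum, Finset.sum_apply]; simp
  rw [h, variance_sum_pi (X := fun _ c => if c = true then _ else 0) fun i => .of_discrete]
  have : variance (fun c => if c = true then 1 else 0) (coin x) = x * (1 - x) := by
    rw [variance_eq_sub .of_discrete, integral_coin h0 h1, integral_coin h0 h1]; simp; ring
  simp_all

theorem integral_cnt_sub_sq (n : ℕ) {x : ℝ} (h0 : 0 ≤ x) (h1 : x ≤ 1) (c : ℝ) :
    ∫ b, (cnt b - c : ℝ) ^ 2 ∂(piM fun _ : Fin n => coin x) =
      n * (x * (1 - x)) + (n * x - c) ^ 2 := by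
  have h := variance_cnt n h0 h1; rw [variance_eq_sub .of_discrete, integral_cnt n h0 h1] at h
  simp_rw [(fun b => by ring : ∀ b : Fin n → Bool, (cnt b - c) ^ 2 = _ ^ 2 - 2 * c * cnt b + c ^ 2)]
  rw [integral_add .of_finite .of_finite, integral_sub .of_finite .of_finite, integral_const_mul,
    integral_cnt n h0 h1]
  simp at h; simp; linarith

lemma cnt_tail (n : ℕ) {x t : ℝ} (h0 : 0 ≤ x) (h1 : x ≤ 1) (ht : 0 < t) :
    (piM fun _ : Fin n => coin x) {b | t ≤ |(cnt b : ℝ) - n * x|} ≤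
      ofReal (n / t ^ 2) := by
  have := meas_ge_le_variance_div_sq (X := fun b => (cnt b))
    (μ := piM fun _ : Fin n => coin x) .of_discrete ht
  rw [integral_cnt n h0 h1, variance_cnt n h0 h1] at this
  refine this.trans (ofReal_le_ofReal ?_); gcongr
  exact mul_le_of_le_one_right n.cast_nonneg (by nlinarith)

/-- Among the configurations with `s` ones, the fraction with a prescribed value at `z`. -/
theorem pi_coin_eval_cnt {L : ℕ} (x : ℝ) (z : Fin L) (b : Bool) (s : ℕ) :
    (L : ℝ≥0∞) * (piM fun _ : Fin L => coin x) {D | D z = b ∧ cnt D = s} =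
      (if b then s else L - s : ℕ) * (piM fun _ : Fin L => coin x) {D | cnt D = s} := by
  set π := piM fun _ : Fin L => coin x
  -- Equal coins are exchangeable, so the probability is the same at every position, and summing
  -- over the positions counts the ones (or the zeros).
  have h1 : ∀ y, π {D | D y = b ∧ cnt D = s} = π {D | D z = b ∧ cnt D = s} := by
    intro y; have : π.map _ = π := pi_map_injective _ (Equiv.swap y z).injective
    conv_rhs => rw [← this, map_apply .of_discrete .of_discrete]; simp [cnt_perm]
  have h2 : L * π {D | D z = b ∧ cnt D = s} = ∑ y, π {D | D y = b ∧ cnt D = s} := by simp_all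
  have h3 : ∀ D : Fin L → Bool, (∑ y, Set.indicator {D : Fin L → Bool | D y = b ∧ cnt D = s} 1 D : ℝ≥0∞) =
      (if b then s else L - s) * Set.indicator {D : Fin L → Bool | cnt D = s} 1 D := by
    intro D; by_cases hs : cnt D = s
    · have : ∀ y, (Set.indicator {D : Fin L → Bool | D y = b ∧ cnt D = s} 1 D : ℝ≥0∞) =
          if D y = b then 1 else 0 := by
        intro y; simp [Set.indicator_apply, hs]
      simp only [this, sum_boole]
      simp only [Set.indicator_apply, Set.mem_ofPred_eq, hs, if_true, Pi.one_apply, mul_one]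
      congr 1
      cases b
      · have := card_filter_add_card_filter_not (s := univ) fun y => D y = true
        simp at this; simp only [cnt] at hs; grind
      · simpa [cnt] using hs
    simp_all
  rw [h2, sum_congr rfl fun y _ => (lintegral_indicator_one .of_discrete).symm,
    ← lintegral_finsetSum _ fun y _ => .of_discrete, lintegral_congr h3, lintegral_const_mul _ .of_discrete,
    lintegral_indicator_one .of_discrete]

lemma coin_ne_zero {x : ℝ} (h0 : 0 < x) (h1 : x < 1) (b : Bool) : coin x {b} ≠ 0 := by
  rw [coin_singleton, prob_coe h0.le h1.le]
  cases b <;> simp <;> linarith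

theorem coin_withDensity {x y : ℝ} (h0 : 0 < x) (h1 : x < 1) :
    coin y = (coin x).withDensity fun b => coin y {b} / coin x {b} := by
  refine ext_of_singleton fun b => ?_
  rw [withDensity_apply _ .of_discrete, lintegral_singleton,
    ENNReal.div_mul_cancel (coin_ne_zero h0 h1 b) (measure_ne_top _ _)]

/-- The density of the law of the value at `z` and the number of ones when the bit at `z` has the
bias `p`, with respect to the case that the number of ones is independent of the bit. -/
def biasDensity (L : ℕ) (Q : ℝ) (x : Bool × ℕ) : ℝ≥0∞ :=
  (if x.1 then x.2 else L - x.2 : ℕ) / (L * coin Q {x.1})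

/-- Changing the bias at `z` reweights the law of equal coins by `coin p {b} / coin Q {b}`. Under
equal coins, the bit at `z` is one with probability `s / L` given that there are `s` ones. Together
this is the product law with the density `biasDensity`. -/
theorem planted_bit_law {L : ℕ} {p Q : ℝ} (h0 : 0 < Q) (h1 : Q < 1) (z : Fin L) :
    (piM fun x : Fin L => coin (if x = z then p else Q)).map (fun D => (D z, cnt D)) =
      ((coin p).prod ((piM fun _ : Fin L => coin Q).map cnt)).withDensity (biasDensity L Q) := by
  have hL : (L : ℝ≥0∞) ≠ 0 := by have := z.pos; simp; omega
  have e0 : ∀ x : Fin L, coin (if x = z then p else Q) = (coin Q).withDensity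
      (if x = z then fun b => coin p {b} / coin Q {b} else 1) := by
    intro x; split_ifs
    · exact coin_withDensity h0 h1
    simp
  have e1 : (piM fun x => coin (if x = z then p else Q)) =
      (piM fun _ => coin Q).withDensity fun D => coin p {D z} / coin Q {D z} := by
    have hp : ∀ x : Fin L, IsProb ((coin Q).withDensity
      (if x = z then fun b => coin p {b} / coin Q {b} else 1)) := fun x => by rw [← e0]; infer_instance
    simp_rw [e0]; rw [pi_withDensity _ fun _ => .of_discrete]; congr 1; funext D
    rw [prod_eq_single z] <;> simp_all
  refine ext_of_singleton fun ⟨b, s⟩ => ?_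
  rw [map_apply .of_discrete .of_discrete, withDensity_apply _ .of_discrete,
    lintegral_singleton, e1, withDensity_apply _ .of_discrete, ← Set.singleton_prod_singleton,
    prod_prod, map_apply .of_discrete .of_discrete]
  have e2 : (fun D => (D z, cnt D)) ⁻¹' ({b} ×ˢ {s}) = {D | D z = b ∧ cnt D = s} := by grind
  have e3 : cnt ⁻¹' {s} = {D : Fin L → Bool | cnt D = s} := rfl
  rw [e2, e3, setLIntegral_congr_fun (g := fun _ => coin p {b} / coin Q {b}) .of_discrete
    (fun D hD => by grind), setLIntegral_const, biasDensity, ENNReal.div_eq_inv_mul,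
    ENNReal.div_eq_inv_mul, ENNReal.mul_inv (.inl hL) (.inl (by simp))]
  have e5 : (piM fun _ => coin Q) {D | D z = b ∧ cnt D = s} =
      (L : ℝ≥0∞)⁻¹ * ((if b then s else L - s) * (piM fun _ : Fin L => coin Q) {D | cnt D = s}) := by
    rw [← (pi_coin_eval_cnt Q z b s), ← mul_assoc, ENNReal.inv_mul_cancel hL (by simp), one_mul]
  rw [e5]; ring

/-- For a fixed bit the density is a binomial count, of ones or of zeros, divided by its mean. Its
second moment is one plus the variance over the squared mean. -/
lemma lintegral_biasDensity_sq {L : ℕ} (hL : 0 < L) {p Q : ℝ} (hp0 : 0 ≤ p) (hp1 : p ≤ 1)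
    (h0 : 0 < Q) (h1 : Q < 1) :
    ∫⁻ x, biasDensity L Q x ^ 2 ∂((coin p).prod ((piM fun _ : Fin L => coin Q).map cnt)) ≤
      ofReal (1 + 1 / (L * (Q * (1 - Q)))) := by
  have hL' : (0 : ℝ) < L := by exact_mod_cast hL
  have hQ : 0 < 1 - Q := by linarith
  rw [lintegral_prod _ disc.aemeasurable, coin_eq, lintegral_add_measure,
    lintegral_smul_measure, lintegral_smul_measure, lintegral_dirac, lintegral_dirac,
    lintegral_map disc disc, lintegral_map disc disc, prob_coe hp0 hp1]
  have e : ∀ b, ∫⁻ D : Fin L → Bool, biasDensity L Q (b, cnt D) ^ 2 ∂(piM fun _ => coin Q) =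
      ofReal (1 + (if b then (1 - Q) / (L * Q) else Q / (L * (1 - Q)))) := by
    intro b
    have e1 : ∀ D : Fin L → Bool, biasDensity L Q (b, cnt D) ^ 2 =
        ofReal (((cnt D - if b then 0 else L) / (L * if b then Q else 1 - Q)) ^ 2) := by
      intro D; rw [biasDensity, coin_singleton, prob_coe h0.le h1.le]
      cases b
      · simp only [Bool.false_eq_true, if_false]
        rw [← ENNReal.ofReal_natCast, ← ENNReal.ofReal_natCast, ← ofReal_mul hL'.le,
          ← ENNReal.ofReal_div_of_pos (by positivity), ← ENNReal.ofReal_pow (by positivity),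
          Nat.cast_sub (cnt_le D)]
        congr 1; ring
      · simp
        rw [← ENNReal.ofReal_natCast, ← ENNReal.ofReal_natCast, ← ofReal_mul hL'.le,
          ← ENNReal.ofReal_div_of_pos (by positivity), ← ENNReal.ofReal_pow (by positivity)]
    rw [lintegral_congr e1, ← ofReal_integral_eq_lintegral_ofReal .of_finite
      (Filter.Eventually.of_forall fun _ => sq_nonneg _)]
    simp_rw [div_pow]; rw [integral_div, integral_cnt_sub_sq L h0.le h1.le]; congr 1
    cases b
    · simp; field_simp; ring
    · simp; field_simp; ring
  rw [e, e, smul_eq_mul, smul_eq_mul, ← ofReal_mul hp0, ← ofReal_mul (by linarith),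
    ← ofReal_add]
  · apply ofReal_le_ofReal; simp only [if_true, Bool.false_eq_true, if_false]
    have f1 : (1 - Q) / (L * Q) ≤ 1 / (L * (Q * (1 - Q))) := by
      rw [div_le_div_iff₀ (by positivity) (by positivity)]
      have : L * Q * ((1 - Q) * (1 - Q)) ≤ L * Q * 1 := by gcongr; nlinarith
      linarith
    have f2 : Q / (L * (1 - Q)) ≤ 1 / (L * (Q * (1 - Q))) := by
      rw [div_le_div_iff₀ (by positivity) (by positivity)]
      have : L * (1 - Q) * (Q * Q) ≤ L * (1 - Q) * 1 := by gcongr; nlinarith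
      linarith
    nlinarith
  · simp; positivity
  · simp; exact mul_nonneg (by linarith) (by positivity)

/-- The origin of the term `k / √N`: there are `k` parts with a divergence of order `1 / L` each,
and `L` will be at least `N / k`. -/
lemma close_planted_bits {k L : ℕ} (hL : 0 < L) {p Q : ℝ} (hp0 : 0 ≤ p) (hp1 : p ≤ 1)
    (h0 : 0 < Q) (h1 : Q < 1) (z : Fin k → Fin L) :
    Close (piM fun _ : Fin k => (coin p).prod ((piM fun _ : Fin L => coin Q).map cnt))
      (piM fun a => (piM fun x : Fin L => coin (if x = z a then p else Q)).map
        fun D => (D (z a), cnt D))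
      (ofReal √(exp (k * (1 / (L * (Q * (1 - Q))))) - 1)) := by
  have hπ := isProb_map (μ := piM fun _ : Fin L => coin Q) (f := cnt) disc
  have hp : ∀ a : Fin k, IsProb (((coin p).prod _).withDensity _) := fun a => by
    rw [← planted_bit_law h0 h1 (z a)]; exact isProb_map disc
  simp_rw [planted_bit_law h0 h1]
  have := @close_pi_of_density _ _ _ _
    _ _
    _ (fun _ => disc) hp _
    (by simp_all) fun _ => lintegral_biasDensity_sq hL hp0 hp1 h0 h1
  rw [Fintype.card_fin] at this; exact this.symm

end Counting

/-! ### The diagonal of the submatrix. -/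

section Diagonal

variable (P : Params)

/-- The purpose of topping up: as long as no cut-off interferes, the number of ones of a part is
that of `B₂`, hence binomial and independent of the bits in `B₁`. -/
lemma cnt_diagBit (hL : P.N / P.k ≤ P.blockLen) (B₁ : Fin P.k → Fin (P.N / P.k) → Bool)
    (B₂ : Fin P.k → Fin P.blockLen → Bool) (a : Fin P.k) (h1 : cnt (B₁ a) ≤ cnt (B₂ a))
    (h2 : cnt (B₂ a) - cnt (B₁ a) ≤ P.blockLen - P.N / P.k) :
    cnt (diagBit P B₁ B₂ a) = cnt (B₂ a) := by
  set s := cnt _ - cnt _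
  have e := card_filter_add_card_filter_not
    (s := univ.filter fun z => diagBit P B₁ B₂ a z = true)
    fun z => z < P.N / P.k
  rw [filter_filter, filter_filter] at e
  have e1 : (univ.filter fun z => diagBit P B₁ B₂ a z = true ∧
      z < P.N / P.k).card = cnt (B₁ a) := by
    symm; refine card_bij _ ?_ (fun z _ z' _ h => Fin.castLE_injective hL h) ?_
    · intro z hz; rw [mem_filter] at hz ⊢; simpa [diagBit] using hz
    · intro z hz; simp at hz; refine ⟨⟨z, hz.2⟩, ?_, rfl⟩; simpa [diagBit, hz.2] using hz.1
  have e2 : (univ.filter fun z => diagBit P B₁ B₂ a z = true ∧ ¬ z < P.N / P.k).card = s := by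
    rw [filter_congr (q := fun z => P.N / P.k ≤ _ ∧ _ < P.N / P.k + s),
      card_filter_fin (by omega)]
    · omega
    · intro z _; by_cases h : z < P.N / P.k
      · simp [h]
      · simp [diagBit, h]; omega
  rw [cnt, ← e]; omega

/-- The expected surplus is `L Q - (N / k) p` for parts of length `L`. The number `g * (N / k)` is a
lower bound for its distance to the two cut-offs `0` and `L - N / k`. -/
lemma measure_unbalanced_le {g : ℝ} (hQ : GoodQ P.p P.q P.Q) (hg : 0 < g * (P.N / P.k : ℕ))
    (h1 : g * (P.N / P.k : ℕ) ≤ P.blockLen * P.Q - (P.N / P.k : ℕ) * P.p)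
    (h2 : g * (P.N / P.k : ℕ) ≤ P.blockLen - (P.N / P.k : ℕ) -
      (P.blockLen * P.Q - (P.N / P.k : ℕ) * P.p)) :
    ((coins (Fin P.k) (Fin (P.N / P.k)) P.p).prod (coins (Fin P.k) (Fin P.blockLen) P.Q))
      {x | ∃ a, ¬ (cnt (x.1 a) ≤ cnt (x.2 a) ∧ cnt (x.2 a) - cnt (x.1 a) ≤ P.blockLen - P.N / P.k)} ≤
      P.k * ofReal (4 * ((P.N / P.k : ℕ) + P.blockLen) / (g * (P.N / P.k : ℕ)) ^ 2) := by
  -- If neither count is off by `t`, half the gap, the surplus stays between the cut-offs;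
  -- Chebyshev's inequality bounds the remaining event.
  set n := P.N / P.k; set t := g * _ / 2 with ht; have htpos : 0 < t := by positivity
  have hsub : {x : (Fin P.k → Fin n → Bool) × (Fin P.k → Fin P.blockLen → Bool) |
      ∃ a, ¬ (cnt (x.1 a) ≤ cnt (x.2 a) ∧ cnt (x.2 a) - cnt (x.1 a) ≤ P.blockLen - n)} ⊆
      ⋃ a, ((fun x => x.1 a) ⁻¹' {b | t ≤ |(cnt b) - n * P.p|} ∪
        (fun x => x.2 a) ⁻¹' {b | t ≤ |(cnt b) - P.blockLen * P.Q|}) := by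
    rintro x ⟨a, ha⟩; rw [Set.mem_iUnion]; refine ⟨a, ?_⟩; by_contra hcon; simp at hcon
    obtain ⟨c1, c2⟩ := hcon; rw [abs_lt] at c1 c2
    have hle' : cnt (x.1 a) ≤ cnt (x.2 a) := by exact_mod_cast (by linarith : (cnt _ : ℝ) ≤ cnt _)
    have h5 : cnt (x.2 a) + n < P.blockLen + cnt (x.1 a) := by exact_mod_cast (by linarith : (cnt _ : ℝ) + n < P.blockLen + cnt _)
    omega
  refine (measure_mono hsub).trans ((measure_iUnion_le _).trans ?_); rw [tsum_fintype]
  have key : ∀ a : Fin P.k, ((coins _ (Fin n) P.p).prod (coins _ (Fin P.blockLen) P.Q))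
      ((fun x => x.1 a) ⁻¹' {b | t ≤ |(cnt b) - n * P.p|} ∪
        (fun x => x.2 a) ⁻¹' {b | t ≤ |(cnt b) - P.blockLen * P.Q|}) ≤
      ofReal (4 * (n + P.blockLen) / (g * n) ^ 2) := by
    intro a; refine (measure_union_le _ _).trans ?_
    refine (add_le_add ((((measurePreserving_eval _ a).comp (measurePreserving_fst)).measure_preimage MeasurableSet.of_discrete.nullMeasurableSet).le.trans (cnt_tail n ((hQ.Q_pos.trans hQ.lt_p).le) hQ.p_le htpos))
      ((((measurePreserving_eval _ a).comp (measurePreserving_snd)).measure_preimage MeasurableSet.of_discrete.nullMeasurableSet).le.trans (cnt_tail P.blockLen hQ.Q_pos.le hQ.Q_lt_one.le htpos))).trans ?_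
    rw [← ofReal_add (by positivity) (by positivity)]; grind
  calc _ ≤ ∑ _a : Fin P.k, ofReal _ := sum_le_sum fun a _ => key a
    _ = _ := by simp

lemma pi_prod_eq_map {ι α β : Type*} [Fintype ι] [MeasurableSpace α] [MeasurableSpace β]
    [Countable α] [Countable β] [MeasurableSingletonClass α] [MeasurableSingletonClass β]
    (μ : ι → Measure α) (ν : ι → Measure β) [∀ i, IsProb (μ i)]
    [∀ i, IsProb (ν i)] :
    ((piM μ).prod (piM ν)).map (fun x i => (x.1 i, x.2 i)) =
      piM fun i => (μ i).prod (ν i) := by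
  refine ext_of_singleton fun f => ?_
  have : (fun (x : (ι → α) × (ι → β)) i => (x.1 i, x.2 i)) ⁻¹' {f} =
      {fun i => (f i).1} ×ˢ {fun i => (f i).2} := by
    grind
  rw [map_apply (by fun_prop) (measurableSet_singleton _), this, prod_prod,
    pi_singleton, pi_singleton, pi_singleton, ← prod_mul_distrib]
  refine prod_congr rfl fun i _ => ?_; rw [← prod_prod, Set.singleton_prod_singleton]

lemma coins_prod_map (z : Fin P.k → Fin (P.N / P.k)) :
    ((coins (Fin P.k) (Fin (P.N / P.k)) P.p).prod (coins (Fin P.k) (Fin P.blockLen) P.Q)).map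
      (fun x a => (x.1 a (z a), cnt (x.2 a))) =
    piM fun _ : Fin P.k => (coin P.p).prod
      ((piM fun _ : Fin P.blockLen => coin P.Q).map cnt) := by
  have hπ := isProb_map (μ := piM fun _ : Fin P.blockLen => coin P.Q) (f := cnt) disc
  have h2 : (piM fun _ => coin P.p) = (coins _ _ P.p).map fun B a => B a (z a) := by
    rw [coins, pi_map_pi (f := fun a (b : Fin _ → Bool) => b _)
      fun _ => disc.aemeasurable]
    simp_rw [(fun a => (measurePreserving_eval _ _).map_eq : ∀ a, (piM fun _ => coin P.p).map (fun b => b (z a)) = coin P.p)]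
  rw [← pi_prod_eq_map, ((pi_map_pi fun _ => disc.aemeasurable).symm), h2, Measure.map_prod_map _ _ disc disc,
    Measure.map_map disc disc]
  rfl

/-- The distance of the diagonal of the submatrix to a diagonal of independent bits. -/
def diagError (g : ℝ) : ℝ≥0∞ :=
  P.k * ofReal (4 * ((P.N / P.k : ℕ) + P.blockLen) / (g * (P.N / P.k : ℕ)) ^ 2) +
    ofReal √(exp (P.k * (1 / (P.blockLen * (P.Q * (1 - P.Q))))) - 1)

variable {P} in
-- As long as no cut-off interferes, the bit at `z a` is a `p`-coin that is independent of the
-- binomial count. `close_planted_bits` compares this pair with the one that arises from independent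
-- bits.
lemma close_diagBit {g : ℝ} (hQ : GoodQ P.p P.q P.Q) (hL : P.N / P.k ≤ P.blockLen)
    (hL0 : 0 < P.blockLen) (hg : 0 < g * (P.N / P.k : ℕ))
    (h1 : g * (P.N / P.k : ℕ) ≤ P.blockLen * P.Q - (P.N / P.k : ℕ) * P.p)
    (h2 : g * (P.N / P.k : ℕ) ≤ P.blockLen - (P.N / P.k : ℕ) -
      (P.blockLen * P.Q - (P.N / P.k : ℕ) * P.p)) (z : Fin P.k → Fin (P.N / P.k)) :
    Close (((coins (Fin P.k) (Fin (P.N / P.k)) P.p).prod (coins (Fin P.k) (Fin P.blockLen) P.Q)).map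
      fun x a => (diagBit P x.1 x.2 a (Fin.castLE hL (z a)), cnt (diagBit P x.1 x.2 a)))
      ((piM fun a => piM fun x : Fin P.blockLen =>
        coin (if x = Fin.castLE hL (z a) then P.p else P.Q)).map
          fun D a => (D a (Fin.castLE hL (z a)), cnt (D a))) (diagError P g) := by
  have c1 := Close.of_map (f := fun x a => (diagBit P x.1 x.2 a (Fin.castLE hL (z a)),
    cnt (diagBit P x.1 x.2 a))) (g := fun x a => (x.1 a (z a), cnt (x.2 a))) disc disc
    ((measure_mono ?_).trans (measure_unbalanced_le P hQ hg h1 h2))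
  · refine c1.trans ?_; rw [coins_prod_map]
    rw [pi_map_pi (f := fun a (D : Fin P.blockLen → Bool) => (D _, cnt D))
      fun _ => disc.aemeasurable]
    exact close_planted_bits hL0 (hQ.Q_pos.trans hQ.lt_p).le hQ.p_le hQ.Q_pos hQ.Q_lt_one _
  · intro x hx; by_contra hcon; simp only [Set.mem_ofPred_eq, not_exists, not_not] at hcon; apply hx
    funext a; rw [cnt_diagBit P hL _ _ a (hcon a).1 (hcon a).2]; simp [diagBit]

variable {P} in
lemma close_cnt_diagBit {g : ℝ} (hQ : GoodQ P.p P.q P.Q) (hL : P.N / P.k ≤ P.blockLen)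
    (hg : 0 < g * (P.N / P.k : ℕ))
    (h1 : g * (P.N / P.k : ℕ) ≤ P.blockLen * P.Q - (P.N / P.k : ℕ) * P.p)
    (h2 : g * (P.N / P.k : ℕ) ≤ P.blockLen - (P.N / P.k : ℕ) -
      (P.blockLen * P.Q - (P.N / P.k : ℕ) * P.p)) :
    Close (((coins (Fin P.k) (Fin (P.N / P.k)) P.p).prod (coins (Fin P.k) (Fin P.blockLen) P.Q)).map
      fun x a => cnt (diagBit P x.1 x.2 a))
      ((coins (Fin P.k) (Fin P.blockLen) P.Q).map fun D a => cnt (D a)) (diagError P g) := by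
  have c1 := Close.of_map (f := fun x a => cnt (diagBit P x.1 x.2 a))
    (g := fun x a => cnt (x.2 a)) disc disc
    ((measure_mono ?_).trans (measure_unbalanced_le P hQ hg h1 h2))
  -- Without a planted index only the cut-offs cause an error, that is, the first summand of
  -- `diagError`.
  · refine Close.mono ?_ le_self_add
    have : (coins (Fin P.k) (Fin P.blockLen) P.Q).map (fun D a => cnt (D a)) =
        ((coins (Fin P.k) (Fin (P.N / P.k)) P.p).prod (coins _ (Fin P.blockLen) P.Q)).map
          fun x a => cnt (x.2 a) := by
      rw [← (measurePreserving_snd (μ := coins (Fin P.k) (Fin _) P.p) (ν := coins _ _ P.Q)).map_eq,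
        Measure.map_map disc disc, map_snd_prod, measure_univ, one_smul]
      rfl
    grind
  · intro x hx; by_contra hcon; simp only [Set.mem_ofPred_eq, not_exists, not_not] at hcon; apply hx
    funext a; exact cnt_diagBit P hL _ _ a (hcon a).1 (hcon a).2

lemma bind_pi_dirac {ι β : Type*} [Fintype ι] [DecidableEq ι] [MeasurableSpace β] (i : ι)
    (μ : ι → Measure β) (ν : Measure β) [∀ i, IsProb (μ i)] [IsProb ν] :
    (ν.bind fun b => piM fun j => if i = j then dirac b else μ j) =
      piM fun j => if i = j then ν else μ j := by
  have hm : ∀ j, Measurable fun b => if i = j then dirac b else μ j := fun j => by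
    split_ifs
    · exact measurable_dirac
    simp
  symm; refine pi_eq fun s hs => ?_
  rw [Measure.bind_apply (.univ_pi hs)
    (measurable_pi_measure hm fun j b => (fun b j => by split_ifs <;> infer_instance) b j).aemeasurable]
  simp_rw [pi_pi]; rw [← mul_prod_erase _ _ (mem_univ i), if_pos rfl]
  have : ∀ b, ∏ j, (if i = j then dirac b else μ j) (s j) =
      (s i).indicator 1 b * ∏ j ∈ univ.erase i, (if i = j then ν else μ j) (s j) := by
    intro b
    rw [← mul_prod_erase _ _ (mem_univ i), if_pos rfl, Measure.dirac_apply' _ (hs i)]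
    congr 1; refine prod_congr rfl fun j hj => ?_; grind
  simp_rw [this]
  rw [lintegral_mul_const _ (measurable_one.indicator (hs i)), lintegral_indicator_one (hs i)]

/-- Each row contains exactly one diagonal cell, so random independent diagonal bits can be merged
into the rows one by one. -/
lemma bind_entryLaw (c : Fin P.k → Fin P.blockLen → ℝ) (θ : P.Perms)
    (pl : P.Row → Prop) :
    ((piM fun a => piM fun x => coin (c a x)).bind fun D =>
      piM fun i => piM fun j => entryLaw P pl (fun i => D i.1 (θ i.1 i.2)) i j) =
    piM fun i : P.Row => piM fun j =>
      coin (if i = j then c i.1 (θ i.1 i.2) else if pl i ∧ pl j then P.p else P.Q) := by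
  have h1 : (piM fun a => piM fun x => coin (c a x)).map
      (fun D (i : P.Row) => D i.1 (θ i.1 i.2)) = piM fun i => coin (c i.1 (θ i.1 i.2)) := by
    rw [pi_pi_eq_map, Measure.map_map disc disc]
    refine pi_map_injective _ (g := fun i => _) ?_; rintro ⟨a, x⟩ ⟨b, y⟩ h; simp at h
    obtain ⟨rfl, h⟩ := h; simp_all
  have h3 : ∀ G : (P.Row → Bool) → Measure (P.Row → P.Row → Bool),
      ((piM fun a => piM fun x => coin (c a x)).bind fun D =>
        G fun i => D i.1 (θ i.1 i.2)) = (piM fun i => coin (c i.1 (θ i.1 i.2))).bind G := by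
    intro G; rw [← h1, map_bind disc disc]
  rw [h3 fun D => piM fun i => piM fun j => entryLaw P pl D i j]
  have h2 : ∀ D : P.Row → Bool, (piM fun i => piM fun j => entryLaw P pl D i j) =
      piM fun i => (fun b => piM fun j => if i = j then dirac b else
        coin (if pl i ∧ pl j then P.p else P.Q)) _ := fun D => rfl
  simp_rw [h2]
  rw [pi_bind_pi _ (κ := fun i b => piM fun j => if i = j then dirac b else
        coin (if pl i ∧ pl j then P.p else P.Q)) (fun _ => disc) fun i b => inferInstance]
  congr 1; funext i; rw [bind_pi_dirac]; grind

/-- The matrix law of the submatrix step with a given diagonal. -/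
def shuffledMatrix (pl : Fin P.k → Fin P.blockLen → Prop) (D : Fin P.k → Fin P.blockLen → Bool) :
    Measure (P.Row → P.Row → Bool) :=
  unif P.Perms fun θ => piM fun i => piM fun j =>
    entryLaw P (fun i => pl i.1 (θ i.1 i.2)) (fun i => D i.1 (θ i.1 i.2)) i j

lemma isProb_shuffledMatrix (pl : Fin P.k → Fin P.blockLen → Prop)
    (D : Fin P.k → Fin P.blockLen → Bool) : IsProb (shuffledMatrix P pl D) :=
  isProb_unif fun _ => inferInstance

/-- A permutation of a part that preserves the planted set and matches `D` with `D'` is absorbed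
into the uniform `θ`. -/
lemma shuffledMatrix_congr (pl : Fin P.k → Fin P.blockLen → Prop)
    {D D' : Fin P.k → Fin P.blockLen → Bool}
    (h : ∀ a c, (univ.filter fun x => (decide (pl a x), D a x) = c).card =
      (univ.filter fun x => (decide (pl a x), D' a x) = c).card) :
    shuffledMatrix P pl D = shuffledMatrix P pl D' := by
  choose τ hτ using fun a => exists_perm_comp_eq (h a); unfold shuffledMatrix
  rw [← unif_equiv (Equiv.mulLeft τ)]; simp_all

lemma card_filter_prod_eq {L : ℕ} {z : Fin L} {D D' : Fin L → Bool} (hc : cnt D = cnt D')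
    (hz : D z = D' z) (c : Bool × Bool) :
    (univ.filter fun x => (decide (x = z), D x) = c).card =
      (univ.filter fun x => (decide (x = z), D' x) = c).card := by
  obtain ⟨c1, c2⟩ := c; simp
  have e : ∀ D : Fin L → Bool, (univ.filter fun x => decide (x = z) = true ∧ D x = c2).card =
      if D z = c2 then 1 else 0 := by
    intro D; split_ifs with h
    · rw [card_eq_one]; refine ⟨z, ?_⟩; grind
    simp_all
  have e' : ∀ D : Fin L → Bool, (univ.filter fun x => D x = c2).card =
      (univ.filter fun x => decide (x = z) = true ∧ D x = c2).card +
      (univ.filter fun x => decide (x = z) = false ∧ D x = c2).card := by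
    intro D; rw [← (card_filter_add_card_filter_not fun x => decide (x = z) = true)]
    congr 2 <;> ext x <;> grind
  cases c1
  · have h1 := e' D; have h2 := e' D'; rw [e] at h1 h2; have h3 := card_filter_bool_eq hc c2; grind
  simp_all

/-- The kernel factors through the statistic `st`, so data processing can be applied to the laws of
`st` alone. -/
lemma Close.bind_of_factor {Ω S β : Type*} [MeasurableSpace Ω] [DiscreteMeasurableSpace Ω]
    [MeasurableSpace S] [DiscreteMeasurableSpace S] [MeasurableSpace β] [Nonempty Ω]
    {Ψ : Ω → Measure β} (hΨ : ∀ ω, IsProb (Ψ ω)) {st : Ω → S}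
    (h : ∀ ω ω', st ω = st ω' → Ψ ω = Ψ ω') {μ ν : Measure Ω} {ε : ℝ≥0∞}
    (hμν : Close (μ.map st) (ν.map st) ε) : Close (μ.bind Ψ) (ν.bind Ψ) ε := by
  obtain ⟨ω₀⟩ := ‹Nonempty Ω›; have hf : FactorsThrough Ψ st := fun ω ω' h' => h ω ω' h'
  set Φ : S → Measure β := Function.extend st Ψ fun _ => Ψ ω₀ with hΦ
  have hΦΨ : ∀ ω, Φ _ = Ψ ω := fun ω => hf.extend_apply _ ω
  have hp : ∀ s, IsProb (Φ s) := by
    intro s; by_cases hs : ∃ ω, st ω = s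
    · grind
    simp_all
  have := hμν.bind disc hp
  rw [map_bind disc disc, map_bind disc disc] at this; simp_all

/-- The matrix of independent bits with bias `p` in the planted rows and columns, else `Q`. -/
def plantedMatrix (pl : P.Row → Prop) : Measure (P.Row → P.Row → Bool) :=
  piM fun i => piM fun j => coin (if pl i ∧ pl j then P.p else P.Q)

lemma bind_shuffledMatrix (c : Fin P.k → Fin P.blockLen → ℝ)
    (pl : Fin P.k → Fin P.blockLen → Prop) (h1 : ∀ a x, pl a x → c a x = P.p)
    (h2 : ∀ a x, ¬ pl a x → c a x = P.Q) :
    ((piM fun a => piM fun x => coin (c a x)).bind (shuffledMatrix P pl)) =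
      unif P.Perms fun θ =>
        plantedMatrix P fun i => pl i.1 (θ i.1 i.2) := by
  unfold shuffledMatrix; rw [bind_unif fun _ => disc]; refine unif_congr fun θ => ?_
  rw [bind_entryLaw, plantedMatrix]; grind

variable {P} {E : Fin P.N → Fin P.k}

/-- Off the diagonal the law is already the right one. The two diagonals differ, but
`shuffledMatrix` sees a diagonal only through the planted bit and the number of ones of each part,
and the laws of these are close. -/
lemma close_submatrix_planted {g : ℝ} (hQ : GoodQ P.p P.q P.Q) (hL : P.N / P.k ≤ P.blockLen)
    (hL0 : 0 < P.blockLen) (hg : 0 < g * (P.N / P.k : ℕ))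
    (h1 : g * (P.N / P.k : ℕ) ≤ P.blockLen * P.Q - (P.N / P.k : ℕ) * P.p)
    (h2 : g * (P.N / P.k : ℕ) ≤ P.blockLen - (P.N / P.k : ℕ) -
      (P.blockLen * P.Q - (P.N / P.k : ℕ) * P.p))
    (e : P.Listing E) (R : ∀ a, {v // E v = a}) :
    Close ((((SimpleGraph.binomialRandom (Fin P.N) (prob P.q)).prod
      (SimpleGraph.binomialRandom (Fin P.k) (prob P.p))).map fun GH => plant E R GH.1 GH.2).bind
        (toKPartiteSubmatrix P E))
      (unif P.Perms fun θ =>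
        plantedMatrix P fun i => θ i.1 i.2 = Fin.castLE hL ((e i.1).symm (R i.1)))
      (diagError P g) := by
  have hp := isProb_map (μ := (SimpleGraph.binomialRandom _ (prob P.q)).prod
      (SimpleGraph.binomialRandom _ (prob P.p))) (f := fun GH => plant E R GH.1 GH.2) disc
  set z : Fin P.k → Fin _ := fun a => (e a).symm _ with hz
  have hpl : ∀ θ i, plantedRow P e θ (fun v => (R (E v)) = v) i ↔
      θ i.1 i.2 = Fin.castLE hL (z i.1) := by
    intro θ i
    constructor
    · rintro ⟨h, h'⟩; have e1 := (e i.1 ⟨θ i.1 i.2, h⟩).2; rw [e1] at h'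
      have e2 : (e i.1).symm (R i.1) = ⟨θ i.1 i.2, h⟩ := by
        rw [Equiv.symm_apply_eq]; exact Subtype.ext h'
      rw [hz]; dsimp only; rw [e2]; rfl
    · intro h; have h0 : (θ i.1 i.2 : ℕ) = z i.1 := by grind
      refine ⟨by rw [h0]; simp, ?_⟩
      have e3 : e i.1 ⟨θ i.1 i.2, by rw [h0]; simp⟩ = R i.1 := by simp_all
      grind
  rw [bind_toKPartiteSubmatrix hQ hL e (fun v => (R (E v)) = v) _
    (by rw [planted_map_edgeBits E R P.p P.q]; congr 1; funext x
        by_cases h : Planted E R x.1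
        · rw [if_pos h, if_pos (by exact h)]
        · rw [if_neg h, if_neg (by exact h)])]
  have e1 : ((coins _ _ P.p).bind fun B₁ => (coins _ _ P.Q).bind fun B₂ => unif _ fun θ =>
      piM fun i => piM fun j => entryLaw P (plantedRow P e θ fun v => (R (E v)) = v)
          (fun i => diagBit P B₁ B₂ i.1 (θ i.1 i.2)) i j) =
      (((coins _ _ P.p).prod (coins _ _ P.Q)).map fun x => diagBit P x.1 x.2).bind
        (shuffledMatrix P fun a x => x = Fin.castLE hL (z a)) := by
    simp_rw [(fun θ => funext fun i => propext (hpl θ i))]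
    rw [prod_map_eq_bind disc, bind_bind disc disc]; congr 1; funext B₁
    rw [map_bind disc disc]; rfl
  rw [e1, ← bind_shuffledMatrix P (fun a x => if x = Fin.castLE hL (z a) then P.p else P.Q)
    _ (fun a x h => if_pos h) fun a x h => if_neg h]
  refine Close.bind_of_factor (isProb_shuffledMatrix P _)
    (st := fun D a => (D a (Fin.castLE hL (z a)), cnt (D a))) ?_ ?_
  · intro D D' h; refine shuffledMatrix_congr P _ fun a c => ?_; have ha := congrFun h a
    convert (card_filter_prod_eq (congrArg Prod.snd ha) (congrArg Prod.fst ha) c)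
  · rw [Measure.map_map disc disc]; exact close_diagBit hQ hL hL0 hg h1 h2 z

lemma close_submatrix_null {g : ℝ} (hQ : GoodQ P.p P.q P.Q) (hL : P.N / P.k ≤ P.blockLen)
    (hg : 0 < g * (P.N / P.k : ℕ))
    (h1 : g * (P.N / P.k : ℕ) ≤ P.blockLen * P.Q - (P.N / P.k : ℕ) * P.p)
    (h2 : g * (P.N / P.k : ℕ) ≤ P.blockLen - (P.N / P.k : ℕ) -
      (P.blockLen * P.Q - (P.N / P.k : ℕ) * P.p))
    (e : P.Listing E) :
    Close ((kPdsNull P.N P.q).bind (toKPartiteSubmatrix P E))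
      (plantedMatrix P fun _ => False) (diagError P g) := by
  have hp : IsProb (kPdsNull P.N P.q) := by unfold kPdsNull; infer_instance
  have hγ : (kPdsNull P.N P.q).map edgeBits = piM fun e =>
      coin (if ∀ v ∈ e.1, False then P.p else P.q) := by
    rw [kPdsNull, binomialRandom_map_edgeBits]; congr 1; funext e; rw [if_neg]; intro h
    obtain ⟨e, he⟩ := e
    induction e using Sym2.ind with
    | _ u v => exact h u (by simp)
  rw [bind_toKPartiteSubmatrix hQ hL e _ _ hγ]
  have e1 : ((coins _ _ P.p).bind fun B₁ => (coins _ _ P.Q).bind fun B₂ => unif _ fun θ =>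
      piM fun i => piM fun j => entryLaw P (plantedRow P e θ fun v => False)
          (fun i => diagBit P B₁ B₂ i.1 (θ i.1 i.2)) i j) =
      (((coins _ _ P.p).prod (coins _ _ P.Q)).map fun x => diagBit P x.1 x.2).bind
        (shuffledMatrix P fun a x => False) := by
    simp_rw [(fun θ => funext fun i => propext ⟨fun ⟨_, h⟩ => h, fun h => h.elim⟩ : ∀ θ, plantedRow P e θ (fun v => False) = fun i => False)]
    rw [prod_map_eq_bind disc, bind_bind disc disc]; congr 1; funext B₁
    rw [map_bind disc disc]; rfl
  have e2 := bind_shuffledMatrix P _ (fun a x => False) (fun a x h => h.elim) fun a x h => rfl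
  rw [unif_const] at e2; rw [e1, ← e2]
  refine Close.bind_of_factor (isProb_shuffledMatrix P _) (st := fun D a => cnt (D a)) ?_ ?_
  · intro D D' h; refine shuffledMatrix_congr P _ fun a c => ?_
    have ha := card_filter_bool_eq (congrFun h a) c.2; obtain ⟨c1, c2⟩ := c
    cases c1
    · simp_all
    · simp
  · rw [Measure.map_map disc disc]; exact close_cnt_diagBit hQ hL hg h1 h2

end Diagonal

/-! ### The Gaussian rejection kernel. -/

section RejectionKernel

lemma φ_eq (ν x : ℝ) : φ ν x = φ 0 0 * exp (-(x - ν) ^ 2 / 2) := by simp [φ, gaussianPDFReal]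

lemma φ_pos (ν x : ℝ) : 0 < φ ν x := gaussianPDFReal_pos _ _ _ one_ne_zero

lemma measurable_φ (ν : ℝ) : Measurable (φ ν) := measurable_gaussianPDFReal _ _

lemma integrable_φ (ν : ℝ) : Integrable (φ ν) := integrable_gaussianPDFReal _ _

lemma φ_shift (ν z : ℝ) : φ ν (z + ν) = φ 0 z := by rw [φ_eq, φ_eq 0 z]; simp

lemma setIntegral_φ (ν : ℝ) {s : Set ℝ} : ∫ x in s, φ ν x = (gaussianReal ν 1).real s := by
  rw [Measure.real, gaussianReal_apply_eq_integral _ one_ne_zero, toReal_ofReal]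
  · rfl
  · exact setIntegral_nonneg_of_ae_restrict (Filter.Eventually.of_forall fun x => (φ_pos ν x).le)

variable {p Q ν : ℝ}

/-- The density proportional to which the rejection kernel samples, before truncation at zero. -/
def rkDens (p Q ν : ℝ) (B : Bool) (x : ℝ) : ℝ :=
  if B then φ ν x - (1 - p) / (1 - Q) * φ 0 x else φ 0 x - Q / p * φ ν x

lemma integrable_rkDens (p Q ν : ℝ) (B : Bool) : Integrable (rkDens p Q ν B) := by
  have := integrable_φ
  cases B
  · exact (this 0).sub ((this ν).const_mul _)
  · exact (this ν).sub ((this 0).const_mul _)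

lemma measurable_rkAccept (p Q ν : ℝ) (B : Bool) : Measurable (rkAccept p Q ν B) := by
  have := measurable_φ; unfold rkAccept
  cases B
  · simp
    exact Measurable.ite (measurableSet_le (by fun_prop) (by fun_prop)) (by fun_prop) (by fun_prop)
  · simp
    exact Measurable.ite (measurableSet_le (by fun_prop) (by fun_prop)) (by fun_prop) (by fun_prop)

lemma measurable_rkProposal (ν : ℝ) (B : Bool) : Measurable (rkProposal ν B) := by
  unfold rkProposal
  cases B <;> simp <;> fun_prop

variable (hQ0 : 0 < Q) (hQp : Q < p) (hp : p ≤ 1)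

lemma rkAccept_mem (hQ0 : 0 < Q) (hQp : Q < p) (hp : p ≤ 1) (B : Bool) (z : ℝ) :
    0 ≤ rkAccept p Q ν B z ∧ rkAccept p Q ν B z ≤ 1 := by
  have hφ := φ_pos; unfold rkAccept
  cases B
  · simp; split_ifs with h
    · have : 0 < p * φ 0 z := mul_pos (by linarith) (hφ _ _); have h5 := (div_le_one this).2 h
      have h6 : 0 ≤ Q * φ ν z / _ := div_nonneg (mul_pos hQ0 (hφ _ _)).le this.le; grind
    simp
  · simp; split_ifs with h
    · have : 0 < _ * φ ν (z + ν) := mul_pos (by linarith : 0 < 1 - Q) (hφ _ _)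
      have h5 := (div_le_one this).2 h
      have h6 : 0 ≤ _ * φ 0 (z + ν) / _ :=
        div_nonneg (mul_nonneg (by linarith : 0 ≤ 1 - p) (hφ _ _).le) this.le
      grind
    simp

/-- The density of the draw cancels the denominator of the acceptance probability, so one round
accepts with the sub-probability density `max 0 (rkDens p Q ν B)`. -/
lemma φ_mul_rkAccept (hQ0 : 0 < Q) (hQp : Q < p) (hp : p ≤ 1) (B : Bool) (z : ℝ) :
    φ 0 z * rkAccept p Q ν B z = max 0 (rkDens p Q ν B (rkProposal ν B z)) := by
  have h1 : 0 < 1 - Q := by linarith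
  have h3 : 0 < p := by linarith
  have hφ := φ_pos
  cases B
  · simp only [rkAccept, rkDens, rkProposal, Bool.false_eq_true, if_false]
    have e : φ 0 z - Q / p * φ ν z = (p * φ 0 z - Q * φ ν z) / p := by grind
    split_ifs with h
    · rw [max_eq_right (by rw [e]; exact div_nonneg (by linarith) h3.le)]; grind
    · rw [max_eq_left (by rw [e]; exact div_nonpos_of_nonpos_of_nonneg (by linarith) h3.le), mul_zero]
  · simp only [rkAccept, rkDens, rkProposal, if_true]
    have e : φ ν (z + ν) - (1 - p) / (1 - Q) * φ 0 (z + ν) =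
      ((1 - Q) * φ ν (z + ν) - (1 - p) * φ 0 (z + ν)) / (1 - Q) := by grind
    split_ifs with h
    · rw [max_eq_right (by rw [e]; exact div_nonneg (by linarith) h1.le), φ_shift]; grind
    · rw [max_eq_left (by rw [e]; exact div_nonpos_of_nonpos_of_nonneg (by linarith) h1.le), mul_zero]

lemma measurable_rkG_step (hQ0 : 0 < Q) (hQp : Q < p) (hp : p ≤ 1) (B : Bool) (μ : Measure ℝ)
    [IsProb μ] :
    Measurable fun z => (coin (rkAccept p Q ν B z)).bind fun a =>
      if a then dirac (rkProposal ν B z) else μ := by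
  refine measurable_of_measurable_coe _ fun s hs => ?_
  have : ∀ z, ((coin (rkAccept p Q ν B z)).bind fun a =>
      if a then dirac (rkProposal ν B z) else μ) s =
      ofReal (rkAccept p Q ν B z) * s.indicator 1 (rkProposal ν B z) +
      ofReal (1 - rkAccept p Q ν B z) * μ s := by
    intro z; have ha := rkAccept_mem (ν := ν) hQ0 hQp hp B z
    rw [Measure.bind_apply hs disc.aemeasurable, coin_eq, prob_coe ha.1 ha.2,
      lintegral_add_measure, lintegral_smul_measure, lintegral_smul_measure, lintegral_dirac,
      lintegral_dirac]
    simp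
  simp_rw [this]; have m1 := measurable_rkAccept p Q ν B
  have m2 : Measurable fun z => (s.indicator 1 _ : ℝ≥0∞) :=
    (measurable_one.indicator hs).comp (measurable_rkProposal ν B)
  fun_prop

lemma isProb_rkG (hQ0 : 0 < Q) (hQp : Q < p) (hp : p ≤ 1) (B : Bool) (J : ℕ) :
    IsProb (rkG p Q ν B J) := by
  induction J with
  | zero => unfold rkG; infer_instance
  | succ J ih =>
    refine isProb_bind (measurable_rkG_step hQ0 hQp hp B _) fun z => isProb_bind disc fun a => ?_
    split_ifs <;> infer_instance

lemma rkG_succ_real (hQ0 : 0 < Q) (hQp : Q < p) (hp : p ≤ 1) (B : Bool) (J : ℕ) {s : Set ℝ}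
    (hs : MeasurableSet s) :
    (rkG p Q ν B (J + 1)).real s = (∫ x in s, max 0 (rkDens p Q ν B x)) +
      (1 - ∫ x, max 0 (rkDens p Q ν B x)) * (rkG p Q ν B J).real s := by
  have hprob := isProb_rkG (ν := ν) hQ0 hQp hp B J; have m1 := measurable_rkAccept p Q ν B
  set c := (rkG p Q ν B J).real s
  have e1 : (rkG p Q ν B (J + 1)).real s = ∫ z, (rkAccept p Q ν B z * s.indicator 1 (rkProposal ν B z) +
      (1 - rkAccept p Q ν B z) * c) ∂gaussianReal 0 1 := by
    rw [Measure.real, rkG, Measure.bind_apply hs (measurable_rkG_step hQ0 hQp hp B _).aemeasurable,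
      ← integral_toReal]
    · refine integral_congr_ae (Filter.Eventually.of_forall fun z => ?_)
      have ha := rkAccept_mem (ν := ν) hQ0 hQp hp B z; dsimp only
      rw [Measure.bind_apply hs disc.aemeasurable, coin_eq, prob_coe ha.1 ha.2,
        lintegral_add_measure, lintegral_smul_measure, lintegral_smul_measure, lintegral_dirac,
        lintegral_dirac, ENNReal.toReal_add
        (by rw [if_pos rfl]; exact ENNReal.mul_ne_top ofReal_ne_top (measure_ne_top _ _))
        (by simp [ENNReal.mul_eq_top])]
      simp [toReal_ofReal ha.1, toReal_ofReal (sub_nonneg.2 ha.2)]; congr 2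
      by_cases h : rkProposal ν B z ∈ s <;> simp [h]
    · exact ((measurable_coe hs).comp (measurable_rkG_step hQ0 hQp hp B _)).aemeasurable
    · refine Filter.Eventually.of_forall fun z => ?_
      have : IsProb ((coin (rkAccept p Q ν B z)).bind fun a =>
        if a then dirac (rkProposal ν B z) else rkG p Q ν B J) := isProb_bind disc fun a => by
          split_ifs <;> infer_instance
      simp
  have hbd : ∀ z, |rkAccept p Q ν B z| ≤ 1 := fun z => by
    have ha := rkAccept_mem (ν := ν) hQ0 hQp hp B z; grind
  have i1 : Integrable (fun z => rkAccept p Q ν B z * s.indicator 1 (rkProposal ν B z)) (gaussianReal 0 1) := by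
    refine .of_bound (m1.mul ((measurable_one.indicator hs).comp (measurable_rkProposal ν B))).aestronglyMeasurable 1 (Filter.Eventually.of_forall fun z => ?_)
    by_cases h : rkProposal ν B z ∈ s
    · simp_all
    simp_all
  have i2 : Integrable _ (gaussianReal 0 1) :=
    .of_bound m1.aestronglyMeasurable 1 (Filter.Eventually.of_forall fun z => hbd z)
  have key : ∀ t : Set ℝ, MeasurableSet t →
      ∫ z, rkAccept p Q ν B z * t.indicator 1 (rkProposal ν B z) ∂gaussianReal 0 1 =
        ∫ x in t, max 0 (rkDens p Q ν B x) := by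
    intro t ht; rw [integral_gaussianReal_eq_integral_smul one_ne_zero, ← integral_indicator ht]
    have e2 : ∀ z, gaussianPDFReal 0 1 z • (rkAccept p Q ν B z * t.indicator 1 (rkProposal ν B z)) =
        t.indicator (fun x => max 0 (rkDens p Q ν B x)) (rkProposal ν B z) := by
      intro z; rw [smul_eq_mul, ← mul_assoc]; change φ 0 z * _ * _ = _
      rw [φ_mul_rkAccept hQ0 hQp hp]; by_cases h : rkProposal ν B z ∈ t <;> simp [h]
    simp_rw [e2]
    cases B
    · simp [rkProposal]
    · simp only [rkProposal]; exact integral_add_right_eq_self _ ν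
  have i3 : Integrable (fun z => (1 - rkAccept p Q ν B z) * c) _ :=
    ((integrable_const 1).sub i2).mul_const c
  rw [e1, integral_add i1 i3, key s hs, integral_mul_const, integral_sub (integrable_const 1) i2]
  have := key Set.univ .univ; simp_all

/-- With `A` the acceptance probability of a round, the output is a geometric sum of accepted parts
plus a mass `(1 - A) ^ J` at the default value. Both sides are multiplied by `A` so that the
induction needs no division. -/
lemma rkG_real_le (hQ0 : 0 < Q) (hQp : Q < p) (hp : p ≤ 1) (B : Bool) (J : ℕ) {s : Set ℝ}
    (hs : MeasurableSet s) (hA : ∫ x, max 0 (rkDens p Q ν B x) ≤ 1) :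
    (∫ x, max 0 (rkDens p Q ν B x)) * (rkG p Q ν B J).real s ≤ (∫ x in s, max 0 (rkDens p Q ν B x)) +
      (∫ x, max 0 (rkDens p Q ν B x)) * (1 - ∫ x, max 0 (rkDens p Q ν B x)) ^ J := by
  have hprob := fun J => isProb_rkG (ν := ν) hQ0 hQp hp B J; set A := ∫ x, max 0 (rkDens p Q ν B x)
  have hm0 : 0 ≤ ∫ x in s, max 0 (rkDens p Q ν B x) := setIntegral_nonneg hs fun x _ => le_max_left _ _
  induction J with
  | zero =>
    linarith [mul_le_mul_of_nonneg_left (measureReal_le_one : (rkG p Q ν B 0).real s ≤ 1) (integral_nonneg fun x => le_max_left _ _ : 0 ≤ A)]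
  | succ J ih =>
    rw [rkG_succ_real hQ0 hQp hp B J hs]; set m := ∫ x in s, max 0 (rkDens p Q ν B x)
    have := mul_le_mul_of_nonneg_left ih (sub_nonneg.2 hA)
    calc A * _ = A * m + (1 - A) * (A * (rkG p Q ν B J).real s) := by ring
      _ ≤ A * m + (1 - A) * (m + A * _ ^ J) := by linarith
      _ = m + A * _ ^ _ := by ring

lemma gaussian_tail {x : ℝ} (hx : 0 ≤ x) :
    (gaussianReal 0 1).real {z | x ≤ z} ≤ exp (-x ^ 2 / 2) := by
  have := measure_ge_le_exp_mul_mgf (μ := gaussianReal 0 1) (X := id) x hx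
    (integrable_exp_mul_gaussianReal x)
  rw [mgf_id_gaussianReal, ← exp_add] at this; refine this.trans (exp_le_exp.2 ?_)
  norm_num; grind

lemma gaussian_tail_neg {x : ℝ} (hx : 0 ≤ x) :
    (gaussianReal 0 1).real {z | z ≤ -x} ≤ exp (-x ^ 2 / 2) := by
  have := measure_le_le_exp_mul_mgf (μ := gaussianReal 0 1) (X := id) (-x) (by linarith)
    (integrable_exp_mul_gaussianReal (-x))
  rw [mgf_id_gaussianReal, ← exp_add] at this; refine this.trans (exp_le_exp.2 ?_)
  norm_num; grind

/-- The likelihood ratio of the two Gaussians is `exp (ν x - ν ^ 2 / 2)`, so `rkDens` can be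
negative only on the tail `t`: `x ≤ -y` for a one, `x - ν ≥ y` for a zero. There truncation at zero
adds at most the density `ψ`, whose tail has mass at most `exp (-y ^ 2 / 2)`. -/
lemma setIntegral_max_rkDens_le {δ y : ℝ} (hQ0 : 0 < Q) (hQp : Q < p) (hp : p ≤ 1) (hν : 0 ≤ ν)
    (hy : 0 ≤ y) (hδ0 : 0 < δ)
    (hδ1 : (1 - p) / (1 - Q) ≤ exp (-δ)) (hδ2 : Q / p ≤ exp (-δ))
    (hνy : ν * y + ν ^ 2 / 2 ≤ δ) (B : Bool) {s : Set ℝ} (hs : MeasurableSet s) :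
    ∫ x in s, max 0 (rkDens p Q ν B x) ≤ (∫ x in s, rkDens p Q ν B x) + exp (-y ^ 2 / 2) := by
  have hφ := φ_pos; have hi := integrable_rkDens p Q ν B
  set t : Set ℝ := if B then {x | x ≤ -y} else {x | y ≤ x - ν} with ht
  have htm : MeasurableSet t := by
    cases B
    · simp only [ht, Bool.false_eq_true, if_false]
      exact measurableSet_le measurable_const (by fun_prop)
    · simp only [ht, if_true]; exact measurableSet_Iic
  set ψ : ℝ → ℝ := if B then φ 0 else φ ν with hψ
  have hψi : Integrable ψ := by cases B <;> simp only [hψ, Bool.false_eq_true, if_false, if_true] <;> exact integrable_φ _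
  have hψ0 : ∀ x, 0 ≤ ψ x := fun x => by cases B <;> simp only [hψ, Bool.false_eq_true, if_false, if_true] <;> exact (hφ _ _).le
  have key : ∀ x, max 0 (rkDens p Q ν B x) ≤ rkDens p Q ν B x + t.indicator ψ x := by
    intro x; have hc := hφ 0 0; by_cases hx : x ∈ t
    · rw [Set.indicator_of_mem hx]; refine max_le ?_ (by linarith [hψ0 x])
      cases B
      · simp only [rkDens, hψ, Bool.false_eq_true, if_false]
        have := (div_le_one (by linarith)).2 hQp.le; nlinarith [hφ 0 x, hφ ν x]
      · simp only [rkDens, hψ, if_true]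
        have : (1 - p) / _ ≤ 1 := (div_le_one (by linarith : 0 < 1 - Q)).2 (by linarith)
        nlinarith [hφ 0 x, hφ ν x]
    · rw [Set.indicator_of_notMem hx, add_zero]; refine max_le ?_ le_rfl
      cases B
      · simp only [ht, Bool.false_eq_true, if_false, Set.mem_ofPred_eq, not_le] at hx
        simp only [rkDens, Bool.false_eq_true, if_false]; rw [φ_eq 0 x, φ_eq ν x]
        have : Q / p * exp (-(x - ν) ^ 2 / 2) ≤ exp (-(x - 0) ^ 2 / 2) := by
          calc _ ≤ exp (-δ) * exp _ := by gcongr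
            _ ≤ _ := by
              rw [← exp_add]; apply exp_le_exp.2; nlinarith
        nlinarith
      · simp only [ht, if_true, Set.mem_ofPred_eq, not_le] at hx; simp only [rkDens, if_true]
        rw [φ_eq 0 x, φ_eq ν x]
        have : (1 - p) / (1 - Q) * exp (-(x - 0) ^ 2 / 2) ≤ exp (-(x - ν) ^ 2 / 2) := by
          calc _ ≤ exp (-δ) * exp _ := by gcongr
            _ ≤ _ := by
              rw [← exp_add]; apply exp_le_exp.2; nlinarith
        nlinarith
  have htail : ∫ x in t, ψ x ≤ exp (-y ^ 2 / 2) := by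
    cases B
    · simp only [hψ, Bool.false_eq_true, if_false, setIntegral_φ]
      have e := gaussianReal_map_sub_const (μ := ν) (v := 1) ν; rw [sub_self] at e
      have := gaussian_tail hy
      rw [← e, map_measureReal_apply (s := {z | y ≤ z}) (by fun_prop)
        (measurableSet_le measurable_const measurable_id)] at this
      exact this
    · simp only [hψ, if_true, setIntegral_φ]; exact gaussian_tail_neg hy
  calc _ ≤ ∫ x in s, _ :=
        setIntegral_mono ((integrable_zero _ _ _).sup hi).integrableOn (hi.add (hψi.indicator htm)).integrableOn key
    _ = (∫ x in s, rkDens p Q ν B x) + ∫ x in s, t.indicator ψ x :=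
        integral_add hi.integrableOn (hψi.indicator htm).integrableOn
    _ ≤ _ := by
        gcongr; refine le_trans ?_ htail; rw [← integral_indicator htm]
        exact setIntegral_le_integral (hψi.indicator htm) (Filter.Eventually.of_forall
          fun x => Set.indicator_nonneg (fun x _ => hψ0 x) x)

/-- The probability with which an ideal version of the kernel would accept. -/
def rkIdeal (p Q : ℝ) (B : Bool) : ℝ := if B then 1 - (1 - p) / (1 - Q) else 1 - Q / p

/-- Truncation only adds mass, so the acceptance probability is at least `rkIdeal`, which is at
least `1 - exp (-δ)`. Hence `J` rejections in a row have probability at most `exp (-δ J)`. -/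
lemma rkG_real_le_ideal {δ y : ℝ} (hQ0 : 0 < Q) (hQp : Q < p) (hp : p ≤ 1) (hν : 0 ≤ ν)
    (hy : 0 ≤ y) (hδ0 : 0 < δ)
    (hδ1 : (1 - p) / (1 - Q) ≤ exp (-δ)) (hδ2 : Q / p ≤ exp (-δ))
    (hνy : ν * y + ν ^ 2 / 2 ≤ δ) (B : Bool) (J : ℕ) {s : Set ℝ} (hs : MeasurableSet s) :
    (rkG p Q ν B J).real s ≤ ((∫ x in s, rkDens p Q ν B x) + exp (-y ^ 2 / 2)) / rkIdeal p Q B +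
      exp (-δ * J) := by
  have hφ := φ_pos; have hi := integrable_rkDens p Q ν B; have him := (integrable_zero _ _ _).sup hi
  have hId : 1 - rkIdeal p Q B ≤ exp (-δ) := by
    cases B
    · simpa [rkIdeal] using hδ2
    · simpa [rkIdeal] using hδ1
  have hId0 : 0 < rkIdeal p Q B := by
    have : exp (-δ) < 1 := by rw [Real.exp_lt_one_iff]; linarith
    linarith
  have hIdA : rkIdeal p Q B ≤ ∫ x, max 0 (rkDens p Q ν B x) := by
    have e : ∫ x, rkDens p Q ν B x = rkIdeal p Q B := by
      have hone : ∀ ν : ℝ, ∫ x, φ ν x = 1 := fun ν => integral_gaussianPDFReal_eq_one _ one_ne_zero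
      cases B
      · simp [rkDens, rkIdeal]
        rw [integral_sub (integrable_φ _) ((integrable_φ _).const_mul _), integral_const_mul, hone, hone, mul_one]
      · simp [rkDens, rkIdeal]
        rw [integral_sub (integrable_φ _) ((integrable_φ _).const_mul _), integral_const_mul, hone, hone, mul_one]
    rw [← e]; exact integral_mono hi him fun x => le_max_right _ _
  have hA1 : ∫ x, max 0 (rkDens p Q ν B x) ≤ 1 := by
    have hone : ∀ ν : ℝ, ∫ x, φ ν x = 1 := fun ν => integral_gaussianPDFReal_eq_one _ one_ne_zero
    cases B
    · rw [← hone 0]; refine integral_mono him (integrable_φ _) fun x => max_le (hφ _ _).le ?_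
      simp [rkDens]
      have : 0 ≤ Q / p * φ ν x := mul_nonneg (div_nonneg hQ0.le (by linarith : 0 < p).le) (hφ _ _).le
      linarith
    · rw [← hone ν]; refine integral_mono him (integrable_φ _) fun x => max_le (hφ _ _).le ?_
      simp only [rkDens, if_true]
      have : 0 ≤ (1 - p) / _ * φ 0 x := mul_nonneg (div_nonneg (by linarith) (by linarith : 0 < 1 - Q).le) (hφ _ _).le
      linarith
  have h4 := rkG_real_le hQ0 hQp hp B J hs hA1
  have h5 := setIntegral_max_rkDens_le hQ0 hQp hp hν hy hδ0 hδ1 hδ2 hνy B hs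
  set A := ∫ x, max 0 (rkDens p Q ν B x); have hApos := hId0.trans_le hIdA
  have h6 : (rkG p Q ν B J).real s ≤ (∫ x in s, max 0 (rkDens p Q ν B x)) / A + (1 - A) ^ J := by
    rw [(by field_simp : (rkG p Q ν B J).real s = A * (rkG p Q ν B J).real s / A), div_add' _ _ _ hApos.ne']
    gcongr; linarith
  refine h6.trans (add_le_add ?_ ?_)
  · calc _ ≤ (∫ x in s, max 0 (rkDens p Q ν B x)) / rkIdeal p Q B := by gcongr
      _ ≤ _ := by gcongr
  · calc _ ^ J ≤ exp (-δ) ^ J := by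
          gcongr; linarith
      _ = _ := by rw [← Real.exp_nat_mul]; grind

/-- Mixed with weights `x` and `1 - x`, the two densities `rkDens / rkIdeal` give `((x - Q) φ_ν + (p
- x) φ_0) / (p - Q)`, which is `φ_ν` at `x = p` and `φ_0` at `x = Q`. The error consists of the
truncation for both bits and of the failure to accept. -/
lemma close_coin_bind_rkG {δ y : ℝ} (hQ0 : 0 < Q) (hQp : Q < p) (hp : p ≤ 1) (hν : 0 ≤ ν)
    (hy : 0 ≤ y) (hδ0 : 0 < δ)
    (hδ1 : (1 - p) / (1 - Q) ≤ exp (-δ)) (hδ2 : Q / p ≤ exp (-δ))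
    (hνy : ν * y + ν ^ 2 / 2 ≤ δ) (b : Bool) (J : ℕ) :
    Close ((coin (if b then p else Q)).bind fun B => rkG p Q ν B J)
      (gaussianReal (if b then ν else 0) 1)
      (ofReal (2 / (p - Q) * exp (-y ^ 2 / 2) + exp (-δ * J))) := by
  intro s hs; have h1 : 0 < 1 - Q := by linarith
  have h3 : 0 < p := by linarith
  have hprob := fun B => isProb_rkG (ν := ν) hQ0 hQp hp B J
  have hx : 0 ≤ (if b then p else Q) ∧ (if b then p else Q) ≤ 1 := by
    cases b <;> simp <;> constructor <;> linarith
  have := isProb_bind (μ := coin (if b then p else Q)) disc hprob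
  rw [← ofReal_measureReal, ← ofReal_measureReal, ← ofReal_add (by positivity) (by positivity)]
  apply ofReal_le_ofReal
  have e : ((coin (if b then p else Q)).bind fun B => rkG p Q ν B J).real s =
      (if b then p else Q) * (rkG p Q ν true J).real s + (1 - if b then p else Q) * (rkG p Q ν false J).real s := by
    rw [Measure.real, Measure.bind_apply hs disc.aemeasurable, coin_eq,
      prob_coe hx.1 hx.2, lintegral_add_measure, lintegral_smul_measure, lintegral_smul_measure,
      lintegral_dirac, lintegral_dirac, ENNReal.toReal_add (by simp [ENNReal.mul_eq_top])
      (by simp [ENNReal.mul_eq_top])]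
    simp only [smul_eq_mul, ENNReal.toReal_mul, toReal_ofReal hx.1,
      toReal_ofReal (sub_nonneg.2 hx.2)]
    rfl
  have k1 := rkG_real_le_ideal hQ0 hQp hp hν hy hδ0 hδ1 hδ2 hνy true J hs
  have k0 := rkG_real_le_ideal hQ0 hQp hp hν hy hδ0 hδ1 hδ2 hνy false J hs
  have d1 : ∫ x in s, rkDens p Q ν true x = (gaussianReal ν 1).real s - (1 - p) / (1 - Q) * (gaussianReal 0 1).real s := by
    simp only [rkDens, if_true]
    rw [integral_sub (integrable_φ _).integrableOn ((integrable_φ _).const_mul _).integrableOn,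
      integral_const_mul, setIntegral_φ, setIntegral_φ]
  have d0 : ∫ x in s, rkDens p Q ν false x = (gaussianReal 0 1).real s - Q / p * (gaussianReal ν 1).real s := by
    simp only [rkDens, Bool.false_eq_true, if_false]
    rw [integral_sub (integrable_φ _).integrableOn ((integrable_φ _).const_mul _).integrableOn,
      integral_const_mul, setIntegral_φ, setIntegral_φ]
  rw [d1] at k1; rw [d0] at k0
  rw [(by simp only [rkIdeal, if_true]; field_simp; ring : rkIdeal p Q true = (p - Q) / (1 - Q))] at k1
  rw [(by simp only [rkIdeal, Bool.false_eq_true, if_false]; field_simp : rkIdeal p Q false = (p - Q) / p)] at k0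
  rw [e]; set G := (gaussianReal ν 1).real s; set G0 := (gaussianReal 0 1).real s
  set T := exp _; set F := exp _
  have hfin : ∀ x : ℝ, 0 ≤ x → x ≤ 1 → x * (rkG p Q ν true J).real s + (1 - x) * (rkG p Q ν false J).real s ≤
      (x - Q) / (p - Q) * G + (p - x) / (p - Q) * G0 + (2 / (p - Q) * T + F) := by
    intro x hx0 hx1
    calc _ ≤ x * _ +
          _ * _ :=
          add_le_add (mul_le_mul_of_nonneg_left k1 hx0) (mul_le_mul_of_nonneg_left k0 (by linarith))
      _ = (x - Q) / (p - Q) * G + (p - x) / (p - Q) * G0 +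
          ((x * (1 - Q) + (1 - x) * p) / (p - Q) * T + F) := by field_simp; ring
      _ ≤ _ := by
        gcongr; nlinarith [mul_nonneg hx0 hQ0.le, mul_nonneg (sub_nonneg.2 hx1) (by linarith)]
  refine (hfin _ hx.1 hx.2).trans (le_of_eq ?_); grind

end RejectionKernel

/-! ### Orthonormal images of Gaussian vectors, by characteristic functions. -/

section Gaussian

lemma charFunDual_gaussianReal_mul (m c : ℝ) (L : StrongDual ℝ ℝ) (hL : ∀ x, L x = c * x) :
    charFunDual (gaussianReal m 1) L = Complex.exp (c * m * Complex.I - c ^ 2 / 2) := by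
  rw [charFunDual_eq_charFun_map_one, (funext hL), gaussianReal_map_const_mul, charFun_gaussianReal]
  simp

lemma charFunDual_pi_gaussianReal {ι : Type*} [Fintype ι] [DecidableEq ι] (m : ι → ℝ)
    (L : StrongDual ℝ (ι → ℝ)) :
    charFunDual (piM fun i => gaussianReal (m i) 1) L =
      Complex.exp (∑ i, ((L (Pi.single i 1) * m i : ℝ) * Complex.I - (L (Pi.single i 1) ^ 2 : ℝ) / 2)) := by
  rw [charFunDual_pi, Complex.exp_sum]; refine prod_congr rfl fun i _ => ?_
  rw [charFunDual_gaussianReal_mul _ _]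
  · push_cast; rfl
  · intro x
    have : (Pi.single i x) = x • Pi.single i 1 := by rw [← Pi.single_smul, smul_eq_mul, mul_one]
    simp [this]; ring

/-- A matrix with orthonormal rows maps independent standard Gaussians to such. -/
lemma pi_gaussianReal_map_matrix {V Y : Type*} [Fintype V] [Fintype Y] [DecidableEq V]
    [DecidableEq Y] (H : Matrix V Y ℝ) (hH : H * H.transpose = 1) (m : Y → ℝ) :
    (piM fun y => gaussianReal (m y) 1).map (fun x => H.mulVec x) =
      piM fun v => gaussianReal (H.mulVec m v) 1 := by
  let T : _ →L[ℝ] _ := LinearMap.toContinuousLinearMap H.mulVecLin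
  have hT : (fun x => H.mulVec x) = T := rfl; refine ext_of_charFunDual ?_; funext L
  rw [hT, charFunDual_map, charFunDual_pi_gaussianReal, charFunDual_pi_gaussianReal]
  have e : ∀ y, (L.comp T) (Pi.single y 1) = ∑ v, L (Pi.single v 1) * H v y := by
    intro y; have h1 : T (Pi.single y 1) = fun v => H v y := by rw [← hT]; funext v; simp
    rw [ContinuousLinearMap.comp_apply, h1, ← L.sum_comp_single]
    refine sum_congr rfl fun v _ => ?_
    have : (Pi.single v (H v y)) = H v y • Pi.single v 1 := by
      rw [← Pi.single_smul, smul_eq_mul, mul_one]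
    rw [ContinuousLinearMap.comp_apply, ContinuousLinearMap.single_apply, this, map_smul, smul_eq_mul, mul_comm]
  rw [sum_sub_distrib, sum_sub_distrib, ← sum_mul, ← sum_mul, ← sum_div, ← sum_div]
  have e1 : ∑ y, (∑ v, L (Pi.single v 1) * H v y) * m y = ∑ v, L (Pi.single v 1) * H.mulVec m v := by
    simp_rw [Matrix.mulVec, dotProduct, sum_mul, mul_sum]; rw [Finset.sum_comm]
    exact sum_congr rfl fun _ _ => sum_congr rfl fun _ _ => by ring
  have e2 : ∑ y, (∑ v, L (Pi.single v 1) * H v y) ^ 2 = ∑ v, L (Pi.single v 1) ^ 2 := by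
    have h1 : ∀ v v', ∑ y, H v y * H v' y = if v = v' then 1 else 0 := by
      intro v v'; have := congrFun (congrFun hH v) v'
      rwa [Matrix.mul_apply, Matrix.one_apply] at this
    calc _ = ∑ y, ∑ v, ∑ v', L _ * L (Pi.single v' 1) * (H v y * H v' y) := by
          refine sum_congr rfl fun y _ => ?_; rw [sq, sum_mul_sum]
          exact sum_congr rfl fun _ _ => sum_congr rfl fun _ _ => by ring
      _ = ∑ v, ∑ v', L _ * L _ * ∑ y, H v y * H v' y := by
          rw [Finset.sum_comm]; refine sum_congr rfl fun v _ => ?_; rw [Finset.sum_comm]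
          exact sum_congr rfl fun v' _ => by rw [mul_sum]
      _ = _ := by
          simp_rw [h1]; simp [sq]
  norm_cast; grind

end Gaussian

/-! ### The rotation matrix and the law of the rotated Gaussian matrix. -/

section Rotation

variable (P : Params)

lemma card_submodule (V : Submodule (ZMod P.r) P.Point) :
    Nat.card V = P.r ^ Module.finrank (ZMod P.r) V := by
  rw [Module.natCard_eq_pow_finrank (K := ZMod P.r), Nat.card_zmod]

lemma card_point : card P.Point = P.r ^ P.t := by simp [ZMod.card]

lemma sum_mem_submodule (V : Submodule (ZMod P.r) P.Point) :
    ∑ y : P.Point, (if y ∈ V then (1 : ℝ) else 0) = (P.r : ℝ) ^ Module.finrank (ZMod P.r) V := by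
  rw [sum_boole, ← Fintype.card_subtype, ← Nat.card_eq_fintype_card]
  exact_mod_cast (card_submodule P V)

lemma two_le_r : 2 ≤ P.r := P.prime.out.two_le

lemma finrank_inf_hyperplane {V V' : P.Hyperplane} (h : V ≠ V') :
    Module.finrank (ZMod P.r) (V.1 ⊓ V'.1 : Submodule (ZMod P.r) P.Point) + 2 = P.t := by
  have h1 := Submodule.finrank_sup_add_finrank_inf_eq V.1 V'.1
  have h2 : Module.finrank (ZMod P.r) (V.1 ⊔ V'.1 : Submodule _ P.Point) ≤ P.t := by
    simpa using (Submodule.finrank_le (V.1 ⊔ V'.1))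
  have h3 : Module.finrank (ZMod P.r) V.1 < Module.finrank (ZMod P.r) (V.1 ⊔ V'.1 : Submodule _ P.Point) := by
    apply Submodule.finrank_lt_finrank_of_lt; rw [left_lt_sup]; intro hle; apply h
    apply Subtype.ext
    exact (Submodule.eq_of_le_of_finrank_eq hle (by have := V.2; have := V'.2; omega)).symm
  omega

/-- Up to the factor `1 / (r ^ t (r - 1))` the product of two entries is `(1 - r 1_V) (1 - r 1_V')`,
so inner products of rows are determined by the sizes of `V`, `V'` and their intersection. Distinct
hyperplanes meet in codimension two, which makes the sum `r ^ t - 2 r ^ t + r ^ t = 0`. -/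
lemma rotation_mul_transpose : rotation P * (rotation P).transpose = 1 := by classical
  have hr : (2 : ℝ) ≤ P.r := by exact_mod_cast two_le_r P
  ext V V'
  rw [Matrix.mul_apply, Matrix.one_apply]
  have e : ∀ y, rotation P V y * (rotation P).transpose y V' = 1 / (P.r ^ P.t * (P.r - 1)) *
      (1 - P.r * (if y ∈ V.1 then 1 else 0) - P.r * (if y ∈ V'.1 then 1 else 0) +
        P.r ^ 2 * (if y ∈ V.1 ⊓ V'.1 then 1 else 0)) := by
    intro y
    have : 1 / √(P.r ^ P.t * (P.r - 1)) * (1 / √(P.r ^ P.t * (P.r - 1))) =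
        1 / (P.r ^ P.t * (P.r - 1)) := by
      rw [div_mul_div_comm, Real.mul_self_sqrt (mul_pos (by positivity) (by linarith)).le, one_mul]
    simp only [rotation, Matrix.transpose_apply, Matrix.of_apply]; rw [mul_mul_mul_comm, this]
    congr 1; by_cases h1 : y ∈ V.1 <;> by_cases h2 : y ∈ V'.1 <;> simp [h1, h2] <;> ring
  simp_rw [e]
  rw [← mul_sum, Finset.sum_add_distrib, sum_sub_distrib, sum_sub_distrib,
    ← mul_sum, ← mul_sum, ← mul_sum, sum_mem_submodule, sum_mem_submodule,
    sum_mem_submodule]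
  have hc : (∑ _y : P.Point, (1 : ℝ)) = P.r ^ P.t := by simp
  rw [hc]
  obtain ⟨s, hs⟩ : ∃ s, P.t = s + 1 := ⟨_, V.2.symm⟩
  have hV : Module.finrank (ZMod P.r) V.1 = s := by grind
  have hr1 : (P.r : ℝ) - 1 ≠ 0 := by linarith
  rw [hV, (by have := V'.2; omega : Module.finrank _ V'.1 = s)]; by_cases h : V = V'
  · subst h; rw [if_pos rfl, inf_idem, hV, hs]; field_simp; ring
  · rw [if_neg h]; have h2 := finrank_inf_hyperplane P h
    obtain ⟨u, hu⟩ : ∃ u, s = u + 1 := ⟨s - 1, by omega⟩; grind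

lemma rotate_apply (M : P.Row → Fin P.k → P.Point → ℝ) (i : P.Row) (aV : Fin P.k × P.Hyperplane) :
    rotate P M i aV = (rotation P).mulVec (M i aV.1) aV.2 := sum_congr rfl fun _ _ => mul_comm _ _

lemma pi_gaussian_rotate (m : P.Row → Fin P.k → P.Point → ℝ) :
    (piM fun i => piM fun a => piM fun y => gaussianReal (m i a y) 1).map
      (fun M i aV => rotate P M i aV) =
    piM fun i => piM fun aV => gaussianReal (rotate P m i aV) 1 := by
  have hm : Measurable fun x => (rotation P).mulVec x := by
    have : (fun x => (rotation P).mulVec x) =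
      LinearMap.toContinuousLinearMap (rotation P).mulVecLin := rfl
    rw [this]; exact ContinuousLinearMap.measurable _
  have h1 : ∀ i, (piM fun a => piM fun y => gaussianReal (m i a y) 1).map
      (fun x a => (rotation P).mulVec (x a)) =
      piM fun a => piM fun v => gaussianReal ((rotation P).mulVec (m i a) v) 1 := by
    intro i; rw [pi_map_pi fun _ => hm.aemeasurable]; congr 1; funext a
    exact pi_gaussianReal_map_matrix _ (rotation_mul_transpose P) _
  have h2 : ∀ i, (piM fun a => piM fun y => gaussianReal (m i a y) 1).map
      (fun x aV => (rotation P).mulVec (x aV.1) aV.2) =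
      piM fun aV => gaussianReal (rotate P m i aV) 1 := by
    intro i
    have e : (fun (x : Fin P.k → P.Point → ℝ) aV => (rotation P).mulVec (x aV.1) aV.2) =
        uncurry ∘ fun x a => (rotation P).mulVec _ := rfl
    have hu : Measurable (uncurry : _ → Fin P.k × P.Hyperplane → ℝ) :=
      measurable_pi_lambda _ fun x => by fun_prop
    rw [e, ← Measure.map_map hu (by fun_prop), h1, ← pi_curry fun a v => gaussianReal _ 1,
      Measure.map_map hu (by fun_prop)]
    simp_rw [rotate_apply]; exact map_id
  simp_rw [rotate_apply P]
  rw [pi_map_pi fun _ => (measurable_pi_lambda _ fun aV => ((measurable_pi_apply aV.2).comp (hm.comp (measurable_pi_apply (X := fun _ => P.Point → ℝ) aV.1))) : Measurable fun x (aV : Fin P.k × P.Hyperplane) => (rotation P).mulVec _ aV.2).aemeasurable]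
  congr 1; funext i; rw [h2]; simp_rw [rotate_apply P]

lemma measurable_rotate : Measurable fun (M : P.Row → Fin P.k → P.Point → ℝ) i aV => rotate P M i aV := by
  simp_rw [rotate_apply]; fun_prop

/-- The mean vector of sample `j` for given columns and row positions; it vanishes on the filler
rows. -/
def outputMean (m : P.Row → Fin P.k → P.Point → ℝ) (c : P.Cols)
    (ι : P.Row ↪ Fin P.d) (j : Fin P.n) : Fin P.d → ℝ :=
  Function.extend ι (fun i => rotate P m i (c j)) 0

lemma measurable_extend_param {α I D : Type*} [MeasurableSpace α] (ι : I ↪ D)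
    {f : α → I → ℝ} {g : α → D → ℝ} (hf : ∀ i, Measurable fun a => f a i)
    (hg : ∀ i, Measurable fun a => g a i) (d : D) :
    Measurable fun a => Function.extend ι (f a) (g a) d := by
  by_cases h : ∃ i, ι i = d
  · obtain ⟨i, rfl⟩ := h; simp_rw [ι.injective.extend_apply]; simp_all
  simp_all

/-- The rotated entries are independent Gaussians. The chosen columns are distinct and the rows are
embedded, so every output coordinate reads its own rotated entry or its own filler variable. -/
lemma pi_gaussian_bind_permuteOutput (m : P.Row → Fin P.k → P.Point → ℝ) :
    (piM fun i => piM fun a => piM fun y => gaussianReal (m i a y) 1).bind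
      (fun M => permuteOutput P (rotate P M)) =
    unif P.Cols fun c => unif (P.Row ↪ Fin P.d) fun ι =>
      piM fun j => stdGaussianAt (outputMean P m c ι j) := by
  have hg : ∀ (c : P.Cols) (ι : P.Row ↪ Fin P.d),
      Measurable fun x : (P.Row → Fin P.k × P.Hyperplane → ℝ) × (Fin P.n → Fin P.d → ℝ) =>
        (fun j => Function.extend ι (fun i => x.1 i (c j)) (x.2 j) : Fin P.n → Fin P.d → ℝ) := fun c ι =>
    measurable_pi_lambda _ fun j => measurable_pi_lambda _ fun d =>
      measurable_extend_param ι (by fun_prop) (by fun_prop) d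
  have hN : IsProb (isgmNull P.n P.d) := by unfold isgmNull stdGaussianAt; infer_instance
  set F : (P.Row → Fin P.k × P.Hyperplane → ℝ) → Measure _ := fun M => permuteOutput P M with hF
  have hmap : ∀ (c : P.Cols) (ι : P.Row ↪ Fin P.d),
      Measurable fun M : P.Row → Fin P.k × P.Hyperplane → ℝ =>
        (isgmNull P.n P.d).map fun Z => fun j => Function.extend ι (fun i => M i (c j)) (Z j) := fun c ι =>
    measurable_map_param measurable_const (fun _ => hN) (hg c ι)
  have hFm : Measurable F := measurable_unif fun c => measurable_unif fun ι => hmap c ι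
  set rm : P.Row → Fin P.k × P.Hyperplane → ℝ := fun i aV => rotate P m i aV
  have e3 : (piM fun i => piM fun a => piM fun y => gaussianReal _ 1).map
      _ = piM fun i => piM fun aV => gaussianReal (rm i aV) 1 :=
    pi_gaussian_rotate P m
  rw [(rfl : _ = fun M => F fun i aV => rotate P M i aV), ← map_bind (measurable_rotate P) hFm, e3, hF]
  unfold permuteOutput; rw [bind_unif fun c => measurable_unif fun ι => hmap c ι]
  refine unif_congr fun c => ?_; rw [bind_unif fun ι => hmap c ι]; refine unif_congr fun ι => ?_
  rw [← prod_map_eq_bind (hg c ι)]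
  have e1 : isgmNull P.n P.d = piM fun _ => piM fun _ => gaussianReal 0 1 := rfl
  set ν : _ ⊕ _ → Measure ℝ := Sum.elim (fun x => gaussianReal _ 1) fun _ => gaussianReal 0 1 with hν
  have hνp : ∀ z, IsProb (ν z) := by
    rintro (z | z) <;> simp only [hν, Sum.elim_inl, Sum.elim_inr] <;> infer_instance
  set g : Fin P.n → Fin P.d → _ ⊕ _ := fun j =>
    Function.extend ι (fun i => .inl (i, c j)) fun d => .inr _ with hgdef
  have hinj : Injective fun x : Fin P.n × Fin P.d => g x.1 x.2 := by
    rintro ⟨j, d⟩ ⟨j', d'⟩ hh; simp only [hgdef] at hh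
    by_cases h : ∃ i, ι i = d <;> by_cases h' : ∃ i, ι i = d'
    · obtain ⟨i, rfl⟩ := h; obtain ⟨i', rfl⟩ := h'
      rw [ι.injective.extend_apply, ι.injective.extend_apply] at hh
      simp only [Sum.inl.injEq, Prod.mk.injEq] at hh; rw [hh.1, c.injective hh.2]
    · obtain ⟨i, rfl⟩ := h
      rw [ι.injective.extend_apply, extend_apply' _ _ _ h'] at hh; cases hh
    · obtain ⟨i, rfl⟩ := h'
      rw [ι.injective.extend_apply, extend_apply' _ _ _ h] at hh; cases hh
    · rw [extend_apply' _ _ _ h, extend_apply' _ _ _ h'] at hh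
      exact Sum.inr.inj hh
  rw [e1, prod_pi_pi_eq_map, Measure.map_map (hg c ι) (by fun_prop)]
  have e2 : ((fun x =>
        (fun j => Function.extend ι (fun i => x.1 i (c j)) (x.2 j) : Fin P.n → Fin P.d → ℝ)) ∘
      fun ω : _ ⊕ _ → ℝ => ((fun i k => ω (.inl (i, k)), fun i k => ω (.inr (i, k))) :
          _ × _)) =
      fun ω j d => ω (g j d) := by
    funext ω j d; simp only [comp_apply, hgdef]; by_cases h : ∃ i, ι i = d
    · obtain ⟨i, rfl⟩ := h; rw [ι.injective.extend_apply, ι.injective.extend_apply]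
    · rw [extend_apply' _ _ _ h, extend_apply' _ _ _ h]
  rw [e2]; refine (pi_map_injective₂ ν hinj).trans ?_; congr 1; funext j; congr 1; funext d
  simp only [hgdef, outputMean]; by_cases h : ∃ i, ι i = d
  · obtain ⟨i, rfl⟩ := h; rw [ι.injective.extend_apply, ι.injective.extend_apply]; rfl
  · rw [extend_apply' _ _ _ h, extend_apply' _ _ _ h]; rfl

end Rotation

/-! ### Counting hyperplanes by their normal vectors. -/

section Hyperplanes

variable (P : Params)

/-- The orthogonal complement of a vector with respect to the dot product. -/
def dotKer (v : P.Point) : Submodule (ZMod P.r) P.Point :=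
  LinearMap.ker (dotProductEquiv (ZMod P.r) (Fin P.t) v)

lemma mem_dotKer {v y : P.Point} : y ∈ dotKer P v ↔ v ⬝ᵥ y = 0 := by simp [dotKer]

lemma finrank_dotKer {v : P.Point} (hv : v ≠ 0) :
    Module.finrank (ZMod P.r) (dotKer P v) + 1 = P.t := (Module.Dual.finrank_ker_add_one_of_ne_zero (by simp_all)).trans (by simp)

/-- The hyperplane orthogonal to a nonzero vector. -/
def hyper (v : {v : P.Point // v ≠ 0}) : P.Hyperplane := ⟨dotKer P v.1, finrank_dotKer P v.2⟩

lemma hyper_surjective : Surjective (hyper P) := by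
  intro V
  have hlt : V.1 < ⊤ := by
    refine lt_top_iff_ne_top.2 fun h => ?_; have := V.2; rw [h, finrank_top] at this; simp_all
  obtain ⟨f, hf, hle⟩ := Submodule.exists_le_ker_of_lt_top V.1 hlt
  refine ⟨⟨(dotProductEquiv _ _).symm f, by simp_all⟩, ?_⟩; apply Subtype.ext
  refine (Submodule.eq_of_le_of_finrank_eq (by simpa [hyper, dotKer] using hle) ?_).symm; grind

lemma hyper_eq_iff (v w : {v : P.Point // v ≠ 0}) :
    hyper P v = hyper P w ↔ ∃ c : (ZMod P.r)ˣ, w.1 = (c : ZMod P.r) • v.1 := by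
  constructor
  · intro h; have h1 : dotKer P v.1 = dotKer P w.1 := congrArg Subtype.val h
    have h2 := mem_span_of_iInf_ker_le_ker (ι := Unit) (L := fun _ => dotProductEquiv _ _ v.1)
      (K := dotProductEquiv _ _ w.1) (by simpa [dotKer] using h1.le)
    rw [Set.range_const, Submodule.mem_span_singleton] at h2; obtain ⟨c, hc⟩ := h2
    rw [← map_smul] at hc; have hc' := (dotProductEquiv _ _).injective hc
    have hc0 : c ≠ 0 := by
      rintro rfl; exact w.2 (by simp_all)
    exact ⟨Units.mk0 c hc0, by simp_all⟩
  · rintro ⟨c, hc⟩; ext y; simp only [hyper, mem_dotKer]; simp_all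

lemma card_hyper_fiber (V : P.Hyperplane) :
    (univ.filter fun v => hyper P v = V).card = P.r - 1 := by
  obtain ⟨v, rfl⟩ := hyper_surjective P V; rw [← ZMod.card_units P.r, ← Finset.card_univ]; symm
  refine card_bij (fun c _ => ⟨_ • v.1, smul_ne_zero c.ne_zero v.2⟩) ?_ ?_ ?_
  · intro c _; simp; exact ((hyper_eq_iff P _ _).2 ⟨c, rfl⟩).symm
  · intro c _ c' _ h; exact Units.ext (smul_left_injective _ v.2 (congrArg Subtype.val h))
  · intro w hw; simp at hw; obtain ⟨c, hc⟩ := (hyper_eq_iff P _ _).1 hw.symm; grind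

lemma card_hyperplane : card P.Hyperplane * (P.r - 1) + 1 = P.r ^ P.t := by
  have h1 : card {v : P.Point // v ≠ 0} = card P.Hyperplane * (P.r - 1) := by
    rw [← Finset.card_univ, card_eq_sum_card_fiberwise (f := hyper P) (t := univ)
      (by simp)]
    simp [card_hyper_fiber]
  have h2 : card {v : P.Point // v ≠ 0} = card P.Point - 1 := by simp
  have h3 : 0 < card P.Point := Fintype.card_pos; rw [← h1, h2, ← card_point P]; omega

/-- Duality: the hyperplanes through `y` have as their normals, `r - 1` for each, the nonzero
vectors orthogonal to `y`. -/
lemma card_hyperplane_mem {y : P.Point} (hy : y ≠ 0) :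
    P.r * ((univ.filter fun V : P.Hyperplane => y ∈ V.1).card * (P.r - 1) + 1) = P.r ^ P.t := by
  have h1 : (univ.filter fun v => y ∈ (hyper P v).1).card =
      (univ.filter fun V : P.Hyperplane => y ∈ V.1).card * (P.r - 1) := by
    rw [card_eq_sum_card_fiberwise (f := hyper P)
      (t := univ.filter fun V => y ∈ V.1) (by intro v; simp)]
    rw [sum_congr rfl, Finset.sum_const, smul_eq_mul]; intro V hV
    rw [← card_hyper_fiber P V]; congr 1; grind
  have h2 : (univ.filter fun v => y ∈ (hyper P v).1).card + 1 = Nat.card (dotKer P y) := by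
    rw [Nat.card_eq_fintype_card, Fintype.card_subtype,
      ← card_erase_add_one (a := (0 : P.Point)) (by simp)]
    congr 1
    refine card_bij _ (fun v hv => ?_) (fun a _ b _ h => Subtype.ext h) fun v hv => ?_
    · simp [mem_dotKer] at hv ⊢; exact ⟨v.2, by rw [dotProduct_comm]; exact hv⟩
    · simp at hv
      exact ⟨⟨v, hv.1⟩, by
        simp [hyper, mem_dotKer]; rw [dotProduct_comm]; exact hv.2, rfl⟩
  rw [← h1, h2, card_submodule, mul_comm, ← pow_succ]; exact congrArg _ (finrank_dotKer P hy)

end Hyperplanes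

/-! ### Steps 2 to 6 applied to a matrix of independent bits. -/

section Tail

variable (P : Params)

instance : DiscreteMeasurableSpace (P.Row → Fin P.k → P.Point → Bool) := by
  have : Countable (P.Row → Fin P.k → P.Point → Bool) := Finite.to_countable; infer_instance

def Params.iterations : ℕ := ⌈3 * P.δ⁻¹ * log (P.m * (P.k * (P.r : ℝ) ^ P.t))⌉₊

def finish (M₃ : P.Row → Fin P.k → P.Point → ℝ) : Measure (Fin P.n → Fin P.d → ℝ) :=
  permuteOutput P (rotate P M₃)

/-- Steps 2 to 6 of the reduction; `finish` stands for steps 5 and 6. -/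
def padAndFinish (M₁ : P.Row → P.Row → Bool) : Measure (Fin P.n → Fin P.d → ℝ) :=
  (padPermute P M₁).bind fun M₂ => (gaussianize P M₂).bind (finish P)

lemma isProb_isgmNull (n d : ℕ) : IsProb (isgmNull n d) := by
  unfold isgmNull stdGaussianAt; infer_instance

lemma measurable_finish : Measurable (finish P) := by
  refine measurable_unif fun c => measurable_unif fun ι =>
    measurable_map_param measurable_const (fun _ => (isProb_isgmNull P.n P.d)) ?_
  refine measurable_pi_lambda _ fun j => measurable_pi_lambda _ fun d =>
    measurable_extend_param ι (fun i => ?_) (by fun_prop) d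
  exact (measurable_pi_apply _).comp ((measurable_pi_apply i).comp ((measurable_rotate P).comp measurable_fst))

lemma isProb_finish (h1 : Nonempty P.Cols)
    (h2 : Nonempty (P.Row ↪ Fin P.d)) (M : P.Row → Fin P.k → P.Point → ℝ) :
    IsProb (finish P M) := by
  have hN := isProb_isgmNull P.n P.d; refine isProb_unif fun c => isProb_unif fun ι => isProb_map ?_
  exact measurable_pi_lambda _ fun j => measurable_pi_lambda _ fun d =>
    measurable_extend_param ι (by fun_prop) (by fun_prop) d

lemma isProb_gaussianize (hQ : GoodQ P.p P.q P.Q) (M : P.Row → Fin P.k → P.Point → Bool) :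
    IsProb (gaussianize P M) := by
  have := fun B J => isProb_rkG (ν := P.τ) hQ.Q_pos hQ.lt_p hQ.p_le B J; unfold gaussianize
  infer_instance

lemma nonempty_pointEquiv : Nonempty (P.Point ≃ Fin (P.r ^ P.t)) :=
  ⟨Fintype.equivFinOfCardEq (card_point P)⟩

lemma isProb_padPermute (M : P.Row → P.Row → Bool) : IsProb (padPermute P M) := by
  have := nonempty_pointEquiv P
  exact isProb_unif fun σ => isProb_unif fun ρ => isProb_map disc

lemma isProb_padAndFinish (hQ : GoodQ P.p P.q P.Q) (h1 : Nonempty P.Cols)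
    (h2 : Nonempty (P.Row ↪ Fin P.d)) (M : P.Row → P.Row → Bool) :
    IsProb (padAndFinish P M) := by
  have := isProb_padPermute P M; refine isProb_bind disc fun M₂ => ?_
  have := isProb_gaussianize P hQ M₂
  exact isProb_bind (measurable_finish P) (isProb_finish P h1 h2)

/-- An entry of the padded and permuted matrix is elevated. -/
def Hot (pl : P.Row → Prop) (σ : Perm P.Row) (ρ : Fin P.k → (P.Point ≃ Fin (P.r ^ P.t)))
    (i : P.Row) (a : Fin P.k) (y : P.Point) : Prop :=
  pl (σ i) ∧ ∃ h : (ρ a y : ℕ) < P.blockLen, pl (a, ⟨ρ a y, h⟩)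

lemma plantedMatrix_bind_padPermute (pl : P.Row → Prop) : (plantedMatrix P pl).bind (padPermute P) =
      unif (Perm P.Row) fun σ => unif (Fin P.k → (P.Point ≃ Fin (P.r ^ P.t))) fun ρ =>
        piM fun i => piM fun a => piM fun y =>
          coin (if decide (Hot P pl σ ρ i a y) then P.p else P.Q) := by
  rw [plantedMatrix, pi_bind_padPermute]; refine unif_congr fun σ => unif_congr fun ρ => ?_
  congr 1; funext i; congr 1; funext a; congr 1; funext y; simp only [padLaw, Hot]
  by_cases h : (ρ a y) < P.blockLen
  · simp [h]
  grind

/-- The law of the entries of a bit after Gaussianization. -/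
lemma pi_bind_gaussianize (hQ : GoodQ P.p P.q P.Q) (m : P.Row → Fin P.k → P.Point → Measure Bool)
    [∀ i a y, IsProb (m i a y)] :
    (piM fun i => piM fun a => piM fun y => m i a y).bind (gaussianize P) =
      piM fun i => piM fun a => piM fun y =>
        (m i a y).bind fun B => rkG P.p P.Q P.τ B P.iterations := by
  have hp := fun B J => isProb_rkG (ν := P.τ) hQ.Q_pos hQ.lt_p hQ.p_le B J; unfold gaussianize
  rw [pi_bind_pi (κ := fun i (x : Fin P.k → P.Point → Bool) => piM fun a => piM fun y =>
    rkG P.p P.Q P.τ (x a y) _) _ (fun _ => disc) (fun _ _ => inferInstance)]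
  congr 1; funext i
  rw [pi_bind_pi (κ := fun a (x : P.Point → Bool) => piM fun y =>
    rkG P.p P.Q P.τ (x y) _) _ (fun _ => disc) (fun _ _ => inferInstance)]
  congr 1; funext a
  rw [pi_bind_pi (κ := fun y x => rkG P.p P.Q P.τ x _) _ (fun _ => disc)
    (fun _ _ => inferInstance)]
  rfl

/-- Padding, permuting and rotating are exact. The only loss is that of the kernel, `ε` for each of
the `m · k · r ^ t` entries. -/
lemma close_padAndFinish (hQ : GoodQ P.p P.q P.Q) (h1 : Nonempty P.Cols)
    (h2 : Nonempty (P.Row ↪ Fin P.d)) {ε : ℝ≥0∞}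
    (hε : ∀ b : Bool, Close ((coin (if b then P.p else P.Q)).bind fun B => rkG P.p P.Q P.τ B P.iterations)
      (gaussianReal (if b then P.τ else 0) 1) ε) (pl : P.Row → Prop) :
    Close ((plantedMatrix P pl).bind (padAndFinish P))
      (unif (Perm P.Row) fun σ => unif (Fin P.k → (P.Point ≃ Fin (P.r ^ P.t))) fun ρ =>
        unif P.Cols fun c => unif (P.Row ↪ Fin P.d) fun ι =>
          piM fun j => stdGaussianAt
            (outputMean P (fun i a y => if Hot P pl σ ρ i a y then P.τ else 0) c ι j))
      (P.m * (P.k * (P.r ^ P.t * ε))) := by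
  have hne := nonempty_pointEquiv P; unfold padAndFinish; rw [← bind_bind
 disc disc, plantedMatrix_bind_padPermute, unif_bind _ disc]
  refine Close.unif fun σ => ?_; rw [unif_bind _ disc]; refine Close.unif fun ρ => ?_
  rw [← bind_bind disc (measurable_finish P), pi_bind_gaussianize P hQ,
    ← pi_gaussian_bind_permuteOutput]
  refine Close.bind ?_ (measurable_finish P) (isProb_finish P h1 h2)
  have hp' := fun x => isProb_bind (μ := coin x)
    (f := fun B => rkG P.p P.Q P.τ B P.iterations) disc fun B => (fun B J => isProb_rkG hQ.Q_pos hQ.lt_p hQ.p_le B J) B _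
  have e2 : P.m * (P.k * (P.r ^ P.t * ε)) =
      card P.Row * (card (Fin P.k) * (card P.Point * ε)) := by
    rw [(by simp [Params.m] : card P.Row = P.m), card_point, Fintype.card_fin]; simp
  rw [e2]
  refine close_pi_const _ _ fun i => close_pi_const _ _ fun a => close_pi_const _ _ fun y => ?_
  simpa using hε (decide (Hot P pl σ ρ i a y))

end Tail

/-! ### Images of fixed sets and points under random injections and bijections. -/

section Reindex

variable {β : Type*} [MeasurableSpace β]

/-- The inverse makes the fibres compatible with right multiplication, as `unif_comp_of_group`
demands. -/
lemma unif_perm_finset {D k : ℕ} (S₀ : Finset (Fin D)) (hS : S₀.card = k)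
    (f : {S : Finset (Fin D) // S.card = k} → Measure β) :
    (unif (Perm (Fin D)) fun g => f ⟨S₀.map g⁻¹.toEmbedding, by simpa using hS⟩) = unif _ f := by
  refine unif_comp_of_group _ ?_ ?_ f
  · rintro ⟨S, h⟩
    obtain ⟨e⟩ : Nonempty ({x // x ∈ S₀} ≃ {x // x ∈ S}) :=
      ⟨Fintype.equivOfCardEq (by simp_all)⟩
    refine ⟨(e.extendSubtype)⁻¹, Subtype.ext ?_⟩
    refine eq_of_subset_of_card_le (fun x hx => ?_) (by grind); rw [mem_map] at hx
    obtain ⟨y, hy, rfl⟩ := hx; exact e.extendSubtype_mem y hy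
  · intro x y g h
    have e : ∀ z : Perm _, S₀.map (z * g)⁻¹.toEmbedding =
        (S₀.map z⁻¹.toEmbedding).map g⁻¹.toEmbedding := by
      intro z; rw [Finset.map_map]; rfl
    grind

/-- The image of a fixed set under a uniformly random injection is a uniformly random set. -/
lemma unif_embedding_finset {I : Type*} [Fintype I] [DecidableEq I] {D k : ℕ} (A : Finset I)
    (hA : A.card = k) [Nonempty (I ↪ Fin D)] (f : {S : Finset (Fin D) // S.card = k} → Measure β) :
    (unif (I ↪ Fin D) fun ι => f ⟨A.map ι, by simpa using hA⟩) = unif _ f := by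
  have h1 : ∀ g : Perm _, (unif _ fun ι => f ⟨A.map ι, by grind⟩) =
      unif _ fun ι => f ⟨(A.map ι).map g⁻¹.toEmbedding, by grind⟩ := by
    intro g; rw [← unif_equiv (Equiv.embeddingCongr (Equiv.refl I) g⁻¹)]
    refine unif_congr fun ι => ?_; congr 2; rw [Finset.map_map]; rfl
  -- Composing with an independent random permutation does not change the law of the injection, and
  -- for a fixed injection the permutation alone makes the image uniform.
  have h2 : (unif _ fun ι => f ⟨A.map ι, by grind⟩) = unif (Perm _) fun g =>
        unif _ fun ι => f ⟨(A.map ι).map g⁻¹.toEmbedding, by grind⟩ := by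
    rw [← unif_congr h1, unif_const]
  rw [h2, unif_comm, unif_congr (fun ι => unif_perm_finset _ (by grind) f), unif_const]

/-- The preimages of fixed elements under uniformly random bijections are uniformly random. -/
lemma unif_equiv_symm {A U V : Type*} [Fintype A] [DecidableEq A] [Fintype U] [DecidableEq U]
    [Fintype V] [DecidableEq V] [Nonempty (U ≃ V)] (x : A → V) (f : (A → U) → Measure β) :
    (unif (A → (U ≃ V)) fun ρ => f fun a => (ρ a).symm (x a)) = unif (A → U) f := by
  obtain ⟨e⟩ := (inferInstance : Nonempty (U ≃ V))
  have h1 : (unif (A → (U ≃ V)) fun ρ => f fun a => (ρ a).symm (x a)) =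
      unif (A → Perm U) fun g => f fun a => (g a)⁻¹ (e.symm (x a)) := by
    rw [← unif_equiv (Equiv.piCongrRight fun _ => Equiv.equivCongr (Equiv.refl U) e)]; rfl
  rw [h1]; refine unif_comp_of_group _ ?_ ?_ f
  · intro y; refine ⟨fun a => Equiv.swap (y a) (e.symm (x a)), funext fun a => ?_⟩; simp
  · intro g g' g₀ h; funext a; have := congrFun h a; simp_all

end Reindex

/-! ### The output in terms of the labels of its samples. -/

section Output

variable (P : Params)

/-- The law of an output sample with a given label. -/
def labelled (S : Finset (Fin P.d)) (b : Bool) : Measure (Fin P.d → ℝ) :=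
  stdGaussianAt fun i => if i ∈ S then (if b then isgmOther P.μ (1 / (P.r : ℝ)) else P.μ) else 0

instance (S : Finset (Fin P.d)) (b : Bool) : IsProb (labelled P S b) := by
  unfold labelled stdGaussianAt; infer_instance

/-- The labels of the output samples. -/
def columnLabels (Y : Fin P.k → P.Point) (c : P.Cols) (j : Fin P.n) : Bool :=
  decide (Y (c j).1 ∈ (c j).2.1)

/-- The factor `√(r ^ t (r - 1))` in `τ` cancels the normalization of the matrix, and for `ε = 1 /
r` the second mean is `μ' = (1 - r) μ`. -/
lemma rotation_mul_τ (V : P.Hyperplane) (y : P.Point) [Decidable (y ∈ V.1)] :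
    rotation P V y * P.τ = if y ∈ V.1 then isgmOther P.μ (1 / (P.r : ℝ)) else P.μ := by
  have hr : (2 : ℝ) ≤ P.r := by exact_mod_cast two_le_r P
  have hR : 0 < √(_ ^ P.t * (P.r - 1)) := Real.sqrt_pos.2 (mul_pos (by positivity) (by linarith))
  simp only [rotation, Matrix.of_apply, Params.τ, isgmOther]; grind

/-- In each part a planted row has a single elevated entry, so its image is `τ` times one column of
the matrix. All planted rows thus share the mean, `μ'` or `μ` according to whether the point of the
part lies on the hyperplane of the sample. -/
lemma outputMean_planted (hR : P.blockLen ≤ P.r ^ P.t) (X : Fin P.k → Fin P.blockLen)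
    (σ : Perm P.Row) (ρ : Fin P.k → (P.Point ≃ Fin (P.r ^ P.t)))
    (c : P.Cols) (ι : P.Row ↪ Fin P.d) (j : Fin P.n) :
    outputMean P (fun i a y => if Hot P (fun i => i.2 = X i.1) σ ρ i a y then P.τ else 0) c ι j =
      fun i => if i ∈ (univ.filter fun i : P.Row => (σ i).2 = X (σ i).1).map ι then
        (if columnLabels P (fun a => (ρ a).symm (Fin.castLE hR (X a))) c j then
          isgmOther P.μ (1 / (P.r : ℝ)) else P.μ) else 0 := by
  funext i; unfold outputMean; by_cases h : ∃ i', ι i' = i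
  · obtain ⟨i, rfl⟩ := h; rw [ι.injective.extend_apply, rotate_apply, Matrix.mulVec, dotProduct]
    simp only [mem_map', mem_filter_univ]
    have hh : ∀ y, Hot P (fun i => i.2 = X i.1) σ ρ i (c j).1 y ↔ (σ i).2 = X (σ i).1 ∧
        y = (ρ (c j).1).symm (Fin.castLE hR (X (c j).1)) := by
      intro y; refine and_congr_right fun _ => ?_; rw [Equiv.eq_symm_apply]; grind
    by_cases hi : (σ i).2 = X (σ i).1
    · rw [if_pos hi]
      have e : ∀ y, (rotation P (c j).2 y *
          if Hot P (fun i => i.2 = X i.1) σ ρ i (c j).1 y then P.τ else 0) =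
          if y = (ρ (c j).1).symm (Fin.castLE hR (X (c j).1)) then rotation P (c j).2 y * P.τ else 0 := by
        grind
      rw [sum_congr rfl fun y _ => e y, sum_ite_eq' univ]
      simp only [mem_univ, columnLabels, decide_eq_true_eq]; exact rotation_mul_τ P _ _
    simp_all
  simp_all

/-- The sources of randomness separate: `ι` makes the support uniform, `ρ` makes the elevated points
`Y` uniform and independent, `c` selects the columns, and `σ` no longer affects the law. -/
lemma unif_output_planted (hR : P.blockLen ≤ P.r ^ P.t) (h2 : Nonempty (P.Row ↪ Fin P.d))
    (X : Fin P.k → Fin P.blockLen) :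
    (unif (Equiv.Perm P.Row) fun σ => unif (Fin P.k → (P.Point ≃ Fin (P.r ^ P.t))) fun ρ =>
        unif P.Cols fun c => unif (P.Row ↪ Fin P.d) fun ι =>
          Measure.pi fun j => stdGaussianAt (outputMean P (fun i a y =>
            if Hot P (fun i => i.2 = X i.1) σ ρ i a y then P.τ else 0) c ι j)) =
      unif {S : Finset (Fin P.d) // S.card = P.k} fun S => unif (Fin P.k → P.Point) fun Y =>
        unif P.Cols fun c =>
          Measure.pi fun j => labelled P S.1 (columnLabels P Y c j) := by
  have hne := nonempty_pointEquiv P; simp_rw [outputMean_planted P hR]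
  have key : ∀ σ : Equiv.Perm P.Row, (unif (Fin P.k → (P.Point ≃ Fin _)) fun ρ =>
        unif _ fun c => unif _ fun ι => Measure.pi fun j => stdGaussianAt fun i =>
            if i ∈ (Finset.univ.filter fun i => (σ i).2 = X (σ i).1).map ι then
              (if columnLabels P (fun a => (ρ a).symm (Fin.castLE hR (X a))) c j then
                isgmOther P.μ (1 / P.r) else P.μ) else 0) =
      unif {S : Finset _ // S.card = P.k} fun S => unif _ fun Y => unif _ fun c =>
          Measure.pi fun j => labelled P S.1 (columnLabels P Y c j) := by
    intro σ
    have hcard : (Finset.univ.filter fun i => (σ i).2 = X (σ i).1).card = P.k := by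
      rw [← Finset.card_map σ.toEmbedding]
      have : (Finset.univ.filter fun i => (σ i).2 = X (σ i).1).map σ.toEmbedding =
          Finset.univ.map ⟨fun a => ((a, X a)), fun a b h => (Prod.mk.inj h).1⟩ := by
        ext x; simp only [Finset.mem_map, Finset.mem_filter, Finset.mem_univ, true_and]
        constructor
        · rintro ⟨y, hy, rfl⟩; exact ⟨(σ y).1, Prod.ext rfl hy.symm⟩
        · rintro ⟨a, rfl⟩; exact ⟨σ.symm (a, X a), by simp, by simp; rfl⟩
      simp_all
    rw [unif_equiv_symm _ fun Y => unif _ fun c => unif _ fun ι =>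
          Measure.pi fun j => stdGaussianAt fun i =>
            if i ∈ (Finset.univ.filter fun i => (σ i).2 = X (σ i).1).map ι then
              (if columnLabels P Y c j then isgmOther P.μ _ else P.μ) else 0]
    rw [unif_comm (A := {S : Finset _ // S.card = P.k})]; refine unif_congr fun Y => ?_
    rw [unif_comm (A := {S : Finset _ // S.card = P.k})]; refine unif_congr fun c => ?_
    exact unif_embedding_finset _ hcard fun S => Measure.pi fun j => labelled P S.1 (columnLabels P Y c j)
  rw [unif_congr key, unif_const]

lemma unif_output_null (h1 : Nonempty P.Cols)
    (h2 : Nonempty (P.Row ↪ Fin P.d)) :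
    (unif (Perm P.Row) fun σ => unif (Fin P.k → (P.Point ≃ Fin (P.r ^ P.t))) fun ρ =>
        unif P.Cols fun c => unif (P.Row ↪ Fin P.d) fun ι =>
          piM fun j => stdGaussianAt (outputMean P (fun i a y =>
            if Hot P (fun _ => False) σ ρ i a y then P.τ else 0) c ι j)) = isgmNull P.n P.d := by
  have hne := nonempty_pointEquiv P
  have key : ∀ σ ρ c ι j, outputMean P (fun i a y =>
            if Hot P (fun _ => False) σ ρ i a y then P.τ else 0) c ι j = 0 := by
    intro σ ρ c ι j; funext d; unfold outputMean; by_cases h : ∃ i', ι i' = d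
    · obtain ⟨i, rfl⟩ := h; rw [ι.injective.extend_apply, rotate_apply, Matrix.mulVec, dotProduct]
      simp [Hot]
    simp_all
  simp_rw [key]; rw [unif_const, unif_const, unif_const, unif_const]; rfl

lemma mix_eq_coin_bind {α : Type*} [MeasurableSpace α] {ε : ℝ} (h0 : 0 ≤ ε) (h1 : ε ≤ 1)
    (D : Bool → Measure α) : mix ε (D false) (D true) = (coin ε).bind D := by
  ext s hs; rw [Measure.bind_apply hs disc.aemeasurable, coin_eq, prob_coe h0 h1]
  simp [mix, add_comm]

lemma isgmPlanted_eq : isgmPlanted P.n P.k P.d P.μ (1 / (P.r : ℝ)) =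
    unif {S : Finset (Fin P.d) // S.card = P.k} fun S =>
      (piM fun _ : Fin P.n => coin (1 / (P.r : ℝ))).bind fun b =>
        piM fun j => labelled P S.1 (b j) := by
  have hr : (2 : ℝ) ≤ P.r := by exact_mod_cast two_le_r P
  refine unif_congr fun S => ?_
  rw [pi_bind_pi _ (fun _ => disc) fun _ _ => inferInstance, ← mix_eq_coin_bind (by simp) ((div_le_one (by linarith)).2 (by linarith))]
  simp [labelled]

/-- The output under the planted hypothesis is close to the target if the labels are close to
independent coins. -/
lemma close_output_planted  (hS : Nonempty {S : Finset (Fin P.d) // S.card = P.k}) {ε : ℝ≥0∞}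
    (hε : Close (unif (Fin P.k → P.Point) fun Y => unif P.Cols fun c =>
      dirac (columnLabels P Y c)) (piM fun _ : Fin P.n => coin (1 / (P.r : ℝ))) ε) :
    Close (unif {S : Finset (Fin P.d) // S.card = P.k} fun S => unif (Fin P.k → P.Point) fun Y =>
        unif P.Cols fun c =>
          piM fun j => labelled P S.1 (columnLabels P Y c j))
      (isgmPlanted P.n P.k P.d P.μ (1 / (P.r : ℝ))) ε := by
  rw [isgmPlanted_eq]; refine Close.unif fun S => ?_
  have := hε.bind (κ := fun b => piM fun j => labelled P S.1 (b j)) disc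
    fun b => inferInstance
  simp_rw [unif_bind _ disc, dirac_bind disc] at this; grind

end Output

/-! ### Draws without replacement and relative entropy. -/

section Urn

variable {κ : Type*} [Fintype κ] (g : κ → Bool)

lemma cnt_cons {n : ℕ} (β : Bool) (b : Fin n → Bool) :
    cnt (Fin.cons β b : Fin (n + 1) → Bool) = cnt b + if β then 1 else 0 := by
  simp only [cnt, card_filter, Fin.sum_univ_succ]
  cases β <;> simp [add_comm]

/-- The mean of a function of the labels of `n` items that are drawn without replacement. -/
def urnMean (n : ℕ) (F : (Fin n → Bool) → ℝ) : ℝ :=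
  (∑ c : Fin n ↪ κ, F fun j => g (c j)) / card (Fin n ↪ κ)

/-- The conditional probability of the label of the next item. -/
def urnWeight (n : ℕ) (b : Fin n → Bool) : ℝ :=
  ((univ.filter fun x => g x = true).card - cnt b) / (card κ - n)

lemma urnMean_mono {n : ℕ} {F G : (Fin n → Bool) → ℝ}
    (h : ∀ c : Fin n ↪ κ, F (fun j => g (c j)) ≤ G fun j => g (c j)) :
    urnMean g n F ≤ urnMean g n G := by
  unfold urnMean; gcongr with c; exact h c

lemma urnMean_add {n : ℕ} (F G : (Fin n → Bool) → ℝ) :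
    urnMean g n (fun b => F b + G b) = urnMean g n F + urnMean g n G := by
  simp [urnMean, Finset.sum_add_distrib, add_div]

lemma urnMean_const_mul {n : ℕ} (a : ℝ) (F : (Fin n → Bool) → ℝ) :
    urnMean g n (fun b => a * F b) = a * urnMean g n F := by
  simp [urnMean, ← mul_sum, mul_div_assoc]

lemma urnMean_const {n : ℕ} (hn : n ≤ card κ) (a : ℝ) : urnMean g n (fun _ => a) = a := by
  simp [urnMean]; simp_all

lemma cnt_comp_embedding {n : ℕ} (c : Fin n ↪ κ) (β : Bool) :
    (univ.filter fun x => x ∉ Set.range c ∧ g x = β).card +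
      (univ.filter fun j => g (c j) = β).card = (univ.filter fun x => g x = β).card := by
  have h : (univ.filter fun j => g (c j) = β).card =
      (univ.filter fun x => x ∈ Set.range c ∧ g x = β).card := by
    rw [← card_map c]; congr 1; grind
  rw [h, add_comm, ← card_filter_add_card_filter_not (s := univ.filter fun x => g x = β)
    (p := fun x => x ∈ Set.range c), filter_filter, filter_filter]
  simp_rw [and_comm]

lemma cnt_add_cnt_not {n : ℕ} (b : Fin n → Bool) :
    cnt b + (univ.filter fun j => b j = false).card = n := by
  simpa [cnt] using (card_filter_add_card_filter_not (s := univ) (p := fun j => b j = true))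

lemma urnWeight_mem {n : ℕ} (hn : n < card κ) (c : Fin n ↪ κ) :
    0 ≤ urnWeight g n (fun j => g (c j)) ∧ 0 ≤ 1 - urnWeight g n fun j => g (c j) := by
  have h1 := cnt_comp_embedding g c true; have h2 := cnt_comp_embedding g c false
  have h3 := cnt_add_cnt_not fun j => g (c j)
  have h4 := card_filter_add_card_filter_not (s := univ) (p := fun x => g x = true)
  simp at h4
  have hc : cnt (fun j => g (c j)) = (univ.filter fun j => g _ = true).card := rfl
  have h0 : (0 : ℝ) < card κ - n := by simp_all
  unfold urnWeight
  constructor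
  · refine div_nonneg ?_ h0.le
    have : (cnt fun j => g (c j)) ≤ (univ.filter fun x => g x = true).card := by omega
    simp_all
  · rw [one_sub_div h0.ne']; refine div_nonneg ?_ h0.le
    have : (univ.filter fun x => g x = true).card + n ≤ card κ + cnt fun j => g (c j) := by
      omega
    have : ((univ.filter fun x => g x = true).card : ℝ) + n ≤
        card κ + (cnt fun j => g (c j) : ℕ) := by exact_mod_cast this
    linarith

/-- The item in position `0` is treated as the one drawn last: given the `n` others it is uniform
among the remaining `card κ - n` items. -/
lemma urnMean_succ {n : ℕ} (hn : n < card κ) (F : (Fin (n + 1) → Bool) → ℝ) :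
    urnMean g (n + 1) F = urnMean g n fun b =>
      urnWeight g n b * F (Fin.cons true b) + (1 - urnWeight g n b) * F (Fin.cons false b) := by
  classical
  have h0 : (card κ : ℝ) - n ≠ 0 := by
    have : (n : ℝ) < card κ := by simp_all
    linarith
  have e1 : (card (Fin (n + 1) ↪ κ) : ℝ) = (card κ - n) * card (Fin n ↪ κ) := by
    rw [Fintype.card_embedding_eq, Fintype.card_embedding_eq, Fintype.card_fin, Fintype.card_fin,
      Nat.descFactorial_succ, Nat.cast_mul, Nat.cast_sub hn.le]
  have e2 : ∑ c : Fin _ ↪ κ, F (fun j => g (c j)) = ∑ c : Fin n ↪ κ, (card κ - n) *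
      (urnWeight g n (fun j => g (c j)) * F (Fin.cons true fun j => g (c j)) +
        (1 - urnWeight g n (fun j => g (c j))) * F (Fin.cons false fun j => g (c j))) := by
    rw [← (Equiv.embeddingFinSucc n κ).symm.sum_comp, Fintype.sum_sigma]
    refine sum_congr rfl fun c _ => ?_
    have e3 : ∀ x : {x // x ∉ Set.range c}, (fun j => g ((Equiv.embeddingFinSucc n κ).symm ⟨c, x⟩ j)) =
        Fin.cons (g x.1) fun j => g (c j) := by
      intro x; funext j; refine Fin.cases ?_ (fun j => ?_) j <;> simp
    simp_rw [e3]
    rw [← sum_subtype (univ.filter fun x => x ∉ Set.range c) (by simp)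
      (f := fun x => F (Fin.cons _ fun j => g (c j)))]
    have e4 : ∀ x, F (Fin.cons (g x) fun j => g (c j)) =
        (if g x = true then F (Fin.cons true fun j => g (c j)) else 0) +
        (if g x = false then F (Fin.cons false fun j => g (c j)) else 0) := by
      grind
    simp_rw [e4]
    rw [Finset.sum_add_distrib, ← sum_filter, ← sum_filter, filter_filter,
      filter_filter, Finset.sum_const, Finset.sum_const, nsmul_eq_mul, nsmul_eq_mul]
    have h2 := cnt_comp_embedding g c false; have h3 := cnt_add_cnt_not fun j => g (c j)
    have h4 := card_filter_add_card_filter_not (s := univ) (p := fun x => g x = true)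
    simp at h4
    have hc : cnt (fun j => g (c j)) = (univ.filter fun j => g _ = true).card := rfl
    unfold urnWeight
    have h5 : ((univ.filter fun x => x ∉ Set.range c ∧ g x = true).card : ℝ) =
        (univ.filter fun x => g x = true).card - (cnt fun j => g (c j) : ℕ) := by
      rw [← (cnt_comp_embedding g c true), hc]; simp
    have h6 : ((univ.filter fun x => x ∉ Set.range c ∧ g x = false).card : ℝ) =
        card κ - n - ((univ.filter fun x => g x = true).card - (cnt fun j => g (c j) : ℕ)) := by
      have : ((univ.filter fun x => x ∉ Set.range c ∧ g x = false).card : ℝ) + n +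
        (univ.filter fun x => g x = true).card = card κ + (cnt fun j => g (c j) : ℕ) := by
        exact_mod_cast (by omega)
      linarith
    grind
  rw [urnMean, e2, e1, ← mul_sum, mul_div_mul_left _ _ h0]; rfl

def urnFrac : ℝ := (univ.filter fun x => g x = true).card / card κ

lemma urnWeight_eq {n : ℕ} (hn : n < card κ) (b : Fin n → Bool) :
    urnWeight g n b = urnFrac g - (cnt b - n * urnFrac g) / (card κ - n) := by
  have h1 : (n : ℝ) < card κ := by simp_all
  unfold urnWeight urnFrac; grind

lemma urnFrac_mem : 0 ≤ urnFrac g ∧ urnFrac g ≤ 1 := by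
  unfold urnFrac; refine ⟨by positivity, div_le_one_of_le₀ ?_ (by simp)⟩
  exact_mod_cast card_le_univ _

/-- Hypergeometric moments by induction over the draws. By `urnWeight_eq` a surplus of ones makes
the next one less likely; this negative feedback keeps the variance below the binomial one. -/
lemma urnMean_moments {n : ℕ} (hn : n ≤ card κ) :
    urnMean g n (fun b => cnt b - n * urnFrac g) = 0 ∧
      urnMean g n (fun b => (cnt b - n * urnFrac g) ^ 2) ≤ n * (urnFrac g * (1 - urnFrac g)) := by
  induction n with
  | zero => simp [urnMean, cnt]
  | succ n ih =>
    have hn' : n < card κ := hn; obtain ⟨ih1, ih2⟩ := ih hn'.le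
    have h0 : (0 : ℝ) < card κ - n := by simp_all
    constructor
    · rw [urnMean_succ g hn']
      have e : urnMean g n (fun b =>
          urnWeight g n b * ((cnt (Fin.cons true b)) - (n + 1 : ℕ) * urnFrac g) +
          (1 - urnWeight g n b) * ((cnt (Fin.cons false b)) - (n + 1 : ℕ) * urnFrac g)) =
          urnMean g n fun b => (1 - 1 / (card κ - n)) * ((cnt b) - n * urnFrac g) := by
        simp only [cnt_cons, urnWeight_eq g hn']; grind
      rw [e, urnMean_const_mul, ih1, mul_zero]
    · rw [urnMean_succ g hn']
      have e : urnMean g n (fun b =>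
          urnWeight g n b * ((cnt (Fin.cons true b)) - (n + 1 : ℕ) * urnFrac g) ^ 2 +
          (1 - urnWeight g n b) * ((cnt (Fin.cons false b)) - (n + 1 : ℕ) * urnFrac g) ^ 2) ≤
          urnMean g n (fun b => (((cnt b) - n * urnFrac g) ^ 2 +
            (-(1 - 2 * urnFrac g) / (card κ - n)) * ((cnt b) - n * urnFrac g)) +
            urnFrac g * (1 - urnFrac g)) := by
        refine urnMean_mono g fun c => ?_; simp only [cnt_cons, urnWeight_eq g hn']
        set X : ℝ := _ - n * urnFrac g; have : 0 ≤ X ^ 2 / (card κ - n) := by positivity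
        grind
      refine e.trans ?_
      rw [urnMean_add, urnMean_add, urnMean_const_mul, ih1, urnMean_const g hn'.le]; grind

def urnProb (n : ℕ) (b : Fin n → Bool) : ℝ := urnMean g n fun b' => if b' = b then 1 else 0

/-- The probability of a sequence of independent bits. -/
def coinProb (ε : ℝ) {n : ℕ} (b : Fin n → Bool) : ℝ := ∏ j, if b j then ε else 1 - ε

lemma coinProb_cons (ε : ℝ) {n : ℕ} (β : Bool) (b : Fin n → Bool) :
    coinProb ε (Fin.cons β b : Fin (n + 1) → Bool) = (if β then ε else 1 - ε) * coinProb ε b := by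
  simp [coinProb, Fin.prod_univ_succ]

lemma coinProb_pos {ε : ℝ} (h0 : 0 < ε) (h1 : ε < 1) {n : ℕ} (b : Fin n → Bool) : 0 < coinProb ε b :=
  prod_pos fun j _ => by grind

lemma urnProb_nonneg {n : ℕ} (b : Fin n → Bool) : 0 ≤ urnProb g n b := by
  refine div_nonneg (sum_nonneg fun c _ => ?_) (by simp); grind

lemma urnProb_pos {n : ℕ} (c : Fin n ↪ κ) : 0 < urnProb g n fun j => g (c j) := by
  have : Nonempty _ := ⟨c⟩
  refine div_pos (sum_pos' (fun c _ => ?_) ⟨c, mem_univ _, ?_⟩) (by exact_mod_cast Fintype.card_pos)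
  · grind
  · simp

lemma urnMean_eq_sum {n : ℕ} (F : (Fin n → Bool) → ℝ) : urnMean g n F = ∑ b, urnProb g n b * F b := by
  unfold urnProb urnMean; simp_rw [div_mul_eq_mul_div, ← sum_div, sum_mul]
  rw [Finset.sum_comm]; simp

lemma urnProb_cons {n : ℕ} (hn : n < card κ) (β : Bool) (b : Fin n → Bool) :
    urnProb g (n + 1) (Fin.cons β b) =
      urnProb g n b * if β then urnWeight g n b else 1 - urnWeight g n b := by
  rw [urnProb, urnMean_succ g hn, urnMean_eq_sum, sum_eq_single b]
  · cases β <;> simp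
  · simp_all
  · simp

/-- The relative entropy of the labels with respect to independent bits. -/
def urnEntropy (ε : ℝ) (n : ℕ) : ℝ := urnMean g n fun b => log (urnProb g n b / coinProb ε b)

lemma mul_log_div_le {w e : ℝ} (hw : 0 ≤ w) (he : 0 < e) : w * log (w / e) ≤ w * (w / e - 1) := by
  rcases hw.eq_or_lt with rfl | hw
  · simp
  · gcongr; exact Real.log_le_sub_one_of_pos (by simp_all)

/-- Chain rule: a draw adds the relative entropy of a coin of bias `W`, its conditional probability,
which is at most `(W - ε) ^ 2 / (ε (1 - ε))` because `log x ≤ x - 1`. With `f = urnFrac g` and `K =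
card κ`, the mean of `(W - ε) ^ 2` is `(f - ε) ^ 2` plus the variance of `W`, at most `n f (1 - f) /
(K - n) ^ 2`, and `K - n ≥ K / 2`. The number `N` stays fixed during the induction, so that every
draw is charged the same amount. -/
lemma urnEntropy_le {ε : ℝ} (h0 : 0 < ε) (h1 : ε < 1) {n N : ℕ} (hN : n ≤ N)
    (hK : 2 * N ≤ card κ) (hK0 : 0 < card κ) :
    urnEntropy g ε n ≤ n * (((urnFrac g - ε) ^ 2 + 4 * N * (urnFrac g * (1 - urnFrac g)) /
      (card κ) ^ 2) / (ε * (1 - ε))) := by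
  induction n with
  | zero => simp [urnEntropy, urnMean, coinProb, urnProb, eq_iff_true_of_subsingleton]
  | succ n ih =>
    have hn' : n < card κ := by omega
    have ih := ih (by omega)
    have hε : 0 < 1 - ε := by linarith
    obtain ⟨m1, m2⟩ := urnMean_moments g hn'.le
    have e : urnMean g n (fun b =>
        urnWeight g n b * log (urnProb g _ (Fin.cons true b) / coinProb ε (Fin.cons true b)) +
        (1 - urnWeight g n b) * log (urnProb g _ (Fin.cons false b) / coinProb ε (Fin.cons false b))) ≤
        urnMean g n (fun b => log (urnProb g n b / coinProb ε b) + 1 / (ε * (1 - ε)) * (((urnFrac g - ε) ^ 2 +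
          (-2 * (urnFrac g - ε) / (card κ - n)) * (cnt b - n * urnFrac g)) +
          1 / (card κ - n) ^ 2 * (cnt b - n * urnFrac g) ^ 2)) := by
      refine urnMean_mono g fun c => ?_; obtain ⟨w0, w1⟩ := urnWeight_mem g hn' c
      have q0 := urnProb_pos g c; have p0 := coinProb_pos h0 h1 (fun j => g (c j))
      simp only [urnProb_cons g hn', coinProb_cons, if_true, Bool.false_eq_true, if_false]
      have split : ∀ w e : ℝ, 0 ≤ w → 0 < e →
          w * log (urnProb g n (fun j => g (c j)) * w / (e * coinProb ε fun j => g (c j))) =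
          w * log (urnProb g n (fun j => g (c j)) / coinProb ε fun j => g (c j)) +
            w * log (w / e) := by
        intro w e hw he; rcases hw.eq_or_lt with rfl | hw
        · simp
        · rw [← mul_add, ← Real.log_mul (by positivity) (by positivity)]; field_simp
      rw [split _ _ w0 h0, split _ _ w1 hε]; have b1 := mul_log_div_le w0 h0
      have b2 := mul_log_div_le w1 hε; have hw := urnWeight_eq g hn' (fun j => g (c j))
      set W := urnWeight g n fun j => g _
      have e1 : W * (W / ε - 1) + (1 - W) * ((1 - W) / (1 - ε) - 1) =
          1 / (ε * (1 - ε)) * (W - ε) ^ 2 := by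
        field_simp; ring
      have e2 : (W - ε) ^ 2 = ((urnFrac g - ε) ^ 2 +
          (-2 * (urnFrac g - ε) / (card κ - n)) * (cnt (fun j => g (c j)) - n * urnFrac g)) +
          1 / (card κ - n) ^ 2 * (cnt (fun j => g (c j)) - n * urnFrac g) ^ 2 := by
        have : (card κ : ℝ) - n ≠ 0 := by
          have : (n : ℝ) < card κ := by exact_mod_cast hn'
          linarith
        rw [hw]; field_simp; ring
      rw [← e2]; linarith
    have hstep := e
    rw [← urnMean_succ g hn' fun b => log (urnProb g _ b / coinProb ε b), urnMean_add,
      urnMean_const_mul, urnMean_add, urnMean_add, urnMean_const_mul, urnMean_const_mul, m1,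
      urnMean_const g hn'.le, mul_zero, add_zero] at hstep
    have hf := urnFrac_mem g
    have hv : 0 ≤ urnFrac g * (1 - urnFrac g) := mul_nonneg hf.1 (by linarith [hf.2])
    have hK2 : (card κ : ℝ) / 2 ≤ card κ - n := by
      have : 2 * (n : ℝ) ≤ card κ := by exact_mod_cast (by omega)
      linarith
    have hnN : n ≤ N := by exact_mod_cast (by omega)
    have hlast : 1 / ((card κ) - n) ^ 2 * urnMean g n (fun b => (cnt b - n * urnFrac g) ^ 2) ≤
        4 * N * (urnFrac g * (1 - urnFrac g)) / (card κ) ^ 2 := by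
      calc _ ≤ 1 / ((card κ : ℝ) / 2) ^ 2 * (N * _) := by
            gcongr
            · exact div_nonneg (sum_nonneg fun c _ => sq_nonneg _) (by positivity)
            · exact m2.trans (by gcongr)
        _ = _ := by field_simp; ring
    change urnEntropy g ε _ ≤ urnEntropy g ε n + _ at hstep
    calc _ ≤ _ := hstep
      _ ≤ n * _ + 1 / _ * (_ ^ 2 + 4 * N * _ / _ ^ 2) := by gcongr
      _ = _ := by push_cast; ring

lemma sum_coinProb {ε : ℝ} (n : ℕ) : ∑ b : Fin n → Bool, coinProb ε b = 1 := by
  unfold coinProb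
  have := prod_univ_sum (fun _ : Fin n => (univ : Finset Bool))
    (fun _ b => if b then ε else 1 - ε)
  rw [Fintype.piFinset_univ] at this; rw [← this]; simp

lemma sum_urnProb {n : ℕ} (hn : n ≤ card κ) : ∑ b : Fin n → Bool, urnProb g n b = 1 := by
  have := urnMean_eq_sum g (n := n) fun _ => 1; rw [urnMean_const g hn] at this; grind

/-- Through the Hellinger distance: `1 + x ≤ exp x` bounds the affinity `∑ √q √p` below by one minus
half the entropy, so `∑ (√q - √p) ^ 2` is at most the entropy. Cauchy-Schwarz with `∑ (√q + √p) ^ 2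
≤ 4` does the rest. -/
lemma sum_urnProb_sub_le {ε : ℝ} (h0 : 0 < ε) (h1 : ε < 1) {n : ℕ} (hn : n ≤ card κ)
    (s : Finset (Fin n → Bool)) :
    ∑ b ∈ s, urnProb g n b ≤ ∑ b ∈ s, coinProb ε b + 2 * √(urnEntropy g ε n) := by
  have p0 : ∀ b : Fin n → Bool, 0 < coinProb ε b := fun b => coinProb_pos h0 h1 b
  have q0 : ∀ b : Fin n → Bool, 0 ≤ urnProb g n b := fun b => urnProb_nonneg g b
  have hA : 1 - urnEntropy g ε n / 2 ≤ ∑ b, √(urnProb g n b) * √(coinProb ε b) := by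
    have e1 : 1 - urnEntropy g ε n / 2 = ∑ b : Fin n → Bool, urnProb g n b *
        (1 + -(1 / 2) * log (urnProb g n b / coinProb ε b)) := by
      rw [← urnMean_eq_sum, urnMean_add, urnMean_const g hn, urnMean_const_mul]
      simp only [urnEntropy]; ring
    rw [e1]; refine sum_le_sum fun b _ => ?_; rcases (q0 b).eq_or_lt with h | h
    · rw [← h]; simp
    · have h2 : √(urnProb g n b) * √(coinProb ε b) =
          urnProb g n b * exp (-(1 / 2) * log (urnProb g n b / coinProb ε b)) := by
        have : exp (-(1 / 2) * log (urnProb g n b / coinProb ε b)) =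
            √(coinProb ε b) / √(urnProb g n b) := by
          rw [mul_comm, ← Real.rpow_def_of_pos (by have := p0 b; positivity), Real.rpow_neg (by have := p0 b; positivity),
            ← Real.sqrt_eq_rpow, Real.sqrt_div h.le, inv_div]
        rw [this, mul_div_assoc', eq_div_iff ((Real.sqrt_pos.2 h).ne'), mul_right_comm, (Real.mul_self_sqrt h.le)]
      rw [h2]; gcongr
      linarith [add_one_le_exp (-(1 / 2) * log (urnProb g n b / coinProb ε b))]
  have hsq : ∀ b, urnProb g n b - coinProb ε b =
      (√(urnProb g n b) - √(coinProb ε b)) * (√(urnProb g n b) + √(coinProb ε b)) := by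
    intro b; nlinarith [Real.mul_self_sqrt (q0 b), Real.mul_self_sqrt (p0 b).le]
  have hminus : ∑ b, (√(urnProb g n b) - √(coinProb ε b)) ^ 2 ≤ urnEntropy g ε n := by
    have : ∀ b, (√(urnProb g n b) - √(coinProb ε b)) ^ 2 =
        urnProb g n b + coinProb ε b - 2 * (√(urnProb g n b) * √(coinProb ε b)) := by
      intro b; nlinarith [Real.mul_self_sqrt (q0 b), Real.mul_self_sqrt (p0 b).le]
    simp_rw [this]
    rw [sum_sub_distrib, Finset.sum_add_distrib, sum_urnProb g hn, sum_coinProb,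
      ← mul_sum]
    linarith
  have hplus : ∑ b, (√(urnProb g n b) + √(coinProb ε b)) ^ 2 ≤ 4 := by
    have : ∀ b ∈ univ, (√(urnProb g n b) + √(coinProb ε b)) ^ 2 ≤
        2 * urnProb g n b + 2 * coinProb ε b := by
      intro b _
      nlinarith [Real.mul_self_sqrt (q0 b), Real.mul_self_sqrt (p0 b).le,
        sq_nonneg (√(urnProb g n b) - √(coinProb ε b))]
    refine (sum_le_sum this).trans ?_
    rw [Finset.sum_add_distrib, ← mul_sum, ← mul_sum, sum_urnProb g hn, sum_coinProb]
    norm_num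
  have hcs : ∑ b ∈ s, (urnProb g n b - coinProb ε b) ≤ √(urnEntropy g ε n) * √4 := by
    simp_rw [hsq]; refine (Real.sum_mul_le_sqrt_mul_sqrt _ _ _).trans ?_; gcongr
    · exact (sum_le_univ_sum_of_nonneg fun b => sq_nonneg _).trans hminus
    · exact (sum_le_univ_sum_of_nonneg fun b => sq_nonneg _).trans hplus
  rw [sum_sub_distrib, show √4 = 2 by rw [show (4 : ℝ) = 2 ^ 2 by norm_num]; simp] at hcs
  linarith

/-- The labels of items drawn without replacement are close to independent bits. -/
lemma close_urn {ε : ℝ} (h0 : 0 < ε) (h1 : ε < 1) {n : ℕ} (hn : n ≤ card κ) :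
    Close (unif (Fin n ↪ κ) fun c => dirac fun j => g (c j))
      (piM fun _ : Fin n => coin ε) (ofReal (2 * √(urnEntropy g ε n))) := by
  classical
  intro s _
  have e1 : (unif (Fin n ↪ κ) fun c => dirac fun j => g (c j)) s =
      ofReal (∑ b ∈ univ.filter (· ∈ s), urnProb g n b) := by
    rw [unif_apply]
    have : ∑ b ∈ univ.filter (· ∈ s), urnProb g n b =
        urnMean g n fun b => if b ∈ s then 1 else 0 := by
      rw [urnMean_eq_sum, sum_filter]; simp
    rw [this, urnMean, sum_div, ENNReal.ofReal_sum_of_nonneg fun c _ => by positivity]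
    refine sum_congr rfl fun c _ => ?_; by_cases h : (fun j => g (c j)) ∈ s
    · simp_all
    simp_all
  have e2 : (piM fun _ => coin ε) s =
      ofReal (∑ b ∈ univ.filter (· ∈ s), coinProb ε b) := by
    rw [ENNReal.ofReal_sum_of_nonneg fun b _ => (coinProb_pos h0 h1 b).le]
    conv_lhs => rw [(by simp : s = ↑(univ.filter (· ∈ s)))]; rw [← sum_measure_singleton]
    refine sum_congr rfl fun b _ => ?_
    rw [pi_singleton, coinProb, ENNReal.ofReal_prod_of_nonneg fun j _ => by grind]
    refine prod_congr rfl fun j _ => ?_; rw [coin_singleton, prob_coe h0.le h1.le]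
  rw [e1, e2, ← ofReal_add (sum_nonneg fun b _ => (coinProb_pos h0 h1 b).le) (by simp)]
  exact ofReal_le_ofReal (sum_urnProb_sub_le g h0 h1 hn _)

end Urn

lemma Close.unif_of_bad {A β : Type*} [Fintype A] [Nonempty A] [MeasurableSpace β] {f : A → Measure β}
    {ν : Measure β} {ε : ℝ≥0∞} (hf : ∀ a, IsProb (f a)) (s : Finset A)
    (h : ∀ a ∉ s, Close (f a) ν ε) : Close (KPdsIsgm.unif A f) ν (s.card / card A + ε) := by
  classical
  intro t ht; rw [unif_apply]
  calc _ ≤ ∑ a, (_⁻¹ * (ν t + ε) + if a ∈ s then _⁻¹ else 0) := by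
        refine sum_le_sum fun a _ => ?_; by_cases ha : a ∈ s
        · rw [if_pos ha]; refine le_add_left ?_
          calc _ ≤ (card A : ℝ≥0∞)⁻¹ * 1 := by gcongr; exact prob_le_one
            _ = _ := mul_one _
        · rw [if_neg ha, add_zero]; gcongr; exact h a ha t ht
    _ = _ := by
      rw [Finset.sum_add_distrib, Finset.sum_const, Finset.card_univ, nsmul_eq_mul, ← mul_assoc,
        ENNReal.mul_inv_cancel (by simp) (by simp), one_mul, ← sum_filter, Finset.sum_const,
        nsmul_eq_mul]
      simp; rw [ENNReal.div_eq_inv_mul]; ring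

/-! ### The labels of the output samples are nearly independent coins. -/

section Labels

variable (P : Params)

lemma card_vanishing_mul_le :
    (univ.filter fun Y : Fin P.k → P.Point => ∃ a, Y a = 0).card * P.r ^ P.t ≤
      P.k * card (Fin P.k → P.Point) := by
  have h1 : (univ.filter fun Y : Fin P.k → P.Point => ∃ a, Y a = 0) =
      univ.biUnion fun a => univ.filter fun Y => Y a = 0 := by
    ext; simp
  have h2 : ∀ a, (univ.filter fun Y : Fin P.k → P.Point => Y a = 0).card * P.r ^ P.t =
      card (Fin P.k → P.Point) := by
    intro a
    have : (univ.filter fun Y : Fin P.k → P.Point => Y a = 0) =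
        Fintype.piFinset (update (fun _ => univ) a {0}) := by
      grind
    rw [this, Fintype.card_piFinset, ← card_point P,
      show card _ = ∏ _ : Fin P.k, card P.Point from Fintype.card_pi]
    have e : ∀ i, (update (fun _ => (univ : Finset P.Point)) a {0} i).card =
        update (fun _ => card P.Point) a 1 i := by
      grind
    simp_rw [e]
    rw [prod_update_of_mem (mem_univ a), one_mul, ← mul_prod_erase _ _ (mem_univ a),
      mul_comm, sdiff_singleton_eq_erase]
  rw [h1]
  calc _ ≤ (∑ a, (univ.filter fun Y : Fin P.k → P.Point => Y a = 0).card) * P.r ^ P.t := by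
        gcongr; exact card_biUnion_le
    _ = _ := by rw [sum_mul, sum_congr rfl fun a _ => h2 a]; simp

lemma card_columns :
    (card (Fin P.k × P.Hyperplane) : ℝ) = P.k * (((P.r : ℝ) ^ P.t - 1) / (P.r - 1)) := by
  have hr : (2 : ℝ) ≤ P.r := by exact_mod_cast two_le_r P
  have h' : (card P.Hyperplane : ℝ) * (P.r - 1) + 1 = P.r ^ P.t := by
    have : ((P.r - 1 : ℕ) : ℝ) = P.r - 1 := by rw [Nat.cast_sub (by have := two_le_r P; omega)]; simp
    rw [← this]; exact_mod_cast (card_hyperplane P)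
  rw [Fintype.card_prod, Fintype.card_fin, ← h']; grind

/-- A nonzero point lies on the same number of hyperplanes as any other, so the composition of the
urn does not depend on `Y`. -/
lemma card_marked {Y : Fin P.k → P.Point} (hY : ∀ a, Y a ≠ 0) :
    ((univ.filter fun c : Fin P.k × P.Hyperplane => decide (Y c.1 ∈ c.2.1) = true).card : ℝ) =
      P.k * (((P.r : ℝ) ^ P.t / P.r - 1) / (P.r - 1)) := by
  have hr : (2 : ℝ) ≤ P.r := by exact_mod_cast two_le_r P
  have h2 : ∀ a, ((univ.filter fun V : P.Hyperplane => Y a ∈ V.1).card : ℝ) =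
      (P.r ^ P.t / P.r - 1) / (P.r - 1) := by
    intro a
    have h' : P.r * (((univ.filter fun V : P.Hyperplane => Y a ∈ V.1).card : ℝ) * (P.r - 1) + 1) =
        P.r ^ P.t := by
      have : ((P.r - 1 : ℕ) : ℝ) = P.r - 1 := by rw [Nat.cast_sub (by have := two_le_r P; omega)]; simp
      rw [← this]; exact_mod_cast (card_hyperplane_mem P (hY a))
    grind
  rw [card_filter, Fintype.sum_prod_type]; simp_all

/-- Zero lies on every hyperplane, so those `Y` that vanish in some part are set aside, at a cost of
`k / r ^ t`. For any other `Y` the labels are `n` draws without replacement from an urn with `K = k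
(r ^ t - 1) / (r - 1)` items. Its marked fraction `f` is at most `1 / r` and close to it; `t1`
bounds the effect of this bias and `t2` the effect of not replacing. The bound `2 ≤ w` ensures that
at most half of the urn is drawn. -/
lemma close_columnLabels {w : ℝ} (hk : 0 < P.k) (hR : 2 ≤ P.r ^ P.t) (hw : 2 ≤ w) (hn : 0 < P.n)
    (hwn : w * P.n ≤ P.k * (((P.r : ℝ) ^ P.t - 1) / (P.r - 1))) :
    Close (unif (Fin P.k → P.Point) fun Y => unif P.Cols fun c =>
      dirac (columnLabels P Y c)) (piM fun _ : Fin P.n => coin (1 / (P.r : ℝ)))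
      (ofReal (P.k / (P.r : ℝ) ^ P.t + 2 * √(2 * P.k / (P.r : ℝ) ^ P.t + 4 / w ^ 2))) := by
  classical
  have hr : (2 : ℝ) ≤ P.r := by exact_mod_cast two_le_r P
  have hR' : (2 : ℝ) ≤ (P.r : ℝ) ^ P.t := by exact_mod_cast hR
  have hk' : (1 : ℝ) ≤ P.k := by exact_mod_cast hk
  have hK := card_columns P
  have hKn : 2 * P.n ≤ card (Fin P.k × P.Hyperplane) := by
    have : (2 : ℝ) * P.n ≤ card (Fin P.k × P.Hyperplane) := by
      rw [hK]; exact le_trans (by gcongr) hwn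
    exact_mod_cast this
  have hemb : Nonempty P.Cols := by
    rw [Embedding.nonempty_iff_card_le]; simp only [Fintype.card_fin]; omega
  rw [(ofReal_add (by positivity) (by positivity))]
  refine (Close.unif_of_bad (fun Y => isProb_unif fun c => inferInstance)
    (univ.filter fun Y => ∃ a, Y a = 0) (fun Y hY => ?_)).mono
    (ε := _ + ofReal (2 * √(2 * P.k / P.r ^ P.t + 4 / w ^ 2))) ?_
  · simp at hY; have h0 : (0 : ℝ) < 1 / P.r := by positivity
    have h1 : 1 / (P.r : ℝ) < 1 := (div_lt_one (by linarith)).2 (by linarith)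
    refine (close_urn (κ := Fin P.k × P.Hyperplane) (fun c => decide (Y c.1 ∈ c.2.1)) h0 h1 (n := P.n) (by omega)).mono (ofReal_le_ofReal ?_)
    gcongr; refine (urnEntropy_le _ h0 h1 le_rfl hKn (by omega)).trans ?_
    have hf : urnFrac (fun c : Fin P.k × P.Hyperplane => decide (Y c.1 ∈ c.2.1)) =
        (P.r ^ P.t / P.r - 1) / (P.r ^ P.t - 1) := by
      have : (P.r : ℝ) - 1 ≠ 0 := by linarith
      rw [urnFrac, card_marked P hY, hK]; field_simp
    set f := urnFrac fun c : Fin P.k × P.Hyperplane => decide (Y c.1 ∈ c.2.1)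
    set K : ℝ := (card (Fin P.k × P.Hyperplane) : ℝ) with hKdef; set R : ℝ := _ ^ P.t
    set r : ℝ := (P.r : ℝ); set n : ℝ := _; set k : ℝ := (P.k : ℝ)
    have hKpos : 0 < K := by rw [hK]; exact mul_pos (by linarith) (div_pos (by linarith) (by linarith))
    have hr1 : 0 < r - 1 := by linarith
    have hR1 : 0 < R - 1 := by linarith
    have hd : f - 1 / r = -((r - 1) / (r * (R - 1))) := by rw [hf]; field_simp; ring
    have hfle : f ≤ 1 / r := by
      have : 0 ≤ (r - 1) / (r * (R - 1)) := by positivity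
      linarith
    have hhalf : 1 / r ≤ 1 / 2 := by gcongr
    have hv : f * (1 - f) ≤ 1 / r * (1 - 1 / r) := by nlinarith
    have hnK : w * n ≤ K := by rw [hK]; exact hwn
    -- The quotient equals `(r - 1) / (R - 1) ^ 2`, and multiplied by `K = k (R - 1) / (r - 1)` it
    -- is just `k / (R - 1)`.
    have t1 : n * ((f - 1 / r) ^ 2 / (1 / r * (1 - 1 / r))) ≤ 2 * k / R := by
      have e : (f - 1 / r) ^ 2 / (1 / r * (1 - 1 / r)) = (r - 1) / (R - 1) ^ 2 := by rw [hd]; field_simp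
      rw [e]
      calc n * _ ≤ K * _ := by gcongr; nlinarith
        _ = k / (R - 1) := by rw [hK]; field_simp
        _ ≤ 2 * k / R := by
          rw [div_le_div_iff₀ hR1 (by linarith)]; nlinarith
    have t2 : n * ((4 * n * (f * (1 - f)) / K ^ 2) / (1 / r * (1 - 1 / r))) ≤ 4 / w ^ 2 := by
      calc n * _ ≤ n * ((4 * n * (1 / r * _) / K ^ 2) / _) := by gcongr
        _ = 4 * (n ^ 2 / K ^ 2) := by field_simp
        _ ≤ 4 * (1 / w ^ 2) := by
          refine mul_le_mul_of_nonneg_left ?_ (by norm_num)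
          rw [div_le_div_iff₀ (by positivity) (by positivity), one_mul, mul_comm, ← mul_pow]; gcongr
        _ = _ := by ring
    calc _ = n * ((f - 1 / r) ^ 2 / (1 / r * (1 - 1 / r))) +
        n * ((4 * n * (f * (1 - f)) / K ^ 2) / (1 / r * (1 - 1 / r))) := by ring
      _ ≤ _ := by linarith
  · gcongr; have hc : 0 < card (Fin P.k → P.Point) := Fintype.card_pos
    have h' : ((univ.filter fun Y : Fin P.k → P.Point => ∃ a, Y a = 0).card : ℝ) /
        card (Fin P.k → P.Point) ≤ P.k / P.r ^ P.t := by
      rw [div_le_div_iff₀ (by exact_mod_cast hc) (by linarith)]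
      exact_mod_cast (card_vanishing_mul_le P)
    refine le_trans (le_of_eq ?_) (ofReal_le_ofReal h')
    rw [ENNReal.ofReal_div_of_pos (by exact_mod_cast hc), ENNReal.ofReal_natCast, ENNReal.ofReal_natCast]

end Labels

/-! ### The errors of all steps put together. -/

section Reduction

variable {P : Params} {E : Fin P.N → Fin P.k}

lemma isProb_toKPartiteSubmatrix (hQ : GoodQ P.p P.q P.Q) (hL : P.N / P.k ≤ P.blockLen)
    (e : P.Listing E) (G : SimpleGraph (Fin P.N)) :
    IsProb (toKPartiteSubmatrix P E G) := by
  have := isProb_graphClone hQ G; rw [toKPartiteSubmatrix_eq P hL e]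
  refine isProb_bind disc fun x => ?_
  refine isProb_bind disc fun B₁ => isProb_bind disc fun B₂ => isProb_unif fun θ =>
    isProb_map disc

lemma isProb_kPdsToIsgm (hQ : GoodQ P.p P.q P.Q) (hL : P.N / P.k ≤ P.blockLen)
    (e : P.Listing E) (hc : Nonempty P.Cols)
    (hι : Nonempty (P.Row ↪ Fin P.d)) (G : SimpleGraph (Fin P.N)) :
    IsProb (kPdsToIsgm P E G) := by
  have := isProb_toKPartiteSubmatrix hQ hL e G
  exact isProb_bind disc (isProb_padAndFinish P hQ hc hι)

variable {g : ℝ} {ε : ℝ≥0∞}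

lemma close_kPdsToIsgm_null (hQ : GoodQ P.p P.q P.Q) (hL : P.N / P.k ≤ P.blockLen)
    (hg : 0 < g * (P.N / P.k : ℕ))
    (h1 : g * (P.N / P.k : ℕ) ≤ P.blockLen * P.Q - (P.N / P.k : ℕ) * P.p)
    (h2 : g * (P.N / P.k : ℕ) ≤ P.blockLen - (P.N / P.k : ℕ) -
      (P.blockLen * P.Q - (P.N / P.k : ℕ) * P.p))
    (e : P.Listing E) (hc : Nonempty P.Cols)
    (hι : Nonempty (P.Row ↪ Fin P.d))
    (hε : ∀ b : Bool, Close ((coin (if b then P.p else P.Q)).bind fun B => rkG P.p P.Q P.τ B P.iterations)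
      (gaussianReal (if b then P.τ else 0) 1) ε) :
    Close ((kPdsNull P.N P.q).bind (kPdsToIsgm P E)) (isgmNull P.n P.d)
      (diagError P g + P.m * (P.k * (P.r ^ P.t * ε))) := by
  have e1 : (kPdsNull P.N P.q).bind (kPdsToIsgm P E) = ((kPdsNull P.N P.q).bind _).bind _ :=
    (bind_bind disc disc).symm
  rw [e1]
  refine ((close_submatrix_null hQ hL hg h1 h2 e).bind disc
    (isProb_padAndFinish P hQ hc hι)).trans ?_
  have := close_padAndFinish P hQ hc hι hε fun _ => False; rwa [unif_output_null P hc hι] at this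

lemma close_kPdsToIsgm_planted (hQ : GoodQ P.p P.q P.Q) (hL : P.N / P.k ≤ P.blockLen)
    (hL0 : 0 < P.blockLen) (hg : 0 < g * (P.N / P.k : ℕ))
    (h1 : g * (P.N / P.k : ℕ) ≤ P.blockLen * P.Q - (P.N / P.k : ℕ) * P.p)
    (h2 : g * (P.N / P.k : ℕ) ≤ P.blockLen - (P.N / P.k : ℕ) -
      (P.blockLen * P.Q - (P.N / P.k : ℕ) * P.p))
    (hR : P.blockLen ≤ P.r ^ P.t)
    (e : P.Listing E) (hN : 0 < P.N / P.k)
    (hc : Nonempty P.Cols) (hι : Nonempty (P.Row ↪ Fin P.d))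
    (hε : ∀ b : Bool, Close ((coin (if b then P.p else P.Q)).bind fun B => rkG P.p P.Q P.τ B P.iterations)
      (gaussianReal (if b then P.τ else 0) 1) ε) {ε' : ℝ≥0∞}
    (hlab : Close (unif (Fin P.k → P.Point) fun Y => unif P.Cols fun c =>
      dirac (columnLabels P Y c)) (piM fun _ : Fin P.n => coin (1 / (P.r : ℝ))) ε') :
    Close ((kPdsPlanted E P.p P.q).bind (kPdsToIsgm P E)) (isgmPlanted P.n P.k P.d P.μ (1 / (P.r : ℝ)))
      (diagError P g + P.m * (P.k * (P.r ^ P.t * ε)) + ε') := by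
  have hne : Nonempty _ := ⟨fun a => e a ⟨0, hN⟩⟩
  have hS : Nonempty {S : Finset (Fin P.d) // S.card = P.k} := by
    obtain ⟨ι⟩ := hι
    exact ⟨⟨univ.map ⟨fun a => ι (a, ⟨0, hL0⟩),
      fun a b h => (Prod.mk.inj (ι.injective h)).1⟩, by simp⟩⟩
  -- Both sides are averages over the planted vertices `R`, and further below over `θ`. For fixed
  -- values the planted row of part `a` is `X a`, and the error does not depend on it.
  rw [kPdsPlanted, unif_bind _ disc, ← unif_const (A := ∀ a, {v // E v = a})
    (isgmPlanted P.n P.k P.d P.μ _)]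
  refine Close.unif fun R => ?_
  have e1 : ∀ γ : Measure _, γ.bind (kPdsToIsgm P E) = (γ.bind _).bind _ := fun γ =>
    (bind_bind disc disc).symm
  rw [e1, add_assoc]
  refine ((close_submatrix_planted hQ hL hL0 hg h1 h2 e R).bind disc
    (isProb_padAndFinish P hQ hc hι)).trans ?_
  rw [unif_bind _ disc, ← unif_const (A := Fin P.k → Perm (Fin P.blockLen))
    (isgmPlanted P.n P.k P.d P.μ _)]
  refine Close.unif fun θ => ?_
  have e2 : (fun i : P.Row => θ i.1 i.2 = Fin.castLE hL ((e i.1).symm (R i.1))) =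
      fun i => i.2 = (fun a => (θ a).symm (Fin.castLE hL ((e a).symm (R a)))) i.1 := by
    grind
  rw [e2]; set X : Fin P.k → Fin P.blockLen := fun a => (θ a).symm _
  refine (close_padAndFinish P hQ hc hι hε fun i => i.2 = X i.1).trans ?_
  rw [unif_output_planted P hR hι X]; exact close_output_planted P hS hlab

end Reduction

/-! ### From closeness to the distance. -/

section Distance

lemma tvDist_le_one {α : Type*} [MeasurableSpace α] (μ ν : Measure α) [IsProb μ]
    [IsProb ν] : tvDist μ ν ≤ 1 := by
  refine tvDist_le_of_close zero_le_one fun s hs => ?_; rw [ofReal_one]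
  exact prob_le_one.trans le_add_self

lemma isProb_kPdsNull (N : ℕ) (q : ℝ) : IsProb (kPdsNull N q) := by
  unfold kPdsNull; infer_instance

lemma isProb_kPdsPlanted {N k : ℕ} (E : Fin N → Fin k) (p q : ℝ) [Nonempty (∀ a, {v // E v = a})] :
    IsProb (kPdsPlanted E p q) := isProb_unif fun R => isProb_map disc

lemma isProb_isgmPlanted {P : Params} (hS : Nonempty {S : Finset (Fin P.d) // S.card = P.k}) :
    IsProb (isgmPlanted P.n P.k P.d P.μ (1 / (P.r : ℝ))) := by
  rw [isgmPlanted_eq]; exact isProb_unif fun S => isProb_bind disc fun b => inferInstance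

end Distance

/-! ### Evaluating the errors for admissible parameters. -/

section Sizes

variable {P : Params} {w : ℝ} {E : Fin P.N → Fin P.k}

lemma Params.Admissible.k_pos (h : P.Admissible w E) : 0 < P.k := by
  rcases Nat.eq_zero_or_pos P.k with h0 | h0
  · have := (h0 ▸ E ⟨0, h.N_pos⟩); exact this.elim0
  grind

lemma Params.Admissible.mul_div (h : P.Admissible w E) : P.k * (P.N / P.k) = P.N :=
  Nat.mul_div_cancel' h.k_dvd

lemma Params.Admissible.part_pos (h : P.Admissible w E) : 0 < P.N / P.k :=
  Nat.div_pos (Nat.le_of_dvd h.N_pos h.k_dvd) h.k_pos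

lemma Params.Admissible.exists_enumeration (h : P.Admissible w E) :
    Nonempty (P.Listing E) :=
  ⟨fun a => (Finite.equivFinOfCardEq (h.parts a)).symm⟩

lemma Params.Admissible.blockLen_bounds (h : P.Admissible w E) (hQ : GoodQ P.p P.q P.Q) :
    (P.p / P.Q + 1) * (P.N / P.k : ℕ) ≤ P.blockLen ∧
      (P.blockLen : ℝ) ≤ (P.p / P.Q + 1) * (P.N / P.k : ℕ) + 1 := by
  have hQ0 := hQ.Q_pos; have hp := hQ.lt_p; have hk : 0 < P.k := by exact_mod_cast h.k_pos
  have e : (P.p / P.Q + 1) * P.N / P.k = (P.p / P.Q + 1) * (P.N / P.k : ℕ) := by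
    conv_lhs => rw [← h.mul_div]
    push_cast; field_simp
  have h0 : 0 ≤ (P.p / P.Q + 1) * (P.N / P.k : ℕ) := by
    have : 0 < P.p := by linarith
    positivity
  unfold Params.blockLen; rw [e]; push_cast
  exact ⟨(Nat.lt_floor_add_one _).le, by linarith [Nat.floor_le h0]⟩

lemma Params.Admissible.two_mul_le_blockLen (h : P.Admissible w E) (hQ : GoodQ P.p P.q P.Q) :
    2 * (P.N / P.k) ≤ P.blockLen := by
  have h1 := (h.blockLen_bounds hQ).1; have := (one_le_div hQ.Q_pos).2 hQ.lt_p.le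
  exact_mod_cast (by nlinarith [(Nat.cast_nonneg (P.N / P.k) : 0 ≤ _)] : (2 : ℝ) * (P.N / P.k : ℕ) ≤ P.blockLen)

lemma Params.Admissible.blockLen_le (h : P.Admissible w E) : P.blockLen ≤ P.r ^ P.t :=
  Nat.le_of_mul_le_mul_left h.m_le_cols h.k_pos

lemma Params.Admissible.nonempty_columns (h : P.Admissible w E) :
    Nonempty P.Cols := by
  rw [Embedding.nonempty_iff_card_le, Fintype.card_fin]
  have h1 : (P.n : ℝ) ≤ card (Fin P.k × P.Hyperplane) := by
    rw [card_columns]; refine le_trans ?_ h.wn_le; nlinarith [h.one_le_w]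
  exact_mod_cast h1

lemma Params.Admissible.nonempty_rows (h : P.Admissible w E) : Nonempty (P.Row ↪ Fin P.d) := by
  rw [Embedding.nonempty_iff_card_le]; simpa [Params.m] using h.m_le_d

lemma Params.δ_pos (hQ : GoodQ P.p P.q P.Q) : 0 < P.δ := by
  have h1 := Real.log_pos ((one_lt_div hQ.Q_pos).2 hQ.lt_p); unfold Params.δ; split_ifs with h
  · exact h1
  · have := lt_of_le_of_ne hQ.p_le h
    exact lt_min h1 (Real.log_pos ((one_lt_div (by linarith)).2 (by linarith [hQ.lt_p])))

lemma Params.δ_le_log (P : Params) : P.δ ≤ log (P.p / P.Q) := by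
  unfold Params.δ; grind

lemma Params.ratio_le (hQ : GoodQ P.p P.q P.Q) : P.Q / P.p ≤ exp (-P.δ) := by
  have hQ0 := hQ.Q_pos; have hp := hQ0.trans hQ.lt_p
  have : P.Q / P.p = exp (-log (P.p / P.Q)) := by
    rw [Real.exp_neg, exp_log (by simp_all), inv_div]
  rw [this]; gcongr; exact P.δ_le_log

lemma Params.coratio_le (hQ : GoodQ P.p P.q P.Q) : (1 - P.p) / (1 - P.Q) ≤ exp (-P.δ) := by
  rcases hQ.p_le.eq_or_lt with h | h
  · rw [h, sub_self, zero_div]; positivity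
  · have h1 : 0 < 1 - P.p := by linarith
    have h2 : 0 < 1 - P.Q := by linarith [hQ.lt_p]
    have : (1 - P.p) / (1 - P.Q) = exp (-log ((1 - P.Q) / (1 - P.p))) := by
      rw [Real.exp_neg, exp_log (by simp_all), inv_div]
    rw [this]; gcongr; unfold Params.δ; grind

/-- Applied with `M` the number of entries, `g = p - Q`, and `a`, `b` the errors of truncation and
of failure to accept. -/
lemma mul_add_le_three_mul_inv {M x g a b : ℝ} (hx : 1 ≤ x) (hxM : x ≤ M) (hg : 0 < g) (hg1 : g ≤ 1)
    (ha : a ≤ (M ^ 3)⁻¹ * g ^ 2) (hb : b ≤ (M ^ 3)⁻¹) : M * (2 / g * a + b) ≤ 3 * x⁻¹ := by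
  have hM := hx.trans hxM
  calc M * _ ≤ M * (2 / g * (_⁻¹ * g ^ 2) + _⁻¹) := by gcongr
    _ = (2 * g + 1) * (M ^ 2)⁻¹ := by grind
    _ ≤ 3 * _⁻¹ := by gcongr; linarith
    _ ≤ 3 * x⁻¹ := by gcongr; nlinarith

lemma Params.Admissible.exists_close_rkG (h : P.Admissible w E) (hQ : GoodQ P.p P.q P.Q) :
    ∃ ε : ℝ≥0∞, (∀ b : Bool, Close ((coin (if b then P.p else P.Q)).bind fun B =>
      rkG P.p P.Q P.τ B P.iterations) (gaussianReal (if b then P.τ else 0) 1) ε) ∧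
      (P.m : ℝ≥0∞) * (P.k * (P.r ^ P.t * ε)) ≤ ofReal (3 * (P.N : ℝ)⁻¹) := by
  have hQ0 := hQ.Q_pos; have hp := hQ.lt_p; have hp1 := hQ.p_le; have hp0 : 0 < P.p := by linarith
  have hδ := Params.δ_pos hQ; have hr : (2 : ℝ) ≤ P.r := by exact_mod_cast two_le_r P
  have hk : (1 : ℝ) ≤ P.k := by exact_mod_cast h.k_pos
  have hN : (1 : ℝ) ≤ P.N := by exact_mod_cast h.N_pos
  have hN' : (1 : ℝ) ≤ (P.N / P.k : ℕ) := by exact_mod_cast h.part_pos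
  obtain ⟨hL1, hL2⟩ := h.blockLen_bounds hQ
  have hL : (P.blockLen : ℝ) ≤ P.r ^ P.t := by exact_mod_cast h.blockLen_le
  have hm : (P.m : ℝ) = P.k * P.blockLen := by simp [Params.m]
  have hL0 : P.p / P.Q ≤ P.blockLen := by nlinarith
  set n' : ℝ := P.m * (P.k * _ ^ P.t) with hn'
  have hmL : (P.blockLen : ℝ) ≤ P.m := by rw [hm]; nlinarith
  have hNm : (P.N : ℝ) ≤ P.m := by
    have h2 : P.N / P.k ≤ P.blockLen := by have := h.two_mul_le_blockLen hQ; omega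
    conv_lhs => rw [← h.mul_div]
    exact_mod_cast Nat.mul_le_mul_left P.k h2
  have hmn : P.m ≤ n' := by
    refine le_mul_of_one_le_right (by positivity) ?_; nlinarith
  have hn0 : 0 < n' := by linarith
  set A : ℝ := 3 * log n' + 2 * log _⁻¹ with hA
  -- `δ ≤ log (p / Q)`, and `p / Q ≤ m / k ≤ n'`. It follows that `3 δ ≤ A`, which makes room for
  -- the term `τ ^ 2 / 2` below.
  have hlogn : P.δ ≤ log n' := P.δ_le_log.trans (log_le_log (by positivity) (by linarith))
  have hlogpQ : 0 ≤ log (P.p - P.Q)⁻¹ :=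
    Real.log_nonneg (one_le_inv_iff₀.2 ⟨by linarith, by linarith⟩)
  have hA0 : 0 < A := by linarith
  have hsA := Real.sqrt_pos.2 hA0
  have hsq := Real.mul_self_sqrt hA0.le
  have hS : 0 < √(P.r ^ P.t * (P.r - 1)) := Real.sqrt_pos.2 (mul_pos (by positivity) (by linarith))
  have hτ0 : 0 ≤ P.τ := mul_nonneg hS.le h.μ_nonneg
  have hτ : P.τ * (2 * √A) ≤ P.δ := by
    have h1 := h.μ_le; have e : P.k * P.m * P.r ^ P.t = n' := by rw [hn']; ring
    rw [e, ← hA] at h1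
    calc P.τ * _ ≤ √_ * (P.δ / _ * _) * _ := by
          unfold Params.τ; gcongr
      _ = P.δ := by field_simp
  -- With `y = (3 / 2) √A`, the bound `2 τ √A ≤ δ` gives `τ y ≤ 3 δ / 4` and leaves room for `τ ^ 2
  -- / 2`. On the other hand `y ^ 2 / 2 ≥ A`, so the tail is at most `exp (-A) = (p - Q) ^ 2 / n' ^
  -- 3`; the factor `(p - Q) ^ 2` pays for `2 / (p - Q)` in the error of the kernel.
  refine ⟨_, fun b => close_coin_bind_rkG (y := 3 / 2 * √A) hQ0 hp hp1 hτ0 (by positivity) hδ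
    (Params.coratio_le hQ) (Params.ratio_le hQ) ?_ b P.iterations, ?_⟩
  · have h1 : P.τ * √A ≤ P.δ / 2 := by linarith
    nlinarith
  · have e1 : exp (-(3 / 2 * √A) ^ 2 / 2) ≤ (n' ^ 3)⁻¹ * (P.p - P.Q) ^ 2 := by
      have e : (n' ^ 3)⁻¹ * (P.p - P.Q) ^ 2 = exp (-A) := by
        rw [hA, neg_add, exp_add, Real.exp_neg, Real.exp_neg, Real.log_inv, mul_neg, Real.exp_neg,
          inv_inv, mul_comm 3, mul_comm 2, Real.exp_mul, Real.exp_mul, exp_log hn0,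
          exp_log (by linarith)]
        norm_cast
      rw [e]; gcongr; nlinarith
    have e2 : exp (-P.δ * P.iterations) ≤ (n' ^ 3)⁻¹ := by
      have e : (n' ^ 3)⁻¹ = exp (-(3 * log n')) := by
        rw [Real.exp_neg, mul_comm 3, Real.exp_mul, exp_log hn0]; norm_cast
      rw [e]; gcongr; have : 3 * P.δ⁻¹ * log n' ≤ P.iterations := Nat.le_ceil _
      have h2 : P.δ * (3 * P.δ⁻¹ * log n') ≤ P.δ * P.iterations := by gcongr
      have h3 : P.δ * (3 * P.δ⁻¹ * log n') = 3 * log n' := by field_simp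
      linarith
    refine le_trans (le_of_eq ?_) (ofReal_le_ofReal (mul_add_le_three_mul_inv (by linarith) (hNm.trans hmn) (by linarith) (by linarith) e1 e2))
    rw [ofReal_mul hn0.le, hn', ofReal_mul (by positivity), ofReal_mul (by positivity),
      ENNReal.ofReal_pow (by positivity), ENNReal.ofReal_natCast, ENNReal.ofReal_natCast,
      ENNReal.ofReal_natCast, mul_assoc, mul_assoc]

/-- In terms of `u = k / √N ≤ 1` one has `k / (N / k) = u ^ 2`. The Chebyshev part is `O(u ^ 2)`,
hence `O(u)`, and the chi-square part is `O(u)` because `exp z - 1 ≤ z exp z`. -/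
lemma Params.Admissible.diagError_le (h : P.Admissible w E) (hQ : GoodQ P.p P.q P.Q)
    (hkN : (P.k : ℝ) ^ 2 ≤ P.N) :
    diagError P (P.Q * (1 - P.Q)) ≤ ofReal ((4 * (P.p / P.Q + 3) / (P.Q * (1 - P.Q)) ^ 2 +
      √(1 / (P.Q * (1 - P.Q)) * exp (1 / (P.Q * (1 - P.Q))))) * (P.k / √(P.N : ℝ))) := by
  have hQ0 := hQ.Q_pos; have hp := hQ.lt_p; have hp1 := hQ.p_le; have hp0 : 0 < P.p := by linarith
  have hQ1 : 0 < 1 - P.Q := by linarith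
  have hk : 1 ≤ P.k := by exact_mod_cast h.k_pos
  have hN : (1 : ℝ) ≤ P.N := by exact_mod_cast h.N_pos
  have hN' : 1 ≤ (P.N / P.k) := by exact_mod_cast h.part_pos
  obtain ⟨hL1, hL2⟩ := h.blockLen_bounds hQ
  have hNk : (P.N : ℝ) = P.k * (P.N / P.k : ℕ) := by exact_mod_cast h.mul_div.symm
  have hpQ : 0 < P.p / P.Q := by positivity
  have hL0 : ((P.N / P.k : ℕ) : ℝ) ≤ P.blockLen := by nlinarith
  set G := P.Q * _
  set x : ℝ := ((P.N / P.k : ℕ) : ℝ); set u : ℝ := P.k / √_ with hu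
  have hu1 := (div_le_one (Real.sqrt_pos.2 (by linarith))).2 (Real.le_sqrt_of_sq_le hkN)
  have hu0 : 0 < u := by positivity
  have hkx : P.k / x = u ^ 2 := by
    rw [hu, div_pow, Real.sq_sqrt (by linarith), hNk]; field_simp
  rw [add_mul, ofReal_add (by positivity) (by positivity)]
  refine add_le_add ?_ (ofReal_le_ofReal ?_)
  · rw [← ENNReal.ofReal_natCast, ← ofReal_mul (by positivity)]
    refine ofReal_le_ofReal ?_
    calc _ * (4 * _ / (G * x) ^ 2) ≤ P.k * (4 * ((P.p / P.Q + 3) * x) / _ ^ 2) := by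
          gcongr; nlinarith
      _ = 4 * (P.p / P.Q + 3) / G ^ 2 * (P.k / x) := by field_simp
      _ ≤ 4 * _ / G ^ 2 * u := by
        gcongr; nlinarith
  · have h1 : P.k * (1 / (P.blockLen * G)) ≤ 1 / G * u ^ 2 := by
      rw [← hkx]
      calc P.k * _ ≤ P.k * (1 / (x * G)) := by gcongr
        _ = _ := by field_simp
    have h2 : exp (P.k * (1 / (P.blockLen * G))) - 1 ≤ 1 / G * exp (1 / G) * u ^ 2 := by
      set z : ℝ := P.k * _
      have hz1 := h1.trans (mul_le_of_le_one_right (by positivity) (pow_le_one₀ hu0.le hu1))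
      have h3 : exp z - 1 ≤ z * exp z := by
        have := add_one_le_exp (-z)
        have h4 : exp (-z) * exp z = 1 := by rw [← exp_add]; simp
        nlinarith [exp_pos z]
      calc exp z - 1 ≤ z * exp z := h3
        _ ≤ (1 / G * u ^ 2) * exp (1 / G) := by gcongr
        _ = _ := by ring
    calc _ ≤ √_ := Real.sqrt_le_sqrt h2
      _ = _ := by rw [Real.sqrt_mul (by positivity), Real.sqrt_sq hu0.le]

/-- For `u = k / √N`, the inequality `r ^ t ≥ m / k ≥ 2 N / k` gives `2 k / r ^ t ≤ u ^ 2`, and the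
square root splits by `u ^ 2 + 4 / w ^ 2 ≤ (u + 2 / w) ^ 2`. -/
lemma Params.Admissible.labelError_le (h : P.Admissible w E) (hQ : GoodQ P.p P.q P.Q)
    (hkN : (P.k : ℝ) ^ 2 ≤ P.N) :
    P.k / (P.r : ℝ) ^ P.t + 2 * √(2 * P.k / (P.r : ℝ) ^ P.t + 4 / w ^ 2) ≤
      4 * (P.k / √(P.N : ℝ)) + 4 * w⁻¹ := by
  have hk : 1 ≤ P.k := by exact_mod_cast h.k_pos
  have hN : (1 : ℝ) ≤ P.N := by exact_mod_cast h.N_pos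
  have hN' : 1 ≤ (P.N / P.k) := by exact_mod_cast h.part_pos
  have hNk : (P.N : ℝ) = P.k * (P.N / P.k : ℕ) := by exact_mod_cast h.mul_div.symm
  have hL : (2 : ℝ) * (P.N / P.k : ℕ) ≤ P.blockLen := by exact_mod_cast h.two_mul_le_blockLen hQ
  have hR : (P.blockLen : ℝ) ≤ P.r ^ P.t := by exact_mod_cast h.blockLen_le
  have hw := h.one_le_w
  set x : ℝ := ((P.N / P.k : ℕ) : ℝ); set R : ℝ := _ ^ P.t; set u : ℝ := P.k / √_
  have hu1 := (div_le_one (Real.sqrt_pos.2 (by linarith))).2 (Real.le_sqrt_of_sq_le hkN)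
  have hu0 : 0 < u := by positivity
  have hkR : 2 * (P.k / R) ≤ u ^ 2 := by
    calc 2 * _ ≤ 2 * (P.k / (2 * x)) := by gcongr; linarith
      _ = _ := by grind
  have h1 : √(2 * P.k / R + 4 / w ^ 2) ≤ u + 2 * w⁻¹ := by
    apply Real.sqrt_le_iff.2; refine ⟨by positivity, ?_⟩
    rw [(by field_simp; norm_num : 4 / w ^ 2 = (2 * w⁻¹) ^ 2), mul_div_assoc]
    have : 0 < w⁻¹ := by positivity
    nlinarith
  nlinarith

end Sizes

/-- The total variation guarantee of the reduction. -/
lemma exists_tvDist_le (p q : ℝ) (hq : 0 < q) (hqp : q < p) (hp : p ≤ 1) : ∃ C c : ℝ, 0 < C ∧ 0 < c ∧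
      ∀ (P : Params) (w : ℝ) (E : Fin P.N → Fin P.k), P.p = p → P.q = q → P.Admissible w E →
        let bound : ℝ := C * (w⁻¹ + (P.k : ℝ) ^ 2 / (w * P.N) + P.k / √(P.N : ℝ)
          + exp (-(c * ((P.N : ℝ) ^ 2 / (P.k * P.n)))) + (P.N : ℝ)⁻¹)
        tvDist ((kPdsNull P.N P.q).bind (kPdsToIsgm P E)) (isgmNull P.n P.d) ≤ bound ∧
        tvDist ((kPdsPlanted E P.p P.q).bind (kPdsToIsgm P E))
          (isgmPlanted P.n P.k P.d P.μ (1 / (P.r : ℝ))) ≤ bound := by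
  set Q : ℝ := 1 - √((1 - p) * (1 - q)) + if p = 1 then √q - 1 else 0 with hQdef
  set D : ℝ := 4 * (p / Q + 3) / (Q * (1 - Q)) ^ 2 +
    √(1 / (Q * (1 - Q)) * exp (1 / (Q * (1 - Q)))) with hD
  -- `D` pays for the diagonal, `4` for the labels, which cost `4 k / √N + 4 / w`, and for
  -- Gaussianization, which costs `3 / N`. Of the other two terms of the bound only nonnegativity is
  -- used, so any positive `c` would do.
  refine ⟨|D| + 4, 1, by positivity, one_pos, fun P w E hPp hPq h => ?_⟩; subst hPp hPq
  have hQe : P.Q = Q := rfl; have hQ := P.goodQ hq hqp hp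
  have hL : P.N / P.k ≤ P.blockLen := by have := h.two_mul_le_blockLen hQ; omega
  have hL0 : 0 < P.blockLen := lt_of_lt_of_le h.part_pos hL; obtain ⟨e⟩ := h.exists_enumeration
  have hc := h.nonempty_columns; have hι := h.nonempty_rows; have hQ0 := hQ.Q_pos
  have hQp := hQ.lt_p; have hQ1 : 0 < 1 - P.Q := by linarith
  have hk : (1 : ℝ) ≤ P.k := by exact_mod_cast h.k_pos
  have hn : (1 : ℝ) ≤ P.n := by exact_mod_cast h.n_pos
  have hN : (1 : ℝ) ≤ P.N := by exact_mod_cast h.N_pos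
  have hN' : (1 : ℝ) ≤ (P.N / P.k : ℕ) := by exact_mod_cast h.part_pos
  have hw := h.one_le_w
  have hne : Nonempty (∀ a, {v // E v = a}) := ⟨fun a => e a ⟨0, h.part_pos⟩⟩
  have hS : Nonempty {S : Finset (Fin P.d) // S.card = P.k} := by
    obtain ⟨ι⟩ := hι
    exact ⟨⟨univ.map ⟨fun a : Fin P.k => ι (a, ⟨0, hL0⟩),
      fun a b h => (Prod.mk.inj (ι.injective h)).1⟩, by simp⟩⟩
  have i1 := isProb_kPdsNull P.N P.q; have i2 := isProb_kPdsPlanted E P.p P.q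
  have i3 := isProb_isgmNull P.n P.d; have i4 := isProb_isgmPlanted hS
  have i5 : IsProb ((kPdsNull P.N P.q).bind (kPdsToIsgm P E)) :=
    isProb_bind disc (isProb_kPdsToIsgm hQ hL e hc hι)
  have i6 : IsProb ((kPdsPlanted E P.p P.q).bind (kPdsToIsgm P E)) :=
    isProb_bind disc (isProb_kPdsToIsgm hQ hL e hc hι)
  set X : ℝ := (P.k : ℝ) ^ 2 / (w * P.N)
  set Y : ℝ := exp (-(1 * ((P.N : ℝ) ^ 2 / (P.k * P.n)))); have hX : 0 ≤ X := by positivity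
  have hY : 0 ≤ Y := by positivity
  have hu : 0 < P.k / √(P.N : ℝ) := div_pos (by linarith) (Real.sqrt_pos.2 (by linarith))
  have hwi : 0 < w⁻¹ := by positivity
  have hNi : 0 < (P.N : ℝ)⁻¹ := by positivity
  have hD0 := le_abs_self D; have hDa := abs_nonneg D; intro bound
  -- In these cases the bound is at least one.
  by_cases htriv : w < 2 ∨ (P.N : ℝ) < P.k ^ 2
  · have : 1 ≤ bound := by
      have : 1 ≤ 4 * (w⁻¹ + X + P.k / √P.N + Y + (P.N : ℝ)⁻¹) := by
        rcases htriv with h | h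
        · have : (1 / 2) ≤ w⁻¹ := by rw [one_div]; gcongr
          linarith
        · have : 1 ≤ P.k / √P.N := by
            rw [one_le_div (Real.sqrt_pos.2 (by linarith))]
            exact (Real.sqrt_le_left (by linarith)).2 h.le
          linarith
      refine this.trans ?_; change _ ≤ _ * _; gcongr; linarith
    exact ⟨(tvDist_le_one _ _).trans this, (tvDist_le_one _ _).trans this⟩
  push Not at htriv; obtain ⟨hw2, hkN⟩ := htriv; obtain ⟨hb1, hb2⟩ := h.blockLen_bounds hQ
  obtain ⟨ε, hε, hε'⟩ := h.exists_close_rkG hQ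
  have hR : 2 ≤ P.r ^ P.t := by
    have := h.two_mul_le_blockLen hQ; have := h.blockLen_le; have := h.part_pos; omega
  have g0 : 0 < P.Q * (1 - P.Q) * (P.N / P.k : ℕ) := by positivity
  have e0 : (P.p / P.Q + 1) * (P.N / P.k : ℕ) * P.Q = (P.p + P.Q) * (P.N / P.k : ℕ) := by field_simp
  -- Here `m ≥ (p / Q + 1) N` enters: it keeps the mean surplus at least `Q N / k` above the lower
  -- cut-off and `(1 - Q) N / k` below the upper one, and `Q (1 - Q)` is a common lower bound of the
  -- two factors.
  have g1 : P.Q * (1 - P.Q) * (P.N / P.k : ℕ) ≤ P.blockLen * P.Q - (P.N / P.k : ℕ) * P.p := by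
    nlinarith [mul_pos hQ0 hQ0]
  have g2 : P.Q * (1 - P.Q) * (P.N / P.k : ℕ) ≤ P.blockLen - (P.N / P.k : ℕ) -
      (P.blockLen * P.Q - (P.N / P.k : ℕ) * P.p) := by
    have h2 : (2 : ℝ) * (P.N / P.k : ℕ) ≤ P.blockLen := by exact_mod_cast h.two_mul_le_blockLen hQ
    have h3 : 2 * (P.N / P.k : ℕ) * (1 - P.Q) ≤ P.blockLen * (1 - P.Q) := by gcongr
    have h4 : P.Q * (1 - P.Q) * (P.N / P.k : ℕ) ≤ 1 * (1 - P.Q) * (P.N / P.k : ℕ) := by gcongr; linarith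
    have h5 : P.Q * (P.N / P.k : ℕ) ≤ P.p * (P.N / P.k : ℕ) := by gcongr
    linarith
  have hdiag' := (h.diagError_le hQ hkN).trans (ofReal_le_ofReal (by gcongr : D * _ ≤ |D| * _))
  have hrest : 0 ≤ |D| * (w⁻¹ + X + Y + (P.N : ℝ)⁻¹) := by positivity
  have hb0 : 0 ≤ bound := by rw [(rfl : bound = _ * _)]; positivity
  constructor
  · refine tvDist_le_of_close hb0 ((close_kPdsToIsgm_null hQ hL g0 g1 g2 e hc hι hε).mono ?_)
    refine (add_le_add hdiag' hε').trans ?_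
    rw [← ofReal_add (by positivity) (by positivity)]; refine ofReal_le_ofReal ?_
    linarith
  · refine tvDist_le_of_close hb0
      ((close_kPdsToIsgm_planted hQ hL hL0 g0 g1 g2 h.blockLen_le e h.part_pos hc hι hε
        (close_columnLabels P h.k_pos hR hw2 h.n_pos h.wn_le)).mono ?_)
    refine (add_le_add (add_le_add hdiag' hε') (ofReal_le_ofReal (h.labelError_le hQ hkN))).trans ?_
    rw [← ofReal_add (by positivity) (by positivity),
      ← ofReal_add (by positivity) (by positivity)]
    refine ofReal_le_ofReal ?_; linarith

/-! ### Semantics of programs without the clock. -/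

section Machine

lemma measurable_nat₂ (f : ℕ → ℕ → ℕ) {α : Type*} [MeasurableSpace α] {g h : α → ℕ}
    (hg : Measurable g) (hh : Measurable h) : Measurable fun x => f (g x) (h x) :=
  (Measurable.of_discrete (f := fun x : ℕ × ℕ => f x.1 x.2)).comp (hg.prodMk hh)

lemma measurable_at {α β : Type*} [MeasurableSpace α] [MeasurableSpace β] {f : ℕ → α → β}
    (hf : ∀ i, Measurable (f i)) {i : α → ℕ} (hi : Measurable i) : Measurable fun x => f (i x) x := (measurable_from_prod_countable_right hf : Measurable fun y : ℕ × α => f y.1 y.2).comp (hi.prodMk measurable_id)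

lemma NExp.measurable_eval (e : NExp) : Measurable fun s : Store => e.eval s := by induction e with
  | lit c => exact measurable_const
  | get a i ih => exact measurable_at (f := fun i s => s.1 a i) (fun i => by fun_prop) ih
  | add e f he hf => exact measurable_nat₂ _ he hf
  | sub e f he hf => exact measurable_nat₂ _ he hf
  | mul e f he hf => exact measurable_nat₂ _ he hf
  | div e f he hf => exact measurable_nat₂ _ he hf
  | mod e f he hf => exact measurable_nat₂ _ he hf

lemma NExp.measurable_cost (e : NExp) : Measurable fun s : Store => e.cost s := by induction e with
  | lit c => exact measurable_const
  | get a i ih =>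
    exact measurable_nat₂ (fun x y => x + 1 + y.size) ih (NExp.get a i).measurable_eval
  | add e f he hf =>
    exact measurable_nat₂ (fun x y => x + 1 + y.size) (he.add hf)
      (NExp.add e f).measurable_eval
  | sub e f he hf =>
    exact measurable_nat₂ (fun x y => x + 1 + y.size) (he.add hf)
      (NExp.sub e f).measurable_eval
  | mul e f he hf =>
    exact measurable_nat₂ (fun x y => x + 1 + y.size) (he.add hf)
      (NExp.mul e f).measurable_eval
  | div e f he hf =>
    exact measurable_nat₂ (fun x y => x + 1 + y.size) (he.add hf)
      (NExp.div e f).measurable_eval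
  | mod e f he hf =>
    exact measurable_nat₂ (fun x y => x + 1 + y.size) (he.add hf)
      (NExp.mod e f).measurable_eval

lemma RExp.measurable_eval (e : RExp) : Measurable fun s : Store => e.eval s := by induction e with
  | ofNat e => exact disc.comp e.measurable_eval
  | get a i => exact measurable_at (f := fun i s => s.2 a i) (fun i => by fun_prop) i.measurable_eval
  | add e f he hf => exact he.add hf
  | sub e f he hf => exact he.sub hf
  | mul e f he hf => exact he.mul hf
  | div e f he hf => exact he.div hf
  | exp e he => exact Real.measurable_exp.comp he
  | log e he => exact Real.measurable_log.comp he
  | sqrt e he => exact he.sqrt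

lemma RExp.measurable_cost (e : RExp) : Measurable fun s : Store => e.cost s := by induction e with
  | ofNat e => exact e.measurable_cost.add_const 1
  | get _ i => exact i.measurable_cost.add_const 1
  | add e f he hf | sub e f he hf | mul e f he hf | div e f he hf => exact (he.add hf).add_const 1
  | exp e he | log e he | sqrt e he => exact he.add_const 1

lemma BExp.measurable_holds (b : BExp) : MeasurableSet {s : Store | b.Holds s} := by induction b with
  | natEq e f => exact measurableSet_eq_fun e.measurable_eval f.measurable_eval
  | natLt e f => exact measurableSet_lt e.measurable_eval f.measurable_eval
  | realLe e f => exact measurableSet_le e.measurable_eval f.measurable_eval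
  | not b hb => exact hb.compl
  | and b c hb hc => exact hb.inter hc

lemma BExp.measurable_cost (b : BExp) : Measurable fun s : Store => b.cost s := by induction b with
  | natEq e f | natLt e f => exact (e.measurable_cost.add f.measurable_cost).add_const 1
  | realLe e f => exact (e.measurable_cost.add f.measurable_cost).add_const 1
  | not b hb => exact hb.add_const 1
  | and b c hb hc => exact (hb.add hc).add_const 1

lemma measurable_coin : Measurable coin := by
  have h : Measurable fun x => (prob x : ℝ) :=
    (continuous_subtype_val.comp (continuous_projIcc)).measurable
  refine measurable_of_measurable_coe _ fun s hs => ?_; simp_rw [coin_eq]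
  exact (h.ennreal_ofReal.mul_const _).add ((measurable_const.sub h).ennreal_ofReal.mul_const _)

lemma measurable_upd {α γ : Type} [MeasurableSpace α] [MeasurableSpace γ] {f : γ → ℕ → ℕ → α}
    (hf : Measurable f) (a : ℕ) {i : γ → ℕ} (hi : Measurable i) {v : γ → α} (hv : Measurable v) :
    Measurable fun x => upd (f x) a (i x) (v x) := by
  refine measurable_pi_lambda _ fun a' => measurable_pi_lambda _ fun i' => ?_
  refine Measurable.ite ?_ hv (by fun_prop); by_cases h : a' = a
  · simpa [h] using measurableSet_eq_fun measurable_const hi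
  simp_all

lemma measurable_iter {f : Config → Measure Config} (hf : Measurable f) (j : ℕ) :
    Measurable (iter f j) := by
  induction j with
  | zero => exact measurable_dirac
  | succ j ih => exact (measurable_bind' ih).comp (hf.comp (by fun_prop))

lemma measurable_run (c : Cmd) : Measurable (run c) := by induction c with
  | skip =>
    have h : Measurable fun x : Config => ((x.1, x.2 + 1)) := by fun_prop
    exact measurable_dirac.comp h
  | setNat a i e =>
    have he := e.measurable_eval.comp (measurable_fst : Measurable (Prod.fst : Config → Store))
    exact measurable_dirac.comp (((measurable_upd (by fun_prop) a (i.measurable_eval.comp measurable_fst) he).prodMk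
      (by fun_prop)).prodMk (measurable_snd.add (((i.measurable_cost.comp measurable_fst).add (e.measurable_cost.comp measurable_fst)).add_const 1)))
  | setReal a i e =>
    have he := e.measurable_eval.comp (measurable_fst : Measurable (Prod.fst : Config → Store))
    exact measurable_dirac.comp ((Measurable.prodMk (by fun_prop)
      (measurable_upd (by fun_prop) a (i.measurable_eval.comp measurable_fst) he)).prodMk (measurable_snd.add (((i.measurable_cost.comp measurable_fst).add (e.measurable_cost.comp measurable_fst)).add_const 1)))
  | ceil a i e =>
    have he := Nat.measurable_ceil.comp
      (e.measurable_eval.comp (measurable_fst : Measurable (Prod.fst : Config → Store)))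
    exact measurable_dirac.comp (((measurable_upd (by fun_prop) a (i.measurable_eval.comp measurable_fst) he).prodMk
      (by fun_prop)).prodMk (measurable_snd.add ((((i.measurable_cost.comp measurable_fst).add (e.measurable_cost.comp measurable_fst)).add_const 1).add he)))
  | flip a i e =>
    exact measurable_map_param (measurable_coin.comp (e.measurable_eval.comp measurable_fst)) (fun _ => inferInstance)
      (((measurable_upd (by fun_prop) a (i.measurable_eval.comp (measurable_fst.comp (measurable_fst : Measurable (Prod.fst : Config × Bool → Config)))) ((Measurable.of_discrete (f := fun b => if b then 1 else 0)).comp measurable_snd)).prodMk (by fun_prop)).prodMk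
        (measurable_snd.comp measurable_fst |>.add (((i.measurable_cost.comp (measurable_fst.comp measurable_fst)).add (e.measurable_cost.comp (measurable_fst.comp measurable_fst))).add_const 1)))
  | gauss a i =>
    exact measurable_map_param measurable_const (fun _ => inferInstance)
      ((Measurable.prodMk (by fun_prop) (measurable_upd (by fun_prop) a (i.measurable_eval.comp (measurable_fst.comp measurable_fst)) measurable_snd)).prodMk
        (measurable_snd.comp measurable_fst |>.add ((i.measurable_cost.comp (measurable_fst.comp measurable_fst)).add_const 1)))
  | seq c₁ c₂ h₁ h₂ => exact (measurable_bind' h₂).comp h₁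
  | ite b c₁ c₂ h₁ h₂ =>
    have h :=
      measurable_fst.prodMk (measurable_snd.add ((b.measurable_cost.comp measurable_fst).add_const 1))
    exact Measurable.ite (b.measurable_holds.preimage measurable_fst) (h₁.comp h) (h₂.comp h)
  | loop e c hc =>
    exact measurable_at
      (fun j => (measurable_iter hc j).comp (measurable_fst.prodMk (measurable_snd.add ((e.measurable_cost.comp measurable_fst).add_const 1)))) (e.measurable_eval.comp measurable_fst)

def delay (D : ℕ) (x : Config) : Config := (x.1, x.2 + D)

lemma measurable_delay (D : ℕ) : Measurable (delay D) := by unfold delay; fun_prop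

lemma iter_delay {f : Config → Measure Config} (hf : Measurable f)
    (h : ∀ D x, f (delay D x) = (f x).map (delay D)) (D j : ℕ) (x : Config) :
    iter f j (delay D x) = (iter f j x).map (delay D) := by
  induction j generalizing x with
  | zero => rw [iter, iter, map_dirac' (measurable_delay D)]
  | succ j ih =>
    have e : ((delay D x).1, (delay D x).2 + 1) = delay D (x.1, x.2 + 1) := by
      simp only [delay]; grind
    rw [iter, iter, e, h, map_bind (measurable_delay D) (measurable_iter hf j),
      bind_map (measurable_iter hf j) (measurable_delay D)]
    grind

/-- No command reads the clock, so a run that starts later is the same run shifted in time. This is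
what allows `sem` to forget the clock. -/
lemma run_delay (c : Cmd) (D : ℕ) (x : Config) : run c (delay D x) = (run c x).map (delay D) := by
  induction c generalizing x D with
  | skip | setNat a i e | setReal a i e | ceil a i e =>
    simp only [run, map_dirac' (measurable_delay D)]; simp only [delay]; grind
  | flip a i e =>
    simp only [run]; rw [Measure.map_map (measurable_delay D) disc]; simp only [delay]
    congr 1; funext b; simp; congr 1; omega
  | gauss a i =>
    obtain ⟨s, T⟩ := x
    have h : Measurable fun z => (((s.1, upd s.2 a (i.eval s) z), T + (i.cost s + 1))) :=
      (measurable_const.prodMk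
        (measurable_upd measurable_const a measurable_const measurable_id)).prodMk measurable_const
    simp only [run]; rw [Measure.map_map (measurable_delay D) h]; simp only [delay]
    congr 1; funext b; simp; congr 1; omega
  | seq c₁ c₂ h₁ h₂ =>
    simp only [run]
    rw [h₁, map_bind (measurable_delay D) (measurable_run c₂), bind_map (measurable_run c₂) (measurable_delay D)]
    grind
  | ite b c₁ c₂ h₁ h₂ =>
    obtain ⟨s, T⟩ := x; have e : T + D + (b.cost s + 1) = T + (b.cost s + 1) + D := by omega
    change (if b.Holds s then run c₁ _ else run c₂ _) = map _
      (if b.Holds s then run c₁ _ else run c₂ _)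
    rw [e]; by_cases hb : b.Holds s
    · rw [if_pos hb, if_pos hb]; exact h₁ D (s, T + _)
    · rw [if_neg hb, if_neg hb]; exact h₂ D (s, T + _)
  | loop e c hc =>
    obtain ⟨s, T⟩ := x
    simp [delay, run, (by omega : T + D + (e.cost s + 1) = T + (e.cost s + 1) + D)]
    exact iter_delay (measurable_run c) hc D _ (s, _)

/-- The law of the memory after the run of a program. -/
def sem (c : Cmd) (s : Store) : Measure Store := (run c (s, 0)).map Prod.fst

lemma run_map_fst (c : Cmd) (x : Config) : (run c x).map Prod.fst = sem c x.1 := by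
  have h := run_delay c x.2 (x.1, 0); rw [(by simp [delay] : delay x.2 _ = x)] at h
  rw [h, Measure.map_map measurable_fst (measurable_delay _)]; rfl

lemma measurable_sem (c : Cmd) : Measurable (sem c) := (measurable_map _ measurable_fst).comp ((measurable_run c).comp (by fun_prop))

lemma sem_seq (c₁ c₂ : Cmd) (s : Store) : sem (.seq c₁ c₂) s = (sem c₁ s).bind (sem c₂) := by
  rw [sem, run, bind_map (measurable_run c₂) measurable_fst, sem, map_bind measurable_fst (measurable_sem c₂)]
  simp_rw [run_map_fst]

lemma sem_skip (s : Store) : sem .skip s = dirac s := by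
  rw [sem, run, map_dirac' measurable_fst]

lemma sem_setNat (a : ℕ) (i e : NExp) (s : Store) :
    sem (.setNat a i e) s = dirac (upd s.1 a (i.eval s) (e.eval s), s.2) := by
  rw [sem, run, map_dirac' measurable_fst]

lemma sem_setReal (a : ℕ) (i : NExp) (e : RExp) (s : Store) :
    sem (.setReal a i e) s = dirac (s.1, upd s.2 a (i.eval s) (e.eval s)) := by
  rw [sem, run, map_dirac' measurable_fst]

lemma sem_flip (a : ℕ) (i : NExp) (e : RExp) (s : Store) :
    sem (.flip a i e) s = (coin (e.eval s)).bind fun b =>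
      dirac (upd s.1 a (i.eval s) (if b then 1 else 0), s.2) := by
  rw [sem, run, Measure.map_map measurable_fst disc, ← bind_dirac_eq_map _ disc]
  rfl

lemma measurable_setReal (s : Store) (a i : ℕ) :
    Measurable fun z : ℝ => ((s.1, upd s.2 a i z) : Store) :=
  measurable_const.prodMk (measurable_upd measurable_const a measurable_const measurable_id)

lemma sem_gauss (a : ℕ) (i : NExp) (s : Store) : sem (.gauss a i) s = (gaussianReal 0 1).bind fun z =>
      dirac (s.1, upd s.2 a (i.eval s) z) := by
  rw [sem, run, Measure.map_map measurable_fst ((measurable_setReal s a _).prodMk measurable_const)]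
  exact (bind_dirac_eq_map _ (measurable_setReal s a _)).symm

lemma sem_ite (b : BExp) (c₁ c₂ : Cmd) (s : Store) :
    sem (.ite b c₁ c₂) s = if b.Holds s then sem c₁ s else sem c₂ s := by
  rw [sem, run]; split_ifs
  · exact run_map_fst c₁ _
  · exact run_map_fst c₂ _

/-- `ν i` acts as a loop invariant: it is the law of the memory after `i` rounds. -/
lemma sem_loop (e : NExp) (c : Cmd) (s : Store) (ν : ℕ → Measure Store) (h0 : ν 0 = dirac s)
    (h : ∀ i < e.eval s, (ν i).bind (sem c) = ν (i + 1)) : sem (.loop e c) s = ν (e.eval s) := by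
  have key : ∀ j x, (iter (run c) j x).map Prod.fst =
      (fun μ => μ.bind (sem c))^[j] (dirac x.1) := by
    intro j
    have aux : ∀ j (μ : Measure Config), (μ.bind (iter (run c) j)).map Prod.fst =
        (fun μ => μ.bind (sem c))^[j] (μ.map Prod.fst) := by
      intro j
      induction j with
      | zero =>
        have : iter (run c) 0 = dirac := rfl; simp_all
      | succ j ih =>
        intro μ
        have hm : Measurable fun x : Config => run c (x.1, x.2 + 1) :=
          (measurable_run c).comp (by fun_prop)
        have e1 : μ.bind (iter (run c) (j + 1)) =
            (μ.bind fun x => run c (x.1, x.2 + 1)).bind (iter (run c) j) := by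
          rw [bind_bind hm (measurable_iter (measurable_run c) j)]; rfl
        rw [e1, ih, iterate_succ_apply, bind_map hm measurable_fst]; simp_rw [run_map_fst]
        rw [map_bind measurable_fst (measurable_sem c)]
    intro x; have := aux j (dirac x)
    rwa [dirac_bind (measurable_iter (measurable_run c) j), map_dirac' measurable_fst] at this
  have it : ∀ j ≤ e.eval s, (fun μ => μ.bind (sem c))^[j] (dirac s) = ν j := by
    intro j
    induction j with
    | zero => simp_all
    | succ j ih =>
      intro hj; rw [iterate_succ_apply', ih (by omega), h j (by omega)]
  exact (key _ _).trans (it _ le_rfl)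

end Machine

/-! ### Updating arrays, counted loops and loops that fill an array. -/

section Memory

def setN (a : ℕ) (f : ℕ → ℕ) (s : Store) : Store := (update s.1 a f, s.2)

def setR (a : ℕ) (f : ℕ → ℝ) (s : Store) : Store := (s.1, update s.2 a f)

@[simp] lemma setN_same (a : ℕ) (f : ℕ → ℕ) (s : Store) : (setN a f s).1 a = f := by simp [setN]

@[simp] lemma setN_ne {a b : ℕ} (h : b ≠ a) (f : ℕ → ℕ) (s : Store) :
    (setN a f s).1 b = s.1 b := by simp [setN, h]

@[simp] lemma setN_snd (a : ℕ) (f : ℕ → ℕ) (s : Store) : (setN a f s).2 = s.2 := rfl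

@[simp] lemma setR_same (a : ℕ) (f : ℕ → ℝ) (s : Store) : (setR a f s).2 a = f := by simp [setR]

@[simp] lemma setR_ne {a b : ℕ} (h : b ≠ a) (f : ℕ → ℝ) (s : Store) :
    (setR a f s).2 b = s.2 b := by simp [setR, h]

@[simp] lemma setR_fst (a : ℕ) (f : ℕ → ℝ) (s : Store) : (setR a f s).1 = s.1 := rfl

@[simp] lemma setN_setN (a : ℕ) (f g : ℕ → ℕ) (s : Store) :
    setN a f (setN a g s) = setN a f s := by simp [setN]

@[simp] lemma setR_setR (a : ℕ) (f g : ℕ → ℝ) (s : Store) :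
    setR a f (setR a g s) = setR a f s := by simp [setR]

@[simp] lemma setN_self (a : ℕ) (s : Store) : setN a (s.1 a) s = s := by simp [setN]

@[simp] lemma setR_self (a : ℕ) (s : Store) : setR a (s.2 a) s = s := by simp [setR]

lemma setN_eq_self {a : ℕ} {f : ℕ → ℕ} {s : Store} (h : s.1 a = f) : setN a f s = s := by simp [← h]

lemma setR_eq_self {a : ℕ} {f : ℕ → ℝ} {s : Store} (h : s.2 a = f) : setR a f s = s := by simp [← h]

lemma setN_comm {a b : ℕ} (h : a ≠ b) (f g : ℕ → ℕ) (s : Store) :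
    setN a f (setN b g s) = setN b g (setN a f s) := by
  simp only [setN, update_comm h]

lemma setN_sort {a b : ℕ} (h : b < a) (f g : ℕ → ℕ) (s : Store) :
    setN a f (setN b g s) = setN b g (setN a f s) := setN_comm h.ne' f g s

lemma setN_setR (a b : ℕ) (f : ℕ → ℕ) (g : ℕ → ℝ) (s : Store) :
    setN a f (setR b g s) = setR b g (setN a f s) := rfl

lemma measurable_setN_apply (a : ℕ) {γ : Type*} [MeasurableSpace γ] {f : γ → ℕ → ℕ} {s : γ → Store}
    (hf : Measurable f) (hs : Measurable s) : Measurable fun x => setN a (f x) (s x) := by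
  refine Measurable.prodMk (measurable_pi_lambda _ fun b => ?_) hs.snd; by_cases h : b = a
  · simp_all
  · simp [h]; exact (measurable_pi_apply b).comp hs.fst

lemma measurable_setR_apply (a : ℕ) {γ : Type*} [MeasurableSpace γ] {f : γ → ℕ → ℝ} {s : γ → Store}
    (hf : Measurable f) (hs : Measurable s) : Measurable fun x => setR a (f x) (s x) := by
  refine Measurable.prodMk hs.fst (measurable_pi_lambda _ fun b => ?_); by_cases h : b = a
  · simp_all
  · simp [h]; exact (measurable_pi_apply b).comp hs.snd

lemma sem_setNat' (a : ℕ) (i e : NExp) (s : Store) :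
    sem (.setNat a i e) s = dirac (setN a (update (s.1 a) (i.eval s) (e.eval s)) s) := by
  rw [sem_setNat]; congr 1; refine Prod.ext (funext fun b => funext fun j => ?_) rfl
  by_cases hb : b = a
  · subst hb; simp [upd, update_apply]
  · simp [upd, hb]

lemma upd_real_eq (s : Store) (a i : ℕ) (v : ℝ) :
    (s.1, upd s.2 a i v) = setR a (update (s.2 a) i v) s := by
  refine Prod.ext rfl (funext fun b => funext fun j => ?_); by_cases hb : b = a
  · subst hb; simp [upd, update_apply]
  · simp [upd, hb]

lemma upd_nat_eq (s : Store) (a i : ℕ) (v : ℕ) :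
    (upd s.1 a i v, s.2) = setN a (update (s.1 a) i v) s := by
  refine Prod.ext (funext fun b => funext fun j => ?_) rfl; by_cases hb : b = a
  · subst hb; simp [upd, update_apply]
  · simp [upd, hb]

lemma sem_setReal' (a : ℕ) (i : NExp) (e : RExp) (s : Store) : sem (.setReal a i e) s =
      dirac (setR a (update (s.2 a) (i.eval s) (e.eval s)) s) := by
  rw [sem_setReal, upd_real_eq]

def bit (b : Bool) : ℕ := if b then 1 else 0

lemma sem_flip_map (a : ℕ) (i : NExp) (e : RExp) (s : Store) :
    sem (.flip a i e) s = (coin (e.eval s)).map fun b =>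
      setN a (update (s.1 a) (i.eval s) (bit b)) s := by
  rw [sem_flip, bind_dirac_eq_map _ disc]; congr 1; funext b
  exact upd_nat_eq _ _ _ _

lemma sem_gauss_map (a : ℕ) (i : NExp) (s : Store) :
    sem (.gauss a i) s = (gaussianReal 0 1).map fun z =>
      setR a (update (s.2 a) (i.eval s) z) s := by
  rw [sem_gauss, bind_dirac_eq_map _ (measurable_setReal s a _)]; congr 1; funext b
  exact upd_real_eq _ _ _ _

/-- Sequencing after a program whose outcome is described by a random variable. -/
lemma sem_seq_map {Ω : Type*} [MeasurableSpace Ω] {μ : Measure Ω} {c₁ : Cmd} (c₂ : Cmd) {s : Store}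
    {F : Ω → Store} (hF : Measurable F) (h : sem c₁ s = μ.map F) :
    sem (.seq c₁ c₂) s = μ.bind fun x => sem c₂ (F x) := by
  rw [sem_seq, h, map_bind hF (measurable_sem c₂)]

lemma sem_seq_dirac {c₁ : Cmd} (c₂ : Cmd) {s s' : Store} (h : sem c₁ s = dirac s') :
    sem (.seq c₁ c₂) s = sem c₂ s' := by
  rw [sem_seq, h, dirac_bind (measurable_sem c₂)]

attribute [simp] NExp.eval RExp.eval

/-- The minimum of an expression and the entry `0` of the array `4`. -/
def capN (e : NExp) : NExp := .sub e (.sub e (.get 4 (.lit 0)))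

@[simp] lemma eval_capN (e : NExp) (s : Store) : (capN e).eval s = min (e.eval s) (s.1 4 0) := by
  simp only [capN, NExp.eval]; omega

/-- The memory with the scratch cell `c` set to `i`. -/
def ctr (c i : ℕ) (s : Store) : Store := setN 3 (update (s.1 3) c i) s

lemma measurable_ctr (c i : ℕ) : Measurable (ctr c i) := by
  refine measurable_setN_apply 3 ?_ measurable_id; refine measurable_pi_lambda _ fun j => ?_
  by_cases hj : j = c
  · simp_all
  · simp [hj]; exact (measurable_pi_apply j).comp (by fun_prop)

lemma measurableSet_counter (c n : ℕ) : MeasurableSet {x : Store | n ≤ x.1 4 0 ∧ x.1 3 c = 0} := (measurableSet_le measurable_const (by fun_prop : Measurable fun x : Store => x.1 4 0)).inter (measurableSet_eq_fun (by fun_prop) measurable_const)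

lemma ctr_ctr (c i j : ℕ) (s : Store) : ctr c i (ctr c j s) = ctr c i s := by simp [ctr]

lemma ctr_self {c i : ℕ} {s : Store} (h : s.1 3 c = i) : ctr c i s = s := by subst h; simp [ctr]

/-- Counted loop: the scratch cell `c` holds the number of the round. -/
def forN (c : ℕ) (e : NExp) (body : Cmd) : Cmd :=
  .seq (.loop e (.seq body (.setNat 3 (.lit c) (capN (.add (.get 3 (.lit c)) (.lit 1))))))
    (.setNat 3 (.lit c) (.lit 0))

lemma sem_set_ctr (c : ℕ) (e : NExp) (s : Store) :
    sem (.setNat 3 (.lit c) e) s = dirac (ctr c (e.eval s) s) := by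
  rw [sem_setNat']; rfl

/-- The counter occupies the scratch cell `c` only during a round and is zero outside, so `ν`
describes the memory without it. The counter is increased through `capN`; the condition `n ≤ x.1 4
0` says that the cap has no effect. -/
lemma sem_forN {c n : ℕ} {e : NExp} {body : Cmd} {s : Store} (ν : ℕ → Measure Store)
    (h0 : ν 0 = dirac s) (he : e.eval s = n)
    (hν : ∀ i ≤ n, ∀ᵐ x ∂ν i, n ≤ x.1 4 0 ∧ x.1 3 c = 0)
    (step : ∀ i < n, ((ν i).bind fun x => sem body (ctr c i x)) = (ν (i + 1)).map (ctr c i)) :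
    sem (forN c e body) s = ν n := by
  have hs : s.1 3 c = 0 := by
    have h := hν 0 (Nat.zero_le _); simp_all
  have hloop := sem_loop e (.seq body (.setNat 3 _ (capN (.add (.get 3 (.lit c)) (.lit 1))))) s
    (fun i => (ν i).map _) (by
      simp only [h0]; rw [map_dirac' (measurable_ctr c 0), ctr_self hs]) (by
      rw [he]; intro i hi
      have hb : Measurable fun x => sem body _ := (measurable_sem _).comp (measurable_ctr c i)
      rw [map_bind (measurable_ctr c i) (measurable_sem _)]; simp_rw [sem_seq]
      rw [← bind_bind hb (measurable_sem _), step i hi, map_bind (measurable_ctr c i) (measurable_sem _),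
        ← bind_dirac_eq_map _ (measurable_ctr c _)]
      refine bind_congr_right ?_; filter_upwards [hν _ hi] with x hx
      rw [sem_set_ctr, ctr_ctr]; congr 2
      simp [(by simp [ctr] : (ctr c i x).1 3 c = i), (by simp [ctr] : (ctr c i x).1 4 0 = x.1 4 0)]
      omega)
  rw [he] at hloop; rw [forN, sem_seq, hloop, map_bind (measurable_ctr c n) (measurable_sem _)]
  conv_rhs => rw [← bind_dirac (m := ν n)]
  refine bind_congr_right ?_
  filter_upwards [hν n le_rfl] with x hx; rw [sem_set_ctr, ctr_ctr]
  exact congrArg _ (ctr_self hx.2)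

lemma sem_forN_det {c n : ℕ} {e : NExp} {body : Cmd} {s : Store} (S : ℕ → Store) (h0 : S 0 = s)
    (he : e.eval s = n) (hcap : ∀ i, n ≤ (S i).1 4 0) (hc : ∀ i, (S i).1 3 c = 0)
    (step : ∀ i < n, sem body (ctr c i (S i)) = dirac (ctr c i (S (i + 1)))) :
    sem (forN c e body) s = dirac (S n) := by
  refine sem_forN (fun i => dirac _) (by grind) he (fun i _ => ?_) fun i hi => ?_
  · simp_all
  · have hb : Measurable fun x => sem body _ := (measurable_sem _).comp (measurable_ctr c i)
    simp_all

/-- Allows a loop that draws coordinate after coordinate to be described by a complete sample from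
the start: round `i` redraws coordinate `i`, on which the memory does not depend yet. -/
lemma pi_resample {ι : Type*} [Fintype ι] [DecidableEq ι] {α : ι → Type*} [∀ i, MeasurableSpace (α i)]
    (m : ∀ i, Measure (α i)) [∀ i, IsProb (m i)] (i : ι) {β : Type*} [MeasurableSpace β]
    {f : (∀ i, α i) → β} (hf : Measurable f) :
    ((piM m).bind fun x => (m i).map fun v => f (update x i v)) =
      (piM m).map f := by
  have hu : Measurable fun z : _ × α i => update z.1 i z.2 := by
    refine measurable_pi_lambda _ fun j => ?_; by_cases h : j = i
    · subst h; simpa using measurable_snd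
    · simp [h]; exact (measurable_pi_apply j).comp measurable_fst
  have h : ((piM m).prod (m i)).map (fun z => update z.1 i z.2) = piM m := by
    symm; refine pi_eq fun t ht => ?_; rw [map_apply hu (.univ_pi ht)]
    have e : (fun z => update z.1 i z.2) ⁻¹' Set.univ.pi t =
        Set.univ.pi (update t i Set.univ) ×ˢ t i := by
      grind
    rw [e, prod_prod, pi_pi, ← mul_prod_erase _ _ (mem_univ i),
      ← mul_prod_erase _ _ (mem_univ i)]
    simp; rw [mul_comm]; congr 1; refine prod_congr rfl fun j hj => ?_; grind
  conv_rhs => rw [← h, Measure.map_map hf hu]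
  exact (prod_map_eq_bind (hf.comp hu)).symm

lemma sem_forN_pi {α : Type*} [MeasurableSpace α] {c n : ℕ} {e : NExp} {body : Cmd} {s : Store}
    (m : Fin n → Measure α) [∀ i, IsProb (m i)] (S : ℕ → (Fin n → α) → Store)
    (hS : ∀ i, Measurable (S i)) (h0 : ∀ x, S 0 x = s) (he : e.eval s = n)
    (hcap : ∀ i x, n ≤ (S i x).1 4 0) (hc : ∀ i x, (S i x).1 3 c = 0)
    (step : ∀ (i : Fin n) x, sem body (ctr c i (S i x)) =
      (m i).map fun v => ctr c i (S (i + 1) (update x i v))) :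
    sem (forN c e body) s = (piM m).map (S n) := by
  refine sem_forN (fun i => (piM m).map _) ?_ he (fun i _ => ?_) fun i hi => ?_
  · have := funext h0; simp_all
  · have hm := measurableSet_counter c n
    exact (ae_map_iff (hS i).aemeasurable hm).2 (.of_forall fun x => ⟨hcap i x, hc i x⟩)
  · have hb : Measurable fun x => sem body _ := (measurable_sem _).comp (measurable_ctr c i)
    rw [map_bind (hS i) hb, Measure.map_map (measurable_ctr c i) (hS _),
      ← pi_resample m ⟨i, hi⟩ ((measurable_ctr c i).comp (hS _))]
    congr 1; funext x; exact step ⟨i, hi⟩ x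

/-- The array with the entries `enc (x 0), enc (x 1), …`, continued by `z`. -/
def arr {α β : Type*} {n : ℕ} (z : β) (enc : α → β) (x : Fin n → α) : ℕ → β :=
  fun y => if h : y < n then enc (x ⟨y, h⟩) else z

lemma arr_of_lt {α β : Type*} {n : ℕ} (z : β) (enc : α → β) (x : Fin n → α) {y : ℕ} (h : y < n) :
    arr z enc x y = enc (x ⟨y, h⟩) := dif_pos h

@[simp] lemma arr_val {α β : Type*} {n : ℕ} (z : β) (enc : α → β) (x : Fin n → α) (y : Fin n) :
    arr z enc x y = enc (x y) := arr_of_lt z enc x y.2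

lemma measurable_arr {α β : Type*} [MeasurableSpace α] [MeasurableSpace β] {n : ℕ} (z : β)
    {enc : α → β} (henc : Measurable enc) : Measurable fun x : Fin n → α => arr z enc x := by
  refine measurable_pi_lambda _ fun y => ?_; by_cases h : y < n
  · simp [arr, h]; exact henc.comp (measurable_pi_apply _)
  · simp only [arr, h]; simp

/-- A loop that draws the entries of an array one after the other. -/
lemma sem_fill {α β : Type*} [MeasurableSpace α] [MeasurableSpace β] {c n : ℕ} {e : NExp}
    {body : Cmd} {s : Store} (W : (ℕ → β) → Store) (hW : Measurable W) (z : β) (enc : α → β)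
    (henc : Measurable enc) (m : Fin n → Measure α) [∀ i, IsProb (m i)]
    (h0 : W (fun _ => z) = s) (he : e.eval s = n) (hcap : ∀ f, n ≤ (W f).1 4 0)
    (hc : ∀ f, (W f).1 3 c = 0)
    (step : ∀ (i : Fin n) f, f i = z → sem body (ctr c i (W f)) =
      (m i).map fun v => ctr c i (W (update f i (enc v)))) :
    sem (forN c e body) s = (piM m).map fun x => W (arr z enc x) := by
  have key := sem_forN_pi m (fun i x => W fun y => if y < i then arr z enc x y else z)
    (fun i => hW.comp (measurable_pi_lambda _ fun y => by
      by_cases h : y < i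
      · simp only [h]; exact (measurable_pi_apply y).comp (measurable_arr z henc)
      · simp only [h]; simp))
    (fun x => by grind) he (fun i x => hcap _) (fun i x => hc _) (fun i x => by
      rw [step i _ (by simp)]; congr 1; funext v; congr 2; funext y; by_cases hy : y = i
      · simp_all
      · rw [update_of_ne hy]; by_cases h : y < i
        · have h1 : y < n := by omega
          have h2 : (⟨y, h1⟩) ≠ i := fun h' => hy (congrArg Fin.val h')
          simp [h, Nat.lt_succ_of_lt h, arr_of_lt z enc _ h1, h2]
        grind)
  rw [key]; congr 1; funext x; congr 1; funext y; by_cases h : y < n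
  · simp [h]
  · simp [h, arr]

end Memory

/-! ### Time bounds for programs that keep the natural cells bounded. -/

section Time

open Polynomial

/-- All natural cells hold at most `B`. -/
def Bounded (B : ℕ) (s : Store) : Prop := ∀ a i, s.1 a i ≤ B

lemma measurableSet_bounded (B T : ℕ) : MeasurableSet {x : Config | Bounded B x.1 ∧ x.2 ≤ T} := by
  refine MeasurableSet.inter ?_ (measurableSet_le (by fun_prop : Measurable fun x : Config => x.2) measurable_const)
  have : {x : Config | Bounded B x.1} = ⋂ a, ⋂ i, {x : Config | x.1.1 a i ≤ B} := by
    ext x; simp [Bounded]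
  refine (congrArg MeasurableSet this).mpr (.iInter fun a => .iInter fun i => ?_)
  exact measurableSet_le (by fun_prop) measurable_const

lemma ae_bind {α β : Type*} [MeasurableSpace α] [MeasurableSpace β] {μ : Measure α}
    {κ : α → Measure β} (hκ : Measurable κ) {p : β → Prop} (hp : MeasurableSet {y | p y})
    (h : ∀ᵐ x ∂μ, ∀ᵐ y ∂κ x, p y) : ∀ᵐ y ∂μ.bind κ, p y := by
  rw [ae_iff, Measure.bind_apply (s := {y | ¬ p y}) hp.compl hκ.aemeasurable]
  have hm : Measurable fun x => κ x {y | ¬ p y} := (measurable_coe hp.compl).comp hκ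
  rw [lintegral_eq_zero_iff hm]; filter_upwards [h] with x hx; exact ae_iff.1 hx

lemma size_le_self (x : ℕ) : x.size ≤ x := Nat.size_le.2 Nat.lt_two_pow_self

namespace NExp

/-- A bound for the value in terms of a bound for the cells. -/
def vb : NExp → ℕ[X]
  | lit c => C c
  | get _ _ => X
  | add e f => e.vb + f.vb
  | sub e _ => e.vb
  | mul e f => e.vb * f.vb
  | div e _ => e.vb
  | mod e _ => e.vb

/-- A bound for the cost in terms of a bound for the cells. -/
def cb : NExp → ℕ[X]
  | lit c => C (1 + c.size)
  | get _ i => i.cb + 1 + X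
  | add e f => e.cb + f.cb + 1 + (e.vb + f.vb)
  | sub e f => e.cb + f.cb + 1 + e.vb
  | mul e f => e.cb + f.cb + 1 + e.vb * f.vb
  | div e f => e.cb + f.cb + 1 + e.vb
  | mod e f => e.cb + f.cb + 1 + e.vb

lemma eval_le {B : ℕ} {s : Store} (h : Bounded B s) (e : NExp) : e.eval s ≤ e.vb.eval B := by
  induction e with
  | lit c => simp [vb]
  | get a i _ => simpa [vb] using h _ _
  | add e f he hf => simp [vb]; omega
  | sub e f he hf => simp only [NExp.eval, vb]; omega
  | mul e f he hf => simp [vb]; exact Nat.mul_le_mul he hf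
  | div e f he hf => exact (Nat.div_le_self _ _).trans he
  | mod e f he hf => exact (Nat.mod_le _ _).trans he

lemma cost_le {B : ℕ} {s : Store} (h : Bounded B s) (e : NExp) : e.cost s ≤ e.cb.eval B := by
  have hs := fun {e} => (size_le_self _).trans (eval_le h e)
  induction e with
  | lit c => simp [cost, cb]
  | get a i ih =>
    have := hs (e := .get a i); simp [cost, cb, vb] at *; omega
  | add e f he hf =>
    have := hs (e := .add e f); simp [cost, cb, vb] at *; omega
  | sub e f he hf =>
    have := hs (e := .sub e f); simp [cost, cb, vb] at *; omega
  | mul e f he hf =>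
    have := hs (e := .mul e f); simp [cost, cb, vb] at *; omega
  | div e f he hf =>
    have := hs (e := .div e f); simp [cost, cb, vb] at *; omega
  | mod e f he hf =>
    have := hs (e := .mod e f); simp [cost, cb, vb] at *; omega

/-- The value is at most the maximum of the cells and `1`. -/
def Small (e : NExp) : Prop := ∀ B s, 1 ≤ B → Bounded B s → e.eval s ≤ B

lemma small_lit {c : ℕ} (h : c ≤ 1) : (lit c).Small := fun _ _ hB _ => h.trans hB
lemma small_get a i : (get a i).Small := fun _ _ _ h => h _ _
lemma small_capN e : (capN e).Small := fun _ _ _ h => by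
  rw [eval_capN]; exact (min_le_right _ _).trans (h _ _)

end NExp

/-- A bound for the cost in terms of a bound for the cells. -/
def RExp.cb : RExp → ℕ[X]
  | ofNat e => e.cb + 1
  | get _ i => i.cb + 1
  | add e f | sub e f | mul e f | div e f => e.cb + f.cb + 1
  | exp e | log e | sqrt e => e.cb + 1

lemma RExp.cost_le {B : ℕ} {s : Store} (h : Bounded B s) (e : RExp) : e.cost s ≤ e.cb.eval B := by
  induction e with
  | ofNat e =>
    have := e.cost_le h; simp [cost, cb]; omega
  | get _ e =>
    have := e.cost_le h; simp [cost, cb]; omega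
  | add e f he hf | sub e f he hf | mul e f he hf | div e f he hf => simp [cost, cb]; omega
  | exp e he | log e he | sqrt e he => simp [cost, cb]; omega

/-- A bound for the cost in terms of a bound for the cells. -/
def BExp.cb : BExp → ℕ[X]
  | natEq e f | natLt e f => e.cb + f.cb + 1
  | realLe e f => e.cb + f.cb + 1
  | not b => b.cb + 1
  | and b c => b.cb + c.cb + 1

lemma BExp.cost_le {B : ℕ} {s : Store} (h : Bounded B s) (b : BExp) : b.cost s ≤ b.cb.eval B := by
  induction b with
  | natEq e f | natLt e f =>
    have := e.cost_le h; have := f.cost_le h; simp [cost, cb]; omega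
  | realLe e f =>
    have := e.cost_le h; have := f.cost_le h; simp [cost, cb]; omega
  | not b hb => simp [cost, cb]; omega
  | and b c hb hc => simp [cost, cb]; omega

namespace Cmd

/-- Programs without rounding that keep the natural cells bounded. -/
def Safe : Cmd → Prop
  | skip => True
  | setNat _ _ e => e.Small
  | setReal _ _ _ => True
  | ceil _ _ _ => False
  | flip _ _ _ => True
  | gauss _ _ => True
  | seq c₁ c₂ => c₁.Safe ∧ c₂.Safe
  | ite _ c₁ c₂ => c₁.Safe ∧ c₂.Safe
  | loop _ c => c.Safe

/-- A bound for the running time of a safe program in terms of a bound for the cells. -/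
def tb : Cmd → ℕ[X]
  | skip => 1
  | setNat _ i e => i.cb + e.cb + 1
  | setReal _ i e => i.cb + e.cb + 1
  | ceil _ i e => i.cb + e.cb + 1 + X
  | flip _ i e => i.cb + e.cb + 1
  | gauss _ i => i.cb + 1
  | seq c₁ c₂ => c₁.tb + c₂.tb
  | ite b c₁ c₂ => b.cb + 1 + (c₁.tb + c₂.tb)
  | loop e c => e.cb + 1 + e.vb * (c.tb + 1)

end Cmd

lemma Bounded.upd {B : ℕ} {s : Store} (h : Bounded B s) (a i : ℕ) {v : ℕ} (hv : v ≤ B)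
    (g : ℕ → ℕ → ℝ) : Bounded B (upd s.1 a i v, g) := by
  intro a' i'; simp only [KPdsIsgm.upd]; split_ifs
  · exact hv
  · exact h _ _

/-- A safe program stores only natural numbers that are at most the maximum of one and the cells, so
the bound `B` persists. Then every expression costs at most a polynomial in `B` and every loop has
at most polynomially many rounds, and the time bound follows by induction. -/
lemma run_bound {B : ℕ} (hB : 1 ≤ B) (c : Cmd) (hc : c.Safe) (x : Config) (hx : Bounded B x.1) :
    ∀ᵐ y ∂run c x, Bounded B y.1 ∧ y.2 ≤ x.2 + c.tb.eval B := by
  induction c generalizing x with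
  | skip =>
    refine (ae_dirac_iff (measurableSet_bounded _ _)).2 ⟨hx, ?_⟩; simp [Cmd.tb]
  | setNat a i e =>
    refine (ae_dirac_iff (measurableSet_bounded _ _)).2 ⟨hx.upd a _ (hc _ _ hB hx) _, ?_⟩
    have := i.cost_le hx; have := e.cost_le hx; simp [Cmd.tb]; omega
  | setReal a i e =>
    refine (ae_dirac_iff (measurableSet_bounded _ _)).2 ⟨hx, ?_⟩; have := i.cost_le hx
    have := e.cost_le hx; simp [Cmd.tb]; omega
  | ceil a i e => exact hc.elim
  | flip a i e =>
    obtain ⟨s, T⟩ := x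
    refine (ae_map_iff disc.aemeasurable (measurableSet_bounded _ _)).2
      (.of_forall fun b => ⟨hx.upd a _ ?_ _, ?_⟩)
    · split_ifs <;> omega
    · have := i.cost_le hx; have := e.cost_le hx; simp [Cmd.tb]; simp only at *; omega
  | gauss a i =>
    obtain ⟨s, T⟩ := x
    refine (ae_map_iff ((measurable_setReal s a _).prodMk measurable_const).aemeasurable
      (measurableSet_bounded _ _)).2 (.of_forall fun b => ⟨hx, ?_⟩)
    have := i.cost_le hx; simp [Cmd.tb]; simp only at *; omega
  | seq c₁ c₂ h₁ h₂ =>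
    refine ae_bind (measurable_run c₂) (measurableSet_bounded _ _) ?_
    filter_upwards [h₁ hc.1 x hx] with y hy; filter_upwards [h₂ hc.2 y hy.1] with z hz
    refine ⟨hz.1, ?_⟩; simp only [Cmd.tb, eval_add]; omega
  | ite b c₁ c₂ h₁ h₂ =>
    have hb := b.cost_le hx; unfold run; split_ifs
    · filter_upwards [h₁ hc.1 _ hx] with y hy; refine ⟨hy.1, ?_⟩; simp [Cmd.tb] at *; omega
    · filter_upwards [h₂ hc.2 _ hx] with y hy; refine ⟨hy.1, ?_⟩; simp [Cmd.tb] at *; omega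
  | loop e c ih =>
    have hit : ∀ j x, Bounded B x.1 →
        ∀ᵐ y ∂iter (run c) j x, Bounded B y.1 ∧ y.2 ≤ x.2 + j * (c.tb.eval B + 1) := by
      intro j
      induction j with
      | zero => exact fun x hx => (ae_dirac_iff (measurableSet_bounded _ _)).2 ⟨hx, by simp⟩
      | succ j ihj =>
        intro x hx
        refine ae_bind (measurable_iter (measurable_run c) j) (measurableSet_bounded _ _) ?_
        filter_upwards [ih hc _ hx] with y hy; filter_upwards [ihj y hy.1] with z hz; grind
    have h1 := e.cost_le hx; filter_upwards [hit _ _ hx] with y hy; refine ⟨hy.1, ?_⟩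
    have h3 := Nat.mul_le_mul_right (c.tb.eval B + 1) (e.eval_le hx)
    simp only [Cmd.tb, eval_add, eval_mul, eval_one] at *; omega

/-- From the memory `s`, the program `c` takes at most `K` steps and leaves the cells bounded. -/
def Takes (B : ℕ) (c : Cmd) (s : Store) (K : ℕ) : Prop :=
  ∀ T, ∀ᵐ y ∂run c (s, T), Bounded B y.1 ∧ y.2 ≤ T + K

lemma takes_of_safe {B : ℕ} (hB : 1 ≤ B) {c : Cmd} (hc : c.Safe) {s : Store} (hs : Bounded B s) :
    Takes B c s (c.tb.eval B) := fun T => run_bound hB c hc _ hs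

lemma takes_setNat {B : ℕ} {s : Store} (hs : Bounded B s) (a : ℕ) (i e : NExp) (he : e.eval s ≤ B) :
    Takes B (.setNat a i e) s ((Cmd.setNat a i e).tb.eval B) := by
  intro T; refine (ae_dirac_iff (measurableSet_bounded _ _)).2 ⟨hs.upd a _ he _, ?_⟩
  have := i.cost_le hs; have := e.cost_le hs; simp [Cmd.tb]; omega

lemma takes_ceil {B : ℕ} {s : Store} (hs : Bounded B s) (a : ℕ) (i : NExp) (e : RExp)
    (he : ⌈e.eval s⌉₊ ≤ B) : Takes B (.ceil a i e) s ((Cmd.ceil a i e).tb.eval B) := by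
  intro T; refine (ae_dirac_iff (measurableSet_bounded _ _)).2 ⟨hs.upd a _ he _, ?_⟩
  have := i.cost_le hs; have := e.cost_le hs; simp [Cmd.tb]; omega

lemma takes_seq {B : ℕ} {c₁ c₂ : Cmd} {s s' : Store} {K₁ K₂ : ℕ} (h₁ : Takes B c₁ s K₁)
    (h : sem c₁ s = dirac s') (h₂ : Takes B c₂ s' K₂) : Takes B (.seq c₁ c₂) s (K₁ + K₂) := by
  intro T
  have h3 : ∀ᵐ y ∂run c₁ (s, T), y.1 = s' := by
    have h5 : ∀ᵐ y ∂(run c₁ (s, T)).map Prod.fst, y = s' := by rw [((run_map_fst c₁ _).trans h)]; simp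
    exact ae_of_ae_map measurable_fst.aemeasurable h5
  refine ae_bind (measurable_run c₂) (measurableSet_bounded _ _) ?_
  filter_upwards [h₁ T, h3] with y hy hy'; obtain ⟨s'', T''⟩ := y; obtain rfl : s'' = s' := hy'
  filter_upwards [h₂ T''] with z hz; grind

end Time

/-! ### Uniform permutations from biased bits. -/

section Shuffle

@[simp] lemma ctr_fst_ne (c i : ℕ) {a : ℕ} (h : a ≠ 3) (s : Store) : (ctr c i s).1 a = s.1 a := by
  simp [ctr, h]

@[simp] lemma ctr_fst_same (c i : ℕ) (s : Store) :
    (ctr c i s).1 3 = update (s.1 3) c i := by simp [ctr]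

@[simp] lemma ctr_snd (c i : ℕ) (s : Store) : (ctr c i s).2 = s.2 := rfl

lemma setN_ctr {a : ℕ} (h : a ≠ 3) (f : ℕ → ℕ) (c i : ℕ) (s : Store) :
    setN a f (ctr c i s) = ctr c i (setN a f s) := by
  rw [ctr, ctr, setN_comm h, setN_ne h.symm]

lemma setR_ctr (a : ℕ) (f : ℕ → ℝ) (c i : ℕ) (s : Store) :
    setR a f (ctr c i s) = ctr c i (setR a f s) := rfl

lemma ctr_comm {c c' : ℕ} (h : c ≠ c') (i i' : ℕ) (s : Store) :
    ctr c i (ctr c' i' s) = ctr c' i' (ctr c i s) := by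
  simp [ctr, update_comm h]

variable {β : Type*} [MeasurableSpace β]

lemma ae_unif_dirac {Ω : Type*} [Fintype Ω] (S : Ω → β) {p : β → Prop} (hp : MeasurableSet {x | p x})
    (h : ∀ ω, p (S ω)) : ∀ᵐ x ∂unif Ω (fun ω => dirac (S ω)), p x := by
  rw [ae_iff, unif_apply]; refine sum_eq_zero fun ω _ => ?_
  rw [ae_iff.1 ((ae_dirac_iff hp).2 (h ω)), mul_zero]

lemma sem_forN_unif {c n : ℕ} {e : NExp} {body : Cmd} {s : Store} (Ω : ℕ → Type)
    [∀ i, Fintype (Ω i)] (S : ∀ i, Ω i → Store)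
    (h0 : (unif (Ω 0) fun ω => dirac (S 0 ω)) = dirac s) (he : e.eval s = n)
    (hcap : ∀ i ω, n ≤ (S i ω).1 4 0) (hc : ∀ i ω, (S i ω).1 3 c = 0)
    (step : ∀ i < n, (unif (Ω i) fun ω => sem body (ctr c i (S i ω))) =
      unif (Ω (i + 1)) fun ω => dirac (ctr c i (S (i + 1) ω))) :
    sem (forN c e body) s = unif (Ω n) fun ω => dirac (S n ω) := by
  refine sem_forN _ h0 he (fun i _ =>
    ae_unif_dirac _ (measurableSet_counter c n) fun ω => ⟨hcap i ω, hc i ω⟩) fun i hi => ?_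
  have hb : Measurable fun x => sem body _ := (measurable_sem _).comp (measurable_ctr c i)
  rw [unif_bind _ hb, unif_map _ (measurable_ctr c i)]; simp_all

lemma unif_resample {ι X : Type*} [Fintype ι] [DecidableEq ι] [Fintype X] (i : ι)
    (f : (ι → X) → Measure β) [Nonempty X] :
    (unif (ι → X) fun x => unif X fun v => f (update x i v)) = unif (ι → X) f := by
  let e : (ι → X) × X ≃ _ × X :=
    { toFun := fun z => (update z.1 i z.2, z.1 i)
      invFun := fun z => (update z.1 i z.2, z.1 i)
      left_inv := fun z => by simp
      right_inv := fun z => by simp }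
  rw [← unif_prod fun x v => f _]; refine (unif_equiv e fun z => f z.1).trans ?_
  rw [unif_prod fun x _ => f x]; exact unif_congr fun x => unif_const _

lemma coin_bind {x : ℝ} (h0 : 0 ≤ x) (h1 : x ≤ 1) (f : Bool → Measure β) :
    (coin x).bind f = ofReal x • f true + ofReal (1 - x) • f false := by
  rw [coin_eq, prob_coe h0 h1]; ext t ht
  rw [Measure.bind_apply ht (disc : Measurable f).aemeasurable, lintegral_add_measure, lintegral_smul_measure,
    lintegral_smul_measure, lintegral_dirac, lintegral_dirac]
  simp

/-- Reservoir sampling: replacing the current index by the new one with probability `1 / (i + 2)`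
keeps it uniform. Biased bits thus yield exactly uniform indices. -/
lemma unif_reservoir (i : ℕ) (f : ℕ → Measure β) :
    (unif (Fin (i + 1)) fun l => (coin (1 / ((i : ℝ) + 2))).bind fun b => if b then f (i + 1) else f l) =
      unif (Fin (i + 2)) fun l => f l := by
  have hi : (0 : ℝ) < i + 2 := by positivity
  simp_rw [coin_bind (by positivity) (by rw [div_le_one hi]; linarith : 1 / ((i : ℝ) + 2) ≤ 1)]
  have e1 : ofReal (1 / (i + 2)) = ((i + 2 : ℕ) : ℝ≥0∞)⁻¹ := by
    rw [one_div, ofReal_inv_of_pos hi, ← ENNReal.ofReal_natCast]; simp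
  have e2 : ofReal (1 - 1 / (i + 2)) = ((i + 1 : ℕ)) * ((i + 2 : ℕ) : ℝ≥0∞)⁻¹ := by
    have : 1 - 1 / (i + 2) = ((i + 1 : ℕ)) * (((i + 2 : ℕ) : ℝ))⁻¹ := by grind
    rw [this, ofReal_mul (by grind), ofReal_inv_of_pos (by grind),
      ENNReal.ofReal_natCast, ENNReal.ofReal_natCast]
  have hne : ((i + 1 : ℕ) : ℝ≥0∞) ≠ 0 := by simp
  have hnt : ((i + 1 : ℕ) : ℝ≥0∞) ≠ ⊤ := ENNReal.natCast_ne_top _; ext t _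
  rw [unif_apply, unif_apply, e1, e2, Fin.sum_univ_castSucc (n := i + 1)]
  simp only [if_true, Bool.false_eq_true, if_false, Measure.add_apply, Measure.smul_apply, smul_eq_mul, Fintype.card_fin, mul_add, Finset.sum_add_distrib, Finset.sum_const, Finset.card_univ, nsmul_eq_mul, Fin.val_castSucc]
  rw [← mul_assoc (_) (_)⁻¹, ENNReal.mul_inv_cancel hne hnt, one_mul, add_comm]; congr 1
  refine sum_congr rfl fun l _ => ?_
  rw [mul_assoc, ← mul_assoc (_)⁻¹, ENNReal.inv_mul_cancel hne hnt, one_mul]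

/-- The permutation of `j + 1` points that arises from `π` by moving the value at `l` to the end
and the new point to `l`. -/
def permSnoc (j : ℕ) : Fin (j + 1) × Perm (Fin j) ≃ Perm (Fin (j + 1)) :=
  (finSuccEquivLast.prodCongr (Equiv.inv _)).trans
    (Perm.decomposeOption.symm.trans ((Equiv.inv _).trans finSuccEquivLast.symm.permCongr))

lemma permSnoc_apply (j : ℕ) (l : Fin (j + 1)) (π : Perm (Fin j)) (y : Fin (j + 1)) :
    permSnoc j (l, π) y = finSuccEquivLast.symm
      (Option.map π (Equiv.swap none (finSuccEquivLast l) (finSuccEquivLast y))) := by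
  rfl

lemma arr_permSnoc (j : ℕ) (l : Fin (j + 1)) (π : Perm (Fin j)) :
    arr 0 Fin.val (permSnoc j (l, π)) =
      update (update (arr 0 Fin.val π) j (arr 0 Fin.val π l)) l j := by
  have hlast : ∀ z : Fin j, finSuccEquivLast _ = some z := finSuccEquivLast_castSucc; funext y
  by_cases hy : y < j + 1
  · rw [arr_of_lt _ _ _ hy, permSnoc_apply]
    obtain ⟨y, rfl⟩ : ∃ y' : Fin _, y' = y := ⟨⟨y, hy⟩, rfl⟩; rw [Fin.eta]; by_cases hyl : y = l
    · simp_all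
    · rw [update_of_ne (fun h => hyl (Fin.ext h))]
      induction y using Fin.lastCases with
      | last => induction l using Fin.lastCases with
        | last => grind
        | cast l => simp
      | cast y =>
        have h2 : (some y) ≠ finSuccEquivLast l := by
          rw [← hlast]; exact fun h => hyl (finSuccEquivLast.injective h)
        rw [hlast, Equiv.swap_apply_of_ne_of_ne (by simp) h2]; have h3 := y.2.ne; simp_all
  · have h1 : y ≠ l := by omega
    have h2 : y ≠ j := by omega
    have h3 : ¬ y < j := by omega
    simp [arr, hy, h1, h2, h3]

def reservoirStep : Cmd :=
  .seq (.flip 3 (.lit 4) (.div (.ofNat (.lit 1)) (.add (.ofNat (.get 3 (.lit 2))) (.ofNat (.lit 2)))))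
    (.seq (.ite (.natEq (.get 3 (.lit 4)) (.lit 1))
        (.setNat 3 (.lit 3) (capN (.add (.get 3 (.lit 2)) (.lit 1)))) .skip)
      (.setNat 3 (.lit 4) (.lit 0)))

lemma sem_reservoirStep {s : Store} {i : ℕ} (h4 : s.1 3 4 = 0) (hi : s.1 3 2 = i) (hcap : i + 1 ≤ s.1 4 0) :
    sem reservoirStep s = (coin (1 / ((i : ℝ) + 2))).bind fun b =>
      if b then dirac (ctr 3 (i + 1) s) else dirac s := by
  have h1 : sem (.flip 3 (.lit 4) (.div (.ofNat (.lit 1))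
      (.add (.ofNat (.get 3 (.lit 2))) (.ofNat (.lit 2))))) s =
      (coin (1 / (i + 2))).map fun b => ctr 4 (bit b) s := by
    rw [sem_flip_map]; simp [hi, ctr]
  rw [reservoirStep, sem_seq_map _ disc h1]; congr 1; funext b
  have h2 : sem (.ite (.natEq (.get 3 (.lit 4)) (.lit 1))
        (.setNat 3 (.lit 3) (capN (.add (.get 3 (.lit 2)) (.lit 1)))) .skip) (ctr 4 (bit b) s) =
      dirac (if b then ctr 3 (i + 1) (ctr 4 (bit b) s) else ctr 4 (bit b) s) := by
    rw [sem_ite]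
    cases b
    · simp [BExp.Holds, bit, sem_skip]
    · simp [BExp.Holds, bit, sem_set_ctr]; grind
  rw [sem_seq_dirac _ h2, sem_set_ctr]
  cases b
  · simp [ctr_ctr]; rw [ctr_self h4]
  · simp; rw [ctr_comm (by decide), ctr_ctr, ctr_self h4]

lemma sem_reservoir {s : Store} {j : ℕ} (hj : s.1 3 1 = j) (h2 : s.1 3 2 = 0) (h3 : s.1 3 3 = 0)
    (h4 : s.1 3 4 = 0) (hcap : j ≤ s.1 4 0) :
    sem (forN 2 (.get 3 (.lit 1)) reservoirStep) s =
      unif (Fin (j + 1)) fun l => dirac (ctr 3 l s) := by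
  refine sem_forN_unif (fun i => Fin (i + 1)) (fun i l => ctr 3 l s) ?_ (by simp_all)
    (fun i l => by simp_all) (fun i l => by simp_all) fun i hi => ?_
  · simp [unif, ctr_self h3]
  · have key : ∀ l : Fin (i + 1), sem reservoirStep (ctr 2 i (ctr 3 l s)) =
        (coin (1 / (i + 2))).bind fun b => if b then dirac (ctr 2 i (ctr 3 (i + 1) s))
          else dirac (ctr 2 i (ctr 3 l s)) := by
      intro l
      rw [sem_reservoirStep (i := i) (by simp_all) (by simp) (by simp; omega), ctr_comm (by decide), ctr_ctr]
    simp_rw [key]; exact unif_reservoir i fun l => dirac (ctr 2 i (ctr 3 l s))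

/-- The array `F` with the `n` entries from `o` on replaced by those of `g`. -/
def overlay (F : ℕ → ℕ) (o n : ℕ) (g : ℕ → ℕ) : ℕ → ℕ :=
  fun y => if o ≤ y ∧ y < o + n then g (y - o) else F y

/-- Replace each of the blocks of the array `a` by a uniformly random permutation; the cells `y`
and `x` of the array `0` hold the number of blocks and their length. -/
def shuffle (a y x : ℕ) : Cmd :=
  forN 0 (.get 0 (.lit y)) (forN 1 (.get 0 (.lit x)) (.seq (forN 2 (.get 3 (.lit 1)) reservoirStep)
    (.seq (.setNat a (.add (.mul (.get 3 (.lit 0)) (.get 0 (.lit x))) (.get 3 (.lit 1)))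
        (.get a (.add (.mul (.get 3 (.lit 0)) (.get 0 (.lit x))) (.get 3 (.lit 3)))))
      (.seq (.setNat a (.add (.mul (.get 3 (.lit 0)) (.get 0 (.lit x))) (.get 3 (.lit 3)))
          (.get 3 (.lit 1)))
        (.setNat 3 (.lit 3) (.lit 0))))))

lemma overlay_permSnoc {F : ℕ → ℕ} {o j : ℕ} (hF : ∀ y, o ≤ y → F y = 0) (l : Fin (j + 1))
    (π : Perm (Fin j)) :
    update (update (overlay F o j (arr 0 Fin.val π)) (o + j)
        (overlay F o j (arr 0 Fin.val π) (o + l))) (o + l) j =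
      overlay F o (j + 1) (arr 0 Fin.val (permSnoc j (l, π))) := by
  have h0 : ∀ u, overlay F o j (arr 0 Fin.val π) (o + u) = arr 0 Fin.val π u := by
    intro u; by_cases h : u < j
    · simp [overlay, h]
    · simp [overlay, h, hF, arr]
  rw [arr_permSnoc, h0]; funext y; by_cases hy : o ≤ y
  · obtain ⟨u, rfl⟩ := Nat.exists_eq_add_of_le hy; by_cases hu : u < j + 1
    · simp [overlay]; grind
    · have h1 : u ≠ l := by omega
      have h2 : u ≠ j := by omega
      have h3 : ¬ u < j := by omega
      simp [overlay, hu, h1, h2, h3]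
  · have h1 : y ≠ o + l := by omega
    have h2 : y ≠ o + j := by omega
    simp [overlay, hy, h1, h2]

/-- Inside-out Fisher-Yates shuffle: in round `j` the entry at a uniform index `l ≤ j` moves to
place `j` and the value `j` takes its place. By the bijection `permSnoc` this turns a uniform
permutation of `j` points into one of `j + 1` points. -/
lemma sem_shuffle_block {a x b L : ℕ} (ha : 5 ≤ a) {s : Store} (hb : s.1 3 0 = b) (h1 : s.1 3 1 = 0)
    (h2 : s.1 3 2 = 0) (h3 : s.1 3 3 = 0) (h4 : s.1 3 4 = 0) (hL : s.1 0 x = L) (hcap : L ≤ s.1 4 0)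
    (hF : ∀ y, b * L ≤ y → s.1 a y = 0) :
    sem (forN 1 (.get 0 (.lit x)) (.seq (forN 2 (.get 3 (.lit 1)) reservoirStep)
      (.seq (.setNat a (.add (.mul (.get 3 (.lit 0)) (.get 0 (.lit x))) (.get 3 (.lit 1)))
          (.get a (.add (.mul (.get 3 (.lit 0)) (.get 0 (.lit x))) (.get 3 (.lit 3)))))
        (.seq (.setNat a (.add (.mul (.get 3 (.lit 0)) (.get 0 (.lit x))) (.get 3 (.lit 3)))
            (.get 3 (.lit 1)))
          (.setNat 3 (.lit 3) (.lit 0)))))) s =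
      unif (Perm (Fin L)) fun π =>
        dirac (setN a (overlay (s.1 a) (b * L) L (arr 0 Fin.val π)) s) := by
  have a3 : a ≠ 3 := by omega
  have a4 : a ≠ 4 := by omega
  refine sem_forN_unif (fun j => Perm (Fin j)) (fun j π => setN a (overlay _ _ j
    (arr 0 Fin.val π)) s) ?_ (by simp_all) (fun j π => by simpa [a4.symm] using hcap)
    (fun j π => by simpa [a3.symm] using h1) fun j hj => ?_
  · have : ∀ π : Perm (Fin 0), overlay (s.1 a) (b * L) 0 (arr 0 Fin.val π) = s.1 a := by
      intro π; funext y; simp [overlay]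
    simp_rw [this, setN_self]; exact unif_const _
  · rw [← unif_equiv (permSnoc j), unif_prod fun l π => dirac (ctr 1 j (setN a
      (overlay _ _ _ (arr 0 Fin.val (permSnoc j (l, π)))) s)), unif_comm]
    refine unif_congr fun π => ?_; set s' := ctr 1 j _
    rw [sem_seq, (sem_reservoir (by simp [s']) (by simp [s', a3.symm, h2]) (by simp [s', a3.symm, h3]) (by simp [s', a3.symm, h4]) (by simp [s', a4.symm]; omega) : sem _ s' = unif (Fin (j + 1)) fun l => dirac _), unif_bind _ (measurable_sem _)]
    refine unif_congr fun l => ?_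
    rw [dirac_bind (measurable_sem _), sem_seq_dirac _ (sem_setNat' _ _ _ _),
      sem_seq_dirac _ (sem_setNat' _ _ _ _), sem_set_ctr]
    rw [← overlay_permSnoc hF]; simp [a3.symm, a3, s', setN_ctr, ctr_ctr]; simp only [hb]
    simp [(by omega : a ≠ 0).symm]
    rw [ctr_comm (by decide), ctr_self (s := setN a _ s) (by simp [a3.symm, h3]), hL]

/-- The array with the blocks `x 0, x 1, …`. -/
def blocks {k L : ℕ} (x : Fin k → Fin L → ℕ) : ℕ → ℕ :=
  arr 0 id fun u : Fin (k * L) => x u.divNat u.modNat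

lemma blocks_apply {k L : ℕ} (x : Fin k → Fin L → ℕ) (b : Fin k) (y : Fin L) :
    blocks x (b * L + y) = x b y := by
  have h : b * L + y < k * L := by
    have := Nat.mul_le_mul_right L (Nat.succ_le_of_lt b.2); grind
  have h1 : (b * L + y) / L = b := by
    rw [mul_comm, Nat.mul_add_div y.pos, Nat.div_eq_of_lt y.2, add_zero]
  have h2 : (b * L + y) % L = y := by rw [mul_comm, Nat.mul_add_mod, Nat.mod_eq_of_lt y.2]
  rw [blocks, arr_of_lt _ _ _ h]; exact congrArg₂ x (Fin.ext h1) (Fin.ext h2)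

lemma sem_shuffle {a y x k L : ℕ} (ha : 5 ≤ a) {s : Store} (h3 : s.1 3 = fun _ => 0)
    (hk : s.1 0 y = k) (hL : s.1 0 x = L) (hkcap : k ≤ s.1 4 0) (hcap : L ≤ s.1 4 0)
    (hF : s.1 a = fun _ => 0) :
    sem (shuffle a y x) s = unif (Fin k → Perm (Fin L)) fun π =>
        dirac (setN a (blocks fun b z => (π b z : ℕ)) s) := by
  have a3 : a ≠ 3 := by omega
  have a4 : a ≠ 4 := by omega
  have hfin : ∀ π : Fin k → Perm (Fin L), blocks (fun b z => (π b z)) =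
      fun u => if u < k * L then blocks (fun b z => (π b z)) u else 0 := by
    intro π; funext u; split_ifs with h
    · rfl
    · simp [blocks, arr, h]
  have hpart : ∀ (π : Fin k → Perm (Fin L)) (i : Fin k) (v : Perm _),
      overlay (fun u => if u < i * L then blocks (fun b z => (π b z)) u else 0) (i * L) L
        (arr 0 Fin.val v) = fun u => if u < (i + 1) * L then
          blocks (fun b z => (update π i v b z)) u else 0 := by
    intro π i v; funext u; by_cases h : u < (i + 1) * L
    · have hLpos : 0 < L := by grind
      have hd := Nat.div_lt_of_lt_mul (by rwa [mul_comm] at h)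
      have hu : u = (u / L) * L + u % L := by rw [mul_comm]; exact (Nat.div_add_mod u L).symm
      have hm := Nat.mod_lt u hLpos
      have hb : ∀ π : Fin k → Perm (Fin L), blocks (fun b z => (π b z)) u =
          π ⟨u / L, by omega⟩ ⟨u % L, hm⟩ := by
        intro π; have := blocks_apply (fun b z => (π b z)) ⟨u / L, by omega⟩ ⟨u % L, hm⟩; grind
      simp [overlay, h]; by_cases hui : i * L ≤ u
      · have hdi := le_antisymm (by omega) ((Nat.le_div_iff_mul_le hLpos).2 hui)
        have h1 : u < i * L + L := by grind
        rw [if_pos ⟨hui, h1⟩, hb, (by grind : u - i * L = u % L), arr_of_lt _ _ _ hm]; grind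
      · have hdi : (⟨u / L, by omega⟩) ≠ i := by grind
        rw [if_neg (fun h' => hui h'.1), if_pos (not_le.1 hui), hb, hb, update_of_ne hdi]
    · have h1 : ¬ (i * L ≤ u ∧ u < i * L + L) := by rw [Nat.succ_mul] at h; omega
      simp [overlay, h, h1, (by grind : ¬ u < i * L)]
  have key := sem_forN_unif (c := 0) (e := .get 0 (.lit y)) (fun _ => Fin k → Perm (Fin L))
    (fun i π => setN a (fun u => if u < i * L then blocks _ u else 0) s)
    (by
      simp; rw [setN_eq_self hF]
      exact unif_const _) (by simpa using hk) (fun i π => by simpa [a4.symm] using hkcap)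
    (fun i π => by simp [a3.symm, h3]) (fun i hi => by
      -- The memory before block `i` is described by a full family `π` of which only the first `i`
      -- members are visible, so that shuffling block `i` amounts to redrawing `π i`.
      refine Eq.trans ?_ (unif_resample (⟨i, hi⟩) _); refine unif_congr fun π => ?_
      rw [sem_shuffle_block ha (b := i) (by simp) (by simp [a3.symm, h3])
        (by simp [a3.symm, h3]) (by simp [a3.symm, h3]) (by simp [a3.symm, h3])
        (by simpa [(by omega : a ≠ 0).symm] using hL) (by simpa [a4.symm] using hcap) (fun u hu => by
          simp [a3, not_lt.2 hu])]
      refine unif_congr fun v => ?_; simp [a3, setN_ctr]; rw [hpart π ⟨i, hi⟩ v])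
  rw [shuffle, key]; refine unif_congr fun π => ?_; rw [← hfin]

end Shuffle

/-! ### Constants of the program, arrays of coins and clones. -/

section Memory

variable (P : Params)

def Params.lines : ℕ := (P.r ^ P.t - 1) / (P.r - 1)

/-- The natural constants that the program keeps in the array `0`. -/
def consts : ℕ → ℕ := fun i => [P.N, P.k, P.n, P.d, P.r, P.t, P.r ^ P.t, P.blockLen, P.iterations, P.m,
  P.N / P.k, P.lines, P.k * P.lines, P.k * P.r ^ P.t, P.m * (P.k * P.r ^ P.t), P.r ^ P.t * P.r ^ P.t,
  P.n * P.d, P.N * P.N, P.k * (P.N / P.k), 1].getD i 0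

/-- The real constants that the program keeps in the array `0`. -/
def realConsts : ℕ → ℝ := fun i => [P.p, P.q, P.μ, P.Q, P.δ, P.τ].getD i 0

/-- A bound for all natural numbers that occur in a run of the program. -/
def capacity : ℕ := P.N * P.N + P.m * (P.k * P.r ^ P.t) + P.r ^ P.t * P.r ^ P.t + P.n * P.d +
  P.iterations + P.k * P.r ^ P.t + P.k * P.lines + P.m + P.d + P.N + P.k + 2 * P.r ^ P.t + P.r + P.n +
  P.t + P.lines + P.blockLen + P.k * (P.N / P.k) + P.N / P.k + 1

/-- The constants are in place and the scratch cells are cleared. -/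
structure Ready (s : Store) : Prop where
  nat : s.1 0 = consts P
  scratch : s.1 3 = fun _ => 0
  cap : s.1 4 0 = capacity P
  real : s.2 0 = realConsts P

variable {P}

lemma Ready.setN {s : Store} (h : Ready P s) {a : ℕ} (ha : 5 ≤ a) (f : ℕ → ℕ) :
    Ready P (setN a f s) := by
  have h0 : 0 ≠ a := by omega
  have h3 : 3 ≠ a := by omega
  have h4 : 4 ≠ a := by omega
  exact ⟨by simp [h0, h.nat], by simp [h3, h.scratch], by simp [h4, h.cap], by simp [h.real]⟩

lemma Ready.setR {s : Store} (h : Ready P s) {a : ℕ} (ha : 1 ≤ a) (f : ℕ → ℝ) :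
    Ready P (setR a f s) := by
  have h0 : 0 ≠ a := by omega
  exact ⟨by simp [h.nat], by simp [h.scratch], by simp [h.cap], by simp [h0, h.real]⟩

/-- Layout of the natural arrays: `0` constants, `1` graph, `2` partition, `3` scratch, `4`
capacity, `5` and `6` the two clones, `7` vertices listed by parts, `8` and `9` the coins for the
diagonal with their sums in `16` and `19`, `10`, `11`, `12` the permutations `θ`, `σ`, `ρ`, `13` and
`14` the output columns and rows, `15` normal vectors, `17` the padded matrix, `18` inner products,
`20` and `21` auxiliary. Real arrays: `0` constants, `1` output, `2` the Gaussianized matrix. -/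
def c0 (i : ℕ) : NExp := .get 0 (.lit i)

def r0 (i : ℕ) : RExp := .get 0 (.lit i)

/-- The number of the round of the outer loop. -/
def ix : NExp := .get 3 (.lit 0)

attribute [simp] c0 r0 ix

lemma safe_forN {c : ℕ} {e : NExp} {body : Cmd} (h : body.Safe) : (forN c e body).Safe :=
  ⟨⟨h, NExp.small_capN _⟩, NExp.small_lit (by norm_num)⟩

lemma safe_shuffle (a y x : ℕ) : (shuffle a y x).Safe := by
  refine safe_forN (safe_forN ⟨safe_forN ⟨trivial, ⟨NExp.small_capN _, trivial⟩, ?_⟩, NExp.small_get _ _,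
    NExp.small_get _ _, ?_⟩) <;> exact NExp.small_lit (by norm_num)

/-- Fill the array `a` with independent random bits. -/
def coinFill (a x : ℕ) (e : RExp) : Cmd := forN 0 (c0 x) (.flip a ix e)

lemma safe_coinFill (a x : ℕ) (e : RExp) : (coinFill a x e).Safe := safe_forN trivial

lemma le_capacity_of_consts (i : ℕ) : consts P i ≤ capacity P := by
  unfold consts capacity; generalize P.N / P.k = N'; by_cases hi : i < 20
  · interval_cases i <;> simp <;> omega
  simp_all

lemma measurable_bit : Measurable bit := disc

lemma measurable_setN_const (a : ℕ) (s : Store) : Measurable fun f : ℕ → ℕ => setN a f s :=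
  measurable_setN_apply a measurable_id measurable_const

lemma measurable_setR_const (a : ℕ) (s : Store) : Measurable fun f : ℕ → ℝ => setR a f s :=
  measurable_setR_apply a measurable_id measurable_const

lemma sem_coinFill {s : Store} (hs : Ready P s) {a x n y : ℕ} (ha : 5 ≤ a)
    (hx : consts P x = n) (h0 : s.1 a = fun _ => 0) :
    sem (coinFill a x (r0 y)) s = (piM fun _ : Fin n => coin (realConsts P y)).map
      fun v => setN a (arr 0 bit v) s := by
  have a3 : 3 ≠ a := by omega
  have a4 : 4 ≠ a := by omega
  refine sem_fill _ (measurable_setN_const a s) 0 bit measurable_bit _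
    (setN_eq_self h0) (by simp [hs.nat, hx]) (fun f => ?_) (fun f => by simp [a3, hs.scratch])
    fun i f _ => ?_
  · simp [a4, hs.cap, ← hx]; exact le_capacity_of_consts x
  · rw [sem_flip_map]; simp [a3.symm, hs.real, setN_ctr]

lemma coin_map {β : Type*} [MeasurableSpace β] {x : ℝ} (h0 : 0 ≤ x) (h1 : x ≤ 1) (f : Bool → β) :
    (coin x).map f = ofReal x • dirac (f true) +
      ofReal (1 - x) • dirac (f false) := by
  rw [← bind_dirac_eq_map _ disc]; exact coin_bind h0 h1 fun b => dirac _

/-- The probability of a vector of two bits of which `c` are one. -/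
def pairWeight (p q Q : ℝ) (b : Bool) (c : ℕ) : ℝ :=
  if b then 1 / (p - q) * ((1 - q) * (p ^ c * (1 - p) ^ (2 - c)) - (1 - p) * (Q ^ c * (1 - Q) ^ (2 - c)))
  else 1 / (p - q) * (p * (Q ^ c * (1 - Q) ^ (2 - c)) - q * (p ^ c * (1 - p) ^ (2 - c)))

lemma cloneWeight_eq (p q Q : ℝ) (b : Bool) (v : Fin 2 → Bool) :
    cloneWeight p q p Q b v = pairWeight p q Q b (bit (v 0) + bit (v 1)) := by
  simp [cloneWeight, pairWeight, card_filter_fin_two, bit]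

/-- A flip yields a single bit, so the pair is drawn bit by bit: the first from its marginal law,
the second from its conditional law. A vanishing denominator does no harm, because the numerator
then vanishes too (`m1`, `m3`). -/
lemma cloneLaw_eq_bind {p q Q : ℝ} (h : GoodQ p q Q) (e : Bool) :
    cloneLaw p q Q e = (coin (pairWeight p q Q e 1 + pairWeight p q Q e 2)).bind fun b =>
      (coin (if b then pairWeight p q Q e 2 / (pairWeight p q Q e 1 + pairWeight p q Q e 2)
        else pairWeight p q Q e 1 / (pairWeight p q Q e 0 + pairWeight p q Q e 1))).map
          fun b' => ![b, b'] := by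
  have hw := fun v => cloneWeight_eq p q Q e v ▸ cloneWeight_nonneg h e v
  have h0 : 0 ≤ pairWeight p q Q e 0 := hw ![false, false]
  have h1 : 0 ≤ pairWeight p q Q e 1 := hw ![true, false]
  have h2 : 0 ≤ pairWeight p q Q e 2 := hw ![true, true]
  have hpq : p - q ≠ 0 := by have := h.q_lt; have := h.lt_p; intro h'; linarith
  have hsum : pairWeight p q Q e 0 + 2 * pairWeight p q Q e 1 + pairWeight p q Q e 2 = 1 := by
    unfold pairWeight; cases e <;> simp <;> field_simp <;> ring
  set w0 := pairWeight p q Q e 0 with hw0; set w1 := pairWeight p q Q e 1 with hw1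
  set w2 := pairWeight p q Q e 2 with hw2
  have m1 : (w1 + w2) * (w2 / (w1 + w2)) = w2 := by
    rcases eq_or_ne (w1 + w2) 0 with h' | h'
    · rw [h', zero_mul]; linarith
    · field_simp
  have m3 : (1 - (w1 + w2)) * (w1 / (w0 + w1)) = w1 := by
    rw [(by linarith : 1 - _ = w0 + w1)]; rcases eq_or_ne (w0 + w1) 0 with h' | h'
    · rw [h', zero_mul]; linarith
    · field_simp
  refine ext_of_singleton fun v => ?_
  have hv : ∀ b b', (![b, b'] = v) = (b = v 0 ∧ b' = v 1) := by
    intro b b'; refine propext ⟨fun h => by simp [← h], fun ⟨h, h'⟩ => ?_⟩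
    funext i; fin_cases i <;> simp [h, h']
  rw [cloneLaw_singleton, cloneWeight_eq, coin_bind (by linarith) (by linarith)]
  simp [coin_map (by positivity : 0 ≤ w2 / (w1 + w2)) (div_le_one_of_le₀ (by linarith) (by linarith)), coin_map (by positivity : 0 ≤ w1 / (w0 + w1)) (div_le_one_of_le₀ (by linarith) (by linarith)), Set.indicator_apply, hv]
  cases v 0 <;> cases v 1 <;> simp [bit] <;>
    rw [← ofReal_mul (by linarith)] <;> congr 1 <;> linarith

def binExp (x : RExp) : ℕ → RExp
  | 0 => .mul (.sub (.ofNat (.lit 1)) x) (.sub (.ofNat (.lit 1)) x)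
  | 1 => .mul x (.sub (.ofNat (.lit 1)) x)
  | _ => .mul x x

def pairExp (b : Bool) (c : ℕ) : RExp := .mul (.div (.ofNat (.lit 1)) (.sub (r0 0) (r0 1)))
    (if b then .sub (.mul (.sub (.ofNat (.lit 1)) (r0 1)) (binExp (r0 0) c))
        (.mul (.sub (.ofNat (.lit 1)) (r0 0)) (binExp (r0 3) c))
      else .sub (.mul (r0 0) (binExp (r0 3) c)) (.mul (r0 1) (binExp (r0 0) c)))

lemma eval_pairExp {s : Store} (hs : s.2 0 = realConsts P) (b : Bool) {c : ℕ} (hc : c ≤ 2) :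
    (pairExp b c).eval s = pairWeight P.p P.q P.Q b c := by
  unfold pairWeight
  interval_cases c <;> cases b <;> simp [pairExp, binExp, hs, realConsts, -mul_eq_mul_left_iff] <;> ring

def clonePair (b : Bool) : Cmd := .seq (.flip 5 ix (.add (pairExp b 1) (pairExp b 2)))
    (.ite (.natEq (.get 5 ix) (.lit 1))
      (.flip 6 ix (.div (pairExp b 2) (.add (pairExp b 1) (pairExp b 2))))
      (.flip 6 ix (.div (pairExp b 1) (.add (pairExp b 0) (pairExp b 1)))))

def cloneFill : Cmd :=
  forN 0 (c0 17) (.ite (.natEq (.get 1 ix) (.lit 1)) (clonePair true) (clonePair false))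

lemma safe_cloneFill : cloneFill.Safe :=
  safe_forN ⟨⟨trivial, trivial, trivial⟩, trivial, trivial, trivial⟩

lemma sem_clonePair (hQ : GoodQ P.p P.q P.Q) {s : Store} (hs : s.2 0 = realConsts P) (b : Bool)
    {i : ℕ} (hi : s.1 3 0 = i) :
    sem (clonePair b) s = (cloneLaw P.p P.q P.Q b).map fun v =>
      setN 5 (update (s.1 5) i (bit (v 0))) (setN 6 (update (s.1 6) i (bit (v 1))) s) := by
  rw [cloneLaw_eq_bind hQ, bind_map disc disc, clonePair,
    sem_seq_map _ disc (sem_flip_map _ _ _ _)]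
  simp [eval_pairExp hs _ (by norm_num : 1 ≤ 2), eval_pairExp hs _ (by norm_num : 2 ≤ 2)]; congr 1
  funext b'; rw [sem_ite, sem_flip_map, sem_flip_map, Measure.map_map disc disc]
  have h5 : ∀ f : ℕ → ℕ, (setN 5 f s).2 0 = realConsts P := fun f => hs
  simp [eval_pairExp (h5 _) _ (by norm_num : 1 ≤ 2), eval_pairExp (h5 _) _ (by norm_num : 2 ≤ 2), eval_pairExp (h5 _) _ (by norm_num : 0 ≤ 2)]
  cases b' <;> simp [BExp.Holds, bit, hi, comp_def, setN_sort]

lemma sem_cloneFill (hQ : GoodQ P.p P.q P.Q) {s : Store} (hs : Ready P s)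
    (h5 : s.1 5 = fun _ => 0) (h6 : s.1 6 = fun _ => 0) (adj : Fin (P.N * P.N) → Bool)
    (h1 : ∀ i : Fin (P.N * P.N), s.1 1 i = bit (adj i)) :
    sem cloneFill s = (piM fun i => cloneLaw P.p P.q P.Q (adj i)).map fun x =>
      setN 5 (arr 0 (fun v => bit (v 0)) x) (setN 6 (arr 0 (fun v => bit (v 1)) x) s) := by
  have := isProb_cloneLaw hQ
  have key := sem_fill (e := c0 17) (body := .ite (.natEq (.get 1 ix) (.lit 1))
      (clonePair true) (clonePair false))
    (fun f => setN 5 (fun y => (f y).1) (setN 6 (fun y => (f y).2) s))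
    (measurable_setN_apply 5 (by fun_prop) (measurable_setN_apply 6 (by fun_prop) measurable_const))
    (0, 0) (fun v => (bit (v 0), bit (v 1))) disc
    (fun i => cloneLaw P.p P.q P.Q (adj i))
    (by rw [setN_eq_self (by simp [h5]), setN_eq_self h6])
    (by simp [hs.nat, consts]) (fun f => by
      have h4 : (setN 5 (fun y => (f y).1) (setN 6 (fun y => (f y).2) s)).1 4 0 = capacity P := by
        simp [hs.cap]
      rw [h4]; exact le_capacity_of_consts 17) (fun f => by simp [hs.scratch]) (fun i f hf => by
      have hb : ∀ b, sem (clonePair b) (ctr 0 i (setN 5 (fun y => (f y).1) (setN 6 (fun y => (f y).2) s))) =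
          (cloneLaw P.p P.q P.Q b).map fun v => ctr 0 i (setN 5 (fun y => (update f i
            (bit (v 0), bit (v 1)) y).1) (setN 6 (fun y => (update f i
              (bit (v 0), bit (v 1)) y).2) s)) := by
        intro b; rw [sem_clonePair hQ (by simpa using hs.real) b (i := i) (by simp)]; congr 1
        funext v
        have e1 : ∀ v : ℕ × ℕ, (fun y => (update f i v y).1) =
            update (fun y => (f y).1) i v.1 := by
          grind
        have e2 : ∀ v : ℕ × ℕ, (fun y => (update f i v y).2) =
            update (fun y => (f y).2) i v.2 := by
          grind
        rw [e1, e2]; simp [setN_ctr, setN_sort]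
      rw [sem_ite, hb, hb]
      cases h : adj i <;> simp [BExp.Holds, h1, h, bit])
  rw [cloneFill, key]; congr 1; funext x; congr 1
  · funext y; unfold arr; grind
  · congr 1; funext y; unfold arr; grind

end Memory

/-! ### Sums over blocks and the list of the vertices of each part. -/

section Tables

variable {P : Params}

lemma cap_le {s : Store} (hs : Ready P s) (i : ℕ) : consts P i ≤ s.1 4 0 :=
  hs.cap ▸ le_capacity_of_consts i

/-- Sum up the blocks of the bits in the array `b`; the cells `x`, `y` of the array `0` hold the
number of the bits and the length of a block. -/
def tally (t b x y : ℕ) : Cmd :=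
  forN 0 (c0 x) (.setNat t (.div ix (c0 y)) (capN (.add (.get t (.div ix (c0 y))) (.get b ix))))

lemma safe_tally (t b x y : ℕ) : (tally t b x y).Safe := safe_forN (NExp.small_capN _)

lemma sem_tally {s : Store} (hs : Ready P s) {t b x y n L : ℕ} (ht : 5 ≤ t) (hbt : b ≠ t)
    (hb5 : 5 ≤ b) (hx : consts P x = n) (hy : consts P y = L) (h0 : s.1 t = fun _ => 0)
    (hb : ∀ u, s.1 b u ≤ 1) :
    sem (tally t b x y) s = dirac
      (setN t (fun a => ∑ u ∈ range n, if u / L = a then s.1 b u else 0) s) := by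
  have t0 : 0 ≠ t := by omega
  have t3 : 3 ≠ t := by omega
  have t4 : 4 ≠ t := by omega
  have hn := hx ▸ cap_le hs x
  refine sem_forN_det (fun i => setN t (fun a => ∑ u ∈ range i, if u / L = a then s.1 b u else 0) s)
    (by simp [setN_eq_self h0]) (by simp [hs.nat, hx]) (fun i => by simp_all)
    (fun i => by simp [t3, hs.scratch]) fun i hi => ?_
  have hsum : (∑ u ∈ range i, if u / L = i / L then s.1 b u else 0) ≤ i := by
    calc _ ≤ ∑ u ∈ range i, 1 := sum_le_sum fun u _ => by split_ifs; exacts [hb u, zero_le_one]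
      _ = i := by simp
  have hbi := hb i; rw [sem_setNat']; have b3 : b ≠ 3 := by omega
  simp [t3.symm, setN_ctr, t0, hs.nat, b3, hbt, t4]; congr 3; funext a; rw [sum_range_succ]
  grind

/-- The number of the vertices before `i` in the part `a`. -/
def countBefore {N k : ℕ} (E : Fin N → Fin k) (i a : ℕ) : ℕ :=
  ∑ u ∈ range i, if ∃ h : u < N, (E ⟨u, h⟩ : ℕ) = a then 1 else 0

lemma countBefore_succ {N k : ℕ} (E : Fin N → Fin k) (i : Fin N) (a : ℕ) :
    countBefore E (i + 1) a = countBefore E i a + if (E i : ℕ) = a then 1 else 0 := by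
  rw [countBefore, sum_range_succ, countBefore]; simp

lemma countBefore_eq_card {N k : ℕ} (E : Fin N → Fin k) (i : ℕ) (a : Fin k) :
    countBefore E i a = (univ.filter fun v : Fin N => (v : ℕ) < i ∧ E v = a).card := by
  rw [countBefore, sum_boole, Nat.cast_id]; symm
  refine card_bij _ ?_ (fun v _ v' _ h => Fin.ext h) ?_
  · grind
  · intro u hu; simp at hu; obtain ⟨hi, h, hE⟩ := hu; exact ⟨⟨u, h⟩, by grind, rfl⟩

lemma countBefore_le {N k : ℕ} (E : Fin N → Fin k) (i a : ℕ) : countBefore E i a ≤ i := by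
  calc _ ≤ ∑ u ∈ range i, 1 := sum_le_sum fun u _ => by split_ifs <;> simp
    _ = i := by simp

/-- The list of the vertices of each part, as far as they come before `i`. -/
def memberArr {N k : ℕ} (E : Fin N → Fin k) (n : ℕ) : ℕ → ℕ → ℕ
  | 0 => fun _ => 0
  | i + 1 => if h : i < N then
      update (memberArr E n i) ((E ⟨i, h⟩ : ℕ) * n + countBefore E i (E ⟨i, h⟩)) i
    else memberArr E n i

section Parts

variable {N k : ℕ} {E : Fin N → Fin k} {n : ℕ}

lemma countBefore_lt (h : ∀ a, Nat.card {v // E v = a} = n) (v : Fin N) :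
    countBefore E v (E v) < n := by
  rw [countBefore_eq_card, ← h _, Nat.card_eq_fintype_card, Fintype.card_subtype]
  refine Finset.card_lt_card (Finset.ssubset_iff_subset_ne.2 ⟨fun u hu => ?_, fun h' => ?_⟩)
  · simp at hu ⊢; exact hu.2
  · have : v ∈ univ.filter fun u : Fin N => (u : ℕ) < v ∧ E u = E v := by rw [h']; simp
    grind

lemma countBefore_mono (E : Fin N → Fin k) {i j : ℕ} (h : i ≤ j) (a : ℕ) :
    countBefore E i a ≤ countBefore E j a :=
  sum_le_sum_of_subset (range_mono h)

/-- The rank of a vertex is below `n` and grows strictly along its part, so part and rank determine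
the vertex. -/
lemma code_injective (h : ∀ a, Nat.card {v // E v = a} = n) {u v : Fin N}
    (he : (E u : ℕ) * n + countBefore E u (E u) = E v * n + countBefore E v (E v)) : u = v := by
  have h1 := countBefore_lt h u
  have hE : (E u) = E v := by
    have e1 : ((E u) * n + countBefore E u (E u)) / n = E u := by
      rw [mul_comm, Nat.mul_add_div (by omega), Nat.div_eq_of_lt h1, add_zero]
    have e2 : ((E v) * n + countBefore E v (E v)) / n = E v := by
      rw [mul_comm, Nat.mul_add_div (by omega), Nat.div_eq_of_lt (countBefore_lt h v), add_zero]
    grind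
  rcases lt_trichotomy u v with hlt | heq | hlt
  · have := countBefore_mono E (Nat.succ_le_of_lt hlt) (E u)
    rw [Nat.succ_eq_add_one, countBefore_succ] at this; grind
  · grind
  · have := countBefore_mono E (Nat.succ_le_of_lt hlt) (E u)
    rw [Nat.succ_eq_add_one, countBefore_succ] at this; grind

lemma memberArr_apply (h : ∀ a, Nat.card {v // E v = a} = n) (i : ℕ) (v : Fin N) (hv : (v : ℕ) < i) :
    memberArr E n i (E v * n + countBefore E v (E v)) = v := by
  induction i with
  | zero => omega
  | succ i ih =>
    rw [memberArr]; split_ifs with hi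
    · by_cases he : (E v) * n + countBefore E v (E v) = (E ⟨i, hi⟩) * n + countBefore E i (E ⟨i, hi⟩)
      · have := code_injective h he; grind
      grind
    grind

/-- The enumeration of the parts in increasing order. -/
lemma exists_increasing_enumeration (h : ∀ a, Nat.card {v // E v = a} = n) :
    ∃ e : ∀ a, Fin n ≃ {v // E v = a}, ∀ (a : Fin k) (x : Fin n), memberArr E n N (a * n + x) = (e a x : Fin N) := by
  have hf : ∀ a : Fin k, Bijective fun v : {v // E v = a} =>
      (⟨countBefore E v a, by have := countBefore_lt h v.1; grind⟩ : Fin n) := by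
    intro a; refine (Fintype.bijective_iff_injective_and_card _).2 ⟨fun u v huv => ?_, ?_⟩
    · refine Subtype.ext (code_injective h ?_); grind
    simp_all
  refine ⟨fun a => (Equiv.ofBijective _ (hf a)).symm, fun a x => ?_⟩
  obtain ⟨v, rfl⟩ := (Equiv.ofBijective _ (hf a)).surjective x
  have := memberArr_apply h N v.1 v.1.2; grind

end Parts

def members : Cmd := forN 0 (c0 0) (.seq
    (.setNat 7 (.add (.mul (.get 2 ix) (c0 10)) (.get 20 (.get 2 ix))) ix)
    (.setNat 20 (.get 2 ix) (capN (.add (.get 20 (.get 2 ix)) (.lit 1)))))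

lemma safe_members : members.Safe := safe_forN ⟨NExp.small_get _ _, NExp.small_capN _⟩

lemma sem_members {s : Store} (hs : Ready P s) (E : Fin P.N → Fin P.k)
    (h2 : ∀ v : Fin P.N, s.1 2 v = E v) (h7 : s.1 7 = fun _ => 0) (h20 : s.1 20 = fun _ => 0) :
    sem members s = dirac
      (setN 7 (memberArr E (P.N / P.k) P.N) (setN 20 (countBefore E P.N) s)) := by
  have hn : P.N ≤ s.1 4 0 := cap_le hs 0
  refine sem_forN_det (fun i => setN 7 _ (setN 20 _ s))
    ?_ (by simp [hs.nat, consts]) (fun i => by simp_all)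
    (fun i => by simp [hs.scratch]) fun i hi => ?_
  · rw [(by funext a; simp [countBefore] : (countBefore E 0) = fun _ => 0), memberArr, setN_eq_self h20, setN_eq_self h7]
  · have hle := countBefore_le E i (E ⟨i, hi⟩)
    rw [sem_seq_dirac _ (sem_setNat' _ _ _ _), sem_setNat']
    have e2 : countBefore E (i + 1) = update (countBefore E i) (E ⟨i, hi⟩)
        (countBefore E i (E ⟨i, hi⟩) + 1) := by
      funext a; rw [(countBefore_succ E ⟨i, hi⟩ a)]; grind
    have e3 : memberArr E (P.N / P.k) (i + 1) = update (memberArr E (P.N / P.k) i)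
        ((E ⟨i, hi⟩) * (P.N / P.k) + countBefore E i (E ⟨i, hi⟩)) i := by
      rw [memberArr, dif_pos hi]
    rw [e2, e3]
    simp [(h2 ⟨i, hi⟩), hs.nat, consts, (min_eq_left (by omega) : min (countBefore E i (E ⟨i, hi⟩) + 1) (s.1 4 0) = countBefore E i _ + 1), setN_ctr, setN_sort]

end Tables

/-! ### Tables of inner products and of normal vectors. -/

section Tables

variable {P : Params}

/-- The inner product of the vectors whose digits to the base `r` are those of `v` and `y`. -/
def digitDot (r t v y : ℕ) : ZMod r :=
  ∑ i ∈ range t, ((v / r ^ i : ℕ) : ZMod r) * ((y / r ^ i : ℕ) : ZMod r)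

lemma digitDot_eq {r t v y : ℕ} (hv : v < r ^ t) :
    digitDot r t v y = (v : ZMod r) * (y : ZMod r) + digitDot r t (v / r) (y / r) := by
  have h := sum_range_succ' (fun i => ((v / r ^ i) : ZMod r) * ((y / r ^ i) : ZMod r)) t
  rw [sum_range_succ, Nat.div_eq_of_lt hv] at h; simp at h; rw [digitDot, h, add_comm]
  simp [digitDot, Nat.div_div_eq_div_mul, pow_succ']

def dotTab (r t u : ℕ) : ℕ := (digitDot r t (u / r ^ t) (u % r ^ t)).val

/-- Removing the last digits of both vectors leads to a cell filled earlier, unless `v / r = 0`. In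
that case the remaining inner product is zero, which is also the value of a cell that has not been
filled yet. -/
lemma dotTab_eq [h : Fact P.r.Prime] {u : ℕ} (hu : u < P.r ^ P.t * P.r ^ P.t) :
    ((u / P.r ^ P.t % P.r) * (u % P.r ^ P.t % P.r) +
      if (u / P.r ^ P.t / P.r) * P.r ^ P.t + u % P.r ^ P.t / P.r < u then
        dotTab P.r P.t ((u / P.r ^ P.t / P.r) * P.r ^ P.t + u % P.r ^ P.t / P.r) else 0) % P.r =
      dotTab P.r P.t u := by
  have hr := two_le_r P; have hR : 0 < P.r ^ P.t := by grind
  set R := P.r ^ P.t with hRdef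
  set v := u / R with hv; set y := u % R with hy; have hvR : v < R := Nat.div_lt_of_lt_mul hu
  have hyr : y / P.r < R := lt_of_le_of_lt (Nat.div_le_self _ _) (Nat.mod_lt _ hR)
  have e1 : ((v / P.r) * R + y / P.r) / R = v / P.r := by
    rw [mul_comm, Nat.mul_add_div hR, Nat.div_eq_of_lt hyr, add_zero]
  have e2 : ((v / P.r) * R + y / P.r) % R = y / P.r := by
    rw [mul_comm, Nat.mul_add_mod, Nat.mod_eq_of_lt hyr]
  have hcell : (if (v / P.r) * R + y / P.r < u then dotTab P.r P.t ((v / P.r) * R + y / P.r) else 0) =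
      (digitDot P.r P.t (v / P.r) (y / P.r)).val := by
    split_ifs with h1
    · rw [dotTab, ← hRdef, e1, e2]
    · have hv0 : v / P.r = 0 := by
        by_contra hne
        have hv1 : v / P.r < v := Nat.div_lt_self (by
          rcases Nat.eq_zero_or_pos v with h | h
          · simp [h] at hne
          grind) (by omega)
        have h2 := Nat.mul_le_mul_right R (Nat.succ_le_of_lt hv1); rw [Nat.succ_mul] at h2
        exact h1 (by rw [(by rw [mul_comm]; exact (Nat.div_add_mod u R).symm : u = v * R + y)]; omega)
      rw [hv0]; simp [digitDot]
  rw [hcell, dotTab, ← hv, ← hy, digitDot_eq hvR, ← ZMod.val_natCast]; simp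

/-- Compute the inner products of all pairs of vectors. -/
def dotTable : Cmd := forN 0 (c0 15) (.setNat 18 ix (capN (.mod (.add
    (.mul (.mod (.div ix (c0 6)) (c0 4)) (.mod (.mod ix (c0 6)) (c0 4)))
    (.get 18 (.add (.mul (.div (.div ix (c0 6)) (c0 4)) (c0 6)) (.div (.mod ix (c0 6)) (c0 4))))) (c0 4))))

lemma safe_dotTable : dotTable.Safe := safe_forN (NExp.small_capN _)

lemma sem_dotTable {s : Store} (hs : Ready P s) (h18 : s.1 18 = fun _ => 0) :
    sem dotTable s = dirac
      (setN 18 (fun u => if u < P.r ^ P.t * P.r ^ P.t then dotTab P.r P.t u else 0) s) := by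
  have hn : P.r ^ P.t * P.r ^ P.t ≤ s.1 4 0 := cap_le hs 15; have hr : P.r ≤ s.1 4 0 := cap_le hs 4
  refine sem_forN_det (fun i => setN 18 (fun u => if u < i then dotTab P.r P.t u else 0) s)
    (by simp [setN_eq_self h18]) (by simp [hs.nat, consts]) (fun i => by simp_all)
    (fun i => by simp [hs.scratch]) fun i hi => ?_
  rw [sem_setNat']; have h1 : dotTab P.r P.t i < P.r := ZMod.val_lt _; congr 1
  simp [setN_ctr, hs.nat]; simp [consts, (dotTab_eq hi)]; congr 2; grind

/-- The numbers whose leading digit to the base `r` is `1`, in increasing order, with the power of `r`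
below them. -/
def leadingOne (r : ℕ) : ℕ → ℕ × ℕ
  | 0 => (1, 1)
  | h + 1 => if (leadingOne r h).1 + 1 = (leadingOne r h).2 + (leadingOne r h).2 then
      ((leadingOne r h).2 * r, (leadingOne r h).2 * r)
    else ((leadingOne r h).1 + 1, (leadingOne r h).2)

/-- The numbers with leading digit one come in blocks `w ≤ v < 2 w` with `w = r ^ j`, and the blocks
before contain `1 + r + ⋯ = (w - 1) / (r - 1)` numbers. The last clause gives the position of `v`
without division. -/
lemma leadingOne_spec {r : ℕ} (hr : 2 ≤ r) (h : ℕ) :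
    (∃ j, (leadingOne r h).2 = r ^ j) ∧ (leadingOne r h).2 ≤ (leadingOne r h).1 ∧
      (leadingOne r h).1 < (leadingOne r h).2 + (leadingOne r h).2 ∧
      h * (r - 1) + 1 = (leadingOne r h).2 + ((leadingOne r h).1 - (leadingOne r h).2) * (r - 1) := by
  obtain ⟨q, rfl⟩ : ∃ q, r = q + 1 := ⟨r - 1, by omega⟩
  induction h with
  | zero => exact ⟨⟨0, rfl⟩, le_rfl, by simp [leadingOne], by simp [leadingOne]⟩
  | succ h ih =>
    obtain ⟨⟨j, hj⟩, h1, h2, h3⟩ := ih; rw [leadingOne]; generalize (leadingOne _ h).1 = v at *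
    generalize (leadingOne _ h).2 = w at *; obtain ⟨x, rfl⟩ := Nat.exists_eq_add_of_le h1
    rw [Nat.add_sub_cancel_left] at h3; split_ifs with hw
    · have hw' : w = x + 1 := by omega
      refine ⟨⟨j + 1, by grind⟩, le_rfl, ?_, ?_⟩
      · grind
      grind
    · refine ⟨⟨j, hj⟩, by simp only; omega, by simp only; omega, ?_⟩
      rw [add_assoc w x 1, Nat.add_sub_cancel_left, Nat.succ_mul, Nat.succ_mul]; linarith

lemma lines_mul : P.lines * (P.r - 1) + 1 = P.r ^ P.t := by
  have hr := two_le_r P; have h := card_hyperplane P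
  have : P.lines = card P.Hyperplane := by
    rw [Params.lines, ← h, Nat.add_sub_cancel, Nat.mul_div_cancel _ (by omega)]
  grind

lemma leadingOne_lt {h : ℕ} (hh : h < P.lines) :
    ∃ j < P.t, (leadingOne P.r h).2 = P.r ^ j ∧ (leadingOne P.r h).1 / P.r ^ j = 1 ∧
      (leadingOne P.r h).1 < P.r ^ (j + 1) ∧ P.r ^ (j + 1) ≤ P.r ^ P.t := by
  have hr := two_le_r P; obtain ⟨⟨j, hj⟩, h1, h2, h3⟩ := leadingOne_spec hr h
  have hl := lines_mul (P := P)
  have h4 : h * (P.r - 1) + 1 < P.r ^ P.t := by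
    have := Nat.mul_le_mul_right (P.r - 1) (Nat.succ_le_of_lt hh); grind
  have hjt : j < P.t := by
    rw [← Nat.pow_lt_pow_iff_right (a := P.r) (by omega), ← hj]; grind
  have h5 : P.r ^ j + P.r ^ j ≤ P.r ^ (j + 1) := by
    rw [pow_succ, ← mul_two]; exact Nat.mul_le_mul_left _ hr
  refine ⟨j, hjt, hj, ?_, by omega, (Nat.pow_le_pow_right (by omega) hjt)⟩; rw [hj] at h1 h2
  exact Nat.div_eq_of_lt_le (by grind) (by rw [Nat.succ_mul, one_mul]; exact h2)

def pairArr (z : ℕ × ℕ) : ℕ → ℕ := update (update (fun _ => 0) 0 z.1) 1 z.2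

/-- List the normal vectors of the hyperplanes. -/
def normals : Cmd := .seq (.setNat 21 (.lit 0) (.lit 1)) (.seq (.setNat 21 (.lit 1) (.lit 1))
    (forN 0 (c0 11) (.seq (.setNat 15 ix (.get 21 (.lit 0)))
      (.ite (.natEq (.add (.get 21 (.lit 0)) (.lit 1)) (.add (.get 21 (.lit 1)) (.get 21 (.lit 1))))
        (.seq (.setNat 21 (.lit 1) (capN (.mul (.get 21 (.lit 1)) (c0 4))))
          (.setNat 21 (.lit 0) (.get 21 (.lit 1))))
        (.setNat 21 (.lit 0) (capN (.add (.get 21 (.lit 0)) (.lit 1))))))))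

lemma safe_normals : normals.Safe :=
  ⟨NExp.small_lit le_rfl, NExp.small_lit le_rfl, safe_forN ⟨NExp.small_get _ _,
    ⟨NExp.small_capN _, NExp.small_get _ _⟩, NExp.small_capN _⟩⟩

lemma sem_normals {s : Store} (hs : Ready P s) (h15 : s.1 15 = fun _ => 0) (h21 : s.1 21 = fun _ => 0) :
    sem normals s = dirac (setN 15 (fun h => if h < P.lines then (leadingOne P.r h).1 else 0)
        (setN 21 (pairArr (leadingOne P.r P.lines)) s)) := by
  have hn : P.lines ≤ s.1 4 0 := cap_le hs 11; have hcap : P.r ^ P.t ≤ s.1 4 0 := cap_le hs 6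
  rw [normals, sem_seq_dirac _ (sem_setNat' _ _ _ _), sem_seq_dirac _ (sem_setNat' _ _ _ _)]
  refine sem_forN_det (fun i => setN 15 (fun h => if h < i then (leadingOne P.r h).1 else 0)
        (setN 21 (pairArr _) s)) ?_ (by simp [hs.nat, consts])
    (fun i => by simp_all) (fun i => by simp [hs.scratch]) fun i hi => ?_
  · simp; rw [setN_eq_self (by simp_all)]; simp [h21, pairArr, leadingOne]
  · obtain ⟨j, hj, h2, h3, h4, h5⟩ := leadingOne_lt hi
    have e15 : (fun h => if h < i + 1 then (leadingOne P.r h).1 else 0) =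
        update (fun h => if h < i then (leadingOne P.r h).1 else 0) i (leadingOne P.r i).1 := by
      grind
    have u1 : ∀ z : ℕ × ℕ, ∀ w, update (pairArr z) 0 w = pairArr (w, z.2) := by
      intro z w; funext u; simp only [pairArr]; grind
    have u2 : ∀ z : ℕ × ℕ, ∀ w, update (pairArr z) 1 w = pairArr (z.1, w) := by
      intro z w; simp [pairArr]
    have p0 : ∀ z : ℕ × ℕ, pairArr z 0 = z.1 := by intro z; simp [pairArr]
    have p1 : ∀ z : ℕ × ℕ, pairArr z 1 = z.2 := by intro z; simp [pairArr]
    rw [e15, sem_seq_dirac _ (sem_setNat' _ _ _ _), sem_ite, leadingOne]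
    by_cases hw : (leadingOne P.r i).1 + 1 = (leadingOne P.r i).2 + (leadingOne P.r i).2
    · rw [if_pos (by simpa [BExp.Holds, p0, p1] using hw), if_pos hw, sem_seq_dirac _ (sem_setNat' _ _ _ _),
        sem_setNat']
      simp [setN_ctr, setN_sort, p0, p1, u1, u2, hs.nat, consts, (min_eq_left (by rw [h2, ← pow_succ]; omega) : min _ (s.1 4 0) = (leadingOne P.r i).2 * P.r)]
    · rw [if_neg (by simpa [BExp.Holds, p0, p1] using hw), if_neg hw, sem_setNat']
      simp [setN_ctr, setN_sort, p0, u1, (min_eq_left (by omega) : min _ (s.1 4 0) = (leadingOne P.r i).1 + 1)]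

end Tables

/-! ### Numbering the points and the hyperplanes. -/

section Points

variable (P : Params)

def finZMod (r : ℕ) [NeZero r] : Fin r ≃ ZMod r where
  toFun x := ((x : ℕ) : ZMod r)
  invFun z := ⟨z.val, ZMod.val_lt z⟩
  left_inv x := Fin.ext (ZMod.val_cast_of_lt x.2)
  right_inv z := ZMod.natCast_zmod_val z

/-- The enumeration of the points by their digits. -/
def pointIdx : P.Point ≃ Fin (P.r ^ P.t) :=
  (Equiv.arrowCongr (Equiv.refl _) (finZMod P.r).symm).trans finFunctionFinEquiv

lemma pointIdx_digit (y : P.Point) (i : Fin P.t) :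
    ((pointIdx P y / P.r ^ (i : ℕ) : ℕ) : ZMod P.r) = y i := by
  obtain ⟨z, rfl⟩ := (pointIdx P).symm.surjective y
  have h : (pointIdx P).symm z i = ((finFunctionFinEquiv.symm z i)) := rfl; simp_all

lemma digitDot_pointIdx (v y : P.Point) :
    digitDot P.r P.t (pointIdx P v) (pointIdx P y) = v ⬝ᵥ y := by
  rw [digitDot, sum_range]; simp_rw [pointIdx_digit]; rfl

variable {P}

def normal (h : Fin P.lines) : P.Point := (pointIdx P).symm ⟨(leadingOne P.r h).1, by
    obtain ⟨j, _, _, _, h4, h5⟩ := leadingOne_lt h.2; exact h4.trans_le h5⟩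

lemma normal_digit (h : Fin P.lines) (i : Fin P.t) :
    normal h i = (((leadingOne P.r h).1 / P.r ^ (i : ℕ) : ℕ) : ZMod P.r) := by
  rw [← pointIdx_digit P (normal h) i, normal, Equiv.apply_symm_apply]

lemma exists_normal_digit (h : Fin P.lines) :
    ∃ j : Fin P.t, normal h j = 1 ∧ ∀ i, j < i → normal h i = 0 := by
  obtain ⟨j, hj, -, h3, h4, -⟩ := leadingOne_lt h.2
  refine ⟨⟨j, hj⟩, by rw [normal_digit, h3, Nat.cast_one], fun i hi => ?_⟩
  rw [normal_digit, Nat.div_eq_of_lt (h4.trans_le (Nat.pow_le_pow_right P.prime.out.pos hi)), Nat.cast_zero]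

lemma normal_ne_zero (h : Fin P.lines) : normal h ≠ 0 := by
  obtain ⟨j, hj, -⟩ := exists_normal_digit h; intro h0; simp_all

lemma normal_injective : Injective (normal (P := P)) := by
  intro h h' e
  have e1 :=
    congrArg Fin.val ((pointIdx P).symm.injective e)
  have hlt : ∀ a b : ℕ, a < b → (leadingOne P.r a).1 < (leadingOne P.r b).1 := by
    intro a b hab
    refine strictMono_nat_of_lt_succ (f := fun h => (leadingOne P.r h).1) (fun h => ?_) hab
    have := Nat.mul_le_mul_left (leadingOne P.r h).2 (two_le_r P); rw [leadingOne]; grind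
  rcases lt_trichotomy (h : ℕ) h' with hl | he | hl
  · grind
  · grind
  grind

/-- A hyperplane has just one normal vector with leading digit one. Indeed, proportional vectors
have the same leading position, and two leading digits one force the factor to be one; surjectivity
follows by counting. -/
lemma bijective_hyper_normal :
    Bijective fun h : Fin P.lines => hyper P ⟨normal h, normal_ne_zero h⟩ := by
  have hc : P.lines = card P.Hyperplane := by
    have h1 := lines_mul (P := P); have h2 := card_hyperplane P; have hr := two_le_r P
    exact Nat.eq_of_mul_eq_mul_right (by omega : 0 < P.r - 1) (by omega)
  refine (Fintype.bijective_iff_injective_and_card _).2 ⟨fun h h' e => ?_, by simp_all⟩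
  obtain ⟨c, hc⟩ := (hyper_eq_iff P _ _).1 e; obtain ⟨j, hj, hj0⟩ := exists_normal_digit h
  obtain ⟨j', hj', hj0'⟩ := exists_normal_digit h'
  have hci : ∀ i, normal h' i = c * normal h i := fun i => by simp_all
  rcases lt_trichotomy j j' with hl | rfl | hl
  · grind
  · have := hci j; refine normal_injective ?_; grind
  grind

def hyperIdx : Fin P.lines ≃ P.Hyperplane := Equiv.ofBijective _ bijective_hyper_normal

lemma mem_hyperIdx (h : Fin P.lines) (y : P.Point) :
    y ∈ (hyperIdx h).1 ↔ digitDot P.r P.t (leadingOne P.r h).1 (pointIdx P y) = 0 := by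
  have h1 : y ∈ (hyperIdx h).1 ↔ normal h ⬝ᵥ y = 0 := mem_dotKer P
  rw [h1, ← digitDot_pointIdx, normal, Equiv.apply_symm_apply]

end Points

/-! ### The rejection kernel on the machine. -/

section Kernel

variable {P : Params}

def semIter (c : Cmd) : ℕ → Store → Measure Store
  | 0, s => dirac s
  | j + 1, s => (sem c s).bind (semIter c j)

lemma measurable_semIter (c : Cmd) (j : ℕ) : Measurable (semIter c j) := by induction j with
  | zero => exact measurable_dirac
  | succ j ih => exact (measurable_bind' ih).comp (measurable_sem c)

lemma sem_loop_iter (e : NExp) (c : Cmd) (s : Store) : sem (.loop e c) s = semIter c (e.eval s) s := by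
  have h : ∀ j x, (iter (run c) j x).map Prod.fst = semIter c j x.1 := by
    intro j
    induction j with
    | zero => intro x; exact map_dirac' measurable_fst _
    | succ j ih =>
      intro x; rw [iter, bind_map (measurable_iter (measurable_run c) j) measurable_fst]
      simp_rw [ih]; rw [← map_bind measurable_fst (measurable_semIter c j), run_map_fst]; rfl
  exact h _ _

/-- The case distinction in `rkAccept` is redundant for a coin: where the ratio exceeds one, the
formula is negative and `coin` clips it to zero. What remains is one expression in `exp`. -/
lemma coin_rkAccept {p Q ν : ℝ} (hQ0 : 0 < Q) (hQp : Q < p) (hp : p ≤ 1) (B : Bool) (z : ℝ) :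
    coin (rkAccept p Q ν B z) = coin (if B then 1 - (1 - p) / (1 - Q) * exp (0 - ν * z - ν * ν / 2)
      else 1 - Q / p * exp (ν * z - ν * ν / 2)) := by
  have hneg : ∀ x y : ℝ, x ≤ 0 → y ≤ 0 → coin x = coin y := by
    intro x y hx hy
    rw [coin, coin, prob, prob, Set.projIcc_of_le_left _ hx, Set.projIcc_of_le_left _ hy]
  have h00 := φ_pos 0 0; unfold rkAccept
  cases B
  · simp
    have hr : Q * φ ν z / (p * φ 0 z) = Q / p * exp (ν * z - ν * ν / 2) := by
      rw [φ_eq ν, φ_eq 0 z, mul_div_mul_comm, mul_div_mul_left _ _ h00.ne', ← exp_sub]; grind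
    split_ifs with h
    · rw [hr]
    · refine hneg _ _ le_rfl ?_
      have := (one_lt_div (mul_pos (by linarith) (φ_pos _ _))).2 (not_le.1 h); linarith
  · simp only [if_true]
    have hr : (1 - p) * φ 0 (z + ν) / ((1 - Q) * φ ν (z + ν)) =
        (1 - p) / (1 - Q) * exp (0 - ν * z - ν * ν / 2) := by
      rw [φ_eq ν, φ_eq 0 _, mul_div_mul_comm, mul_div_mul_left _ _ h00.ne', ← exp_sub]; grind
    split_ifs with h
    · rw [hr]
    · refine hneg _ _ le_rfl ?_
      have := (one_lt_div (mul_pos (by linarith) (φ_pos _ _))).2 (not_le.1 h); linarith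

/-- The accepted proposals. -/
def rkAccepted : Cmd := .ite (.natEq (.get 3 (.lit 2)) (.lit 1))
    (.ite (.natEq (.get 17 ix) (.lit 1)) (.setReal 2 ix (.add (.get 2 ix) (r0 5))) .skip)
    (.setReal 2 ix (.ofNat (.lit 0)))

/-- The decision about a proposal. -/
def rkDecide : Cmd := (.ite (.natEq (.get 17 ix) (.lit 1))
    (.flip 3 (.lit 2) (.sub (.ofNat (.lit 1)) (.mul
      (.div (.sub (.ofNat (.lit 1)) (r0 0)) (.sub (.ofNat (.lit 1)) (r0 3)))
      (.exp (.sub (.sub (.ofNat (.lit 0)) (.mul (r0 5) (.get 2 ix)))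
        (.div (.mul (r0 5) (r0 5)) (.ofNat (.lit 2))))))))
    (.flip 3 (.lit 2) (.sub (.ofNat (.lit 1)) (.mul (.div (r0 3) (r0 0))
      (.exp (.sub (.mul (r0 5) (.get 2 ix)) (.div (.mul (r0 5) (r0 5)) (.ofNat (.lit 2)))))))))

/-- One iteration of the rejection kernel; the scratch cell `2` tells whether it has stopped. -/
def rkStep : Cmd := .ite (.natEq (.get 3 (.lit 2)) (.lit 0))
    (.seq (.gauss 2 ix) (.seq rkDecide rkAccepted)) .skip

def rkFill : Cmd := forN 0 (c0 14) (.seq (.loop (c0 8) rkStep) (.setNat 3 (.lit 2) (.lit 0)))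

lemma safe_rkFill : rkFill.Safe :=
  safe_forN ⟨⟨⟨trivial, ⟨trivial, trivial⟩, ⟨trivial, trivial⟩, trivial⟩, trivial⟩,
    NExp.small_lit (by norm_num)⟩

lemma sem_rkStep_stopped {s : Store} (h : s.1 3 2 = 1) : sem rkStep s = dirac s := by
  rw [rkStep, sem_ite, if_neg (by simp [BExp.Holds, h]), sem_skip]

lemma sem_rkAccepted {s : Store} {u : ℕ} {B a : Bool} {z : ℝ} (hu : s.1 3 0 = u)
    (h17 : s.1 17 u = bit B) (h2 : s.1 3 2 = 0) (h0 : s.2 2 u = 0) (hτ : s.2 0 5 = P.τ) :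
    sem rkAccepted (ctr 2 (bit a) (setR 2 (update (s.2 2) u z) s)) = dirac
      (if a then ctr 2 1 (setR 2 (update (s.2 2) u (rkProposal P.τ B z)) s) else s) := by
  rw [rkAccepted, sem_ite, sem_ite]
  cases a
  · rw [if_neg (by simp [BExp.Holds, bit]), sem_setReal']; simp [bit]; rw [ctr_self (by simp_all)]
    simp [hu, ← h0]
  · rw [if_pos (by simp [BExp.Holds, bit])]
    cases B
    · rw [if_neg (by simp [BExp.Holds, bit, hu, h17]), sem_skip]; simp [rkProposal, bit]
    · rw [if_pos (by simp [BExp.Holds, bit, hu, h17]), sem_setReal']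
      simp [rkProposal, bit, hu, hτ, setR_ctr]

lemma sem_rkStep (hQ : GoodQ P.p P.q P.Q) {s : Store} {u : ℕ} {B : Bool} (hu : s.1 3 0 = u)
    (h17 : s.1 17 u = bit B) (h2 : s.1 3 2 = 0) (h0 : s.2 2 u = 0) (hr : s.2 0 = realConsts P)
    {K : Store → Measure Store} (hK : Measurable K) :
    (sem rkStep s).bind K = (gaussianReal 0 1).bind fun z => (coin (rkAccept P.p P.Q P.τ B z)).bind fun a =>
      K (if a then ctr 2 1 (setR 2 (update (s.2 2) u (rkProposal P.τ B z)) s) else s) := by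
  have hF : Measurable fun z => setR 2 (update (s.2 2) u z) s :=
    measurable_setR_apply 2 (by fun_prop) measurable_const
  have hm : Measurable fun z => sem (.seq rkDecide rkAccepted) _ := (measurable_sem _).comp hF
  rw [rkStep, sem_ite, if_pos (by simp [BExp.Holds, h2]), sem_seq, sem_gauss_map]
  rw [(by simp [hu] : (NExp.eval s ix) = u), map_bind hF (measurable_sem _), bind_bind hm hK]
  congr 1; funext z
  have hf : sem rkDecide (setR 2 (update (s.2 2) u z) s) =
      (coin (rkAccept P.p P.Q P.τ B z)).map fun a =>
        ctr 2 (bit a) (setR 2 (update (s.2 2) u z) s) := by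
    rw [coin_rkAccept hQ.Q_pos hQ.lt_p hQ.p_le, rkDecide, sem_ite, sem_flip_map, sem_flip_map]
    cases B
    · rw [if_neg (by simp [BExp.Holds, hu, h17, bit])]; simp [hr, realConsts, hu, ctr]
    · rw [if_pos (by simp [BExp.Holds, hu, h17, bit])]; simp [hr, realConsts, hu, ctr]
  rw [sem_seq, hf, map_bind disc (measurable_sem _)]
  simp_rw [sem_rkAccepted (P := P) hu h17 h2 h0 (by simp [hr, realConsts])]
  rw [bind_bind disc hK]; simp_all

/-- A rejection resets the cell to zero and so restores the memory; an acceptance sets the flag,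
after which all rounds are idle. This is the recursion of `rkG`, and its default output is the
initial zero of the cell. -/
lemma semIter_rkStep (hQ : GoodQ P.p P.q P.Q) {s : Store} {u : ℕ} {B : Bool} (hu : s.1 3 0 = u)
    (h17 : s.1 17 u = bit B) (h2 : s.1 3 2 = 0) (h0 : s.2 2 u = 0) (hr : s.2 0 = realConsts P) (j : ℕ) :
    (semIter rkStep j s).map (ctr 2 0) = (rkG P.p P.Q P.τ B j).map fun z =>
      setR 2 (update (s.2 2) u z) s := by
  have hF : Measurable fun z => setR 2 (update (s.2 2) u z) s :=
    measurable_setR_apply 2 (by fun_prop) measurable_const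
  have hhalt : ∀ j s', s'.1 3 2 = 1 → semIter rkStep j s' = dirac s' := by
    intro j
    induction j with
    | zero => intro s' _; rfl
    | succ j ih =>
      intro s' h
      rw [semIter, sem_rkStep_stopped h, dirac_bind (measurable_semIter _ _), ih s' h]
  induction j with
  | zero =>
    rw [semIter, rkG, map_dirac' (measurable_ctr 2 0), map_dirac' hF, ctr_self h2]
    simp [← h0]
  | succ j ih =>
    have hp := isProb_rkG (ν := P.τ) hQ.Q_pos hQ.lt_p hQ.p_le B j
    have hK : Measurable fun s' => (semIter rkStep j s').map _ :=
      (measurable_map _ (measurable_ctr 2 0)).comp (measurable_semIter _ _)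
    rw [semIter, bind_map (measurable_semIter _ _) (measurable_ctr 2 0), sem_rkStep hQ hu h17 h2 h0 hr hK, rkG,
      bind_map (measurable_rkG_step hQ.Q_pos hQ.lt_p hQ.p_le B _) hF]
    congr 1; funext z; rw [bind_map disc hF]; congr 1; funext a
    cases a
    · grind
    · simp only [if_true]
      rw [hhalt _ _ (by simp), map_dirac' (measurable_ctr 2 0), map_dirac' hF, ctr_ctr,
        ctr_self (by simp_all)]

lemma sem_rkFill (hQ : GoodQ P.p P.q P.Q) {s : Store} (hs : Ready P s)
    (bits : Fin (P.m * (P.k * P.r ^ P.t)) → Bool)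
    (h17 : ∀ u : Fin (P.m * (P.k * P.r ^ P.t)), s.1 17 u = bit (bits u)) (h2 : s.2 2 = fun _ => 0) :
    sem rkFill s = (piM fun u => rkG P.p P.Q P.τ (bits u) P.iterations).map fun x =>
      setR 2 (arr 0 id x) s := by
  have hp := fun B => isProb_rkG (ν := P.τ) hQ.Q_pos hQ.lt_p hQ.p_le B P.iterations
  refine sem_fill _ (measurable_setR_const 2 s) 0 id measurable_id
    _ (setR_eq_self h2) (by simp [hs.nat, consts])
    (fun f => cap_le hs 14) (fun f => by simp [hs.scratch]) fun i f hf => ?_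
  rw [sem_seq, sem_loop_iter, (by simp [hs.nat, consts] : NExp.eval _ _ = P.iterations), (funext fun s' => sem_set_ctr _ _ _ : sem (.setNat 3 _ (.lit 0)) = fun s' => dirac (ctr 2 0 s'))]
  rw [(bind_dirac_eq_map _ (measurable_ctr 2 0)), semIter_rkStep hQ (u := i) (B := bits i) (by simp) (by simp_all) (by simp [hs.scratch]) (by simp_all)
    (by simp [hs.real])]
  simp [setR_ctr]

end Kernel

/-! ### The padded and permuted matrix on the machine. -/

section Bits

variable (P : Params)

/-- The entry of the padded and permuted matrix that the arrays determine, if they do. -/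
def storedBit (s : Store) (u : ℕ) : Option Bool := let kR := P.k * P.r ^ P.t
  let N' := P.N / P.k
  let i := s.1 11 (u / kR)
  let b := s.1 12 (u % kR)
  let a := u % kR / P.r ^ P.t
  let j := a * P.blockLen + b
  let v := s.1 7 (i / P.blockLen * N' + s.1 10 i)
  let w := s.1 7 (a * N' + s.1 10 j)
  if b < P.blockLen then if i = j then
      if s.1 10 i < N' then some (decide (s.1 8 (i / P.blockLen * N' + s.1 10 i) = 1))
      else some (decide (s.1 10 i < N' + (s.1 19 (i / P.blockLen) - s.1 16 (i / P.blockLen))))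
    else if s.1 10 i < N' ∧ s.1 10 j < N' then
      some (if i < j then decide (s.1 5 (min v w * P.N + max v w) = 1)
        else decide (s.1 6 (min v w * P.N + max v w) = 1))
    else none
  else none

/-- The law of a bit, if it is given, and a biased coin otherwise. -/
def fillLaw (x : ℝ) (o : Option Bool) : Measure Bool := o.elim (coin x) dirac

instance (x : ℝ) (o : Option Bool) : IsProb (fillLaw x o) := by
  cases o
  · exact inferInstanceAs (IsProb (coin x))
  · exact dirac.isProbabilityMeasure

variable {P}

def rowExp : NExp := .get 11 (.div ix (c0 13))
def posExp : NExp := .get 12 (.mod ix (c0 13))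
def partExp : NExp := .div (.mod ix (c0 13)) (c0 6)
def colExp : NExp := .add (.mul partExp (c0 7)) posExp
def rowVertex : NExp := .get 7 (.add (.mul (.div rowExp (c0 7)) (c0 10)) (.get 10 rowExp))
def colVertex : NExp := .get 7 (.add (.mul partExp (c0 10)) (.get 10 colExp))
/-- The position of the two vertices in the arrays of clones. -/
def pairIdx : NExp :=
  .add (.mul (.sub rowVertex (.sub rowVertex colVertex)) (c0 0)) (.add rowVertex (.sub colVertex rowVertex))

def bitFill : Cmd := forN 0 (c0 14) (.ite (.natLt posExp (c0 7)) (.ite (.natEq rowExp colExp)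
      (.ite (.natLt (.get 10 rowExp) (c0 10))
        (.setNat 17 ix (.get 8 (.add (.mul (.div rowExp (c0 7)) (c0 10)) (.get 10 rowExp))))
        (.ite (.natLt (.get 10 rowExp)
            (.add (c0 10) (.sub (.get 19 (.div rowExp (c0 7))) (.get 16 (.div rowExp (c0 7))))))
          (.setNat 17 ix (.lit 1)) (.setNat 17 ix (.lit 0))))
      (.ite (.and (.natLt (.get 10 rowExp) (c0 10)) (.natLt (.get 10 colExp) (c0 10)))
        (.ite (.natLt rowExp colExp) (.setNat 17 ix (.get 5 pairIdx)) (.setNat 17 ix (.get 6 pairIdx)))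
        (.flip 17 ix (r0 3))))
    (.flip 17 ix (r0 3)))

lemma safe_bitFill : bitFill.Safe :=
  safe_forN ⟨⟨⟨NExp.small_get _ _, NExp.small_lit le_rfl, NExp.small_lit zero_le_one⟩,
    ⟨NExp.small_get _ _, NExp.small_get _ _⟩, trivial⟩, trivial⟩

lemma bit_decide {x : ℕ} (h : x ≤ 1) : bit (decide (x = 1)) = x := by interval_cases x <;> rfl

lemma sem_bitFill {s : Store} (hs : Ready P s) (h5 : ∀ u, s.1 5 u ≤ 1) (h6 : ∀ u, s.1 6 u ≤ 1)
    (h8 : ∀ u, s.1 8 u ≤ 1) (h17 : s.1 17 = fun _ => 0) :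
    sem bitFill s = (piM fun u : Fin (P.m * (P.k * P.r ^ P.t)) =>
      fillLaw P.Q (storedBit P s u)).map fun x => setN 17 (arr 0 bit x) s := by
  refine sem_fill _ (measurable_setN_const 17 s) 0 bit measurable_bit _
    (setN_eq_self h17) (by simp [hs.nat, consts]) (fun f => by
      rw [setN_ne (by decide)]; exact cap_le hs 14)
    (fun f => by simp [hs.scratch]) fun u f _ => ?_
  set s' := ctr 0 u _; have e0 : ix.eval s' = u := by simp [s']
  have eget : ∀ a e, a ≠ 17 → a ≠ 3 → (NExp.get a e).eval s' = s.1 a (e.eval s') := by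
    intro a e h1 h2; simp [s', h1, h2]
  have ec : ∀ i, (c0 i).eval s' = consts P i := by intro i; simp [s', hs.nat]
  have e11 : rowExp.eval s' = s.1 11 (u / (P.k * P.r ^ P.t)) := by
    rw [rowExp, eget _ _ (by decide) (by decide)]; simp only [NExp.eval, ec]; rfl
  have e12 : posExp.eval s' = s.1 12 (u % (P.k * P.r ^ P.t)) := by
    rw [posExp, eget _ _ (by decide) (by decide)]; simp only [NExp.eval, ec]; rfl
  have ea : partExp.eval s' = u % (P.k * P.r ^ P.t) / P.r ^ P.t := by
    simp only [partExp, NExp.eval, ec]; rfl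
  have ej : colExp.eval s' = u % (P.k * P.r ^ P.t) / P.r ^ P.t * P.blockLen +
      s.1 12 (u % (P.k * P.r ^ P.t)) := by
    simp only [colExp, NExp.eval, ea, e12, ec]; rfl
  have eL : consts P 7 = P.blockLen := rfl; have eN : consts P 10 = P.N / P.k := rfl
  have ev : rowVertex.eval s' = _ := eget 7 _ (by decide) (by decide)
  have ew : colVertex.eval s' = _ := eget 7 _ (by decide) (by decide)
  have et := fun e => eget 10 e (by decide) (by decide)
  simp only [NExp.eval.eq_3, NExp.eval.eq_5, NExp.eval.eq_6, et, e11, ea, ej, ec, eL, eN] at ev ew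
  -- With truncated subtraction, `v - (v - w)` is the minimum and `v + (w - v)` the maximum.
  have ep : pairIdx.eval s' = min (rowVertex.eval s') (colVertex.eval s') * P.N +
      max (rowVertex.eval s') (colVertex.eval s') := by
    simp only [pairIdx, NExp.eval, ec]; congr 2 <;> omega
  have hset : ∀ e : NExp, ∀ b : Bool, e.eval s' = bit b →
      sem (.setNat 17 ix e) s' = (dirac b).map fun v => ctr 0 u (setN 17 (update f u (bit v)) s) := by
    intro e b he; rw [sem_setNat', he, map_dirac' disc, e0]; simp [s', setN_ctr]
  have hflip : sem (.flip 17 ix (r0 3)) s' =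
      (coin P.Q).map fun v => ctr 0 u (setN 17 (update f u (bit v)) s) := by
    rw [sem_flip_map, e0, (by simp [s', hs.real, realConsts] : (r0 3).eval s' = P.Q)]
    simp [s', setN_ctr]
  simp only [sem_ite, BExp.Holds, et, e12, ej, storedBit]
  simp only [NExp.eval.eq_3, NExp.eval.eq_4, NExp.eval.eq_6, eget 19 _ (by decide) (by decide),
    eget 16 _ (by decide) (by decide), e11, ec, eL, eN]
  split_ifs
  · refine hset _ _ ?_; rw [eget 8 _ (by decide) (by decide), bit_decide (h8 _)]
    simp only [NExp.eval.eq_3, NExp.eval.eq_5, NExp.eval.eq_6, et, e11, ec, eL, eN]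
  · rename_i h; exact hset _ _ (by simp [h, bit])
  · rename_i h; exact hset _ _ (by simp [h, bit])
  · refine hset _ _ ?_; rw [eget 5 _ (by decide) (by decide), bit_decide (h5 _), ep, ev, ew]
  · refine hset _ _ ?_; rw [eget 6 _ (by decide) (by decide), bit_decide (h6 _), ep, ev, ew]
  · exact hflip
  · exact hflip

end Bits

/-! ### The rotation and the output on the machine. -/

section Output

variable {P : Params}

/-- The column of the rotated matrix that becomes the current sample. -/
def sampleExp : NExp := .get 13 (.div ix (c0 3))

def entryExp : RExp := .get 2 (.add (.mul (.get 14 (.mod ix (c0 3))) (c0 13))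
    (.add (.mul (.div sampleExp (c0 11)) (c0 6)) (.get 3 (.lit 1))))

def scaleExp : RExp :=
  .div (.ofNat (.lit 1)) (.sqrt (.mul (.ofNat (c0 6)) (.sub (.ofNat (c0 4)) (.ofNat (.lit 1)))))

def addTerm : Cmd :=
  .ite (.natEq (.get 18 (.add (.mul (.get 15 (.mod sampleExp (c0 11))) (c0 6)) (.get 3 (.lit 1)))) (.lit 0))
    (.setReal 1 ix (.add (.get 1 ix)
      (.mul entryExp (.mul scaleExp (.sub (.ofNat (.lit 1)) (.ofNat (c0 4)))))))
    (.setReal 1 ix (.add (.get 1 ix) (.mul entryExp (.mul scaleExp (.ofNat (.lit 1))))))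

def outFill : Cmd :=
  forN 0 (c0 16) (.ite (.natLt (.get 14 (.mod ix (c0 3))) (c0 9)) (forN 1 (c0 6) addTerm) (.gauss 1 ix))

lemma safe_outFill : outFill.Safe := safe_forN ⟨safe_forN ⟨trivial, trivial⟩, trivial⟩

variable (P) in
def storedTerm (s : Store) (row col y : ℕ) : ℝ :=
  s.2 2 (row * (P.k * P.r ^ P.t) + (col / P.lines * P.r ^ P.t + y)) *
    (1 / √((P.r : ℝ) ^ P.t * (P.r - 1)) *
      if s.1 18 (s.1 15 (col % P.lines) * P.r ^ P.t + y) = 0 then 1 - (P.r : ℝ) else 1)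

variable (P) in
def outLaw (s : Store) (u : ℕ) : Measure ℝ := if s.1 14 (u % P.d) < P.m then
    dirac (∑ y ∈ range (P.r ^ P.t), storedTerm P s (s.1 14 (u % P.d)) (s.1 13 (u / P.d)) y)
  else gaussianReal 0 1

instance (s : Store) (u : ℕ) : IsProb (outLaw P s u) := by
  unfold outLaw; split_ifs <;> infer_instance

lemma sem_outFill {s : Store} (hs : Ready P s) (h1 : s.2 1 = fun _ => 0) :
    sem outFill s = (piM fun u : Fin (P.n * P.d) => outLaw P s u).map fun x =>
      setR 1 (arr 0 id x) s := by
  refine sem_fill _ (measurable_setR_const 1 s) 0 id measurable_id _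
    (setR_eq_self h1) (by simp [hs.nat, consts]) (fun f => cap_le hs 16)
    (fun f => by simp [hs.scratch]) fun u f hf => ?_
  have hcond : BExp.Holds (ctr 0 u (setR 1 f s)) (.natLt (.get 14 (.mod ix (c0 3))) (c0 9)) ↔
      s.1 14 (u % P.d) < P.m := by
    simp [BExp.Holds, hs.nat, consts]
  rw [sem_ite]; by_cases hc : s.1 14 (u % P.d) < P.m
  · have hm : Measurable fun v => ctr 0 u (setR 1 (update f u (id v)) s) :=
      (measurable_ctr 0 u).comp (measurable_setR_apply 1 (by fun_prop) measurable_const)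
    rw [if_pos (hcond.2 hc), outLaw, if_pos hc, map_dirac' hm]
    set g := storedTerm P s _ _ with hg
    have := sem_forN_det (c := 1) (e := c0 6) (body := addTerm) (s := ctr 0 u (setR 1 f s))
      (fun y => ctr 0 u (setR 1 (Function.update f u (∑ y ∈ Finset.range y, g y)) s))
      (by simp [← hf]) (by simp [hs.nat]) (fun y => cap_le hs 6) (fun y => by simp [hs.scratch])
      (fun y hy => by
        rw [addTerm, sem_ite, sem_setReal', sem_setReal', sum_range_succ]
        by_cases h18 : s.1 18 (s.1 15 (s.1 13 (u / P.d) % P.lines) * P.r ^ P.t + y) = 0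
        · rw [if_pos (by simpa [BExp.Holds, sampleExp, hs.nat, consts] using h18)]
          simp [setR_ctr, hs.nat, consts, sampleExp, entryExp, scaleExp, hg, storedTerm, h18]
        · rw [if_neg (by simpa [BExp.Holds, sampleExp, hs.nat, consts] using h18)]
          simp [setR_ctr, hs.nat, consts, sampleExp, entryExp, scaleExp, hg, storedTerm, h18])
    exact this
  · rw [if_neg (fun h => hc (hcond.1 h)), outLaw, if_neg hc, sem_gauss_map]; simp [setR_ctr]

end Output

/-! ### Random columns and rows from shuffled lists. -/

section Tail

variable {β : Type*} [MeasurableSpace β]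

/-- Every injection is a permutation of `ι₀`, and all arise equally often; so the first entries of a
shuffled list form a uniform injection. Inverting the permutation makes the fibres compatible with
right multiplication. -/
lemma unif_perm_embedding {I A : Type*} [Fintype A] [DecidableEq A] [Fintype (I ↪ A)]
    (ι₀ : I ↪ A) (F : (I ↪ A) → Measure β) :
    (unif (Perm A) fun π => F (ι₀.trans π.toEmbedding)) = unif (I ↪ A) F := by
  have := fun (ι : I ↪ A) x => Classical.propDecidable (x ∈ Set.range ι)
  rw [← unif_equiv (Equiv.inv _)]; refine unif_comp_of_group _ (fun ι => ?_) (fun x y g h => ?_) F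
  · let e : {x // x ∈ Set.range ι₀} ≃ {x // x ∈ Set.range ι} :=
      (Equiv.ofInjective ι₀ ι₀.injective).symm.trans (Equiv.ofInjective ι ι.injective)
    refine ⟨(e.extendSubtype)⁻¹, ?_⟩; ext i; simp; rw [(e.extendSubtype_apply_of_mem _ ⟨i, rfl⟩)]
    simp [e]
  · ext i; have := DFunLike.congr_fun h i; simp at this ⊢; grind

lemma unif_unique_pi {X : Type*} [Fintype X] (f : X → Measure β) :
    (unif (Fin 1 → X) fun x => f (x 0)) = unif X f := unif_equiv (Equiv.funUnique _ X) f

variable (P : Params)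

def rowIdx : P.Row ≃ Fin P.m := finProdFinEquiv

lemma rowIdx_val (i : P.Row) : (rowIdx P i : ℕ) = i.1 * P.blockLen + i.2 := by
  show ((finProdFinEquiv i) : ℕ) = _; rw [finProdFinEquiv_apply_val]; ring

def entryIdx : P.Row × Fin P.k × P.Point ≃ Fin (P.m * (P.k * P.r ^ P.t)) :=
  ((rowIdx P).prodCongr ((((Equiv.refl _).prodCongr (pointIdx P))).trans finProdFinEquiv)).trans
    finProdFinEquiv

lemma entryIdx_val (i : P.Row) (a : Fin P.k) (y : P.Point) : (entryIdx P (i, a, y) : ℕ) =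
    rowIdx P i * (P.k * P.r ^ P.t) + (a * P.r ^ P.t + pointIdx P y) := by
  simp [entryIdx]; ring

def columnIdx : Fin (P.k * P.lines) ≃ Fin P.k × P.Hyperplane :=
  finProdFinEquiv.symm.trans ((Equiv.refl _).prodCongr hyperIdx)

variable {P}

def readOut (n d : ℕ) (s : Store) : Fin n → Fin d → ℝ := fun j i => s.2 1 (j * d + i)

lemma measurable_readOut (n d : ℕ) : Measurable (readOut n d) := by unfold readOut; fun_prop

/-- The arrays from which the rotation is computed. -/
structure Tabled (P : Params) (s : Store) : Prop where
  normals : s.1 15 = fun h => if h < P.lines then (leadingOne P.r h).1 else 0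
  dots : s.1 18 = fun u => if u < P.r ^ P.t * P.r ^ P.t then dotTab P.r P.t u else 0

/-- A zero in the table of inner products marks the points on the hyperplane with the given normal
(`mem_hyperIdx`), so the stored terms are the summands of the matrix product. -/
lemma sum_storedTerm {s : Store} (ht : Tabled P s) {x : Fin (P.m * (P.k * P.r ^ P.t)) → ℝ}
    (h2 : s.2 2 = arr 0 id x) (i : P.Row) (c : Fin (P.k * P.lines)) :
    ∑ y ∈ range (P.r ^ P.t), storedTerm P s (rowIdx P i) c y =
      rotate P (fun i a y => x (entryIdx P (i, a, y))) i (columnIdx P c) := by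
  obtain ⟨⟨a, h⟩, rfl⟩ := finProdFinEquiv.surjective c
  have e1 : ((finProdFinEquiv (a, h))) / P.lines = a := by
    rw [finProdFinEquiv_apply_val, add_comm, Nat.mul_add_div h.pos, Nat.div_eq_of_lt h.2, add_zero]
  have e2 : ((finProdFinEquiv (a, h))) % P.lines = h := by
    rw [finProdFinEquiv_apply_val, add_comm, Nat.mul_add_mod, Nat.mod_eq_of_lt h.2]
  rw [(by simp [columnIdx] : columnIdx P _ = (a, hyperIdx h)), sum_range, ← (pointIdx P).sum_comp]
  simp only [rotate, Matrix.of_apply, Matrix.mul_apply, Matrix.transpose_apply, rotation]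
  refine sum_congr rfl fun y _ => ?_
  have hn : (leadingOne P.r h).1 < P.r ^ P.t := by
    obtain ⟨j, _, _, _, h4, h5⟩ := leadingOne_lt h.2; grind
  have hu : (leadingOne P.r h).1 * P.r ^ P.t + (pointIdx P y) < P.r ^ P.t * P.r ^ P.t := by
    have := Nat.mul_le_mul_right (P.r ^ P.t) (Nat.succ_le_of_lt hn); grind
  have d1 : ((leadingOne P.r h).1 * P.r ^ P.t + (pointIdx P y)) / P.r ^ P.t = (leadingOne P.r h).1 := by
    rw [mul_comm, Nat.mul_add_div (by have := P.prime.out.pos; grind), Nat.div_eq_of_lt (pointIdx P y).2, add_zero]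
  have d2 : ((leadingOne P.r h).1 * P.r ^ P.t + (pointIdx P y)) % P.r ^ P.t = pointIdx P y := by
    rw [mul_comm, Nat.mul_add_mod, Nat.mod_eq_of_lt (pointIdx P y).2]
  have e3 : s.1 18 (s.1 15 h * P.r ^ P.t + (pointIdx P y)) = 0 ↔ y ∈ (hyperIdx h).1 := by
    rw [ht.normals, ht.dots]; simp [hu]; rw [dotTab, d1, d2, ZMod.val_eq_zero, mem_hyperIdx]
  rw [storedTerm, e1, e2, h2, ← entryIdx_val, arr_val]; grind

def finishCmd : Cmd := .seq (shuffle 13 19 12) (.seq (shuffle 14 19 3) outFill)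

lemma safe_finishCmd : finishCmd.Safe := ⟨safe_shuffle _ _ _, safe_shuffle _ _ _, safe_outFill⟩

/-- The filler sample is read only outside the embedded rows, so the coordinates are independent:
point masses in these rows, Gaussians elsewhere. -/
lemma permuteOutput_eq (M : Matrix P.Row (Fin P.k × P.Hyperplane) ℝ) :
    permuteOutput P M = unif P.Cols fun c => unif (P.Row ↪ Fin P.d) fun ι =>
      piM fun j => piM fun y =>
        if h : ∃ i, ι i = y then dirac (M h.choose (c j)) else gaussianReal 0 1 := by
  refine unif_congr fun c => unif_congr fun ι => ?_
  have h : ∀ j y, Measurable fun z => Function.extend ι (fun i => M i (c j)) (fun _ => z) y := by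
    intro j y; unfold Function.extend; split_ifs
    · simp
    · exact measurable_id
  refine Eq.trans (pi_pi_map _ h) ?_; congr 1; funext j; congr 1; funext y; unfold Function.extend
  split_ifs with hy
  · simp
  simp

lemma sem_finishCmd (hnK : P.n ≤ P.k * P.lines) (hmd : P.m ≤ P.d) {s : Store} (hs : Ready P s)
    (ht : Tabled P s) (h13 : s.1 13 = fun _ => 0) (h14 : s.1 14 = fun _ => 0) (h1 : s.2 1 = fun _ => 0)
    {x : Fin (P.m * (P.k * P.r ^ P.t)) → ℝ} (h2 : s.2 2 = arr 0 id x) :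
    (sem finishCmd s).map (readOut P.n P.d) = finish P fun i a y => x (entryIdx P (i, a, y)) := by
  set M := rotate P fun i a y => x _ with hM
  have hb1 : ∀ {L : ℕ} (π : Fin 1 → Perm (Fin L)) (y : Fin L),
      blocks (fun b z => (π b z)) y = π 0 y := by
    intro L π y; have := blocks_apply (fun b z => (π b z)) 0 y; simpa using this
  rw [finishCmd, sem_seq, (sem_shuffle (k := 1) (L := P.k * P.lines) (by decide) hs.scratch (by rw [hs.nat]; rfl) (by rw [hs.nat]; rfl) (cap_le hs 19) (cap_le hs 12) h13), unif_bind _ (measurable_sem _), unif_map _ (measurable_readOut _ _)]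
  simp_rw [dirac_bind (measurable_sem _)]; let ι₁ : Fin P.n ↪ Fin _ := Fin.castLEEmb hnK
  let ι₂ : P.Row ↪ Fin P.d := (rowIdx P).toEmbedding.trans (Fin.castLEEmb hmd)
  have key : ∀ π : Fin 1 → Perm (Fin _),
      (sem (.seq (shuffle 14 19 3) outFill) (setN 13 (blocks fun b z => (π b z)) s)).map
        (readOut P.n P.d) = unif (P.Row ↪ Fin P.d) fun ι =>
          piM fun j => piM fun y => if h : ∃ i, ι i = y then
            dirac (M h.choose (columnIdx P (π 0 (ι₁ j)))) else gaussianReal 0 1 := by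
    intro π; have hs' := hs.setN (by decide : 5 ≤ 13) (blocks fun b z => (π b z))
    rw [sem_seq, (sem_shuffle (k := 1) (L := P.d) (by decide) hs'.scratch (by rw [hs'.nat]; rfl) (by rw [hs'.nat]; rfl) (cap_le hs' 19) (cap_le hs' 3) (by simp [h14])), unif_bind _ (measurable_sem _), unif_map _ (measurable_readOut _ _)]
    simp_rw [dirac_bind (measurable_sem _)]; refine Eq.trans ?_ (unif_perm_embedding ι₂ _)
    -- Array `14` tells for each output row which matrix row to put there. This is the inverse of
    -- the permutation that embeds the rows, and inversion preserves the uniform law.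
    refine Eq.trans ?_ (unif_unique_pi _); refine (unif_equiv (Equiv.inv _) _).symm.trans ?_
    refine unif_congr fun π' => ?_
    set s' := setN 14 _
      _ with hs'def
    have hread : (readOut P.n P.d) ∘ (fun v => setR 1 (arr 0 id v) s') =
        fun v j y => v (finProdFinEquiv (j, y)) := by
      funext v j y
      have e : j * P.d + y = (finProdFinEquiv (j, y)) := by rw [finProdFinEquiv_apply_val]; ring
      simp only [comp, readOut, setR_same, e, arr_val, id]
    rw [(sem_outFill (hs'.setN (by decide) _) (by simp [h1])), Measure.map_map (measurable_readOut _ _)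
      (measurable_setR_apply 1 (measurable_arr 0 measurable_id) measurable_const), hread,
      pi_map_injective₂ _ (fun a b h => finProdFinEquiv.injective h)]
    congr 1; funext j; congr 1; funext y
    have u1 : ((finProdFinEquiv (j, y))) / P.d = j := by
      rw [finProdFinEquiv_apply_val, add_comm, Nat.mul_add_div y.pos, Nat.div_eq_of_lt y.2, add_zero]
    have u2 : ((finProdFinEquiv (j, y))) % P.d = y := by
      rw [finProdFinEquiv_apply_val, add_comm, Nat.mul_add_mod, Nat.mod_eq_of_lt y.2]
    have g14 : s'.1 14 y = ((π' 0)⁻¹ y) := by rw [hs'def, setN_same, hb1]; rfl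
    have g13 : s'.1 13 j = π 0 (ι₁ j) := by
      have := hb1 π (ι₁ j); exact this
    rw [outLaw, u1, u2, g14, g13]
    have hiff : (∃ i, (ι₂.trans (π' 0).toEmbedding) i = y) ↔ (((π' 0)⁻¹ y)) < P.m := by
      constructor
      · rintro ⟨i, hi⟩; have : (π' 0)⁻¹ y = ι₂ i := by rw [Perm.inv_eq_iff_eq, ← hi]; rfl
        rw [this]; exact (rowIdx P i).2
      · intro h; refine ⟨(rowIdx P).symm ⟨_, h⟩, ?_⟩
        have : ι₂ ((rowIdx P).symm ⟨_, h⟩) = (π' 0)⁻¹ y := by simp [ι₂]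
        rw [Embedding.trans_apply, this]; exact (π' 0).apply_symm_apply y
    by_cases hy : (((π' 0)⁻¹ y)) < P.m
    · have hy' := hiff.2 hy; rw [if_pos hy, dif_pos hy']
      have : (((π' 0)⁻¹ y) : ℕ) = rowIdx P hy'.choose := by
        have h' : (π' 0)⁻¹ y = ι₂ hy'.choose := by
          rw [Perm.inv_eq_iff_eq]; exact hy'.choose_spec.symm
        rw [h']; rfl
      rw [this, hM, ← sum_storedTerm (s := s') ⟨by simp [hs'def, ht.normals], by simp [hs'def, ht.dots]⟩
        (by simpa [hs'def] using h2)]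
    · rw [if_neg hy, dif_neg (fun h => hy (hiff.1 h))]
  simp_rw [key]; rw [finish, ← hM, permuteOutput_eq]
  refine Eq.trans ?_ (unif_equiv (Equiv.embeddingCongr (Equiv.refl _) (columnIdx P)) _)
  refine Eq.trans ?_ (unif_perm_embedding ι₁ _); refine Eq.trans ?_ (unif_unique_pi _); rfl

end Tail

/-! ### The program after the first random bits. -/

section Assemble

variable {P : Params}

lemma unif_equiv' {A B β : Type*} [MeasurableSpace β] {_ : Fintype A} {_ : Fintype B} (e : A ≃ B)
    (f : B → Measure β) : (unif A fun a => f (e a)) = unif B f := unif_equiv e f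

lemma map_sem_seq {Ω β : Type*} [MeasurableSpace Ω] [MeasurableSpace β] {μ : Measure Ω} {c₁ : Cmd} (c₂ : Cmd)
    {s : Store} {F : Ω → Store} (hF : Measurable F) (h : sem c₁ s = μ.map F) {g : Store → β} (hg : Measurable g) :
    (sem (.seq c₁ c₂) s).map g = μ.bind fun x => (sem c₂ (F x)).map g := by
  rw [sem_seq_map c₂ hF h]; exact bind_map ((measurable_sem c₂).comp hF) hg

lemma sem_rkFill_finish (hQ : GoodQ P.p P.q P.Q) (hnK : P.n ≤ P.k * P.lines) (hmd : P.m ≤ P.d) {s : Store}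
    (hs : Ready P s) (ht : Tabled P s) (h13 : s.1 13 = fun _ => 0) (h14 : s.1 14 = fun _ => 0)
    (h1 : s.2 1 = fun _ => 0) (h2 : s.2 2 = fun _ => 0) (v : Fin (P.m * (P.k * P.r ^ P.t)) → Bool)
    (h17 : s.1 17 = arr 0 bit v) :
    (sem (.seq rkFill finishCmd) s).map (readOut P.n P.d) =
      (gaussianize P fun i a y => v (entryIdx P (i, a, y))).bind (finish P) := by
  have hp := fun B J => isProb_rkG (ν := P.τ) hQ.Q_pos hQ.lt_p hQ.p_le B J
  rw [map_sem_seq _ (measurable_setR_apply 2 (measurable_arr 0 measurable_id) measurable_const) (sem_rkFill hQ hs v (fun u => by simp_all) h2) (measurable_readOut _ _)]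
  have h : ∀ x : Fin _ → ℝ, (sem finishCmd (setR 2 (arr 0 id x) s)).map _ =
        finish P fun i a y => x _ := fun x =>
    sem_finishCmd hnK hmd (hs.setR (by decide) _) ⟨by simp [ht.normals], by simp [ht.dots]⟩
      (by simp_all) (by simp_all) (by simp [h1]) (by simp)
  simp_rw [h]
  rw [← map_bind (by fun_prop) (measurable_finish P), (pi_map_injective₃ _ (fun a b h => (entryIdx P).injective h))]
  rfl

lemma sem_bitFill_finish (hQ : GoodQ P.p P.q P.Q) (hnK : P.n ≤ P.k * P.lines) (hmd : P.m ≤ P.d) {s : Store}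
    (hs : Ready P s) (ht : Tabled P s) (h13 : s.1 13 = fun _ => 0) (h14 : s.1 14 = fun _ => 0)
    (h1 : s.2 1 = fun _ => 0) (h2 : s.2 2 = fun _ => 0) (h5 : ∀ u, s.1 5 u ≤ 1) (h6 : ∀ u, s.1 6 u ≤ 1)
    (h8 : ∀ u, s.1 8 u ≤ 1) (h17 : s.1 17 = fun _ => 0) :
    (sem (.seq bitFill (.seq rkFill finishCmd)) s).map (readOut P.n P.d) =
      (piM fun i => piM fun a => piM fun y =>
        fillLaw P.Q (storedBit P s (entryIdx P (i, a, y)))).bind fun M => (gaussianize P M).bind (finish P) := by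
  rw [map_sem_seq _ disc (sem_bitFill hs h5 h6 h8 h17) (measurable_readOut _ _)]
  have h : ∀ x : Fin _ → Bool, (sem _ (setN 17 (arr 0 bit x) s)).map _ =
        (gaussianize P fun i a y => x _).bind _ := fun x =>
    sem_rkFill_finish hQ hnK hmd (hs.setN (by decide) _) ⟨by simp [ht.normals], by simp [ht.dots]⟩
      (by simp_all) (by simp_all) (by simp [h1]) (by simp [h2]) x (by simp)
  simp_rw [h]
  rw [← (pi_map_injective₃ (fun u : Fin _ => fillLaw P.Q (storedBit P s u)) (fun a b h => (entryIdx P).injective h)), map_bind disc disc]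

/-- The entries of `cloneMatrix`, where `none` stands for a random bit. -/
def cloneEntry {E : Fin P.N → Fin P.k} (e : P.Listing E)
    (B₁ : Fin P.k → Fin (P.N / P.k) → Bool) (B₂ : Fin P.k → Fin P.blockLen → Bool)
    (θ : P.Perms) (x : Sym2 (Fin P.N) → Fin 2 → Bool) (i j : P.Row) : Option Bool :=
  if i = j then some (diagBit P B₁ B₂ i.1 (θ i.1 i.2))
  else if h : (θ i.1 i.2 : ℕ) < P.N / P.k ∧ (θ j.1 j.2 : ℕ) < P.N / P.k then
    some (x s((e i.1 ⟨θ i.1 i.2, h.1⟩ : Fin P.N), (e j.1 ⟨θ j.1 j.2, h.2⟩ : Fin P.N))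
      (if toLex i < toLex j then 0 else 1))
  else none

variable {E : Fin P.N → Fin P.k} {e : P.Listing E}
  {B₁ : Fin P.k → Fin (P.N / P.k) → Bool} {B₂ : Fin P.k → Fin P.blockLen → Bool}
  {x : Sym2 (Fin P.N) → Fin 2 → Bool}

lemma coins_map_cloneMatrix (θ : P.Perms) :
    ((coins P.Row P.Row P.Q).map fun Z => cloneMatrix P e B₁ B₂ θ x Z) =
      piM fun i => piM fun j => fillLaw P.Q (cloneEntry e B₁ B₂ θ x i j) := by
  refine Eq.trans (congrArg (fun f => (coins P.Row P.Row P.Q).map f) ?_) ((pi_pi_map _ (f := fun i j z => (cloneEntry e B₁ B₂ θ x i j).getD z) (fun _ _ => disc)).trans ?_)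
  · funext Z i j; simp only [cloneMatrix, cloneEntry]; grind
  · congr 1; funext i; congr 1; funext j
    cases cloneEntry e B₁ B₂ θ x i j with
    | none => exact map_id
    | some b => simp only [Option.getD_some, Measure.map_const, measure_univ, one_smul]; rfl

/-- The tables and the random bits of the first step are in place. -/
structure Sampled (e : P.Listing E) (B₁ : Fin P.k → Fin (P.N / P.k) → Bool)
    (B₂ : Fin P.k → Fin P.blockLen → Bool) (x : Sym2 (Fin P.N) → Fin 2 → Bool) (s : Store) : Prop where
  ready : Ready P s
  tabled : Tabled P s
  members : ∀ (a : Fin P.k) (z : Fin (P.N / P.k)), s.1 7 (a * (P.N / P.k) + z) = (e a z : Fin P.N)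
  fst : ∀ u v : Fin P.N, s.1 5 (min (u : ℕ) v * P.N + max (u : ℕ) v) = bit (x s(u, v) 0)
  snd : ∀ u v : Fin P.N, s.1 6 (min (u : ℕ) v * P.N + max (u : ℕ) v) = bit (x s(u, v) 1)
  fst_le : ∀ u, s.1 5 u ≤ 1
  snd_le : ∀ u, s.1 6 u ≤ 1
  bits : ∀ (a : Fin P.k) (z : Fin (P.N / P.k)), s.1 8 (a * (P.N / P.k) + z) = bit (B₁ a z)
  bits_le : ∀ u, s.1 8 u ≤ 1
  cnt_bits : ∀ a : Fin P.k, s.1 16 a = cnt (B₁ a)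
  cnt_other : ∀ a : Fin P.k, s.1 19 a = cnt (B₂ a)
  zero : ∀ a ∈ [10, 11, 12, 13, 14, 17], s.1 a = fun _ => 0
  out : s.2 1 = fun _ => 0
  real : s.2 2 = fun _ => 0

lemma rowIdx_lt {i j : P.Row} : (rowIdx P i : ℕ) < rowIdx P j ↔ toLex i < toLex j := by
  rw [rowIdx_val, rowIdx_val, Prod.Lex.toLex_lt_toLex, Fin.lt_def, Fin.lt_def, Fin.ext_iff]
  constructor
  · intro h; rcases lt_trichotomy i.1 j.1 with h' | h' | h'
    · grind
    · grind
    · have := Nat.mul_le_mul_right P.blockLen (Nat.succ_le_of_lt h'); grind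
  · rintro (h | ⟨h, h'⟩)
    · have := Nat.mul_le_mul_right P.blockLen (Nat.succ_le_of_lt h); grind
    grind

lemma bit_eq_one (b : Bool) : decide (bit b = 1) = b := by cases b <;> rfl

/-- The arrays `10`, `11` and `12` decode to `θ`, `σ` and `ρ`, and the numbering of the rows
respects their order, so that the same clone is read as in `cloneEntry`. -/
lemma fillLaw_storedBit {s : Store} (S : Sampled e B₁ B₂ x s) (θ : P.Perms)
    (σ : Perm P.Row) (ρ : Fin P.k → (P.Point ≃ Fin (P.r ^ P.t))) (i : P.Row) (a : Fin P.k) (y : P.Point)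
    {s' : Store} (h10 : s'.1 10 = blocks fun b z => (θ b z : ℕ))
    (h11 : ∀ i, s'.1 11 (rowIdx P i) = rowIdx P (σ i))
    (h12 : ∀ (a : Fin P.k) y, s'.1 12 (a * P.r ^ P.t + pointIdx P y) = ρ a y)
    (hs' : ∀ a ∈ [5, 6, 7, 8, 16, 19], s'.1 a = s.1 a) :
    fillLaw P.Q (storedBit P s' (entryIdx P (i, a, y))) =
      padLaw P (fun i j => fillLaw P.Q (cloneEntry e B₁ B₂ θ x i j)) σ ρ i a y := by
  have hlt : a * P.r ^ P.t + pointIdx P y < P.k * P.r ^ P.t := by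
    have := Nat.mul_le_mul_right (P.r ^ P.t) (Nat.succ_le_of_lt a.2); rw [Nat.succ_mul] at this
    have := (pointIdx P y).2; omega
  have u1 : (entryIdx P (i, a, y)) / (P.k * P.r ^ P.t) = rowIdx P i := by
    rw [entryIdx_val, mul_comm, Nat.mul_add_div (by omega), Nat.div_eq_of_lt hlt, add_zero]
  have u2 : (entryIdx P (i, a, y)) % (P.k * P.r ^ P.t) = a * P.r ^ P.t + pointIdx P y := by
    rw [entryIdx_val, mul_comm, Nat.mul_add_mod, Nat.mod_eq_of_lt hlt]
  have u3 : (a * P.r ^ P.t + pointIdx P y) / P.r ^ P.t = a := by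
    have := (pointIdx P y).2
    rw [mul_comm, Nat.mul_add_div (by omega), Nat.div_eq_of_lt this, add_zero]
  have hrow : ∀ i : P.Row, s'.1 10 (rowIdx P i) = θ i.1 i.2 := fun i => by
    rw [rowIdx_val, h10, blocks_apply]
  unfold storedBit padLaw
  simp [u1, u2, u3, h11, h12, hrow, (fun i => by rw [rowIdx_val, mul_comm, Nat.mul_add_div i.2.pos, Nat.div_eq_of_lt i.2.2, add_zero] : ∀ i : P.Row, (rowIdx P i) / P.blockLen = i.1), hs' 5 (by decide), hs' 6 (by decide), hs' 7 (by decide), hs' 8 (by decide), hs' 16 (by decide), hs' 19 (by decide)]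
  by_cases hb : (ρ a y) < P.blockLen
  · rw [if_pos hb, dif_pos hb]; set j : P.Row := (a, ⟨ρ a y, hb⟩)
    rw [((rowIdx_val P j).symm), (rfl : a = j.1), hrow]; unfold cloneEntry
    simp only [rowIdx_lt, Fin.val_inj, EmbeddingLike.apply_eq_iff_eq]; split_ifs with h1 h2 h3 h4
    · have := S.bits (σ i).1 ⟨_, h2⟩; rw [this, bit_eq_one, diagBit, dif_pos h2]
    · rw [S.cnt_bits, S.cnt_other, diagBit, dif_neg h2]
    all_goals first
      | rfl
      | have m1 := S.members (σ i).1 ⟨_, h3.1⟩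
        rw [m1, (S.members j.1 ⟨_, h3.2⟩)]
        first
          | rw [S.fst, bit_eq_one]
          | rw [S.snd, bit_eq_one]
  · rw [if_neg hb, dif_neg hb]; rfl

/-- The program after the first random bits. -/
def arrange : Cmd := .seq (shuffle 10 1 7) (.seq (shuffle 11 19 9) (.seq (shuffle 12 1 6)
    (.seq bitFill (.seq rkFill finishCmd))))

lemma safe_arrange : arrange.Safe :=
  ⟨safe_shuffle _ _ _, safe_shuffle _ _ _, safe_shuffle _ _ _, safe_bitFill, safe_rkFill, safe_finishCmd⟩

/-- The three shuffles supply `θ`, `σ` and `ρ` up to the numbering of rows and points. The reduction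
draws the filler bits before rows and columns are permuted, the program draws them afterwards, cell
by cell; `coins_map_cloneMatrix` and `pi_bind_padPermute` show that the laws agree. -/
lemma sem_arrange (hQ : GoodQ P.p P.q P.Q) (hnK : P.n ≤ P.k * P.lines) (hmd : P.m ≤ P.d) {s : Store}
    (S : Sampled e B₁ B₂ x s) :
    (sem arrange s).map (readOut P.n P.d) = unif P.Perms fun θ =>
      ((coins P.Row P.Row P.Q).map fun Z => cloneMatrix P e B₁ B₂ θ x Z).bind (padAndFinish P) := by
  rw [arrange, sem_seq, sem_shuffle (k := P.k) (L := P.blockLen) (by decide) S.ready.scratch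
    (by rw [S.ready.nat]; rfl) (by rw [S.ready.nat]; rfl) (cap_le S.ready 1) (cap_le S.ready 7)
    (S.zero _ (by decide)), unif_bind _ (measurable_sem _), unif_map _ (measurable_readOut _ _)]
  refine unif_congr fun θ => ?_; rw [dirac_bind (measurable_sem _), coins_map_cloneMatrix]
  unfold padAndFinish; rw [← bind_bind disc disc, pi_bind_padPermute]
  have r1 := S.ready.setN (by decide : 5 ≤ 10) (blocks fun b z => (θ b z))
  rw [sem_seq, sem_shuffle (k := 1) (L := P.m) (by decide) r1.scratch
    (by rw [r1.nat]; rfl) (by rw [r1.nat]; rfl) (cap_le r1 19) (cap_le r1 9)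
    (by simpa using S.zero 11 (by decide)), unif_bind _ (measurable_sem _), unif_bind _ disc,
    unif_map _ (measurable_readOut _ _)]
  refine Eq.trans (unif_equiv' ((rowIdx P).permCongr.trans (Equiv.funUnique _ _).symm) _).symm
    (unif_congr fun σ => ?_)
  rw [dirac_bind (measurable_sem _)]
  set π := ((rowIdx P).permCongr.trans (Equiv.funUnique (Fin 1) _).symm) σ with hπ
  have r2 := r1.setN (by decide : 5 ≤ 11) (blocks fun b z => (π b z))
  rw [sem_seq, sem_shuffle (k := P.k) (L := P.r ^ P.t) (by decide) r2.scratch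
    (by rw [r2.nat]; rfl) (by rw [r2.nat]; rfl) (cap_le r2 1) (cap_le r2 6)
    (by simpa using S.zero 12 (by decide)), unif_bind _ (measurable_sem _), unif_bind _ disc,
    unif_map _ (measurable_readOut _ _)]
  refine Eq.trans (unif_equiv' (Equiv.piCongrRight fun _ => Equiv.equivCongr (pointIdx P) (Equiv.refl _)) _).symm
    (unif_congr fun ρ => ?_)
  rw [dirac_bind (measurable_sem _)]
  rw [sem_bitFill_finish hQ hnK hmd (r2.setN (by decide) _)
    ⟨by simp [S.tabled.normals], by simp [S.tabled.dots]⟩ (by simpa using S.zero 13 (by decide))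
    (by simpa using S.zero 14 (by decide)) (by simpa using S.out) (by simpa using S.real)
    (by simpa using S.fst_le) (by simpa using S.snd_le) (by simpa using S.bits_le)
    (by simpa using S.zero 17 (by decide))]
  congr 1; congr 1; funext i; congr 1; funext a; congr 1; funext y
  refine fillLaw_storedBit S θ σ ρ i a y (by simp) (fun i => ?_) (fun a y => ?_) (fun a ha => ?_)
  · have h := blocks_apply (fun b z => (π b z)) 0 (rowIdx P i); simp_all
  · rw [setN_same, blocks_apply]; simp_all
  · simp at ha; rcases ha with rfl | rfl | rfl | rfl | rfl | rfl <;> simp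

end Assemble

/-! ### The program after the computation of the constants. -/

section Body

variable {P : Params}

lemma tally_arr {k L : ℕ} (b : Fin (k * L) → Bool) (a : Fin k) :
    (∑ u ∈ range (k * L), if u / L = a then arr 0 bit b u else 0) =
      cnt fun z => b (finProdFinEquiv (a, z)) := by
  rw [sum_range, ← finProdFinEquiv.sum_comp, Fintype.sum_prod_type, sum_eq_single a]
  · rw [cnt, card_filter]; refine sum_congr rfl fun z _ => ?_
    have h : ((finProdFinEquiv (a, z))) / L = a := by
      rw [finProdFinEquiv_apply_val, add_comm, Nat.mul_add_div z.pos, Nat.div_eq_of_lt z.2, add_zero]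
    rw [if_pos h, arr_val]; rfl
  · intro a' _ ha; refine sum_eq_zero fun z _ => if_neg ?_
    rw [finProdFinEquiv_apply_val, add_comm, Nat.mul_add_div z.pos, Nat.div_eq_of_lt z.2, add_zero]
    grind
  · simp

lemma bit_le (b : Bool) : bit b ≤ 1 := by cases b <;> simp [bit]

lemma arr_le_one {α : Type*} {n : ℕ} {enc : α → ℕ} (h : ∀ a, enc a ≤ 1) (x : Fin n → α) (u : ℕ) :
    arr 0 enc x u ≤ 1 := by
  unfold arr; grind

/-- The cell of the adjacency matrix that belongs to a pair of vertices. -/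
def pairCell (N : ℕ) (e : Sym2 (Fin N)) : Fin (N * N) := finProdFinEquiv (e.inf, e.sup)

lemma pairCell_injective (N : ℕ) : Injective (pairCell N) := fun e f h => by
  have := finProdFinEquiv.injective h
  exact Sym2.inf_eq_inf_and_sup_eq_sup.1 ⟨congrArg Prod.fst this, congrArg Prod.snd this⟩

lemma pairCell_mk {N : ℕ} (u v : Fin N) :
    (pairCell N s(u, v) : ℕ) = min (u : ℕ) v * N + max (u : ℕ) v := by
  rw [pairCell, finProdFinEquiv_apply_val]; simp; ring

lemma adj_pairCell {N : ℕ} (G : SimpleGraph (Fin N)) (e : Sym2 (Fin N)) :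
    decide (G.Adj (pairCell N e).divNat (pairCell N e).modNat) = decide (e ∈ G.edgeSet) := by
  have h := finProdFinEquiv.symm_apply_apply (e.inf, e.sup)
  have h1 : (pairCell N e).divNat = e.inf := congrArg Prod.fst h
  have h2 : (pairCell N e).modNat = e.sup := congrArg Prod.snd h; rw [h1, h2]
  induction e with | _ a b
  rw [Sym2.inf_mk, Sym2.sup_mk]; refine decide_eq_decide.2 ?_; rw [SimpleGraph.mem_edgeSet]
  rcases le_total a b with hab | hab
  · grind
  · rw [inf_of_le_right hab, sup_of_le_left hab, G.adj_comm]

/-- The program clones every cell of the adjacency matrix, but a pair is only ever read at its cell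
in increasing order; forgetting the other cells leaves `graphClone`. -/
lemma map_pairCell (hQ : GoodQ P.p P.q P.Q) (G : SimpleGraph (Fin P.N)) :
    ((piM fun i : Fin (P.N * P.N) => cloneLaw P.p P.q P.Q (decide (G.Adj i.divNat i.modNat))).map
      fun x e => x (pairCell P.N e)) = graphClone P.p P.q P.p P.Q 2 G := by
  have := isProb_cloneLaw hQ; rw [pi_map_injective _ (pairCell_injective P.N)]
  simp_rw [adj_pairCell]; rfl

/-- The graph and the partition are stored, and the arrays in use are cleared. -/
structure Loaded (P : Params) (E : Fin P.N → Fin P.k) (G : SimpleGraph (Fin P.N)) (s : Store) : Prop where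
  ready : Ready P s
  adj : ∀ i : Fin (P.N * P.N), s.1 1 i = bit (decide (G.Adj i.divNat i.modNat))
  part : ∀ v : Fin P.N, s.1 2 v = E v
  zero : ∀ a, 5 ≤ a → s.1 a = fun _ => 0
  out : s.2 1 = fun _ => 0
  real : s.2 2 = fun _ => 0

/-- The program after the computation of the constants. -/
def body : Cmd := .seq members (.seq normals (.seq dotTable (.seq cloneFill (.seq (coinFill 8 18 (r0 0))
    (.seq (tally 16 8 18 10) (.seq (coinFill 9 9 (r0 3)) (.seq (tally 19 9 9 7) arrange)))))))

lemma safe_body : body.Safe :=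
  ⟨safe_members, safe_normals, safe_dotTable, safe_cloneFill, safe_coinFill _ _ _, safe_tally _ _ _ _,
    safe_coinFill _ _ _, safe_tally _ _ _ _, safe_arrange⟩

lemma map_coins {k L : ℕ} (x : ℝ) : ((piM fun _ : Fin (k * L) => coin x).map
    fun b (a : Fin k) (z : Fin L) => b (finProdFinEquiv (a, z))) = coins (Fin k) (Fin L) x :=
  pi_map_injective₂ _ fun _ _ h => finProdFinEquiv.injective h

lemma sem_body (hQ : GoodQ P.p P.q P.Q) (hnK : P.n ≤ P.k * P.lines) (hmd : P.m ≤ P.d)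
    (hL : P.N / P.k ≤ P.blockLen) {E : Fin P.N → Fin P.k} (hE : ∀ a, Nat.card {v // E v = a} = P.N / P.k)
    {G : SimpleGraph (Fin P.N)} {s : Store} (S : Loaded P E G s) :
    (sem body s).map (readOut P.n P.d) = kPdsToIsgm P E G := by
  classical
  obtain ⟨e, he⟩ := exists_increasing_enumeration hE
  let g x B₁ B₂ : Measure _ := unif _ fun θ =>
      ((coins P.Row P.Row P.Q).map fun Z => cloneMatrix P e B₁ B₂ θ x Z).bind (padAndFinish P)
  have hR : kPdsToIsgm P E G = (graphClone P.p P.q P.p P.Q 2 G).bind fun x =>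
      (coins _ _ P.p).bind fun B₁ =>
      (coins _ _ P.Q).bind fun B₂ => g x B₁ B₂ := by
    show (toKPartiteSubmatrix P E G).bind _ = _
    rw [toKPartiteSubmatrix_eq P hL e G, bind_bind disc disc]; congr 1; ext1 x
    rw [bind_bind disc disc]; congr 1; ext1 B₁
    rw [bind_bind disc disc]; congr 1; ext1 B₂; exact unif_bind _ disc
  have r := S.ready; have rN := fun {s} (r : Ready P s) a (h : 5 ≤ a) f => Ready.setN r h f
  rw [hR, body, sem_seq_dirac _ (sem_members r E S.part (S.zero 7 (by decide)) (S.zero 20 (by decide))),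
    sem_seq_dirac _ (sem_normals (rN (rN r 20 (by decide) _) 7 (by decide) _)
      (by simpa using S.zero 15 (by decide)) (by simpa using S.zero 21 (by decide)))]
  have r3 := rN (rN (rN (rN r 20 (by decide) (countBefore E P.N)) 7 (by decide)
    (memberArr E (P.N / P.k) P.N)) 21 (by decide) (pairArr (leadingOne P.r P.lines))) 15 (by decide)
    (fun h => if h < P.lines then (leadingOne P.r h).1 else 0)
  rw [sem_seq_dirac _ (sem_dotTable r3 (by simpa using S.zero 18 (by decide)))]
  have r4 := rN r3 18 (by decide) (fun u => if u < P.r ^ P.t * P.r ^ P.t then dotTab P.r P.t u else 0)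
  rw [map_sem_seq _ disc (sem_cloneFill hQ r4 (by simpa using S.zero 5 (by decide))
    (by simpa using S.zero 6 (by decide)) _
    (by simpa using S.adj)) (measurable_readOut _ _), ← map_pairCell hQ, map_bind disc disc]
  congr 1; ext1 x
  have r5 := rN (rN r4 6 (by decide) (arr 0 (fun v => bit (v 1)) x)) 5 (by decide) (arr 0 (fun v => bit (v 0)) x)
  rw [map_sem_seq _ disc (sem_coinFill (n := P.k * _) r5 (by decide) rfl
    (by simpa using S.zero 8 (by decide))) (measurable_readOut _ _), ← map_coins P.p,
    map_bind disc disc]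
  congr 1; ext1 b₁; have r6 := rN r5 8 (by decide) (arr 0 bit b₁)
  rw [sem_seq_dirac _ (sem_tally (n := P.k * _) (L := P.N / P.k) r6 (by decide) (by decide) (by decide) rfl rfl
    (by simpa using S.zero 16 (by decide)) (fun u => by simpa using arr_le_one bit_le b₁ u))]
  have r7 := fun f => rN r6 16 (by decide) f
  rw [map_sem_seq _ disc (sem_coinFill (n := P.k * P.blockLen) (r7 _) (by decide) rfl
    (by simpa using S.zero 9 (by decide))) (measurable_readOut _ _), ← map_coins P.Q,
    map_bind disc disc]
  congr 1; ext1 b₂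
  have r8 := rN (r7 fun a => ∑ u ∈ range (P.k * (P.N / P.k)), if u / (P.N / P.k) = a then
    arr 0 bit b₁ u else 0) 9 (by decide) (arr 0 bit b₂)
  simp at r8 ⊢
  rw [sem_seq_dirac _ (sem_tally (n := P.k * P.blockLen) (L := P.blockLen) r8 (by decide) (by decide) (by decide) rfl rfl
    (by simpa using S.zero 19 (by decide)) (fun u => by simpa using arr_le_one bit_le b₂ u))]
  refine sem_arrange hQ hnK hmd ?_
  have hx : ∀ c (u v : Fin P.N), arr 0 (fun v => bit (v c)) x (min (u : ℕ) v * P.N + max (u : ℕ) v) =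
      bit _ := fun c u v => by rw [← pairCell_mk, arr_val]
  have hb : ∀ {k L : ℕ} b (a : Fin k) (z : Fin L), arr 0 bit b (a * L + z) =
      bit (b (finProdFinEquiv (a, z))) := fun {k L} b a z => by
    rw [← arr_val 0 bit b, finProdFinEquiv_apply_val]; congr 1; ring
  have hx1 : ∀ c u, arr 0 (fun v => bit (v c)) x u ≤ 1 := fun c => arr_le_one (fun v => bit_le _) x
  refine ⟨rN r8 19 (by decide) _, ⟨by simp, by simp⟩, ?_, ?_, ?_, ?_, ?_, ?_, ?_, ?_, ?_, ?_, by simpa using S.out,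
    by simpa using S.real⟩
  · simpa using he
  · simpa using hx 0
  · simpa using hx 1
  · simpa using hx1 0
  · simpa using hx1 1
  · simpa using hb b₁
  · simpa using arr_le_one bit_le b₁
  · simpa using tally_arr b₁
  · simpa using tally_arr b₂
  · intro a ha; simp at ha
    rcases ha with rfl | rfl | rfl | rfl | rfl | rfl <;> simpa using S.zero _ (by decide)

end Body

/-! ### The computation of the constants. -/

section Prelude

open Polynomial

/-- The program `c` leads from the memory `s` to the memory `s'`, and its time and its numbers stay bounded. -/
def Det (B : ℕ) (c : Cmd) (s s' : Store) : Prop :=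
  Bounded B s → sem c s = dirac s' ∧ Takes B c s (c.tb.eval B) ∧ Bounded B s'

lemma Det.seq {B : ℕ} {c₁ c₂ : Cmd} {s s' s'' : Store} (h₁ : Det B c₁ s s') (h₂ : Det B c₂ s' s'') :
    Det B (.seq c₁ c₂) s s'' := fun hb => by
  obtain ⟨e1, t1, b1⟩ := h₁ hb; obtain ⟨e2, t2, b2⟩ := h₂ b1
  refine ⟨(sem_seq_dirac c₂ e1).trans e2, ?_, b2⟩; rw [Cmd.tb, eval_add]; exact takes_seq t1 e1 t2

lemma bounded_setN {B a : ℕ} {s : Store} {i v : ℕ} (h : Bounded B s) (hv : v ≤ B) :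
    Bounded B (setN a (update (s.1 a) i v) s) := by
  rw [← upd_nat_eq]; exact h.upd a i hv _

lemma det_setNat {B a i v : ℕ} {e : NExp} {s : Store} (he : e.eval s = v) (hv : v ≤ B) :
    Det B (.setNat a (.lit i) e) s (setN a (update (s.1 a) i v) s) := fun hb =>
  ⟨by rw [sem_setNat', he]; rfl, takes_setNat hb _ _ _ (he ▸ hv), bounded_setN hb hv⟩

lemma det_ceil {B a i v : ℕ} {e : RExp} {s : Store} (he : ⌈e.eval s⌉₊ = v) (hv : v ≤ B) :
    Det B (.ceil a (.lit i) e) s (setN a (update (s.1 a) i v) s) := fun hb => by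
  refine ⟨?_, takes_ceil hb _ _ _ (he ▸ hv), bounded_setN hb hv⟩
  rw [sem, run, map_dirac' measurable_fst, he, upd_nat_eq]; rfl

lemma det_setReal {B a i : ℕ} (hB : 1 ≤ B) {v : ℝ} {e : RExp} {s : Store} (he : e.eval s = v) :
    Det B (.setReal a (.lit i) e) s (setR a (update (s.2 a) i v) s) := fun hb =>
  ⟨by rw [sem_setReal', he]; rfl, takes_of_safe hB (c := .setReal a _ e) trivial hb, hb⟩

lemma det_skip {B : ℕ} (hB : 1 ≤ B) (s : Store) : Det B .skip s s := fun hb =>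
  ⟨sem_skip s, takes_of_safe hB (c := .skip) trivial hb, hb⟩

lemma Takes.mono {B : ℕ} {c : Cmd} {s : Store} {K K' : ℕ} (h : Takes B c s K) (hK : K ≤ K') :
    Takes B c s K' := fun T => by
  filter_upwards [h T] with y hy; grind

lemma det_ite {B : ℕ} {b : BExp} {c₁ c₂ : Cmd} {s s' : Store} (h₁ : b.Holds s → Det B c₁ s s')
    (h₂ : ¬ b.Holds s → Det B c₂ s s') : Det B (.ite b c₁ c₂) s s' := fun hb => by
  have hc := b.cost_le hb
  have key : ∀ c, Det B c s s' → c.tb.eval B ≤ c₁.tb.eval B + c₂.tb.eval B →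
      (∀ T, run (.ite b c₁ c₂) (s, T) = run c (s, T + (b.cost s + 1))) → sem (.ite b c₁ c₂) s = sem c s →
      sem (.ite b c₁ c₂) s = dirac s' ∧ Takes B (.ite b c₁ c₂) s ((Cmd.ite b c₁ c₂).tb.eval B) ∧
        Bounded B s' := by
    intro c hd hle hr hs; obtain ⟨e1, t1, b1⟩ := hd hb; refine ⟨hs.trans e1, fun T => ?_, b1⟩
    rw [hr]; filter_upwards [t1 _] with y hy; refine ⟨hy.1, ?_⟩; simp [Cmd.tb]; omega
  by_cases h : b.Holds s
  · exact key c₁ (h₁ h) (by omega) (fun T => if_pos h) ((sem_ite _ _ _ _).trans (if_pos h))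
  · exact key c₂ (h₂ h) (by omega) (fun T => if_neg h) ((sem_ite _ _ _ _).trans (if_neg h))

def upto {α : Type*} (z : α) (f : ℕ → α) (i : ℕ) : ℕ → α := fun x => if x < i then f x else z

lemma update_upto {α : Type*} (z : α) (f : ℕ → α) (i : ℕ) :
    update (upto z f i) i (f i) = upto z f (i + 1) := by
  funext x; rcases lt_trichotomy x i with h | h | h
  · simp [upto, h.ne, h, h.trans _]
  · subst h; simp [upto]
  · simp [upto, h.ne', not_lt.2 h.le, not_lt.2 (Nat.succ_le_of_lt h)]

@[simp] lemma upto_of_lt {α : Type*} {z : α} {f : ℕ → α} {i x : ℕ} (h : x < i) : upto z f i x = f x := if_pos h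

variable (P : Params) (E : Fin P.N → Fin P.k) (G : SimpleGraph (Fin P.N))

/-- The input with the first `i` natural and `j` real constants in place. The input itself is `stage
P E G 6 3`, and each computed constant advances one of the indices. -/
def stage (i j : ℕ) : Store :=
  setN 0 (upto 0 (consts P) i) (setR 0 (upto 0 (realConsts P) j) (inputStore P E G))

variable {P E G}

@[simp] lemma stage_fst (i j : ℕ) : (stage P E G i j).1 0 = upto 0 (consts P) i := by simp [stage]

@[simp] lemma stage_snd (i j : ℕ) : (stage P E G i j).2 0 = upto 0 (realConsts P) j := by simp [stage]

lemma stage_setN (i j v : ℕ) (hv : consts P i = v) :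
    setN 0 (Function.update ((stage P E G i j).1 0) i v) (stage P E G i j) = stage P E G (i + 1) j := by
  rw [← hv, stage_fst, update_upto]; simp [stage]

lemma stage_setR (i j : ℕ) :
    setR 0 (update ((stage P E G i j).2 0) j (realConsts P j)) (stage P E G i j) =
      stage P E G i (j + 1) := by
  rw [stage_snd, update_upto]; simp [stage, setN_setR]

lemma inputStore_eq_stage : inputStore P E G = stage P E G 6 3 := by
  refine Prod.ext (funext fun a => ?_) (funext fun a => ?_)
  · by_cases ha : a = 0
    · subst ha; rw [stage_fst]; funext x; by_cases hx : x < 6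
      · rw [upto_of_lt hx]; interval_cases x <;> rfl
      · rw [upto, if_neg hx]; exact List.getD_eq_default _ _ (by simp_all)
    · simp [stage, ha]
  · by_cases ha : a = 0
    · subst ha; rw [stage_snd]; funext x; by_cases hx : x < 3
      · rw [upto_of_lt hx]; interval_cases x <;> rfl
      · rw [upto, if_neg hx]; exact List.getD_eq_default _ _ (by grind)
    · simp [stage, ha]

lemma det_stage {i j : ℕ} {e : NExp} (he : e.eval (stage P E G i j) = consts P i) :
    Det (capacity P) (.setNat 0 (.lit i) e) (stage P E G i j) (stage P E G (i + 1) j) := by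
  have := det_setNat (a := 0) (i := i) he (le_capacity_of_consts i)
  rwa [stage_setN _ _ _ rfl] at this

lemma det_stageReal {i j : ℕ} {e : RExp} (he : e.eval (stage P E G i j) = realConsts P j) :
    Det (capacity P) (.setReal 0 (.lit j) e) (stage P E G i j) (stage P E G i (j + 1)) := by
  have := det_setReal (a := 0) (i := j) (le_capacity_of_consts (P := P) 19) he
  rwa [stage_setR] at this

lemma det_stageCeil {i j : ℕ} {e : RExp} (he : ⌈e.eval (stage P E G i j)⌉₊ = consts P i) :
    Det (capacity P) (.ceil 0 (.lit i) e) (stage P E G i j) (stage P E G (i + 1) j) := by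
  have := det_ceil (a := 0) (i := i) he (le_capacity_of_consts i)
  rwa [stage_setN _ _ _ rfl] at this

def oneExp : RExp := .ofNat (.lit 1)
def pIsOne : BExp := .realLe oneExp (r0 0)
def rootExp : RExp := .sub oneExp (.sqrt (.mul (.sub oneExp (r0 0)) (.sub oneExp (r0 1))))
def setQ : Cmd := .ite pIsOne (.setReal 0 (.lit 3) (.add rootExp (.sub (.sqrt (r0 1)) oneExp)))
  (.setReal 0 (.lit 3) rootExp)
def ratioExp : RExp := .log (.div (r0 0) (r0 3))
def coratioExp : RExp := .log (.div (.sub oneExp (r0 3)) (.sub oneExp (r0 0)))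
def setDelta : Cmd := .ite pIsOne (.setReal 0 (.lit 4) ratioExp)
  (.ite (.realLe ratioExp coratioExp) (.setReal 0 (.lit 4) ratioExp) (.setReal 0 (.lit 4) coratioExp))
def setTau : Cmd := .setReal 0 (.lit 5) (.mul (.sqrt (.mul (.ofNat (c0 6)) (.sub (.ofNat (c0 4)) oneExp))) (r0 2))
def lenExp : RExp := .div (.mul (.add (.div (r0 0) (r0 3)) oneExp) (.ofNat (c0 0))) (.ofNat (c0 1))
/-- The command that computes the number of points. -/
def setPoints : Cmd := .ceil 0 (.lit 6) (.exp (.mul (.ofNat (c0 5)) (.log (.ofNat (c0 4)))))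
/-- The command that computes `m / k`. -/
def setLen : Cmd := .seq (.ceil 0 (.lit 7) lenExp)
  (.ite (.realLe (.ofNat (c0 7)) lenExp) (.setNat 0 (.lit 7) (.add (c0 7) (.lit 1))) .skip)
def setIterations : Cmd := .ceil 0 (.lit 8) (.mul (.mul (.ofNat (.lit 3)) (.div oneExp (r0 4)))
  (.log (.mul (.ofNat (.mul (c0 1) (c0 7))) (.mul (.ofNat (c0 1)) (.ofNat (c0 6))))))
def sumExp : ℕ → NExp
  | 0 => c0 6
  | i + 1 => .add (sumExp i) (c0 i)

lemma holds_pIsOne (hQ : GoodQ P.p P.q P.Q) {i j : ℕ} (hj : 0 < j) :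
    pIsOne.Holds (stage P E G i j) ↔ P.p = 1 := by
  simp only [pIsOne, oneExp, BExp.Holds, RExp.eval, NExp.eval, r0, stage_snd, upto_of_lt hj]
  rw [Nat.cast_one]; exact ⟨fun h => le_antisymm hQ.p_le h, fun h => h.ge⟩

lemma det_setQ (hQ : GoodQ P.p P.q P.Q) :
    Det (capacity P) setQ (stage P E G 6 3) (stage P E G 6 4) := by
  refine det_ite (fun h => det_stageReal ?_) fun h => det_stageReal ?_
  all_goals
    rw [holds_pIsOne hQ (by norm_num)] at h; simp [rootExp, oneExp, realConsts, Params.Q, h]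

lemma det_setDelta (hQ : GoodQ P.p P.q P.Q) :
    Det (capacity P) setDelta (stage P E G 6 4) (stage P E G 6 5) := by
  have e1 : ratioExp.eval (stage P E G 6 4) = log (P.p / P.Q) := by simp [ratioExp, realConsts]
  have e2 : coratioExp.eval (stage P E G 6 4) = log ((1 - P.Q) / (1 - P.p)) := by
    simp [coratioExp, oneExp, realConsts]
  have e3 : realConsts P 4 = P.δ := rfl
  refine det_ite (fun h => det_stageReal ?_) fun h => det_ite (fun h' => det_stageReal ?_)
    fun h' => det_stageReal ?_
  all_goals rw [holds_pIsOne hQ (by norm_num)] at h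
  · rw [e1, e3, Params.δ, if_pos h]
  · rw [BExp.Holds, e1, e2] at h'; rw [e1, e3, Params.δ, if_neg h, min_eq_left h']
  · rw [BExp.Holds, e1, e2, not_le] at h'; rw [e2, e3, Params.δ, if_neg h, min_eq_right h'.le]

/-- Expressions have no powers, but `exp (t * log r)` is exactly `r ^ t`, and so is its ceiling. -/
lemma det_setPoints : Det (capacity P) setPoints (stage P E G 6 5) (stage P E G 7 5) := by
  refine det_stageCeil ?_; have hr : 0 < P.r := by exact_mod_cast P.prime.out.pos
  have : RExp.eval (stage P E G 6 5) (.exp (.mul (.ofNat (c0 5)) (.log (.ofNat (c0 4))))) = ((P.r ^ P.t : ℕ)) := by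
    simp; rw [← Real.log_pow, exp_log (by positivity)]; push_cast; rfl
  rw [this, Nat.ceil_natCast]; rfl

lemma det_setTau : Det (capacity P) setTau (stage P E G 7 5) (stage P E G 7 6) := by
  refine det_stageReal ?_; simp [oneExp, consts, realConsts, Params.τ]

/-- `⌊x⌋ + 1` is obtained from the ceiling, to which one has to be added exactly if `x` is an
integer. -/
lemma det_setLen (hQ : GoodQ P.p P.q P.Q) : Det (capacity P) setLen (stage P E G 7 6) (stage P E G 8 6) := by
  set x : ℝ := (P.p / P.Q + 1) * P.N / P.k with hx
  have hx0 : 0 ≤ x := by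
    have := hQ.Q_pos; have := hQ.Q_pos.trans hQ.lt_p; positivity
  have hlen : P.blockLen = ⌊x⌋₊ + 1 := rfl
  have hcap : P.blockLen ≤ capacity P := le_capacity_of_consts 7
  have hle : ⌈x⌉₊ ≤ P.blockLen := Nat.ceil_le.2 (by rw [hlen]; push_cast; exact (Nat.lt_floor_add_one x).le)
  refine (det_ceil (congrArg Nat.ceil (by simp [lenExp, oneExp, consts, realConsts, hx])) (hle.trans hcap)).seq ?_
  set s := setN 0 _ _ with hs
  have e2 : lenExp.eval s = x := by simp [hs, lenExp, oneExp, consts, realConsts, hx]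
  have hfin : setN 0 (update _ 7 P.blockLen) _ = stage P E G 8 6 := stage_setN 7 6 _ rfl
  refine det_ite (fun h => ?_) fun h => ?_
  · simp [BExp.Holds, e2] at h
    have hf := le_antisymm (Nat.floor_le_ceil x) ((Nat.le_floor_iff hx0).2 h)
    have := det_setNat (a := 0) (i := 7) (e := .add _ (.lit 1))
      (by rw [NExp.eval, (by simp [hs] : (c0 7).eval s = ⌈x⌉₊), hlen, hf]; rfl) hcap
    simp_all
  · simp [BExp.Holds, e2] at h
    have hf := le_antisymm hle (by
      rw [hlen, Nat.succ_le_iff, Nat.floor_lt hx0]; exact h)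
    rw [(by grind : s = stage P E G 8 6)]; exact det_skip (le_capacity_of_consts 19) _

lemma det_setIterations : Det (capacity P) setIterations (stage P E G 8 6) (stage P E G 9 6) := by
  refine det_stageCeil ?_; simp [oneExp, consts, realConsts, Params.iterations, Params.m]

end Prelude

/-! ### The whole program and its running time. -/

section Program

open Polynomial

variable {P : Params} {E : Fin P.N → Fin P.k} {G : SimpleGraph (Fin P.N)}

/-- The commands that compute the products of the first constants. -/
def setProducts : Cmd :=
  .seq (.setNat 0 (.lit 9) (.mul (c0 1) (c0 7))) (.seq (.setNat 0 (.lit 10) (.div (c0 0) (c0 1)))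
  (.seq (.setNat 0 (.lit 11) (.div (.sub (c0 6) (.lit 1)) (.sub (c0 4) (.lit 1))))
  (.seq (.setNat 0 (.lit 12) (.mul (c0 1) (c0 11))) (.seq (.setNat 0 (.lit 13) (.mul (c0 1) (c0 6)))
  (.seq (.setNat 0 (.lit 14) (.mul (c0 9) (c0 13))) (.seq (.setNat 0 (.lit 15) (.mul (c0 6) (c0 6)))
  (.seq (.setNat 0 (.lit 16) (.mul (c0 2) (c0 3))) (.seq (.setNat 0 (.lit 17) (.mul (c0 0) (c0 0)))
  (.seq (.setNat 0 (.lit 18) (.mul (c0 1) (c0 10))) (.setNat 0 (.lit 19) (.lit 1)))))))))))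

lemma det_setProducts : Det (capacity P) setProducts (stage P E G 9 6) (stage P E G 20 6) := by
  refine Det.seq (det_stage ?_) (Det.seq (det_stage ?_) (Det.seq (det_stage ?_) (Det.seq (det_stage ?_)
    (Det.seq (det_stage ?_) (Det.seq (det_stage ?_) (Det.seq (det_stage ?_) (Det.seq (det_stage ?_)
    (Det.seq (det_stage ?_) (Det.seq (det_stage ?_) (det_stage ?_))))))))))
  all_goals simp [consts, Params.m, Params.lines]

def setup : Cmd := .seq setQ (.seq setDelta (.seq setPoints (.seq setTau (.seq setLen
  (.seq setIterations (.seq setProducts (.setNat 4 (.lit 0) (sumExp 20))))))))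

variable (P E G) in
def loadedStore : Store :=
  setN 4 (update ((stage P E G 20 6).1 4) 0 (capacity P)) (stage P E G 20 6)

lemma det_setup (hQ : GoodQ P.p P.q P.Q) :
    Det (capacity P) setup (inputStore P E G) (loadedStore P E G) := by
  rw [inputStore_eq_stage]
  refine (det_setQ hQ).seq ((det_setDelta hQ).seq (det_setPoints.seq (det_setTau.seq ((det_setLen hQ).seq
    (det_setIterations.seq (det_setProducts.seq (det_setNat ?_ le_rfl)))))))
  simp [sumExp, consts, capacity]; ring

lemma loaded_loadedStore : Loaded P E G (loadedStore P E G) := by classical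
  refine ⟨⟨?_, ?_, ?_, ?_⟩, fun i => ?_, fun v => ?_, fun a ha => ?_, ?_, ?_⟩
  · rw [loadedStore, setN_ne (by decide), stage_fst]; funext x; by_cases hx : x < 20
    · simp_all
    · rw [upto, if_neg hx]; exact (List.getD_eq_default _ _ (by simp_all)).symm
  · simp [loadedStore]; rfl
  · simp [loadedStore]
  · rw [loadedStore, setN_snd, stage_snd]; funext x; by_cases hx : x < 6
    · simp_all
    · rw [upto, if_neg hx]; exact (List.getD_eq_default _ _ (by simp_all)).symm
  · have h : (loadedStore P E G).1 1 i = if ∃ u v : Fin P.N, (i : ℕ) = u * P.N + v ∧ G.Adj u v then 1 else 0 := by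
      simp [loadedStore]; rfl
    have hi : (i : ℕ) = i.divNat * P.N + i.modNat := by
      rw [Fin.coe_divNat, Fin.coe_modNat]; exact (Nat.div_add_mod' _ _).symm
    rw [h, bit]; congr 1; rw [decide_eq_true_eq, eq_iff_iff]
    refine ⟨fun ⟨u, v, hu, hG⟩ => ?_, fun hG => ⟨_, _, hi, hG⟩⟩
    rwa [(Fin.ext (by rw [Fin.coe_divNat, hu, mul_comm, Nat.mul_add_div v.pos, Nat.div_eq_of_lt v.2, add_zero]) : i.divNat = u), (Fin.ext (by rw [Fin.coe_modNat, hu, mul_comm, Nat.mul_add_mod, Nat.mod_eq_of_lt v.2]) : i.modNat = v)]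
  · have h : (loadedStore P E G).1 2 v = (inputStore P E G).1 2 v := by simp [loadedStore, stage]
    exact dif_pos v.2
  · have h0 : a ≠ 0 := by omega
    obtain ⟨a, rfl⟩ := Nat.exists_eq_add_of_le ha; rw [Nat.add_comm]
    rfl
  · simp [loadedStore]; rfl
  · simp [loadedStore]; rfl

lemma bounded_inputStore : Bounded (capacity P) (inputStore P E G) := by classical
  intro a i; have one_le : 1 ≤ capacity P := le_capacity_of_consts 19; match a with
  | 0 =>
    rw [inputStore_eq_stage, stage_fst, upto]; split_ifs
    · exact le_capacity_of_consts i
    simp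
  | 1 =>
    show (if _ then 1 else 0) ≤ _; split_ifs <;> omega
  | 2 =>
    show (if h : i < P.N then _ else 0) ≤ _; split_ifs with h
    · exact (E ⟨i, h⟩).2.le.trans (le_capacity_of_consts 1)
    simp
  | a + 3 => exact Nat.zero_le _

/-- The program that runs the reduction. -/
def program : Cmd := .seq setup body

lemma map_run_program (hQ : GoodQ P.p P.q P.Q) (hnK : P.n ≤ P.k * P.lines) (hmd : P.m ≤ P.d)
    (hL : P.N / P.k ≤ P.blockLen) (hE : ∀ a, Nat.card {v // E v = a} = P.N / P.k) :
    (run program (inputStore P E G, 0)).map (output P.n P.d) = kPdsToIsgm P E G := by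
  obtain ⟨h, -, -⟩ := det_setup hQ bounded_inputStore
  have h1 : output P.n P.d = readOut P.n P.d ∘ Prod.fst := rfl
  rw [h1, ← Measure.map_map (measurable_readOut _ _) measurable_fst, run_map_fst, program,
    sem_seq_dirac _ h, sem_body hQ hnK hmd hL hE loaded_loadedStore]

lemma run_program_le (hQ : GoodQ P.p P.q P.Q) :
    ∀ᵐ x ∂run program (inputStore P E G, 0), x.2 ≤ program.tb.eval (capacity P) := by
  obtain ⟨h, ht, hb⟩ := det_setup hQ bounded_inputStore
  filter_upwards [(takes_seq ht h (takes_of_safe (le_capacity_of_consts 19) safe_body hb) 0)] with x hx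
  rw [program, Cmd.tb, eval_add]; omega

lemma eval_mono (f : ℕ[X]) : Monotone fun x => f.eval x := fun x y h => by
  simp only [eval_eq_sum, Polynomial.sum]; gcongr

lemma Params.Admissible.n_le {w : ℝ} (h : P.Admissible w E) : P.n ≤ P.k * P.lines := by
  obtain ⟨e⟩ := h.nonempty_columns; have := Fintype.card_le_of_embedding e
  rwa [Fintype.card_fin, Fintype.card_prod, Fintype.card_fin, ← Fintype.card_congr (hyperIdx),
    Fintype.card_fin] at this

lemma Params.δ_congr {P P' : Params} (hp : P.p = P'.p) (hq : P.q = P'.q) : P.δ = P'.δ := by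
  simp [Params.δ, Params.Q, hp, hq]

lemma iterations_le {c M : ℕ} (hQ : GoodQ P.p P.q P.Q) (hc : 3 * P.δ⁻¹ ≤ c) (hK : P.k * P.r ^ P.t ≤ M)
    (hm : P.m ≤ M) : P.iterations ≤ c * (M * M) := by
  have hδ := Params.δ_pos hQ; refine Nat.ceil_le.2 ?_
  have h1 : log (P.m * (P.k * P.r ^ P.t)) ≤ (M * M : ℕ) := by
    rw [(by push_cast; ring : (P.m : ℝ) * _ = (P.m * (P.k * P.r ^ P.t) : ℕ))]
    refine (Real.log_le_self (Nat.cast_nonneg _)).trans ?_; exact_mod_cast Nat.mul_le_mul hm hK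
  calc 3 * P.δ⁻¹ * log _ ≤ 3 * P.δ⁻¹ * (M * M : ℕ) := by gcongr
    _ ≤ c * _ := by gcongr
    _ = (c * _ : ℕ) := by simp

/-- The number of iterations is at most `c` times a square because `log x ≤ x`; all other summands
are at most quadratic in `N + M + 1`. -/
lemma capacity_le {w : ℝ} {c M : ℕ} (h : P.Admissible w E) (hQ : GoodQ P.p P.q P.Q) (hc : 3 * P.δ⁻¹ ≤ c)
    (hK : P.k * P.r ^ P.t ≤ M) (hd : P.d ≤ M) : capacity P ≤ (c + 20) * (P.N + M + 1) ^ 2 := by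
  have hm := h.m_le_d.trans hd; have hJ := iterations_le hQ hc hK hm; have hn := h.n_le
  have hn0 := h.n_pos; have hr := P.prime.out.two_le
  have hlR : P.lines ≤ P.r ^ P.t := (Nat.div_le_self _ _).trans (Nat.sub_le _ _)
  have hRM := (Nat.le_mul_of_pos_left _ h.k_pos).trans hK
  have hkM := (Nat.le_mul_of_pos_right _ (by grind)).trans hK
  have hklM := (Nat.mul_le_mul_left _ hlR).trans hK
  have htR : P.t ≤ P.r ^ P.t := (Nat.lt_pow_self (by omega)).le
  -- For `t = 0` there would be no column to choose.
  have ht : P.t ≠ 0 := by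
    intro h0; rw [(by simp [Params.lines, h0] : P.lines = 0)] at hn; omega
  have hrR : P.r ≤ P.r ^ P.t := Nat.le_self_pow ht _; have hL := h.blockLen_le
  have hdiv := Nat.div_le_self P.N P.k; set S := P.N + M + 1
  have q1 : P.N * P.N ≤ S * S := Nat.mul_le_mul (by omega) (by omega)
  have q2 : P.m * (P.k * P.r ^ P.t) ≤ S * S := Nat.mul_le_mul (by omega) (by omega)
  have q3 : P.r ^ P.t * P.r ^ P.t ≤ S * S := Nat.mul_le_mul (by omega) (by omega)
  have q4 : P.n * P.d ≤ S * S := Nat.mul_le_mul (by omega) (by omega)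
  have q5 : c * (M * M) ≤ c * (S * S) := Nat.mul_le_mul_left _ (Nat.mul_le_mul (by omega) (by omega))
  have q6 : S * 1 ≤ S * S := Nat.mul_le_mul_left _ (by omega)
  rw [(by ring : _ * S ^ 2 = c * (S * S) + 20 * (S * S)), capacity, h.mul_div]; omega

lemma exists_time (p q : ℝ) (f : ℕ[X]) : ∃ time : ℕ[X], ∀ (P : Params) (w : ℝ) (E : Fin P.N → Fin P.k),
    P.p = p → P.q = q → 0 < q → q < p → p ≤ 1 → P.Admissible w E → P.k * P.r ^ P.t ≤ f.eval P.N →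
    P.d ≤ f.eval P.N → ∀ G : SimpleGraph (Fin P.N),
      (run program (inputStore P E G, 0)).map (output P.n P.d) = kPdsToIsgm P E G ∧
      ∀ᵐ x ∂run program (inputStore P E G, 0), x.2 ≤ time.eval P.N := by
  -- `δ` depends on `p` and `q` alone, so dummy parameters give its value before `P` is known.
  let P₀ : Params := ⟨0, 0, p, q, 0, 0, 0, 2, 0⟩
  refine ⟨program.tb.comp (C (⌈3 * P₀.δ⁻¹⌉₊ + 20) * (X + f + 1) ^ 2),
    fun P w E hp hq hq0 hqp hp1 h hK hd G => ?_⟩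
  subst hp hq; have hQ := P.goodQ hq0 hqp hp1
  refine ⟨map_run_program hQ h.n_le h.m_le_d ?_ h.parts, ?_⟩
  · have := h.two_mul_le_blockLen hQ; omega
  · filter_upwards [run_program_le hQ] with x hx; refine hx.trans ?_; rw [eval_comp]
    refine eval_mono _ ?_
    simpa using capacity_le h hQ ((Params.δ_congr rfl rfl) ▸ Nat.le_ceil _) hK hd

end Program

end KPdsIsgm

end

theorem theorem4p1 :
    -- one program `A` for all parameters
    ∃ A : KPdsIsgm.Cmd, ∀ p q : ℝ, 0 < q → q < p → p ≤ 1 →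
      -- total variation guarantee under both hypotheses
      (∃ C c : ℝ, 0 < C ∧ 0 < c ∧
        ∀ (P : KPdsIsgm.Params) (w : ℝ) (E : Fin P.N → Fin P.k), P.p = p → P.q = q →
          P.Admissible w E →
          let bound : ℝ := C * (w⁻¹ + (P.k : ℝ) ^ 2 / (w * P.N) + P.k / √(P.N : ℝ)
            + Real.exp (-(c * ((P.N : ℝ) ^ 2 / (P.k * P.n)))) + (P.N : ℝ)⁻¹)
          KPdsIsgm.tvDist
              ((KPdsIsgm.kPdsNull P.N P.q).bind (KPdsIsgm.kPdsToIsgm P E))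
              (KPdsIsgm.isgmNull P.n P.d) ≤ bound ∧
          KPdsIsgm.tvDist
              ((KPdsIsgm.kPdsPlanted E P.p P.q).bind (KPdsIsgm.kPdsToIsgm P E))
              (KPdsIsgm.isgmPlanted P.n P.k P.d P.μ (1 / (P.r : ℝ))) ≤ bound) ∧
      -- the program runs the reduction in polynomial time
      (∀ poly : Polynomial ℕ, ∃ time : Polynomial ℕ,
        ∀ (P : KPdsIsgm.Params) (w : ℝ) (E : Fin P.N → Fin P.k), P.p = p → P.q = q →
          P.Admissible w E → P.k * P.r ^ P.t ≤ poly.eval P.N → P.d ≤ poly.eval P.N →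
          ∀ G : SimpleGraph (Fin P.N),
            (KPdsIsgm.run A (KPdsIsgm.inputStore P E G, 0)).map (KPdsIsgm.output P.n P.d)
                = KPdsIsgm.kPdsToIsgm P E G ∧
            ∀ᵐ x ∂(KPdsIsgm.run A (KPdsIsgm.inputStore P E G, 0)),
              x.2 ≤ time.eval P.N) := by
  refine ⟨KPdsIsgm.program, fun p q hq hqp hp => ⟨KPdsIsgm.exists_tvDist_le p q hq hqp hp, fun f => ?_⟩⟩
  obtain ⟨time, ht⟩ := KPdsIsgm.exists_time p q f
  exact ⟨time, fun P w E h1 h2 h hK hd G => ht P w E h1 h2 hq hqp hp h hK hd G⟩
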